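/- **Conventions.** Let $\mathfrak g_0$ be a real semisimple Lie algebra with Killing form $\kappa$, let $\theta$ be a Cartan involution of $\mathfrak g_0$ (an involutive automorphism with $\kappa(X,\theta X)<0$ for $X\neq0$), $\mathfrak k=\{\theta X=X\}$, $\mathfrak s=\{\theta X=-X\}$, let $\mathfrak a_0\subset\mathfrak s$ be maximal abelian, and fix an open Weyl chamber in $\mathfrak a_0$. Let $\mathfrak m_0$ be the centralizer of $\mathfrak a_0$ in $\mathfrak k$ and $\mathfrak n_0$ the sum of the root spaces of the positive restricted roots. Then $\mathfrak p_0=\mathfrak m_0\oplus\mathfrak a_0\oplus\mathfrak n_0$ is a minimal parabolic subalgebra of $\mathfrak g_0$. Let $\mathfrak g$ be a complex semisimple Lie algebra with Cartan subalgebra $\mathfrak h$, roots $\Delta$, and simple roots $\alpha_1,\dots,\alpha_\ell$. Put $\mathfrak b=\mathfrak h\oplus\bigoplus_{\beta\in\Delta_+}\mathfrak g^\beta$, and for $S\subset\{1,\dots,\ell\}$ put $\Delta^S=\Delta\cap\sum_{i\in S}\mathbb Z\alpha_i$ and $P_S=\mathfrak b\oplus\bigoplus_{\beta\in\Delta_-\cap\Delta^S}\mathfrak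 g^\beta$, so $P_\emptyset=\mathfrak b$. Simple roots are numbered in the standard way: $\alpha_i=\varepsilon_i-\varepsilon_{i+1}$ for $\mathfrak{sl}(\ell+1,\mathbb C)$; for the other types $\alpha_i=\varepsilon_i-\varepsilon_{i+1}$ for $i<\ell$, and $\alpha_\ell=\varepsilon_\ell$ for $\mathfrak{so}(2\ell+1,\mathbb C)$, $\alpha_\ell=2\varepsilon_\ell$ for $\mathfrak{sp}(\ell,\mathbb C)$ (rank $\ell$), $\alpha_\ell=\varepsilon_{\ell-1}+\varepsilon_\ell$ for $\mathfrak{so}(2\ell,\mathbb C)$, $\ell\ge2$. "$\mathfrak p_0^{\mathbb C}\cong P_S$" means that there is an isomorphism of complex Lie algebras $\varphi:\mathbb C\otimes_{\mathbb R}\mathfrak g_0\to\mathfrak g$, where $\mathfrak g$ is the classical complex Lie algebra of the type of $\mathfrak g_0^{\mathbb C}$, with $\varphi(\mathfrak p_0^{\mathbb C})=P_S$. **Theorem.** Each of the real Lie algebras $\mathfrak g_0$ below has a minimal parabolic subalgebra, and for every choice of $(\theta,\mathfrak a_0,\text{Weyl chamber})$ the following holds. 1. (Split forms.) For $\mathfrak{sl}(n,\mathbb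 R)$ ($n\ge2$), $\mathfrak{so}(r,r)$ ($r\ge2$), $\mathfrak{so}(r+1,r)$ ($r\ge1$) and $\mathfrak{sp}(n,\mathbb R)$ ($n\ge1$): $\mathfrak m_0=0$ and $\mathfrak p_0^{\mathbb C}\cong\mathfrak b$, by an isomorphism that also maps $\mathfrak a_0^{\mathbb C}$ onto $\mathfrak h$. 2. For $\mathfrak{su}(n,n)$ ($n>1$): $\mathfrak m_0\cong\mathfrak u(1)^{n-1}$, $\dim\mathfrak a_0=n$, $\dim\mathfrak n_0=n(2n-1)$, and $\mathfrak p_0^{\mathbb C}\cong\mathfrak b\subset\mathfrak{sl}(2n,\mathbb C)$, by an isomorphism that also maps $\mathfrak m_0^{\mathbb C}\oplus\mathfrak a_0^{\mathbb C}$ onto $\mathfrak h$. 3. For $\mathfrak{su}^*(2n)$ ($n>1$): $\mathfrak m_0\cong\mathfrak{su}(2)^n$, $\dim\mathfrak a_0=n-1$, $\dim\mathfrak n_0=2n(n-1)$, and $\mathfrak p_0^{\mathbb C}\cong P_S$ with $S=\{1,3,\dots,2n-1\}$. 4. For $\mathfrak{su}(p,r)$ ($p>r\ge1$): $\mathfrak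 m_0\cong\mathfrak{su}(p-r)\oplus\mathfrak u(1)^r$, $\dim\mathfrak a_0=r$, $\dim\mathfrak n_0=r(2p-1)$, and $\mathfrak p_0^{\mathbb C}\cong P_S$ with $S=\{r+1,\dots,p-1\}$. 5. For $\mathfrak{so}(p,r)$ ($p>r+1$, $r\ge1$): $\mathfrak m_0\cong\mathfrak{so}(p-r)$, $\dim\mathfrak a_0=r$, $\dim\mathfrak n_0=r(p-1)$, and $\mathfrak p_0^{\mathbb C}\cong P_S$ with $S=\{r+1,\dots,[(p+r)/2]\}$ if $p\ne r+2$, and $S=\emptyset$ (so $P_S=\mathfrak b$) if $p=r+2$. 6. For $\mathfrak{sp}(p,r)$ ($p\ge r\ge1$): $\mathfrak m_0\cong\mathfrak{sp}(p-r)\oplus\mathfrak{sp}(1)^r$, $\dim\mathfrak a_0=r$, $\dim\mathfrak n_0=r(4p-1)$, and $\mathfrak p_0^{\mathbb C}\cong P_S$ with $S=\{1,3,\dots,2r-1\}$ if $p=r$, and $S=\{1,3,\dots,2r-1\}\cup\{2r+1,2r+2,\dots,p+r\}$ if $p>r$. 7. For $\mathfrak{so}^*(2n)$ with $n=2r$,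 $r\ge1$: $\mathfrak m_0\cong\mathfrak{so}(3)^r$, $\dim\mathfrak a_0=r$, $\dim\mathfrak n_0=r(4r-3)$, and $\mathfrak p_0^{\mathbb C}\cong P_S$ with $S=\{1,3,\dots,n-1\}$, by an isomorphism that also maps $\mathfrak t^{\mathbb C}\oplus\mathfrak a_0^{\mathbb C}$ onto $\mathfrak h$ for some Cartan subalgebra $\mathfrak t$ of $\mathfrak m_0$. 8. For $\mathfrak{so}^*(2n)$ with $n=2r+1$, $r\ge1$: $\mathfrak m_0\cong\mathfrak{so}(2)\oplus\mathfrak{so}(3)^r$, $\dim\mathfrak a_0=r$, $\dim\mathfrak n_0=r(4r+1)$, and $\mathfrak p_0^{\mathbb C}\cong P_S$ with $S=\{1,3,\dots,n-2\}$. All dimensions are over $\mathbb R$. -/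

import Mathlib

open scoped TensorProduct DirectSum
open Matrix

attribute [local instance 100] LieRing.ofAssociativeRing

noncomputable section

namespace MinimalParabolics

/-! ### Roots relative to an abelian subalgebra -/

section Roots

variable {R L : Type*} [CommRing R] [LieRing L] [LieAlgebra R L]

/-- The simultaneous eigenspace `{X | [H, X] = β(H) X for all H ∈ h}` in `L`. -/
def rootSpace (h : LieSubalgebra R L) (β : Module.Dual R h) : Submodule R L :=
  (LieModule.weightSpace L (β : h → R)).toSubmodule

theorem mem_rootSpace (h : LieSubalgebra R L) (β : Module.Dual R h) (X : L) :
    X ∈ rootSpace h β ↔ ∀ H : h, ⁅(H : L), X⁆ = β H • X :=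
  LieModule.mem_weightSpace _ _

/-- The roots of `L` relative to `h`: the nonzero functionals with a nonzero eigenspace. -/
def roots (h : LieSubalgebra R L) : Set (Module.Dual R h) :=
  {β | β ≠ 0 ∧ rootSpace h β ≠ ⊥}

end Roots

/-! ### Minimal parabolic subalgebras of a real semisimple Lie algebra -/

section Real

variable (g : Type*) [LieRing g] [LieAlgebra ℝ g]

/-- The data that determine a minimal parabolic subalgebra of a real semisimple Lie algebra: a
Cartan involution, a maximal abelian subspace of its `-1`-eigenspace, and an open Weyl chamber,
given by one of its points, which determines the positive restricted roots. -/
structure MinimalParabolic where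
  /-- The Cartan involution. -/
  θ : g ≃ₗ⁅ℝ⁆ g
  involutive : ∀ X, θ (θ X) = X
  killing_neg : ∀ X, X ≠ 0 → killingForm ℝ g X (θ X) < 0
  /-- The subalgebra `a₀`. -/
  a : LieSubalgebra ℝ g
  a_le : ∀ X ∈ a, θ X = -X
  a_abelian : ∀ X ∈ a, ∀ Y ∈ a, ⁅X, Y⁆ = 0
  a_maximal : ∀ X, θ X = -X → (∀ H ∈ a, ⁅H, X⁆ = 0) → X ∈ a
  /-- A regular element of `a₀`. -/
  H₀ : a
  regular : ∀ μ ∈ roots a, μ H₀ ≠ 0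

namespace MinimalParabolic

variable {g} (P : MinimalParabolic g)

/-- `m₀`, the centralizer of `a₀` in the maximal compact subalgebra `k` (the fixed points of the
Cartan involution). -/
def m : LieSubalgebra ℝ g where
  carrier := {X | P.θ X = X ∧ ∀ H ∈ P.a, ⁅H, X⁆ = 0}
  add_mem' := by
    rintro X Y ⟨hX, hX'⟩ ⟨hY, hY'⟩
    refine ⟨by rw [map_add, hX, hY], fun H hH => ?_⟩
    rw [lie_add, hX' H hH, hY' H hH, add_zero]
  zero_mem' := ⟨map_zero _, fun H _ => lie_zero H⟩
  smul_mem' := by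
    rintro c X ⟨hX, hX'⟩
    refine ⟨by rw [map_smul, hX], fun H hH => ?_⟩
    rw [lie_smul, hX' H hH, smul_zero]
  lie_mem' := by
    rintro X Y ⟨hX, hX'⟩ ⟨hY, hY'⟩
    refine ⟨by rw [LieEquiv.map_lie, hX, hY], fun H hH => ?_⟩
    rw [leibniz_lie, hX' H hH, hY' H hH, zero_lie, lie_zero, add_zero]

/-- `n₀`, the sum of the root spaces of the positive restricted roots. -/
def n : Submodule ℝ g :=
  ⨆ μ ∈ {μ : Module.Dual ℝ P.a | μ ∈ roots P.a ∧ 0 < μ P.H₀}, rootSpace P.a μ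

/-- The minimal parabolic subalgebra `p₀ = m₀ + a₀ + n₀`. -/
def p : Submodule ℝ g :=
  P.m.toSubmodule ⊔ P.a.toSubmodule ⊔ P.n

end MinimalParabolic

end Real

/-! ### Standard parabolic subalgebras of a complex semisimple Lie algebra

Here `h` is a Cartan subalgebra and `α 0, …, α (ℓ - 1)` are the simple roots; the simple root
`α i` carries the label `i + 1`, so that the labels are `1, …, ℓ`. -/

section Complex

variable {g : Type*} [LieRing g] [LieAlgebra ℂ g] (h : LieSubalgebra ℂ g) {l : ℕ}
  (α : Fin l → Module.Dual ℂ h)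

/-- The positive roots. -/
def positiveRoots : Set (Module.Dual ℂ h) :=
  {β | β ∈ roots h ∧ β ∈ AddSubmonoid.closure (Set.range α)}

/-- The negative roots. -/
def negativeRoots : Set (Module.Dual ℂ h) :=
  {β | β ∈ roots h ∧ -β ∈ positiveRoots h α}

/-- `Δ^S`, the roots that are integral combinations of the simple roots with label in `S`. -/
def leviRoots (S : Set ℕ) : Set (Module.Dual ℂ h) :=
  {β | β ∈ roots h ∧ β ∈ AddSubgroup.closure (α '' {i : Fin l | (i : ℕ) + 1 ∈ S})}

/-- The Borel subalgebra `b = h ⊕ ⨁_{β > 0} g^β`. -/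
def borel : Submodule ℂ g :=
  h.toSubmodule ⊔ ⨆ β ∈ positiveRoots h α, rootSpace h β

/-- The standard parabolic subalgebra `P_S = b ⊕ ⨁_{β ∈ Δ^S, β < 0} g^β`. -/
def standardParabolic (S : Set ℕ) : Submodule ℂ g :=
  borel h α ⊔ ⨆ β ∈ negativeRoots h α ∩ leviRoots h α S, rootSpace h β

theorem standardParabolic_empty : standardParabolic h α ∅ = borel h α := by
  have h0 : negativeRoots h α ∩ leviRoots h α ∅ = ∅ := by
    ext β
    simp only [leviRoots, roots, Set.mem_inter_iff, Set.mem_ofPred_eq, Set.mem_empty_iff_false,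
      iff_false]
    rintro ⟨-, ⟨hβ, -⟩, hβ'⟩
    apply hβ
    simpa using hβ'
  rw [standardParabolic, h0]
  simp

/-- The image in `g` of the complexification of a real subspace of a Lie algebra `g₀`, under an
identification of the complexification of `g₀` with `g`. -/
def complexImage {g₀ g : Type*} [LieRing g₀] [LieAlgebra ℝ g₀] [LieRing g] [LieAlgebra ℂ g]
    (φ : ℂ ⊗[ℝ] g₀ ≃ₗ⁅ℂ⁆ g) (V : Submodule ℝ g₀) : Submodule ℂ g :=
  (V.baseChange ℂ).map φ.toLinearEquiv.toLinearMap

end Complex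

/-! ### The classical complex Lie algebras with their Cartan subalgebras and simple roots -/

section ClassicalComplex

variable {ι : Type*} [Fintype ι] [DecidableEq ι]

/-- The subalgebra of the diagonal matrices in a Lie algebra of matrices. -/
def diagonalCartan (g : LieSubalgebra ℂ (Matrix ι ι ℂ)) : LieSubalgebra ℂ g where
  carrier := {X | (X : Matrix ι ι ℂ).IsDiag}
  add_mem' := by
    intro X Y hX hY
    exact Matrix.IsDiag.add hX hY
  zero_mem' := Matrix.isDiag_zero
  smul_mem' := by
    intro c X hX
    exact Matrix.IsDiag.smul c hX
  lie_mem' := by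
    intro X Y hX hY
    have h : ∀ A B : Matrix ι ι ℂ, A.IsDiag → B.IsDiag → (⁅A, B⁆ : Matrix ι ι ℂ).IsDiag := by
      intro A B hA hB
      rw [← (Matrix.isDiag_iff_diagonal_diag A).1 hA, ← (Matrix.isDiag_iff_diagonal_diag B).1 hB,
        LieRing.of_associative_ring_bracket, Matrix.diagonal_mul_diagonal,
        Matrix.diagonal_mul_diagonal]
      exact (Matrix.isDiag_diagonal _).sub (Matrix.isDiag_diagonal _)
    exact h _ _ hX hY

/-- The functional that reads off the `j`-th diagonal entry. -/
def entry (g : LieSubalgebra ℂ (Matrix ι ι ℂ)) (j : ι) : Module.Dual ℂ (diagonalCartan g) where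
  toFun H := ((H : g) : Matrix ι ι ℂ) j j
  map_add' _ _ := rfl
  map_smul' _ _ := rfl

/-- `sl(N, ℂ)`. -/
abbrev slC (N : ℕ) : LieSubalgebra ℂ (Matrix (Fin N) (Fin N) ℂ) :=
  LieAlgebra.SpecialLinear.sl (Fin N) ℂ

/-- `so(2l + 1, ℂ)`, for a quadratic form for which the diagonal matrices form a Cartan
subalgebra. -/
abbrev soOddC (l : ℕ) : LieSubalgebra ℂ (Matrix (Unit ⊕ Fin l ⊕ Fin l) (Unit ⊕ Fin l ⊕ Fin l) ℂ) :=
  LieAlgebra.Orthogonal.typeB (Fin l) ℂ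

/-- `sp(l, ℂ)`, of rank `l`. -/
abbrev spC (l : ℕ) : LieSubalgebra ℂ (Matrix (Fin l ⊕ Fin l) (Fin l ⊕ Fin l) ℂ) :=
  LieAlgebra.Symplectic.sp (Fin l) ℂ

/-- `so(2l, ℂ)`, for a quadratic form for which the diagonal matrices form a Cartan subalgebra. -/
abbrev soEvenC (l : ℕ) : LieSubalgebra ℂ (Matrix (Fin l ⊕ Fin l) (Fin l ⊕ Fin l) ℂ) :=
  LieAlgebra.Orthogonal.typeD (Fin l) ℂ

/-- The simple roots `ε₁ - ε₂, …, ε_{N-1} - ε_N` of `sl(N, ℂ)`. -/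
def simpleA (N : ℕ) (i : Fin (N - 1)) : Module.Dual ℂ (diagonalCartan (slC N)) :=
  entry (slC N) ⟨i, by omega⟩ - entry (slC N) ⟨i + 1, by omega⟩

/-- The simple roots `ε₁ - ε₂, …, ε_{l-1} - ε_l, ε_l` of `so(2l + 1, ℂ)`. -/
def simpleB (l : ℕ) (i : Fin l) : Module.Dual ℂ (diagonalCartan (soOddC l)) :=
  if hi : (i : ℕ) + 1 < l then
    entry (soOddC l) (Sum.inr (Sum.inl i)) - entry (soOddC l) (Sum.inr (Sum.inl ⟨i + 1, hi⟩))
  else entry (soOddC l) (Sum.inr (Sum.inl i))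

/-- The simple roots `ε₁ - ε₂, …, ε_{l-1} - ε_l, 2 ε_l` of `sp(l, ℂ)`. -/
def simpleC (l : ℕ) (i : Fin l) : Module.Dual ℂ (diagonalCartan (spC l)) :=
  if hi : (i : ℕ) + 1 < l then
    entry (spC l) (Sum.inl i) - entry (spC l) (Sum.inl ⟨i + 1, hi⟩)
  else (2 : ℂ) • entry (spC l) (Sum.inl i)

/-- The simple roots `ε₁ - ε₂, …, ε_{l-1} - ε_l, ε_{l-1} + ε_l` of `so(2l, ℂ)`, for `2 ≤ l`. -/
def simpleD (l : ℕ) (i : Fin l) : Module.Dual ℂ (diagonalCartan (soEvenC l)) :=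
  if hi : (i : ℕ) + 1 < l then
    entry (soEvenC l) (Sum.inl i) - entry (soEvenC l) (Sum.inl ⟨i + 1, hi⟩)
  else entry (soEvenC l) (Sum.inl ⟨i - 1, by omega⟩) + entry (soEvenC l) (Sum.inl i)

end ClassicalComplex

/-! ### The classical real Lie algebras -/

section ClassicalReal

variable {ι : Type*} [Fintype ι] [DecidableEq ι]

/-- A complex Lie algebra of matrices, regarded as a real one. -/
def realified (g : LieSubalgebra ℂ (Matrix ι ι ℂ)) : LieSubalgebra ℝ (Matrix ι ι ℂ) where
  carrier := g
  add_mem' := g.add_mem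
  zero_mem' := g.zero_mem
  smul_mem' := by
    intro c X hX
    have h : c • X = (c : ℂ) • X := by
      ext i j
      simp
    rw [h]
    exact g.smul_mem _ hX
  lie_mem' := g.lie_mem

/-- The real Lie algebra of the complex matrices `X` with `Xᴴ K + K X = 0`. -/
def skewHermitian (K : Matrix ι ι ℂ) : LieSubalgebra ℝ (Matrix ι ι ℂ) where
  carrier := {X | Xᴴ * K + K * X = 0}
  add_mem' := by
    intro X Y hX hY
    simp only [Set.mem_ofPred_eq] at hX hY ⊢
    rw [Matrix.conjTranspose_add, add_mul, mul_add, add_add_add_comm, hX, hY, add_zero]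
  zero_mem' := by simp
  smul_mem' := by
    intro c X hX
    simp only [Set.mem_ofPred_eq] at hX ⊢
    rw [Matrix.conjTranspose_smul, star_trivial, smul_mul_assoc, mul_smul_comm, ← smul_add, hX,
      smul_zero]
  lie_mem' := by
    intro X Y hX hY
    simp only [Set.mem_ofPred_eq] at hX hY ⊢
    have hX' : Xᴴ * K = -(K * X) := eq_neg_of_add_eq_zero_left hX
    have hY' : Yᴴ * K = -(K * Y) := eq_neg_of_add_eq_zero_left hY
    rw [LieRing.of_associative_ring_bracket, Matrix.conjTranspose_sub, Matrix.conjTranspose_mul,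
      Matrix.conjTranspose_mul, sub_mul, mul_assoc, mul_assoc, hX', hY', mul_neg, mul_neg,
      ← mul_assoc, ← mul_assoc, hX', hY']
    noncomm_ring

/-- The real Lie algebra of the complex matrices `X` with `X J = J X̄`. -/
def conjCommuting (J : Matrix ι ι ℂ) : LieSubalgebra ℝ (Matrix ι ι ℂ) where
  carrier := {X | X * J = J * X.map star}
  add_mem' := by
    intro X Y hX hY
    simp only [Set.mem_ofPred_eq] at hX hY ⊢
    rw [Matrix.map_add star star_add, add_mul, mul_add, hX, hY]
  zero_mem' := by simp
  smul_mem' := by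
    intro c X hX
    simp only [Set.mem_ofPred_eq] at hX ⊢
    have h : (c • X).map star = c • X.map star := by
      ext i j
      simp
    rw [h, smul_mul_assoc, mul_smul_comm, hX]
  lie_mem' := by
    intro X Y hX hY
    simp only [Set.mem_ofPred_eq] at hX hY ⊢
    have hm : ∀ A B : Matrix ι ι ℂ, (A * B).map star = A.map star * B.map star :=
      fun A B => Matrix.map_mul (f := starRingEnd ℂ)
    have hs : ∀ A B : Matrix ι ι ℂ, (A - B).map star = A.map star - B.map star :=
      fun A B => Matrix.map_sub star star_sub A B
    rw [LieRing.of_associative_ring_bracket, hs, hm, hm, sub_mul, mul_sub, mul_assoc, hY,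
      mul_assoc, hX, ← mul_assoc, hX, ← mul_assoc, hY, mul_assoc, mul_assoc]

/-- `sl(n, ℝ)`. -/
abbrev slR (n : ℕ) : LieSubalgebra ℝ (Matrix (Fin n) (Fin n) ℝ) :=
  LieAlgebra.SpecialLinear.sl (Fin n) ℝ

/-- `so(p, r)`. -/
abbrev soPR (p r : ℕ) : LieSubalgebra ℝ (Matrix (Fin p ⊕ Fin r) (Fin p ⊕ Fin r) ℝ) :=
  LieAlgebra.Orthogonal.so' (Fin p) (Fin r) ℝ

/-- `sp(n, ℝ)`, of rank `n`. -/
abbrev spR (n : ℕ) : LieSubalgebra ℝ (Matrix (Fin n ⊕ Fin n) (Fin n ⊕ Fin n) ℝ) :=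
  LieAlgebra.Symplectic.sp (Fin n) ℝ

/-- `su(p, r)`. -/
abbrev suPR (p r : ℕ) : LieSubalgebra ℝ (Matrix (Fin p ⊕ Fin r) (Fin p ⊕ Fin r) ℂ) :=
  skewHermitian (LieAlgebra.Orthogonal.indefiniteDiagonal (Fin p) (Fin r) ℂ) ⊓
    realified (LieAlgebra.SpecialLinear.sl (Fin p ⊕ Fin r) ℂ)

/-- `su*(2n)`. -/
abbrev suStar (n : ℕ) : LieSubalgebra ℝ (Matrix (Fin n ⊕ Fin n) (Fin n ⊕ Fin n) ℂ) :=
  conjCommuting (Matrix.J (Fin n) ℂ) ⊓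
    realified (LieAlgebra.SpecialLinear.sl (Fin n ⊕ Fin n) ℂ)

/-- `sp(p, r)`, the real form of `sp(p + r, ℂ)` that preserves a Hermitian form of signature
`(2p, 2r)`. -/
abbrev spPR (p r : ℕ) : LieSubalgebra ℝ
    (Matrix ((Fin p ⊕ Fin r) ⊕ (Fin p ⊕ Fin r)) ((Fin p ⊕ Fin r) ⊕ (Fin p ⊕ Fin r)) ℂ) :=
  skewHermitian (Matrix.fromBlocks
      (LieAlgebra.Orthogonal.indefiniteDiagonal (Fin p) (Fin r) ℂ) 0 0
      (LieAlgebra.Orthogonal.indefiniteDiagonal (Fin p) (Fin r) ℂ)) ⊓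
    realified (LieAlgebra.Symplectic.sp (Fin p ⊕ Fin r) ℂ)

/-- `so*(2n)`. -/
abbrev soStar (n : ℕ) : LieSubalgebra ℝ (Matrix (Fin n ⊕ Fin n) (Fin n ⊕ Fin n) ℂ) :=
  skewHermitian (Matrix.J (Fin n) ℂ) ⊓ realified (LieAlgebra.Orthogonal.so (Fin n ⊕ Fin n) ℂ)

/-- The one-dimensional Lie algebra `u(1)`. -/
abbrev u1 : LieSubalgebra ℝ (Matrix (Fin 1) (Fin 1) ℂ) :=
  skewHermitian 1

/-- The compact Lie algebra `su(k)`. -/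
abbrev suCompact (k : ℕ) : LieSubalgebra ℝ (Matrix (Fin k) (Fin k) ℂ) :=
  skewHermitian 1 ⊓ realified (LieAlgebra.SpecialLinear.sl (Fin k) ℂ)

/-- The compact Lie algebra `so(k)`. -/
abbrev soCompact (k : ℕ) : LieSubalgebra ℝ (Matrix (Fin k) (Fin k) ℝ) :=
  LieAlgebra.Orthogonal.so (Fin k) ℝ

/-- The compact Lie algebra `sp(k)`, of rank `k`. -/
abbrev spCompact (k : ℕ) : LieSubalgebra ℝ (Matrix (Fin k ⊕ Fin k) (Fin k ⊕ Fin k) ℂ) :=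
  skewHermitian 1 ⊓ realified (LieAlgebra.Symplectic.sp (Fin k) ℂ)

end ClassicalReal

end MinimalParabolics

end

/-!
The proof reduces every choice of `(θ, a₀, chamber)` to one model, and reads everything off the
regular element `H₀` of the model.

**Conjugacy.** Any two choices for the same Lie algebra are conjugate under an automorphism. For two
Cartan involutions `θ` and `θ'` the automorphism `θ θ'` is positive for the inner product
`-κ(X, θ Y)`, its square root is again an automorphism, and it conjugates `θ'` to `θ`
(`IsCartanInvolution.exists_conj`). Once the involutions agree, let `k` maximise `κ(k H, H')` over
the compact group of the automorphisms that commute with `θ`, where `H` and `H'` are the regular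
elements of the two choices. The first variation says that `k H` and `H'` commute, so the two
maximal abelian subspaces agree; the second variation says that no root changes sign between `k H`
and `H'`, so the two chambers agree (`IsCartanInvolution.exists_critical`,
`MinimalParabolic.exists_conj`). Hence a statement that is invariant under isomorphisms has to be
verified for a single choice in a single isomorphic copy (`forall_of_realForm`).

**Models.** The copies are Lie algebras of matrices over `ℝ`, `ℂ` or `ℍ` which are stable under the
conjugate transpose, with `θ X = -Xᴴ` and a real diagonal `H₀` (`ofDiagonal`). They are the matrices
whose trace has real part zero, over `ℝ` and `ℍ` (`linearParabolic`), and the matrices that are skew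
for the orthogonal sum of an anisotropic form and `r` hyperbolic planes, with
`H₀ = (0, r, …, 1, -r, …, -1)` (`IsWittSubalgebra.parabolic`); for `su(p, r)` the trace is zero as
well. A real diagonal matrix whose nonzero entries are distinct has a small centralizer, which gives
`a₀` and `m₀` at once. The dimension of `n₀` follows from `dim g₀ = dim m₀ + dim a₀ + 2 dim n₀`
(`MinimalParabolic.finrank_eq`).

**Complexification.** The subalgebra `p₀` is the sum of the eigenspaces of `ad H₀` with nonnegative
eigenvalues. If the complexification takes `H₀` to a dominant diagonal matrix `D`, then the image of
the complexification of `p₀` is the sum of the eigenspaces of `ad D` with nonnegative eigenvalues,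
and this is `P_S` for the set `S` of the simple roots which vanish on `D`
(`IsRootedBy.complexImage_p`). So `S` is found by looking for equal consecutive entries of `D`: an
entry `t` of `H₀` occurs once in `D` when the scalars are `ℝ` or `ℂ`, and twice when they are `ℍ`,
which is where the odd labels come from; the kernel of `H₀` contributes the zeros of `D` and the
remaining labels. In the same way `m₀ + a₀` is the centralizer of `H₀`, so it becomes the Cartan
subalgebra when the entries of `D` are distinct (`complexImage_m_sup_a`). For `so*(4r)` they are not
distinct, and one adds a regular element of `m₀` to separate them (`exists_isCartanSubalgebra`).
-/

namespace MinimalParabolics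

/-! ### Conjugacy of Cartan involutions -/

section Conjugacy

variable {g : Type*} [LieRing g] [LieAlgebra ℝ g]

/-- A Cartan involution: an involutive automorphism `θ` for which `-κ(X, θ Y)` is positive
definite. -/
structure IsCartanInvolution (θ : g ≃ₗ⁅ℝ⁆ g) : Prop where
  involutive : ∀ X, θ (θ X) = X
  killing_neg : ∀ X, X ≠ 0 → killingForm ℝ g X (θ X) < 0

theorem MinimalParabolic.isCartanInvolution (P : MinimalParabolic g) : IsCartanInvolution P.θ :=
  ⟨P.involutive, P.killing_neg⟩

theorem killingForm_map_map {g' : Type*} [LieRing g'] [LieAlgebra ℝ g'] (e : g ≃ₗ⁅ℝ⁆ g')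
    (X Y : g) : killingForm ℝ g' (e X) (e Y) = killingForm ℝ g X Y :=
  LieAlgebra.killingForm_of_equiv_apply e X Y

theorem killingForm_lie_left (X Y Z : g) :
    killingForm ℝ g ⁅X, Y⁆ Z = -killingForm ℝ g Y ⁅X, Z⁆ := by
  rw [← lie_skew, map_neg, LinearMap.neg_apply, killingForm, LieModule.traceForm_apply_lie_apply]

theorem killingForm_symm (X Y : g) : killingForm ℝ g X Y = killingForm ℝ g Y X :=
  LieModule.traceForm_comm ℝ g g X Y

namespace IsCartanInvolution

variable {θ θ' : g ≃ₗ⁅ℝ⁆ g}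

/-- The inner product `-κ(X, θ Y)` attached to a Cartan involution. -/
@[reducible] noncomputable def core (h : IsCartanInvolution θ) : InnerProductSpace.Core ℝ g where
  inner X Y := -killingForm ℝ g X (θ Y)
  conj_inner_symm X Y := by
    simp only [conj_trivial, neg_inj]
    rw [killingForm_symm, ← killingForm_map_map θ, h.involutive]
  re_inner_nonneg X := by
    by_cases hX : X = 0
    · simp [hX]
    · simpa using (h.killing_neg X hX).le
  add_left X Y Z := by simp [add_comm]
  smul_left X Y r := by simp
  definite X hX := by
    by_contra h0
    have := h.killing_neg X h0
    simp only [neg_eq_zero] at hX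
    linarith

/-- The norm of the inner product `-κ(X, θ Y)`. -/
@[reducible] noncomputable def normedAddCommGroup (h : IsCartanInvolution θ) :
    NormedAddCommGroup g :=
  h.core.toNormedAddCommGroup

/-- The inner product space structure of `-κ(X, θ Y)`. -/
@[reducible] noncomputable def innerProductSpace (h : IsCartanInvolution θ) :
    @InnerProductSpace ℝ g _ h.normedAddCommGroup.toSeminormedAddCommGroup :=
  letI := h.normedAddCommGroup
  InnerProductSpace.ofCore h.core.toCore

/-- Any two Cartan involutions are conjugate. The operator `θ θ'` is positive for the inner product
of `θ`, its square root is an automorphism because the eigenspaces of `θ θ'` multiply like a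
grading, and this square root conjugates `θ'` to `θ`. -/
theorem exists_conj [FiniteDimensional ℝ g] (h : IsCartanInvolution θ)
    (h' : IsCartanInvolution θ') : ∃ φ : g ≃ₗ⁅ℝ⁆ g, ∀ X, φ (θ' X) = θ (φ X) := by
  let _ := h.normedAddCommGroup
  let _ := h.innerProductSpace
  have hin : ∀ X Y : g, inner ℝ X Y = -killingForm ℝ g X (θ Y) := fun X Y => rfl
  let N : g →ₗ[ℝ] g := θ.toLinearEquiv.toLinearMap ∘ₗ θ'.toLinearEquiv.toLinearMap
  have hN : ∀ X, N X = θ (θ' X) := fun X => rfl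
  have hNlie : ∀ X Y, N ⁅X, Y⁆ = ⁅N X, N Y⁆ := fun X Y => by
    rw [hN, LieEquiv.map_lie, LieEquiv.map_lie]; rfl
  have hsymm : N.IsSymmetric := by
    intro X Y
    rw [hin, hin, hN, hN, killingForm_map_map, h.involutive,
      ← killingForm_map_map θ' X, h'.involutive]
  set n := Module.finrank ℝ g with hn
  let b := hsymm.eigenvectorBasis hn.symm
  let ev := hsymm.eigenvalues hn.symm
  have hb : ∀ i, N (b i) = ev i • b i := fun i => hsymm.apply_eigenvectorBasis hn.symm i
  have hb0 : ∀ i, b i ≠ 0 := fun i => by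
    simpa using b.toBasis.ne_zero i
  have hpos : ∀ v : g, v ≠ 0 → ∀ c : ℝ, N v = c • v → 0 < c := by
    intro v hv c hc
    have h1 : inner ℝ (N v) v = -killingForm ℝ g v (θ' v) := by
      rw [hin, hN, killingForm_map_map, killingForm_symm]
    have h2 : 0 < inner ℝ (N v) v := by
      rw [h1]
      linarith [h'.killing_neg v hv]
    rw [hc, inner_smul_left] at h2
    have h3 : 0 < inner ℝ v v := by
      rw [hin]
      linarith [h.killing_neg v hv]
    exact pos_of_mul_pos_left (by simpa using h2) h3.le
  -- the square root of `N = θ θ'`, on an orthonormal basis of eigenvectors of `N`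
  let φ : g →ₗ[ℝ] g := b.toBasis.constr ℝ fun i => Real.sqrt (ev i) • b i
  have hφb : ∀ i, φ (b i) = Real.sqrt (ev i) • b i := fun i => by
    have := b.toBasis.constr_basis ℝ (fun i => Real.sqrt (ev i) • b i) i
    rwa [OrthonormalBasis.coe_toBasis] at this
  have hφ : ∀ (v : g) (c : ℝ), N v = c • v → φ v = Real.sqrt c • v := by
    intro v c hv
    have hc : ∀ i, b.repr v i • Real.sqrt (ev i) • b i = Real.sqrt c • b.repr v i • b i := by
      intro i
      have h1 := hsymm.eigenvectorBasis_apply_self_apply hn.symm v i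
      rw [hv] at h1
      simp only [map_smul, PiLp.smul_apply, smul_eq_mul] at h1
      by_cases h0 : b.repr v i = 0
      · simp [h0]
      · have : c = ev i := mul_right_cancel₀ h0 h1
        rw [this, smul_comm]
    conv_lhs => rw [← b.sum_repr v]
    conv_rhs => rw [← b.sum_repr v]
    rw [map_sum, Finset.smul_sum]
    exact Finset.sum_congr rfl fun i _ => by rw [map_smul, hφb, hc]
  -- the eigenvalues of `N` multiply under the bracket, hence so do their square roots
  have hφlie : ∀ X Y, φ ⁅X, Y⁆ = ⁅φ X, φ Y⁆ := by
    intro X Y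
    have key : ∀ i j, φ ⁅b i, b j⁆ = ⁅φ (b i), φ (b j)⁆ := by
      intro i j
      rw [hφ _ (ev i * ev j) (by rw [hNlie, hb, hb, smul_lie, lie_smul, smul_smul]),
        hφb, hφb, smul_lie, lie_smul, smul_smul,
        Real.sqrt_mul (hpos _ (hb0 i) _ (hb i)).le]
    rw [← b.sum_repr X, ← b.sum_repr Y]
    simp only [map_sum, map_smul, sum_lie, lie_sum, smul_lie, lie_smul, key]
  have hinj : Function.Injective φ := by
    rw [← LinearMap.ker_eq_bot, LinearMap.ker_eq_bot']
    intro v hv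
    refine b.toBasis.ext_elem fun i => ?_
    have h1 : b.repr (φ v) i = Real.sqrt (ev i) * b.repr v i := by
      conv_lhs => rw [← b.sum_repr v]
      simp only [map_sum, map_smul, hφb, b.repr_self]
      simp [Pi.single_apply, mul_comm]
    rw [hv] at h1
    have h2 : Real.sqrt (ev i) ≠ 0 := (Real.sqrt_pos.2 (hpos _ (hb0 i) _ (hb i))).ne'
    simpa [h2, eq_comm] using h1
  let φ' : g →ₗ⁅ℝ⁆ g := { φ with map_lie' := fun {X Y} => hφlie X Y }
  refine ⟨LieEquiv.ofBijective φ' ⟨hinj, LinearMap.injective_iff_surjective.1 hinj⟩, ?_⟩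
  suffices φ ∘ₗ θ'.toLinearEquiv.toLinearMap = θ.toLinearEquiv.toLinearMap ∘ₗ φ from
    fun X => LinearMap.congr_fun this X
  refine b.toBasis.ext fun i => ?_
  have hc := hpos _ (hb0 i) _ (hb i)
  have h1 : θ' (b i) = ev i • θ (b i) := by
    rw [← map_smul, ← hb, hN, h.involutive]
  -- the involution maps the eigenspace of `N` for `c` to the one for the inverse of `c`
  have h2 : N (θ' (b i)) = (ev i)⁻¹ • θ' (b i) := by
    rw [hN, h'.involutive, h1, smul_smul, inv_mul_cancel₀ hc.ne', one_smul]
  change φ (θ' (b.toBasis i)) = θ (φ (b.toBasis i))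
  rw [OrthonormalBasis.coe_toBasis, hφ _ _ h2, hφb, map_smul, h1, smul_smul, Real.sqrt_inv]
  congr 1
  have := Real.sqrt_pos.2 hc
  field_simp
  exact (Real.sq_sqrt hc.le).symm

end IsCartanInvolution

end Conjugacy

section Exponential

variable {V : Type*} [NormedAddCommGroup V] [NormedSpace ℝ V] [FiniteDimensional ℝ V]

/-- The derivative of `t ↦ exp (tA) v`. -/
theorem hasDerivAt_exp_smul_apply (A : V →L[ℝ] V) (v : V) (t : ℝ) :
    HasDerivAt (fun s : ℝ => NormedSpace.exp (s • A) v) (A (NormedSpace.exp (t • A) v)) t := by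
  have : CompleteSpace V := FiniteDimensional.complete ℝ V
  have h := (hasDerivAt_exp_smul_const' (𝕂 := ℝ) A t)
  exact h.clm_apply (hasDerivAt_const t v) |>.congr_deriv (by simp)

theorem exp_smul_exp_neg_smul_apply (A : V →L[ℝ] V) (s : ℝ) (v : V) :
    NormedSpace.exp (s • A) (NormedSpace.exp ((-s) • A) v) = v := by
  have : CompleteSpace V := FiniteDimensional.complete ℝ V
  let _ : NormedAlgebra ℚ (V →L[ℝ] V) := NormedAlgebra.restrictScalars ℚ ℝ _
  have h := NormedSpace.exp_add_of_commute (x := s • A) (y := (-s) • A)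
    ((Commute.refl A).smul_left s |>.smul_right (-s))
  rw [← add_smul, add_neg_cancel, zero_smul, NormedSpace.exp_zero] at h
  exact (DFunLike.congr_fun h v).symm

/-- The exponential of a derivation of a bilinear product is an automorphism of the product. -/
theorem exp_apply_bilinear (A : V →L[ℝ] V) (β : V →L[ℝ] V →L[ℝ] V)
    (hA : ∀ x y, A (β x y) = β (A x) y + β x (A y)) (t : ℝ) (x y : V) :
    NormedSpace.exp (t • A) (β x y) =
      β (NormedSpace.exp (t • A) x) (NormedSpace.exp (t • A) y) := by
  have : CompleteSpace V := FiniteDimensional.complete ℝ V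
  -- the product `exp (-sA) β(exp (sA) x, exp (sA) y)` does not depend on `s`
  have hd : ∀ s : ℝ, HasDerivAt (fun s : ℝ => NormedSpace.exp ((-s) • A)
      (β (NormedSpace.exp (s • A) x) (NormedSpace.exp (s • A) y))) 0 s := by
    intro s
    have h1 : HasDerivAt (fun u : ℝ => NormedSpace.exp ((-u) • A))
        (-(NormedSpace.exp ((-s) • A) * A)) s := by
      have := (hasDerivAt_exp_smul_const (𝕂 := ℝ) A (-s)).scomp s (hasDerivAt_neg s)
      simpa [Function.comp_def] using this
    have h2 := β.hasFDerivAt.comp_hasDerivAt s (hasDerivAt_exp_smul_apply A x s)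
    have h3 := h2.clm_apply (hasDerivAt_exp_smul_apply A y s)
    refine (h1.clm_apply h3).congr_deriv ?_
    simp only [Function.comp_apply, _root_.neg_apply, mul_apply_eq_comp, hA,
      map_add]
    abel
  have hc := is_const_of_deriv_eq_zero (fun s => (hd s).differentiableAt)
    (fun s => (hd s).deriv) t 0
  simp only [neg_zero, zero_smul, NormedSpace.exp_zero, one_apply_eq_self] at hc
  rw [← hc, exp_smul_exp_neg_smul_apply]

end Exponential

section Conjugacy

variable {g : Type*} [LieRing g] [LieAlgebra ℝ g]

/-- If `f` has a global maximum at `0`, then its first derivative at `0` vanishes and its second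
derivative at `0` is nonpositive. -/
theorem deriv_conditions_of_max {f f' : ℝ → ℝ} {f'' : ℝ} (h1 : ∀ t, HasDerivAt f (f' t) t)
    (h2 : HasDerivAt f' f'' 0) (hmax : ∀ t, f t ≤ f 0) : f' 0 = 0 ∧ f'' ≤ 0 := by
  have h0 : f' 0 = 0 := by
    have : IsLocalMax f 0 := Filter.Eventually.of_forall hmax
    exact this.hasDerivAt_eq_zero (h1 0)
  refine ⟨h0, ?_⟩
  by_contra! hpos
  have hd : deriv f = f' := funext fun t => (h1 t).deriv
  have hloc := isLocalMin_of_deriv_deriv_pos (f := f) (x₀ := 0)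
    (by rw [hd, h2.deriv]; exact hpos) (by rw [hd, h0]) (h1 0).continuousAt
  have hc : f =ᶠ[nhds 0] fun _ => f 0 := by
    filter_upwards [hloc] with t ht
    exact le_antisymm (hmax t) ht
  have hc' : f' =ᶠ[nhds 0] fun _ => 0 := by
    have := hc.deriv
    rw [hd] at this
    simpa using this
  have := (h2.congr_of_eventuallyEq hc'.symm).unique (hasDerivAt_const (0 : ℝ) (0 : ℝ))
  linarith

/-- For `H` and `H'` there is an automorphism `k` commuting with the Cartan involution that
maximises `κ(k H, H')`; the first and second variation along `exp (t ad X)`, with `X` fixed by the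
Cartan involution, give the stated conditions. -/
theorem IsCartanInvolution.exists_critical [FiniteDimensional ℝ g] {θ : g ≃ₗ⁅ℝ⁆ g}
    (h : IsCartanInvolution θ) (H H' : g) : ∃ k : g ≃ₗ⁅ℝ⁆ g, (∀ X, k (θ X) = θ (k X)) ∧
      ∀ X, θ X = X → killingForm ℝ g ⁅X, k H⁆ H' = 0 ∧ killingForm ℝ g ⁅X, ⁅X, k H⁆⁆ H' ≤ 0 := by
  let _ := h.normedAddCommGroup
  let _ := h.innerProductSpace
  have : CompleteSpace g := FiniteDimensional.complete ℝ g
  have hin : ∀ X Y : g, inner ℝ X Y = -killingForm ℝ g X (θ Y) := fun X Y => rfl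
  have hnorm : ∀ k : g ≃ₗ⁅ℝ⁆ g, (∀ X, k (θ X) = θ (k X)) → ∀ X, ‖k X‖ = ‖X‖ := by
    intro k hk X
    rw [@norm_eq_sqrt_real_inner g, @norm_eq_sqrt_real_inner g, hin, hin, ← hk, killingForm_map_map]
  let θc : g →L[ℝ] g := LinearMap.toContinuousLinearMap θ.toLinearEquiv.toLinearMap
  have hθc : ∀ X, θc X = θ X := fun X => rfl
  let β : g →L[ℝ] g →L[ℝ] g := LinearMap.toContinuousLinearMap
    ((LinearMap.toContinuousLinearMap : (g →ₗ[ℝ] g) ≃ₗ[ℝ] (g →L[ℝ] g)).toLinearMap ∘ₗ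
      (LieAlgebra.ad ℝ g).toLinearMap)
  have hβ : ∀ X Y, β X Y = ⁅X, Y⁆ := fun X Y => rfl
  let κ : g →L[ℝ] ℝ := LinearMap.toContinuousLinearMap ((killingForm ℝ g) H')
  have hκ : ∀ X, κ X = killingForm ℝ g X H' := fun X => killingForm_symm _ _
  -- the automorphisms commuting with the Cartan involution; they are isometries, and the last
  -- condition, which follows from the others, makes the compactness evident
  let K : Set (g →L[ℝ] g) := {k | (∀ X Y, k (β X Y) = β (k X) (k Y)) ∧
    (∀ X, k (θc X) = θc (k X)) ∧ ∀ X, ‖k X‖ = ‖X‖}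
  have hev : ∀ X, Continuous fun k : g →L[ℝ] g => k X := fun X =>
    (ContinuousLinearMap.apply ℝ g X).continuous
  have hKclosed : IsClosed K := by
    have h1 : IsClosed {k : g →L[ℝ] g | ∀ X Y, k (β X Y) = β (k X) (k Y)} := by
      simp only [Set.ofPred_forall]
      refine isClosed_iInter fun X => isClosed_iInter fun Y => isClosed_eq (hev _) ?_
      exact (β.continuous.comp (hev X)).clm_apply (hev Y)
    have h2 : IsClosed {k : g →L[ℝ] g | ∀ X, k (θc X) = θc (k X)} := by
      simp only [Set.ofPred_forall]
      exact isClosed_iInter fun X => isClosed_eq (hev _) (θc.continuous.comp (hev X))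
    have h3 : IsClosed {k : g →L[ℝ] g | ∀ X, ‖k X‖ = ‖X‖} := by
      simp only [Set.ofPred_forall]
      exact isClosed_iInter fun X => isClosed_eq (hev X).norm continuous_const
    exact h1.inter (h2.inter h3)
  have hKcompact : IsCompact K := by
    have : ProperSpace (g →L[ℝ] g) := FiniteDimensional.proper ℝ _
    refine (isCompact_closedBall (0 : g →L[ℝ] g) 1).of_isClosed_subset hKclosed fun k hk => ?_
    rw [mem_closedBall_zero_iff]
    exact k.opNorm_le_bound zero_le_one fun X => by rw [hk.2.2 X, one_mul]
  obtain ⟨k₀, hk₀, hmax⟩ := hKcompact.exists_isMaxOn (f := fun k => κ (k H))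
    ⟨ContinuousLinearMap.id ℝ g, fun _ _ => rfl, fun _ => rfl, fun _ => rfl⟩
    (κ.continuous.comp (hev H)).continuousOn
  have hinj : Function.Injective k₀.toLinearMap := by
    rw [← LinearMap.ker_eq_bot, LinearMap.ker_eq_bot']
    intro X hX
    have h1 := hk₀.2.2 X
    rw [show k₀ X = 0 from hX, norm_zero] at h1
    exact norm_eq_zero.1 h1.symm
  let k : g ≃ₗ⁅ℝ⁆ g := LieEquiv.ofBijective
    ({ k₀.toLinearMap with map_lie' := fun {X Y} => hk₀.1 X Y } : g →ₗ⁅ℝ⁆ g)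
    ⟨hinj, LinearMap.injective_iff_surjective.1 hinj⟩
  have hk : ∀ X, k X = k₀ X := fun X => rfl
  refine ⟨k, hk₀.2.1, fun X hX => ?_⟩
  let A : g →L[ℝ] g := β X
  have hexpinv := exp_smul_exp_neg_smul_apply A
  have hexpinj : ∀ s : ℝ, Function.Injective (NormedSpace.exp (s • A) : g →L[ℝ] g) := by
    intro s
    have hl : Function.LeftInverse (NormedSpace.exp ((-s) • A) : g →L[ℝ] g)
          (NormedSpace.exp (s • A) : g →L[ℝ] g) := by
      intro v
      have := hexpinv (-s) v
      rwa [neg_neg] at this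
    exact hl.injective
  have hexplie : ∀ (s : ℝ) (Y Z : g), NormedSpace.exp (s • A) ⁅Y, Z⁆ =
      ⁅NormedSpace.exp (s • A) Y, NormedSpace.exp (s • A) Z⁆ := fun s Y Z =>
    exp_apply_bilinear A β (fun Y Z => by simp only [A, hβ, leibniz_lie X Y Z]) s Y Z
  have hexpθ : ∀ (s : ℝ) (Y : g), NormedSpace.exp (s • A) (θ Y) =
      θ (NormedSpace.exp (s • A) Y) := by
    intro s Y
    have hc : Commute θc (s • A) := by
      refine Commute.smul_right ?_ s
      ext Y
      change θ ⁅X, Y⁆ = ⁅X, θ Y⁆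
      rw [LieEquiv.map_lie, hX]
    exact (DFunLike.congr_fun hc.exp_right.eq Y).symm
  let e : ℝ → g ≃ₗ⁅ℝ⁆ g := fun s => LieEquiv.ofBijective
    ({ (NormedSpace.exp (s • A)).toLinearMap with map_lie' := fun {Y Z} => hexplie s Y Z } :
      g →ₗ⁅ℝ⁆ g)
    ⟨hexpinj s, fun v => ⟨_, hexpinv s v⟩⟩
  have he : ∀ s Y, e s Y = NormedSpace.exp (s • A) Y := fun s Y => rfl
  -- a curve in `K` through `k₀`, along which the maximum is attained at `s = 0`
  have hmem : ∀ s : ℝ, NormedSpace.exp (s • A) * k₀ ∈ K := by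
    intro s
    refine ⟨fun Y Z => ?_, fun Y => ?_, fun Y => ?_⟩
    · change NormedSpace.exp (s • A) (k₀ (β Y Z)) = _
      rw [hk₀.1 Y Z]
      exact hexplie s _ _
    · change NormedSpace.exp (s • A) (k₀ (θc Y)) = _
      rw [hk₀.2.1 Y]
      exact hexpθ s _
    · change ‖e s (k₀ Y)‖ = _
      rw [hnorm (e s) (hexpθ s), hk₀.2.2]
  have hd1 : ∀ v t, HasDerivAt (fun s : ℝ => κ (NormedSpace.exp (s • A) v))
      (κ (NormedSpace.exp (t • A) (A v))) t := by
    intro v t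
    have h1 := κ.hasFDerivAt.comp_hasDerivAt t (hasDerivAt_exp_smul_apply A v t)
    have hc : Commute A (NormedSpace.exp (t • A)) := ((Commute.refl A).smul_right t).exp_right
    refine h1.congr_deriv ?_
    congr 1
    exact DFunLike.congr_fun hc.eq v
  have hfin := deriv_conditions_of_max (hd1 (k₀ H)) (hd1 (A (k₀ H)) 0) (fun t => by
    simp only [zero_smul, NormedSpace.exp_zero, one_apply_eq_self]
    exact hmax (hmem t))
  simp only [zero_smul, NormedSpace.exp_zero, one_apply_eq_self] at hfin
  rw [hk, ← hκ, ← hκ]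
  exact hfin

end Conjugacy

/-! ### Conjugacy of minimal parabolic subalgebras -/

section Conjugacy

variable {g : Type*} [LieRing g] [LieAlgebra ℝ g]

namespace MinimalParabolic

theorem mem_m (P : MinimalParabolic g) {X : g} :
    X ∈ P.m ↔ P.θ X = X ∧ ∀ H ∈ P.a, ⁅H, X⁆ = 0 := Iff.rfl

theorem killingForm_pos_of_map_eq_neg (P : MinimalParabolic g) {X : g} (hX : P.θ X = -X)
    (h0 : X ≠ 0) : 0 < killingForm ℝ g X X := by
  have := P.killing_neg X h0
  rw [hX, map_neg] at this
  linarith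

theorem lie_theta_of_mem_a (P : MinimalParabolic g) {H : g} (hH : H ∈ P.a) (X : g) :
    ⁅H, P.θ X⁆ = -P.θ ⁅H, X⁆ := by
  rw [LieEquiv.map_lie, P.a_le H hH, neg_lie, neg_neg]

/-- The root space of `0` is `m₀ + a₀`. -/
theorem mem_m_sup_a (P : MinimalParabolic g) {X : g} :
    X ∈ P.m.toSubmodule ⊔ P.a.toSubmodule ↔ ∀ H ∈ P.a, ⁅H, X⁆ = 0 := by
  constructor
  · intro hX H hH
    obtain ⟨Y, hY, Z, hZ, rfl⟩ := Submodule.mem_sup.1 hX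
    rw [lie_add, (P.mem_m.1 hY).2 H hH, P.a_abelian H hH Z hZ, add_zero]
  · intro hX
    have h1 : ∀ H ∈ P.a, ⁅H, P.θ X⁆ = 0 := fun H hH => by
      rw [P.lie_theta_of_mem_a hH, hX H hH, map_zero, neg_zero]
    refine Submodule.mem_sup.2 ⟨(1 / 2 : ℝ) • (X + P.θ X), P.mem_m.2 ⟨?_, fun H hH => ?_⟩,
      (1 / 2 : ℝ) • (X - P.θ X), P.a_maximal _ ?_ fun H hH => ?_, ?_⟩
    · rw [map_smul, map_add, P.involutive, add_comm]
    · rw [lie_smul, lie_add, hX H hH, h1 H hH, add_zero, smul_zero]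
    · rw [map_smul, map_sub, P.involutive, ← smul_neg, neg_sub]
    · rw [lie_smul, lie_sub, hX H hH, h1 H hH, sub_zero, smul_zero]
    · rw [← smul_add, add_add_sub_cancel, ← two_smul ℝ X, smul_smul]
      norm_num

/-- The restricted root space decomposition: the operators `ad H`, `H ∈ a₀`, commute and are
symmetric for the inner product of the Cartan involution. -/
theorem iSup_rootSpace [FiniteDimensional ℝ g] (P : MinimalParabolic g) :
    ⨆ μ : Module.Dual ℝ P.a, rootSpace P.a μ = ⊤ := by
  let _ := P.isCartanInvolution.normedAddCommGroup
  let _ := P.isCartanInvolution.innerProductSpace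
  have hin : ∀ X Y : g, inner ℝ X Y = -killingForm ℝ g X (P.θ Y) := fun X Y => rfl
  let T : P.a → g →ₗ[ℝ] g := fun H => LieAlgebra.ad ℝ g (H : g)
  have hT : ∀ H : P.a, (T H).IsSymmetric := by
    intro H X Y
    change inner ℝ ⁅(H : g), X⁆ Y = inner ℝ X ⁅(H : g), Y⁆
    rw [hin, hin, killingForm_lie_left, P.lie_theta_of_mem_a H.2, map_neg, neg_neg]
  have hcomm : Pairwise (Function.onFun Commute T) := by
    intro H H' _
    refine LinearMap.ext fun X => ?_
    change ⁅(H : g), ⁅(H' : g), X⁆⁆ = ⁅(H' : g), ⁅(H : g), X⁆⁆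
    rw [leibniz_lie, P.a_abelian H H.2 H' H'.2, zero_lie, zero_add]
  have htop := LinearMap.IsSymmetric.iSup_iInf_eq_top_of_commute hT hcomm
  rw [eq_top_iff, ← htop]
  refine iSup_le fun χ => ?_
  by_cases hbot : (⨅ H, Module.End.eigenspace (T H) (χ H)) = ⊥
  · rw [hbot]
    exact bot_le
  obtain ⟨v, hv, hv0⟩ := Submodule.exists_mem_ne_zero_of_ne_bot hbot
  have hmem : ∀ {w : g}, w ∈ (⨅ H, Module.End.eigenspace (T H) (χ H)) →
      ∀ H : P.a, ⁅(H : g), w⁆ = χ H • w := fun hw H =>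
    Module.End.mem_eigenspace_iff.1 ((Submodule.mem_iInf _).1 hw H)
  let μ : Module.Dual ℝ P.a :=
    { toFun := χ
      map_add' := fun H H' => by
        apply smul_left_injective ℝ hv0
        simp only [add_smul]
        rw [← hmem hv, ← hmem hv, ← hmem hv, ← add_lie]
        rfl
      map_smul' := fun c H => by
        apply smul_left_injective ℝ hv0
        simp only [RingHom.id_apply, smul_eq_mul, mul_smul]
        rw [← hmem hv, ← hmem hv, ← smul_lie]
        rfl }
  refine le_trans (fun w hw => ?_) (le_iSup _ μ)
  exact (mem_rootSpace _ _ _).2 (hmem hw)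

/-- The sum of the eigenspaces of `ad H` for the positive eigenvalues. -/
def _root_.MinimalParabolics.posEigen (H : g) : Submodule ℝ g :=
  ⨆ c ∈ Set.Ioi (0 : ℝ), Module.End.eigenspace (LieAlgebra.ad ℝ g H) c

/-- The sum of the eigenspaces of `ad H` for the negative eigenvalues. -/
def _root_.MinimalParabolics.negEigen (H : g) : Submodule ℝ g :=
  ⨆ c ∈ Set.Iio (0 : ℝ), Module.End.eigenspace (LieAlgebra.ad ℝ g H) c

theorem rootSpace_le_eigenspace (P : MinimalParabolic g) (μ : Module.Dual ℝ P.a) :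
    rootSpace P.a μ ≤ Module.End.eigenspace (LieAlgebra.ad ℝ g (P.H₀ : g)) (μ P.H₀) :=
  fun _ hX => Module.End.mem_eigenspace_iff.2 ((mem_rootSpace _ _ _).1 hX P.H₀)

/-- The decomposition into root spaces, sorted by the sign of the roots at `H₀`: `g₀` is the sum of
`m₀ + a₀`, of `n₀` and of the negative eigenspaces of `ad H₀`. -/
theorem sup_eq_top [FiniteDimensional ℝ g] (P : MinimalParabolic g) :
    (P.m.toSubmodule ⊔ P.a.toSubmodule) ⊔ P.n ⊔ negEigen (P.H₀ : g) = ⊤ := by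
  rw [eq_top_iff, ← P.iSup_rootSpace]
  refine iSup_le fun μ => ?_
  by_cases hbot : rootSpace P.a μ = ⊥
  · rw [hbot]
    exact bot_le
  by_cases h0 : μ = 0
  · refine le_sup_of_le_left (le_sup_of_le_left fun X hX => P.mem_m_sup_a.2 fun H hH => ?_)
    have := (mem_rootSpace _ _ _).1 hX ⟨H, hH⟩
    simpa [h0] using this
  have hroot : μ ∈ roots P.a := ⟨h0, hbot⟩
  rcases lt_or_gt_of_ne (P.regular μ hroot) with h | h
  · refine le_sup_of_le_right ((P.rootSpace_le_eigenspace μ).trans ?_)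
    exact le_biSup (fun c => Module.End.eigenspace (LieAlgebra.ad ℝ g (P.H₀ : g)) c) h
  · refine le_sup_of_le_left (le_sup_of_le_right ?_)
    exact le_biSup (fun μ => rootSpace P.a μ) (show μ ∈ {μ | μ ∈ roots P.a ∧ 0 < μ P.H₀} from
      ⟨hroot, h⟩)

theorem n_le_posEigen (P : MinimalParabolic g) : P.n ≤ posEigen (P.H₀ : g) :=
  iSup₂_le fun μ hμ => (P.rootSpace_le_eigenspace μ).trans
    (le_biSup (fun c => Module.End.eigenspace (LieAlgebra.ad ℝ g (P.H₀ : g)) c) hμ.2)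

theorem m_sup_a_le_eigenspace (P : MinimalParabolic g) : P.m.toSubmodule ⊔ P.a.toSubmodule ≤
    Module.End.eigenspace (LieAlgebra.ad ℝ g (P.H₀ : g)) 0 := by
  intro X hX
  rw [Module.End.mem_eigenspace_iff, zero_smul]
  exact P.mem_m_sup_a.1 hX _ P.H₀.2

theorem _root_.MinimalParabolics.disjoint_posEigen (H : g) :
    Disjoint (Module.End.eigenspace (LieAlgebra.ad ℝ g H) 0) (posEigen H) := by
  have := (Module.End.eigenspaces_iSupIndep (LieAlgebra.ad ℝ g H)).disjoint_biSup
    (x := 0) (y := Set.Ioi 0) (by simp)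
  exact this

theorem _root_.MinimalParabolics.disjoint_negEigen (H : g) :
    Disjoint (Module.End.eigenspace (LieAlgebra.ad ℝ g H) 0 ⊔ posEigen H) (negEigen H) := by
  have := (Module.End.eigenspaces_iSupIndep (LieAlgebra.ad ℝ g H)).disjoint_biSup_biSup
    (s := Set.Ici 0) (t := Set.Iio 0) (Set.disjoint_left.2 fun x hx hx' => not_lt.2 hx hx')
  refine this.mono_left (sup_le ?_ ?_)
  · exact le_biSup (fun c => Module.End.eigenspace (LieAlgebra.ad ℝ g H) c) (Set.mem_Ici.2 le_rfl)
  · exact iSup₂_le fun c hc =>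
      le_biSup (fun c => Module.End.eigenspace (LieAlgebra.ad ℝ g H) c)
        (Set.mem_Ici.2 (le_of_lt hc))

/-- `m₀ + a₀` is the centralizer of the regular element `H₀`. -/
theorem m_sup_a_eq_eigenspace [FiniteDimensional ℝ g] (P : MinimalParabolic g) :
    P.m.toSubmodule ⊔ P.a.toSubmodule =
    Module.End.eigenspace (LieAlgebra.ad ℝ g (P.H₀ : g)) 0 := by
  have h1 := disjoint_negEigen (P.H₀ : g)
  have h2 := disjoint_posEigen (P.H₀ : g)
  refine eq_of_le_of_inf_le_of_sup_le (z := P.n ⊔ negEigen (P.H₀ : g)) P.m_sup_a_le_eigenspace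
    ?_ ?_
  · refine le_trans ?_ bot_le
    have h3 : Disjoint (posEigen (P.H₀ : g)) (negEigen (P.H₀ : g)) := h1.mono_left le_sup_right
    have h4 := h2.disjoint_sup_right_of_disjoint_sup_left h1
    exact (h4.mono_right (sup_le_sup_right P.n_le_posEigen _)).le_bot
  · rw [← sup_assoc, ← sup_assoc, P.sup_eq_top]
    exact le_top

theorem n_eq_posEigen [FiniteDimensional ℝ g] (P : MinimalParabolic g) :
    P.n = posEigen (P.H₀ : g) := by
  have h1 := disjoint_negEigen (P.H₀ : g)
  have h2 := disjoint_posEigen (P.H₀ : g)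
  refine eq_of_le_of_inf_le_of_sup_le
    (z := (P.m.toSubmodule ⊔ P.a.toSubmodule) ⊔ negEigen (P.H₀ : g)) P.n_le_posEigen ?_ ?_
  · refine le_trans ?_ bot_le
    rw [sup_comm] at h1
    have h4 := h2.symm.disjoint_sup_right_of_disjoint_sup_left h1
    exact (h4.mono_right (sup_le_sup_right P.m_sup_a_le_eigenspace _)).le_bot
  · have := P.sup_eq_top
    rw [sup_right_comm, sup_comm] at this
    rw [this]
    exact le_top

theorem lie_eq_zero_of_lie_H₀ [FiniteDimensional ℝ g] (P : MinimalParabolic g) {X : g}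
    (hX : ⁅(P.H₀ : g), X⁆ = 0) :
    ∀ H ∈ P.a, ⁅H, X⁆ = 0 := by
  rw [← P.mem_m_sup_a, P.m_sup_a_eq_eigenspace, Module.End.mem_eigenspace_iff, zero_smul]
  exact hX

theorem map_theta_posEigen (P : MinimalParabolic g) :
    (posEigen (P.H₀ : g)).map P.θ.toLinearEquiv.toLinearMap ≤ negEigen (P.H₀ : g) := by
  rw [posEigen, Submodule.map_iSup]
  refine iSup_le fun c => ?_
  rw [Submodule.map_iSup]
  refine iSup_le fun hc => ?_
  refine le_trans ?_ (le_biSup (fun c => Module.End.eigenspace (LieAlgebra.ad ℝ g (P.H₀ : g)) c)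
    (show -c ∈ Set.Iio (0 : ℝ) by simpa using hc))
  rintro _ ⟨X, hX, rfl⟩
  rw [SetLike.mem_coe, Module.End.mem_eigenspace_iff] at hX
  rw [Module.End.mem_eigenspace_iff]
  change ⁅(P.H₀ : g), P.θ X⁆ = -c • P.θ X
  rw [P.lie_theta_of_mem_a P.H₀.2, show ⁅(P.H₀ : g), X⁆ = c • X from hX, map_smul, neg_smul]

theorem map_theta_negEigen (P : MinimalParabolic g) :
    (negEigen (P.H₀ : g)).map P.θ.toLinearEquiv.toLinearMap ≤ posEigen (P.H₀ : g) := by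
  rw [negEigen, Submodule.map_iSup]
  refine iSup_le fun c => ?_
  rw [Submodule.map_iSup]
  refine iSup_le fun hc => ?_
  refine le_trans ?_ (le_biSup (fun c => Module.End.eigenspace (LieAlgebra.ad ℝ g (P.H₀ : g)) c)
    (show -c ∈ Set.Ioi (0 : ℝ) by simpa using hc))
  rintro _ ⟨X, hX, rfl⟩
  rw [SetLike.mem_coe, Module.End.mem_eigenspace_iff] at hX
  rw [Module.End.mem_eigenspace_iff]
  change ⁅(P.H₀ : g), P.θ X⁆ = -c • P.θ X
  rw [P.lie_theta_of_mem_a P.H₀.2, show ⁅(P.H₀ : g), X⁆ = c • X from hX, map_smul, neg_smul]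

/-- The dimension formula for `g₀ = m₀ + a₀ + n₀ + θ n₀`. -/
theorem finrank_eq [FiniteDimensional ℝ g] (P : MinimalParabolic g) : Module.finrank ℝ g =
    Module.finrank ℝ P.m + Module.finrank ℝ P.a + 2 * Module.finrank ℝ P.n := by
  have hn : Module.finrank ℝ (negEigen (P.H₀ : g)) = Module.finrank ℝ P.n := by
    rw [P.n_eq_posEigen]
    refine le_antisymm ?_ ?_
    · rw [← LinearEquiv.finrank_map_eq P.θ.toLinearEquiv]
      exact Submodule.finrank_mono P.map_theta_negEigen
    · rw [← LinearEquiv.finrank_map_eq P.θ.toLinearEquiv (posEigen (P.H₀ : g))]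
      exact Submodule.finrank_mono P.map_theta_posEigen
  have h1 := disjoint_negEigen (P.H₀ : g)
  have h2 := disjoint_posEigen (P.H₀ : g)
  have h3 : Disjoint P.m.toSubmodule P.a.toSubmodule := by
    rw [Submodule.disjoint_def]
    intro X hX hX'
    have h4 := P.a_le X hX'
    rw [(P.mem_m.1 hX).1] at h4
    have h5 : (2 : ℝ) • X = 0 := by
      rw [two_smul]
      nth_rewrite 1 [h4]
      exact neg_add_cancel X
    exact (smul_eq_zero.1 h5).resolve_left two_ne_zero
  have e1 := Submodule.finrank_sup_add_finrank_inf_eq P.m.toSubmodule P.a.toSubmodule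
  have e2 := Submodule.finrank_sup_add_finrank_inf_eq (P.m.toSubmodule ⊔ P.a.toSubmodule) P.n
  have e3 := Submodule.finrank_sup_add_finrank_inf_eq
    (P.m.toSubmodule ⊔ P.a.toSubmodule ⊔ P.n) (negEigen (P.H₀ : g))
  rw [h3.eq_bot, finrank_bot] at e1
  rw [P.m_sup_a_eq_eigenspace, P.n_eq_posEigen, h2.eq_bot, finrank_bot,
    ← P.m_sup_a_eq_eigenspace, ← P.n_eq_posEigen] at e2
  rw [P.sup_eq_top, P.m_sup_a_eq_eigenspace, P.n_eq_posEigen, h1.eq_bot, finrank_bot,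
    ← P.m_sup_a_eq_eigenspace, ← P.n_eq_posEigen, finrank_top] at e3
  change _ = Module.finrank ℝ P.m.toSubmodule + Module.finrank ℝ P.a.toSubmodule + _
  omega

end MinimalParabolic
end Conjugacy

section Conjugacy

variable {g g' : Type*} [LieRing g] [LieAlgebra ℝ g] [LieRing g'] [LieAlgebra ℝ g']

theorem lieEquiv_inj (e : g ≃ₗ⁅ℝ⁆ g') {X Y : g} : e X = e Y ↔ X = Y :=
  e.injective.eq_iff

theorem posEigen_map (e : g ≃ₗ⁅ℝ⁆ g') (H : g) :
    posEigen (e H) = (posEigen H).map e.toLinearEquiv.toLinearMap := by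
  simp only [posEigen, Submodule.map_iSup]
  refine iSup_congr fun c => iSup_congr fun _ => ?_
  ext X
  rw [Submodule.mem_map, Module.End.mem_eigenspace_iff]
  constructor
  · intro hX
    refine ⟨e.symm X, ?_, e.apply_symm_apply X⟩
    rw [Module.End.mem_eigenspace_iff]
    apply (lieEquiv_inj e).1
    rw [LieAlgebra.ad_apply, LieEquiv.map_lie, map_smul, e.apply_symm_apply]
    exact hX
  · rintro ⟨Y, hY, rfl⟩
    rw [Module.End.mem_eigenspace_iff] at hY
    have := congrArg e hY
    rw [LieAlgebra.ad_apply, LieEquiv.map_lie, map_smul] at this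
    exact this

theorem mem_posEigen_map (e : g ≃ₗ⁅ℝ⁆ g') (H X : g) :
    e X ∈ posEigen (e H) ↔ X ∈ posEigen H := by
  rw [posEigen_map]
  exact e.injective.mem_set_image (s := posEigen H)

namespace MinimalParabolic

/-- Transport of the data of a minimal parabolic subalgebra along an isomorphism. -/
def map (P : MinimalParabolic g) (e : g ≃ₗ⁅ℝ⁆ g') : MinimalParabolic g' where
  θ := (e.symm.trans P.θ).trans e
  involutive X := by simp [P.involutive]
  killing_neg X hX := by
    have := P.killing_neg (e.symm X) (by simpa using hX)
    rw [← killingForm_map_map e] at this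
    simpa using this
  a := P.a.map e.toLieHom
  a_le := by
    rintro _ ⟨X, hX, rfl⟩
    have : P.θ X = -X := P.a_le X hX
    simp [this]
  a_abelian := by
    rintro _ ⟨X, hX, rfl⟩ _ ⟨Y, hY, rfl⟩
    have := congrArg e (P.a_abelian X hX Y hY)
    rw [LieEquiv.map_lie, map_zero] at this
    exact this
  a_maximal X hX hX' := by
    refine ⟨e.symm X, P.a_maximal _ ?_ fun H hH => ?_, e.apply_symm_apply X⟩
    · apply (lieEquiv_inj e).1
      simpa using hX
    · apply (lieEquiv_inj e).1
      have := hX' (e H) ⟨H, hH, rfl⟩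
      rw [LieEquiv.map_lie, map_zero, e.apply_symm_apply]
      exact this
  H₀ := ⟨e P.H₀, ⟨P.H₀, P.H₀.2, rfl⟩⟩
  regular μ hμ := by
    let i : P.a →ₗ[ℝ] (P.a.map e.toLieHom) :=
      { toFun := fun H => ⟨e H, ⟨H, H.2, rfl⟩⟩
        map_add' := fun _ _ => Subtype.ext (map_add e _ _)
        map_smul' := fun _ _ => Subtype.ext (map_smul e _ _) }
    refine P.regular (μ ∘ₗ i) ⟨fun h0 => hμ.1 ?_, fun h0 => hμ.2 ?_⟩
    · refine LinearMap.ext ?_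
      rintro ⟨_, H, hH, rfl⟩
      exact LinearMap.congr_fun h0 ⟨H, hH⟩
    · rw [Submodule.eq_bot_iff] at h0 ⊢
      intro X hX
      rw [mem_rootSpace] at hX
      have := h0 (e.symm X) ((mem_rootSpace _ _ _).2 fun H => by
        apply (lieEquiv_inj e).1
        rw [LieEquiv.map_lie, map_smul, e.apply_symm_apply]
        exact hX (i H))
      simpa using this

variable (P : MinimalParabolic g) (e : g ≃ₗ⁅ℝ⁆ g')

theorem map_theta_apply (X : g) : (P.map e).θ (e X) = e (P.θ X) := by
  change e (P.θ (e.symm (e X))) = _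
  rw [e.symm_apply_apply]

theorem mem_map_a (X : g) : e X ∈ (P.map e).a ↔ X ∈ P.a := by
  constructor
  · rintro ⟨Y, hY, h⟩
    rwa [← e.injective h]
  · exact fun h => ⟨X, h, rfl⟩

theorem mem_map_m (X : g) : e X ∈ (P.map e).m ↔ X ∈ P.m := by
  rw [mem_m, mem_m, map_theta_apply, lieEquiv_inj]
  refine and_congr_right fun _ => ⟨fun h H hH => ?_, ?_⟩
  · apply (lieEquiv_inj e).1
    rw [LieEquiv.map_lie, map_zero]
    exact h _ ((P.mem_map_a e H).2 hH)
  · rintro h _ ⟨H, hH, rfl⟩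
    have := congrArg e (h H hH)
    rwa [LieEquiv.map_lie, map_zero] at this

theorem mem_map_n [FiniteDimensional ℝ g] [FiniteDimensional ℝ g'] (X : g) :
    e X ∈ (P.map e).n ↔ X ∈ P.n := by
  rw [n_eq_posEigen, n_eq_posEigen]
  exact mem_posEigen_map e _ X

end MinimalParabolic

theorem iSup_rootSpace_congr {a b : LieSubalgebra ℝ g} (h : a = b) (H : a) (H' : b)
    (hs : ∀ μ ∈ roots b, (0 < μ ⟨H, h ▸ H.2⟩ ↔ 0 < μ H')) :
    (⨆ μ ∈ {μ : Module.Dual ℝ a | μ ∈ roots a ∧ 0 < μ H}, rootSpace a μ) =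
      ⨆ μ ∈ {μ : Module.Dual ℝ b | μ ∈ roots b ∧ 0 < μ H'}, rootSpace b μ := by
  subst h
  refine iSup_congr fun μ => iSup_congr_Prop ?_ fun _ => rfl
  exact and_congr_right (hs μ)

namespace MinimalParabolic

/-- The sign of the second variation of `κ(k H, H')` at a maximum: a root takes values of the same
sign on `H` and `H'`. -/
theorem root_mul_nonneg (P : MinimalParabolic g) {H : P.a}
    (hvar : ∀ X, P.θ X = X → killingForm ℝ g ⁅X, ⁅X, (H : g)⁆⁆ P.H₀ ≤ 0)
    {μ : Module.Dual ℝ P.a} (hμ : μ ∈ roots P.a) : 0 ≤ μ H * μ P.H₀ := by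
  obtain ⟨E, hE, hE0⟩ := Submodule.exists_mem_ne_zero_of_ne_bot hμ.2
  rw [mem_rootSpace] at hE
  have hθE : ∀ H : P.a, ⁅(H : g), P.θ E⁆ = -(μ H • P.θ E) := fun H => by
    rw [P.lie_theta_of_mem_a H.2, hE, map_smul]
  have hs : P.θ (E - P.θ E) = -(E - P.θ E) := by
    rw [map_sub, P.involutive, neg_sub]
  have hne : E - P.θ E ≠ 0 := by
    intro h0
    rw [sub_eq_zero] at h0
    apply hμ.1
    refine LinearMap.ext fun H => ?_
    have h1 := hθE H
    rw [← h0, hE] at h1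
    have h2 : (2 * μ H) • E = 0 := by
      rw [two_mul, add_smul]
      nth_rewrite 1 [h1]
      exact neg_add_cancel _
    simpa [hE0] using h2
  have hpos := P.killingForm_pos_of_map_eq_neg hs hne
  have hX : ∀ H : P.a, ⁅E + P.θ E, (H : g)⁆ = -(μ H • (E - P.θ E)) := fun H => by
    rw [← lie_skew, lie_add, hE, hθE, smul_sub, sub_eq_add_neg]
  -- the second variation in the direction of `X = E + θ E`
  have h := hvar (E + P.θ E) (by rw [map_add, P.involutive, add_comm])
  rw [killingForm_lie_left, hX, hX] at h
  simp only [map_neg, map_smul, LinearMap.neg_apply, LinearMap.smul_apply, smul_eq_mul,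
    neg_neg] at h
  have h3 : 0 ≤ (μ H * μ P.H₀) * killingForm ℝ g (E - P.θ E) (E - P.θ E) := by linarith
  exact nonneg_of_mul_nonneg_left h3 hpos

/-- The data of any two minimal parabolic subalgebras are conjugate under an automorphism. -/
theorem exists_conj [FiniteDimensional ℝ g] (P Q : MinimalParabolic g) :
    ∃ ψ : g ≃ₗ⁅ℝ⁆ g, ∀ X, (ψ X ∈ Q.a ↔ X ∈ P.a) ∧ (ψ X ∈ Q.m ↔ X ∈ P.m) ∧
      (ψ X ∈ Q.n ↔ X ∈ P.n) := by
  obtain ⟨φ, hφ⟩ := Q.isCartanInvolution.exists_conj P.isCartanInvolution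
  obtain ⟨k, hk, hcrit⟩ := Q.isCartanInvolution.exists_critical ((P.map φ).H₀ : g) (Q.H₀ : g)
  set ψ := φ.trans k with hψ
  have hψ' : ∀ X, ψ X = k (φ X) := fun X => rfl
  let R := P.map ψ
  have hRH : (R.H₀ : g) = k ((P.map φ).H₀ : g) := rfl
  rw [← hRH] at hcrit
  have hθ : ∀ X, R.θ X = Q.θ X := by
    intro X
    obtain ⟨Y, rfl⟩ : ∃ Y, ψ Y = X := ψ.surjective X
    change (P.map ψ).θ (ψ Y) = _
    rw [map_theta_apply, hψ', hψ', hφ, hk]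
  -- the first variation in the direction of `X = ⁅R.H₀, Q.H₀⁆` gives `κ(X, X) = 0`, while `κ` is
  -- negative definite on the elements fixed by the Cartan involution
  have hcomm : ⁅(R.H₀ : g), (Q.H₀ : g)⁆ = 0 := by
    by_contra h0
    have hfix : Q.θ ⁅(R.H₀ : g), (Q.H₀ : g)⁆ = ⁅(R.H₀ : g), (Q.H₀ : g)⁆ := by
      rw [LieEquiv.map_lie, Q.a_le _ Q.H₀.2, ← hθ, R.a_le _ R.H₀.2, neg_lie, lie_neg, neg_neg]
    have h1 := (hcrit _ hfix).1
    rw [killingForm, LieModule.traceForm_apply_lie_apply] at h1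
    have h2 := Q.killing_neg _ h0
    rw [hfix] at h2
    exact h2.ne h1
  have hcomm' : ⁅(Q.H₀ : g), (R.H₀ : g)⁆ = 0 := by rw [← lie_skew, hcomm, neg_zero]
  -- commuting with a regular element is commuting with all of the maximal abelian subspace
  have ha1 : ∀ X ∈ Q.a, X ∈ R.a := by
    intro X hX
    refine R.a_maximal X (by rw [hθ, Q.a_le X hX]) (R.lie_eq_zero_of_lie_H₀ ?_)
    have := Q.lie_eq_zero_of_lie_H₀ hcomm' X hX
    rw [← lie_skew, this, neg_zero]
  have ha : R.a = Q.a := by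
    refine le_antisymm (fun X hX => ?_) ha1
    refine Q.a_maximal X (by rw [← hθ, R.a_le X hX]) (Q.lie_eq_zero_of_lie_H₀ ?_)
    exact R.a_abelian _ (ha1 _ Q.H₀.2) X hX
  have hn : R.n = Q.n := by
    refine iSup_rootSpace_congr ha _ _ fun μ hμ => ?_
    set H : Q.a := ⟨R.H₀, ha ▸ R.H₀.2⟩ with hH
    have h1 := Q.root_mul_nonneg (H := H) (fun X hX => (hcrit X hX).2) hμ
    have h2 := Q.regular μ hμ
    -- otherwise a root vector would commute with the regular element `R.H₀`, hence with `a₀`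
    have h3 : μ H ≠ 0 := by
      intro h0
      obtain ⟨E, hE, hE0⟩ := Submodule.exists_mem_ne_zero_of_ne_bot hμ.2
      rw [mem_rootSpace] at hE
      apply hμ.1
      refine LinearMap.ext fun Y => ?_
      have h4 := R.lie_eq_zero_of_lie_H₀ (X := E) (by
        have := hE H
        rwa [h0, zero_smul] at this) Y (ha1 Y Y.2)
      rw [hE] at h4
      simpa [hE0] using h4
    have h4 : 0 < μ H * μ Q.H₀ := lt_of_le_of_ne h1 (mul_ne_zero h3 h2).symm
    exact (pos_iff_pos_of_mul_pos h4)
  refine ⟨ψ, fun X => ⟨?_, ?_, ?_⟩⟩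
  · rw [← ha]
    exact P.mem_map_a ψ X
  · rw [← P.mem_map_m ψ, mem_m, mem_m, ← hθ, ← ha]
  · rw [← hn]
    exact P.mem_map_n ψ X

/-- Any two minimal parabolic subalgebras of isomorphic Lie algebras correspond to each other under
an isomorphism. -/
theorem exists_equiv [FiniteDimensional ℝ g] [FiniteDimensional ℝ g'] (e : g ≃ₗ⁅ℝ⁆ g')
    (P : MinimalParabolic g) (Q : MinimalParabolic g') :
    ∃ ψ : g ≃ₗ⁅ℝ⁆ g', ∀ X, (ψ X ∈ Q.a ↔ X ∈ P.a) ∧ (ψ X ∈ Q.m ↔ X ∈ P.m) ∧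
      (ψ X ∈ Q.n ↔ X ∈ P.n) := by
  obtain ⟨ψ, hψ⟩ := (P.map e).exists_conj Q
  refine ⟨e.trans ψ, fun X => ?_⟩
  have := hψ (e X)
  rwa [mem_map_a, mem_map_m, mem_map_n] at this

end MinimalParabolic
end Conjugacy

/-! ### Complexifications -/

section Complexification

variable {L L' g : Type*} [LieRing L] [LieAlgebra ℝ L] [LieRing L'] [LieAlgebra ℝ L'] [LieRing g]
  [LieAlgebra ℂ g]

/-- A map `f : L → g` that exhibits the real Lie algebra `L` as a real form of the complex Lie
algebra `g`: a real homomorphism such that `g = f(L) ⊕ i f(L)`. The real scalars are embedded into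
`ℂ` explicitly, so that `g` needs no real structure of its own. -/
structure IsRealForm (f : L → g) : Prop where
  map_add : ∀ X Y, f (X + Y) = f X + f Y
  map_smul : ∀ (c : ℝ) X, f (c • X) = (c : ℂ) • f X
  map_lie : ∀ X Y, f ⁅X, Y⁆ = ⁅f X, f Y⁆
  exists_eq : ∀ Y, ∃ A B, Y = f A + Complex.I • f B
  eq_zero : ∀ A B, f A + Complex.I • f B = 0 → A = 0 ∧ B = 0

namespace IsRealForm

variable {f : L → g}

theorem map_zero (hf : IsRealForm f) : f 0 = 0 := by
  simpa using hf.map_smul 0 0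

theorem map_neg (hf : IsRealForm f) (X : L) : f (-X) = -f X := by
  simpa using hf.map_smul (-1) X

theorem comp (hf : IsRealForm f) (e : L' ≃ₗ⁅ℝ⁆ L) : IsRealForm (f ∘ e) where
  map_add X Y := by simp [hf.map_add]
  map_smul c X := by simp [hf.map_smul]
  map_lie X Y := by
    simp only [Function.comp_apply]
    rw [LieEquiv.map_lie, hf.map_lie]
  exists_eq Y := by
    obtain ⟨A, B, h⟩ := hf.exists_eq Y
    exact ⟨e.symm A, e.symm B, by simpa using h⟩
  eq_zero A B h := by
    obtain ⟨hA, hB⟩ := hf.eq_zero _ _ h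
    exact ⟨(lieEquiv_inj e).1 (hA.trans (_root_.map_zero e).symm),
      (lieEquiv_inj e).1 (hB.trans (_root_.map_zero e).symm)⟩

/-- The real-linear map underlying a real form. -/
def toLinearMap (hf : IsRealForm f) : L →ₗ[ℝ] g where
  toFun := f
  map_add' := hf.map_add
  map_smul' c X := by
    rw [hf.map_smul]
    exact (RCLike.real_smul_eq_coe_smul (K := ℂ) c (f X)).symm

theorem exists_tmul_add_tmul (t : ℂ ⊗[ℝ] L) :
    ∃ A B : L, t = (1 : ℂ) ⊗ₜ[ℝ] A + Complex.I • ((1 : ℂ) ⊗ₜ[ℝ] B) := by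
  induction t with
  | zero => exact ⟨0, 0, by simp⟩
  | tmul z X =>
    refine ⟨z.re • X, z.im • X, ?_⟩
    rw [TensorProduct.tmul_smul, TensorProduct.tmul_smul, TensorProduct.smul_tmul',
      TensorProduct.smul_tmul', TensorProduct.smul_tmul', ← TensorProduct.add_tmul]
    congr 1
    apply Complex.ext <;> simp
  | add s t hs ht =>
    obtain ⟨A, B, rfl⟩ := hs
    obtain ⟨A', B', rfl⟩ := ht
    refine ⟨A + A', B + B', ?_⟩
    rw [TensorProduct.tmul_add, TensorProduct.tmul_add, smul_add]
    abel

/-- The identification of the complexification of `L` with `g`. -/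
noncomputable def equiv (hf : IsRealForm f) : ℂ ⊗[ℝ] L ≃ₗ⁅ℂ⁆ g :=
  LieEquiv.ofBijective
    ({ hf.toLinearMap.liftBaseChange ℂ with
      map_lie' := by
        intro s t
        change hf.toLinearMap.liftBaseChange ℂ ⁅s, t⁆ =
          ⁅hf.toLinearMap.liftBaseChange ℂ s, hf.toLinearMap.liftBaseChange ℂ t⁆
        have key : ∀ (z w : ℂ) (X Y : L), hf.toLinearMap.liftBaseChange ℂ ⁅z ⊗ₜ[ℝ] X, w ⊗ₜ[ℝ] Y⁆ =
            ⁅hf.toLinearMap.liftBaseChange ℂ (z ⊗ₜ[ℝ] X),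
              hf.toLinearMap.liftBaseChange ℂ (w ⊗ₜ[ℝ] Y)⁆ := by
          intro z w X Y
          rw [LieAlgebra.ExtendScalars.bracket_tmul, LinearMap.liftBaseChange_tmul,
            LinearMap.liftBaseChange_tmul, LinearMap.liftBaseChange_tmul, smul_lie, lie_smul,
            smul_smul]
          exact congrArg _ (hf.map_lie X Y)
        induction s with
        | zero => simp
        | add s s' hs hs' => rw [add_lie, _root_.map_add, hs, hs', _root_.map_add, add_lie]
        | tmul z X =>
          induction t with
          | zero =>
            refine (congrArg _ (lie_zero (z ⊗ₜ[ℝ] X : ℂ ⊗[ℝ] L))).trans ?_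
            rw [_root_.map_zero, lie_zero]
          | add s s' hs hs' =>
            refine (congrArg _ (lie_add (z ⊗ₜ[ℝ] X : ℂ ⊗[ℝ] L) s s')).trans ?_
            rw [_root_.map_add, _root_.map_add, lie_add]
            exact congrArg₂ _ hs hs'
          | tmul w Y => exact key z w X Y } : ℂ ⊗[ℝ] L →ₗ⁅ℂ⁆ g)
    (by
      have hval : ∀ A B : L, hf.toLinearMap.liftBaseChange ℂ
          ((1 : ℂ) ⊗ₜ[ℝ] A + Complex.I • ((1 : ℂ) ⊗ₜ[ℝ] B)) = f A + Complex.I • f B := by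
        intro A B
        rw [_root_.map_add, _root_.map_smul, LinearMap.liftBaseChange_tmul,
          LinearMap.liftBaseChange_tmul, one_smul, one_smul]
        rfl
      constructor
      · change Function.Injective (hf.toLinearMap.liftBaseChange ℂ)
        rw [← LinearMap.ker_eq_bot, LinearMap.ker_eq_bot']
        intro t ht
        obtain ⟨A, B, rfl⟩ := exists_tmul_add_tmul t
        rw [hval] at ht
        obtain ⟨rfl, rfl⟩ := hf.eq_zero A B ht
        simp
      · intro Y
        obtain ⟨A, B, rfl⟩ := hf.exists_eq Y
        exact ⟨_, hval A B⟩)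

theorem equiv_tmul (hf : IsRealForm f) (z : ℂ) (X : L) : hf.equiv (z ⊗ₜ[ℝ] X) = z • f X := rfl

theorem mem_complexImage (hf : IsRealForm f) (V : Submodule ℝ L) (Y : g) :
    Y ∈ complexImage hf.equiv V ↔ ∃ A ∈ V, ∃ B ∈ V, Y = f A + Complex.I • f B := by
  constructor
  · rintro ⟨t, ht, rfl⟩
    rw [SetLike.mem_coe, Submodule.baseChange_eq_span] at ht
    change ∃ A ∈ V, ∃ B ∈ V, hf.equiv t = _
    induction ht using Submodule.span_induction with
    | zero => exact ⟨0, V.zero_mem, 0, V.zero_mem, by simp [hf.map_zero]⟩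
    | mem t ht =>
      obtain ⟨A, hA, rfl⟩ := ht
      refine ⟨A, hA, 0, V.zero_mem, ?_⟩
      simp [hf.map_zero, hf.equiv_tmul]
    | add s t _ _ hs ht =>
      obtain ⟨A, hA, B, hB, h⟩ := hs
      obtain ⟨A', hA', B', hB', h'⟩ := ht
      refine ⟨A + A', V.add_mem hA hA', B + B', V.add_mem hB hB', ?_⟩
      rw [_root_.map_add, h, h', hf.map_add, hf.map_add, smul_add]
      abel
    | smul z t _ ht =>
      obtain ⟨A, hA, B, hB, h⟩ := ht
      refine ⟨z.re • A - z.im • B, V.sub_mem (V.smul_mem _ hA) (V.smul_mem _ hB),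
        z.im • A + z.re • B, V.add_mem (V.smul_mem _ hA) (V.smul_mem _ hB), ?_⟩
      rw [_root_.map_smul, h, sub_eq_add_neg, hf.map_add, hf.map_add, hf.map_neg, hf.map_smul,
        hf.map_smul, hf.map_smul, hf.map_smul]
      have hz : z = z.re + z.im * Complex.I := (Complex.re_add_im z).symm
      have hzI : z * Complex.I = -z.im + z.re * Complex.I := by
        apply Complex.ext <;> simp
      rw [smul_add, smul_smul, hzI]
      generalize (z.re : ℂ) = a at *
      generalize (z.im : ℂ) = b at *
      rw [hz]
      module
  · rintro ⟨A, hA, B, hB, rfl⟩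
    have h1 : ∀ A ∈ V, f A ∈ complexImage hf.equiv V := fun A hA =>
      ⟨1 ⊗ₜ[ℝ] A, Submodule.tmul_mem_baseChange_of_mem 1 hA, by
        change hf.equiv _ = _
        rw [hf.equiv_tmul, one_smul]⟩
    exact Submodule.add_mem _ (h1 A hA) (Submodule.smul_mem _ _ (h1 B hB))

theorem complexImage_le (hf : IsRealForm f) {V : Submodule ℝ L} {W : Submodule ℂ g}
    (h : ∀ A ∈ V, f A ∈ W) : complexImage hf.equiv V ≤ W := by
  intro Y hY
  obtain ⟨A, hA, B, hB, rfl⟩ := (hf.mem_complexImage V Y).1 hY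
  exact W.add_mem (h A hA) (W.smul_mem _ (h B hB))

theorem le_complexImage (hf : IsRealForm f) {V : Submodule ℝ L} {A : L} (hA : A ∈ V) :
    f A ∈ complexImage hf.equiv V :=
  (hf.mem_complexImage V _).2 ⟨A, hA, 0, V.zero_mem, by simp [hf.map_zero]⟩

theorem complexImage_comp (hf : IsRealForm f) (e : L' ≃ₗ⁅ℝ⁆ L) {V : Submodule ℝ L'}
    {V' : Submodule ℝ L} (h : ∀ X, e X ∈ V' ↔ X ∈ V) :
    complexImage (hf.comp e).equiv V = complexImage hf.equiv V' := by
  ext Y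
  rw [mem_complexImage, mem_complexImage]
  constructor
  · rintro ⟨A, hA, B, hB, rfl⟩
    exact ⟨e A, (h A).2 hA, e B, (h B).2 hB, rfl⟩
  · rintro ⟨A, hA, B, hB, rfl⟩
    refine ⟨e.symm A, (h _).1 (by simpa using hA), e.symm B, (h _).1 (by simpa using hB), ?_⟩
    simp

/-- The sum of the eigenspaces of `ad D` for the nonnegative real eigenvalues. -/
def _root_.MinimalParabolics.nonnegEigenC (D : g) : Submodule ℂ g :=
  ⨆ c ∈ {z : ℂ | ∃ c : ℝ, 0 ≤ c ∧ z = c}, Module.End.eigenspace (LieAlgebra.ad ℂ g D) c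

/-- The sum of the eigenspaces of `ad D` for the negative real eigenvalues. -/
def _root_.MinimalParabolics.negEigenC (D : g) : Submodule ℂ g :=
  ⨆ c ∈ {z : ℂ | ∃ c : ℝ, c < 0 ∧ z = c}, Module.End.eigenspace (LieAlgebra.ad ℂ g D) c

theorem _root_.MinimalParabolics.mem_nonnegEigenC {D Y : g} {c : ℝ} (hc : 0 ≤ c)
    (h : ⁅D, Y⁆ = (c : ℂ) • Y) : Y ∈ nonnegEigenC D :=
  Submodule.mem_iSup_of_mem (c : ℂ) (Submodule.mem_iSup_of_mem ⟨c, hc, rfl⟩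
    (Module.End.mem_eigenspace_iff.2 h))

theorem _root_.MinimalParabolics.mem_negEigenC {D Y : g} {c : ℝ} (hc : c < 0)
    (h : ⁅D, Y⁆ = (c : ℂ) • Y) : Y ∈ negEigenC D :=
  Submodule.mem_iSup_of_mem (c : ℂ) (Submodule.mem_iSup_of_mem ⟨c, hc, rfl⟩
    (Module.End.mem_eigenspace_iff.2 h))

theorem _root_.MinimalParabolics.disjoint_negEigenC (D : g) :
    Disjoint (nonnegEigenC D) (negEigenC D) := by
  refine (Module.End.eigenspaces_iSupIndep (LieAlgebra.ad ℂ g D)).disjoint_biSup_biSup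
    (Set.disjoint_left.2 ?_)
  rintro _ ⟨c, hc, rfl⟩ ⟨c', hc', h⟩
  rw [Complex.ofReal_inj.1 h] at hc
  exact not_lt.2 hc hc'

/-- The complexification of `p₀` is the sum of the nonnegative eigenspaces of the image `D` of the
regular element. Hence it equals any subspace of this sum that, together with the negative
eigenspaces, spans everything. -/
theorem complexImage_p [FiniteDimensional ℝ L] (hf : IsRealForm f) (P : MinimalParabolic L)
    {W : Submodule ℂ g} (hW : W ≤ nonnegEigenC (f P.H₀))
    (hsup : W ⊔ negEigenC (f P.H₀) = ⊤) : complexImage hf.equiv P.p = W := by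
  have heig : ∀ {X : L} {c : ℝ}, X ∈ Module.End.eigenspace (LieAlgebra.ad ℝ L (P.H₀ : L)) c →
      ⁅f P.H₀, f X⁆ = (c : ℂ) • f X := by
    intro X c hX
    rw [Module.End.mem_eigenspace_iff] at hX
    rw [← hf.map_lie, ← hf.map_smul]
    exact congrArg f hX
  -- the preimage of a complex subspace is a real subspace
  let pre : Submodule ℂ g → Submodule ℝ L := fun W =>
    (W.restrictScalars ℝ).comap hf.toLinearMap
  have hneg : ∀ A ∈ negEigen (P.H₀ : L), f A ∈ negEigenC (f P.H₀) := by
    have : negEigen (P.H₀ : L) ≤ pre (negEigenC (f P.H₀)) :=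
      iSup₂_le fun c hc X hX => mem_negEigenC hc (heig hX)
    exact fun A hA => this hA
  have hpos : ∀ A ∈ P.p, f A ∈ nonnegEigenC (f P.H₀) := by
    have : P.p ≤ pre (nonnegEigenC (f P.H₀)) := by
      rw [MinimalParabolic.p, P.m_sup_a_eq_eigenspace, P.n_eq_posEigen]
      refine sup_le (fun X hX => mem_nonnegEigenC le_rfl (heig hX)) ?_
      exact iSup₂_le fun c hc X hX => mem_nonnegEigenC (le_of_lt hc) (heig hX)
    exact fun A hA => this hA
  have htop : complexImage hf.equiv P.p ⊔ complexImage hf.equiv (negEigen (P.H₀ : L)) = ⊤ := by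
    have hmem : ∀ A, f A ∈
        complexImage hf.equiv P.p ⊔ complexImage hf.equiv (negEigen (P.H₀ : L)) := by
      intro A
      have hA : A ∈ P.p ⊔ negEigen (P.H₀ : L) := by
        rw [MinimalParabolic.p, P.sup_eq_top]
        trivial
      obtain ⟨B, hB, C, hC, rfl⟩ := Submodule.mem_sup.1 hA
      rw [hf.map_add]
      exact Submodule.add_mem_sup (hf.le_complexImage hB) (hf.le_complexImage hC)
    rw [eq_top_iff]
    intro Y _
    obtain ⟨A, B, rfl⟩ := hf.exists_eq Y
    exact Submodule.add_mem _ (hmem A) (Submodule.smul_mem _ _ (hmem B))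
  have hle := hf.complexImage_le hpos
  have e1 : complexImage hf.equiv P.p = nonnegEigenC (f P.H₀) := by
    refine eq_of_le_of_inf_le_of_sup_le (z := negEigenC (f P.H₀)) hle ?_ ?_
    · exact (disjoint_negEigenC _).le_bot.trans bot_le
    · refine le_top.trans ?_
      rw [← htop]
      exact sup_le_sup_left (hf.complexImage_le hneg) _
  have e2 : W = nonnegEigenC (f P.H₀) := by
    refine eq_of_le_of_inf_le_of_sup_le (z := negEigenC (f P.H₀)) hW ?_ ?_
    · exact (disjoint_negEigenC _).le_bot.trans bot_le
    · rw [hsup]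
      exact le_top
  rw [e1, e2]

/-- The complexification of `m₀ + a₀` is the centralizer of the image of the regular element. -/
theorem mem_complexImage_m_sup_a [FiniteDimensional ℝ L] (hf : IsRealForm f)
    (P : MinimalParabolic L) (Y : g) :
    Y ∈ complexImage hf.equiv (P.m.toSubmodule ⊔ P.a.toSubmodule) ↔ ⁅f P.H₀, Y⁆ = 0 := by
  have hmem : ∀ A, A ∈ P.m.toSubmodule ⊔ P.a.toSubmodule ↔ ⁅(P.H₀ : L), A⁆ = 0 := by
    intro A
    rw [P.m_sup_a_eq_eigenspace, Module.End.mem_eigenspace_iff, zero_smul]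
    rfl
  rw [mem_complexImage]
  constructor
  · rintro ⟨A, hA, B, hB, rfl⟩
    rw [lie_add, lie_smul, ← hf.map_lie, ← hf.map_lie, (hmem A).1 hA, (hmem B).1 hB, hf.map_zero,
      smul_zero, add_zero]
  · intro hY
    obtain ⟨A, B, rfl⟩ := hf.exists_eq Y
    rw [lie_add, lie_smul, ← hf.map_lie, ← hf.map_lie] at hY
    obtain ⟨hA, hB⟩ := hf.eq_zero _ _ hY
    exact ⟨A, (hmem A).2 hA, B, (hmem B).2 hB, rfl⟩

/-- A real form of a Lie algebra with trivial center has trivial center. -/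
theorem center_eq_zero (hf : IsRealForm f) (hg : ∀ Y : g, (∀ Z : g, ⁅Y, Z⁆ = 0) → Y = 0) (X : L)
    (hX : ∀ Z : L, ⁅X, Z⁆ = 0) : X = 0 := by
  have h1 : f X = 0 := by
    refine hg _ fun Z => ?_
    obtain ⟨A, B, rfl⟩ := hf.exists_eq Z
    rw [lie_add, lie_smul, ← hf.map_lie, ← hf.map_lie, hX, hX, hf.map_zero, smul_zero, add_zero]
  exact (hf.eq_zero X 0 (by rw [h1, hf.map_zero, smul_zero, add_zero])).1

end IsRealForm
end Complexification

/-! ### Standard parabolic subalgebras of Lie algebras of matrices -/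

section Complex

variable {κ : Type*} [Fintype κ] [DecidableEq κ]

theorem mem_diagonalCartan {g : LieSubalgebra ℂ (Matrix κ κ ℂ)} {X : g} :
    X ∈ diagonalCartan g ↔ ∀ i j, i ≠ j → (X : Matrix κ κ ℂ) i j = 0 := by
  constructor
  · exact fun h i j hij => h hij
  · exact fun h i j hij => h i j hij

theorem lie_apply_of_isDiag {R : Type*} [Ring R] {H : Matrix κ κ R} (hH : ∀ i j, i ≠ j → H i j = 0)
    (X : Matrix κ κ R) (i j : κ) : ⁅H, X⁆ i j = H i i * X i j - X i j * H j j := by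
  rw [LieRing.of_associative_ring_bracket, Matrix.sub_apply, Matrix.mul_apply, Matrix.mul_apply,
    Finset.sum_eq_single i (fun k _ hk => by rw [hH i k hk.symm, zero_mul]) (by simp),
    Finset.sum_eq_single j (fun k _ hk => by rw [hH k j hk, mul_zero]) (by simp)]

theorem lie_diagonalCartan_apply {g : LieSubalgebra ℂ (Matrix κ κ ℂ)} (H : diagonalCartan g)
    (X : g) (i j : κ) : ((⁅(H : g), X⁆ : g) : Matrix κ κ ℂ) i j =
      (entry g i - entry g j) H * (X : Matrix κ κ ℂ) i j := by
  rw [LieSubalgebra.coe_bracket, lie_apply_of_isDiag (mem_diagonalCartan.1 H.2)]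
  change _ = (((H : g) : Matrix κ κ ℂ) i i - ((H : g) : Matrix κ κ ℂ) j j) * _
  ring

open Classical in
/-- The component of weight `χ` of a matrix, with respect to the diagonal matrices in `g`. -/
noncomputable def weightPart (g : LieSubalgebra ℂ (Matrix κ κ ℂ))
    (χ : Module.Dual ℂ (diagonalCartan g)) (X : Matrix κ κ ℂ) : Matrix κ κ ℂ :=
  Matrix.of fun i j => if entry g i - entry g j = χ then X i j else 0

/-- The properties of a Lie algebra `g` of complex matrices which imply that the diagonal matrices
in `g` form a Cartan subalgebra with the simple roots `α`, and which describe its roots. -/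
structure IsRootedBy {l : ℕ} (g : LieSubalgebra ℂ (Matrix κ κ ℂ))
    (α : Fin l → Module.Dual ℂ (diagonalCartan g)) : Prop where
  /-- `g` contains the weight components of its elements. -/
  weightPart_mem : ∀ X ∈ g, ∀ χ, weightPart g χ X ∈ g
  /-- Some diagonal matrix in `g` has distinct entries. -/
  exists_regular : ∃ D : diagonalCartan g, ∀ i j, i ≠ j → entry g i D ≠ entry g j D
  /-- `g` is stable under the transposition followed by the conjugation with a diagonal matrix. -/
  exists_transpose : ∃ c : κ → ℂ, (∀ i, c i ≠ 0) ∧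
    ∀ X ∈ g, (Matrix.of fun i j => (c i)⁻¹ * X j i * c j) ∈ g
  /-- Each weight of `g` is a sum of simple roots, up to the sign. -/
  weight_mem : ∀ X ∈ g, ∀ i j, i ≠ j → X i j ≠ 0 →
    entry g i - entry g j ∈ AddSubmonoid.closure (Set.range α) ∨
      entry g j - entry g i ∈ AddSubmonoid.closure (Set.range α)

variable {l : ℕ} {g : LieSubalgebra ℂ (Matrix κ κ ℂ)} {α : Fin l → Module.Dual ℂ (diagonalCartan g)}

/-- The centralizer of a diagonal matrix with distinct entries consists of the diagonal matrices. -/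
theorem lie_eq_zero_iff_mem_diagonalCartan (D : diagonalCartan g)
    (hD : ∀ i j, i ≠ j → entry g i D ≠ entry g j D) (Y : g) :
    ⁅(D : g), Y⁆ = 0 ↔ Y ∈ diagonalCartan g := by
  rw [mem_diagonalCartan]
  constructor
  · intro h i j hij
    have h1 := lie_diagonalCartan_apply D Y i j
    rw [h] at h1
    have h2 : (entry g i - entry g j) D ≠ 0 := sub_ne_zero.2 (hD i j hij)
    exact (mul_eq_zero.1 h1.symm).resolve_left h2
  · intro h
    refine Subtype.ext (Matrix.ext fun i j => ?_)
    rw [lie_diagonalCartan_apply]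
    by_cases hij : i = j
    · simp [hij]
    · rw [h i j hij, mul_zero]
      rfl

/-- A nonnegative combination `β` of the simple roots is nonnegative on a dominant `D`, and it
vanishes there only if it is a combination of the simple roots that vanish on `D`. -/
theorem exists_sum_eq (D : diagonalCartan g) {a : Fin l → ℝ} (ha : ∀ k, 0 ≤ a k)
    (hD : ∀ k, α k D = a k) {S : Set ℕ} (hS : ∀ k : Fin l, a k = 0 → (k : ℕ) + 1 ∈ S)
    {β : Module.Dual ℂ (diagonalCartan g)} (hβ : β ∈ AddSubmonoid.closure (Set.range α)) :
    ∃ c : ℝ, 0 ≤ c ∧ β D = c ∧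
      (c = 0 → β ∈ AddSubgroup.closure (α '' {i : Fin l | (i : ℕ) + 1 ∈ S})) := by
  induction hβ using AddSubmonoid.closure_induction with
  | mem β hβ =>
    obtain ⟨k, rfl⟩ := hβ
    exact ⟨a k, ha k, hD k, fun h => AddSubgroup.subset_closure ⟨k, hS k h, rfl⟩⟩
  | zero => exact ⟨0, le_rfl, by simp, fun _ => AddSubgroup.zero_mem _⟩
  | add β γ _ _ hβ hγ =>
    obtain ⟨b, hb, h1, h2⟩ := hβ
    obtain ⟨c, hc, h3, h4⟩ := hγ
    refine ⟨b + c, add_nonneg hb hc, by rw [LinearMap.add_apply, h1, h3, Complex.ofReal_add],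
      fun h => ?_⟩
    exact AddSubgroup.add_mem _ (h2 (by linarith)) (h4 (by linarith))

/-- `P_S` lies in the sum of the eigenspaces of `ad D` with nonnegative eigenvalues, if `D` is
dominant and exactly the simple roots with label in `S` vanish on it. -/
theorem standardParabolic_le_nonnegEigenC (D : diagonalCartan g) {a : Fin l → ℝ}
    (ha : ∀ k, 0 ≤ a k) (hD : ∀ k, α k D = a k) {S : Set ℕ}
    (hS : ∀ k : Fin l, a k = 0 ↔ (k : ℕ) + 1 ∈ S) :
    standardParabolic (diagonalCartan g) α S ≤ nonnegEigenC (D : g) := by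
  refine sup_le (sup_le (fun H hH => ?_) ?_) ?_
  · refine mem_nonnegEigenC (c := 0) le_rfl ?_
    rw [Complex.ofReal_zero, zero_smul]
    refine Subtype.ext (Matrix.ext fun i j => ?_)
    rw [lie_diagonalCartan_apply]
    by_cases hij : i = j
    · simp [hij]
    · rw [mem_diagonalCartan.1 hH i j hij, mul_zero]
      rfl
  · refine iSup₂_le fun β hβ X hX => ?_
    obtain ⟨c, hc, h, -⟩ := exists_sum_eq D ha hD (fun k => (hS k).1) hβ.2
    refine mem_nonnegEigenC hc ?_
    rw [← h]
    exact (mem_rootSpace _ _ _).1 hX D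
  · refine iSup₂_le fun β hβ X hX => ?_
    have h0 : β D = 0 := by
      have := hβ.2.2
      clear hX hβ
      induction this using AddSubgroup.closure_induction with
      | mem β hβ =>
        obtain ⟨k, hk, rfl⟩ := hβ
        rw [hD, (hS k).2 hk, Complex.ofReal_zero]
      | zero => simp
      | add β γ _ _ hβ hγ => simp [hβ, hγ]
      | neg β _ hβ => simp [hβ]
    refine mem_nonnegEigenC (c := 0) le_rfl ?_
    rw [Complex.ofReal_zero, ← h0]
    exact (mem_rootSpace _ _ _).1 hX D

theorem IsRootedBy.neg_mem_roots (hg : IsRootedBy g α) {β : Module.Dual ℂ (diagonalCartan g)}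
    (hβ : β ∈ roots (diagonalCartan g)) : -β ∈ roots (diagonalCartan g) := by
  obtain ⟨c, hc, hcg⟩ := hg.exists_transpose
  refine ⟨neg_ne_zero.2 hβ.1, ?_⟩
  obtain ⟨E, hE, hE0⟩ := Submodule.exists_mem_ne_zero_of_ne_bot hβ.2
  rw [mem_rootSpace] at hE
  rw [Submodule.ne_bot_iff]
  refine ⟨⟨_, hcg E E.2⟩, (mem_rootSpace _ _ _).2 fun H => Subtype.ext (Matrix.ext fun i j => ?_),
    fun h0 => hE0 (Subtype.ext (Matrix.ext fun i j => ?_))⟩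
  · rw [lie_diagonalCartan_apply]
    have h1 := lie_diagonalCartan_apply H E j i
    rw [hE] at h1
    have h2 : β H * (E : Matrix κ κ ℂ) j i = (entry g j - entry g i) H * (E : Matrix κ κ ℂ) j i :=
      h1
    change (entry g i - entry g j) H * ((c i)⁻¹ * (E : Matrix κ κ ℂ) j i * c j) =
      (-β) H * ((c i)⁻¹ * (E : Matrix κ κ ℂ) j i * c j)
    simp only [LinearMap.sub_apply, LinearMap.neg_apply] at h2 ⊢
    linear_combination ((c i)⁻¹ * c j) * h2
  · have h1 : (c j)⁻¹ * (E : Matrix κ κ ℂ) i j * c i = 0 :=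
      congrFun (congrFun (congrArg Subtype.val h0) j) i
    simpa [hc] using h1

/-- Together with the negative eigenspaces of `ad D`, `P_S` spans `g`. So `P_S` contains all
nonnegative eigenspaces. -/
theorem IsRootedBy.standardParabolic_sup (hg : IsRootedBy g α) (D : diagonalCartan g)
    {a : Fin l → ℝ} (ha : ∀ k, 0 ≤ a k) (hD : ∀ k, α k D = a k) {S : Set ℕ}
    (hS : ∀ k : Fin l, a k = 0 ↔ (k : ℕ) + 1 ∈ S) :
    standardParabolic (diagonalCartan g) α S ⊔ negEigenC (D : g) = ⊤ := by
  classical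
  rw [eq_top_iff]
  intro X _
  -- it suffices to place each weight component `M` of an element
  let s : Finset (Module.Dual ℂ (diagonalCartan g)) :=
    Finset.univ.image fun p : κ × κ => entry g p.1 - entry g p.2
  have hX : X = ∑ χ ∈ s, (⟨weightPart g χ X, hg.weightPart_mem X X.2 χ⟩ : g) := by
    refine Subtype.ext (Matrix.ext fun i j => ?_)
    rw [AddSubmonoidClass.coe_finsetSum, Matrix.sum_apply]
    simp only [weightPart, Matrix.of_apply]
    rw [Finset.sum_ite_eq, if_pos]
    exact Finset.mem_image.2 ⟨(i, j), Finset.mem_univ _, rfl⟩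
  rw [hX]
  refine Submodule.sum_mem _ fun χ _ => ?_
  set M : g := ⟨weightPart g χ X, hg.weightPart_mem X X.2 χ⟩ with hM
  have hMij : ∀ i j, (M : Matrix κ κ ℂ) i j ≠ 0 → entry g i - entry g j = χ := by
    intro i j h
    by_contra h0
    exact h (if_neg h0)
  by_cases hM0 : M = 0
  · rw [hM0]
    exact Submodule.zero_mem _
  by_cases hχ : χ = 0
  · refine Submodule.mem_sup_left (Submodule.mem_sup_left (Submodule.mem_sup_left ?_))
    change M ∈ diagonalCartan g
    rw [mem_diagonalCartan]
    intro i j hij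
    by_contra h0
    obtain ⟨D', hD'⟩ := hg.exists_regular
    have h1 := hMij i j h0
    rw [hχ, sub_eq_zero] at h1
    exact hD' i j hij (by rw [h1])
  have hroot : M ∈ rootSpace (diagonalCartan g) χ := by
    refine (mem_rootSpace _ _ _).2 fun H => Subtype.ext (Matrix.ext fun i j => ?_)
    rw [lie_diagonalCartan_apply]
    change _ = χ H * (M : Matrix κ κ ℂ) i j
    by_cases h0 : (M : Matrix κ κ ℂ) i j = 0
    · rw [h0, mul_zero, mul_zero]
    · rw [hMij i j h0]
  have hχroot : χ ∈ roots (diagonalCartan g) :=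
    ⟨hχ, (Submodule.ne_bot_iff _).2 ⟨M, hroot, hM0⟩⟩
  obtain ⟨i, j, hij⟩ : ∃ i j, (M : Matrix κ κ ℂ) i j ≠ 0 := by
    by_contra! h0
    exact hM0 (Subtype.ext (Matrix.ext h0))
  have hne : i ≠ j := by
    rintro rfl
    have := hMij i i hij
    rw [sub_self] at this
    exact hχ this.symm
  rcases hg.weight_mem M M.2 i j hne hij with h | h
  · rw [hMij i j hij] at h
    refine Submodule.mem_sup_left (Submodule.mem_sup_left (Submodule.mem_sup_right ?_))
    exact Submodule.mem_iSup_of_mem χ (Submodule.mem_iSup_of_mem ⟨hχroot, h⟩ hroot)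
  · rw [← neg_sub, hMij i j hij] at h
    obtain ⟨c, hc, h1, h2⟩ := exists_sum_eq D ha hD (fun k => (hS k).1) h
    -- a negative root belongs to `P_S` if it vanishes on `D`, and is negative on `D` otherwise
    rcases hc.eq_or_lt with hc | hc
    · refine Submodule.mem_sup_left (Submodule.mem_sup_right ?_)
      refine Submodule.mem_iSup_of_mem χ (Submodule.mem_iSup_of_mem
        ⟨⟨hχroot, hg.neg_mem_roots hχroot, h⟩, hχroot, ?_⟩ hroot)
      simpa using AddSubgroup.neg_mem _ (h2 hc.symm)
    · refine Submodule.mem_sup_right (mem_negEigenC (c := -c) (by linarith) ?_)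
      rw [Complex.ofReal_neg, ← h1, LinearMap.neg_apply, neg_neg]
      exact (mem_rootSpace _ _ _).1 hroot D

/-- If a real form takes the regular element to a dominant diagonal matrix on which exactly the
simple roots with label in `S` vanish, then it takes `p₀` to `P_S`. -/
theorem IsRootedBy.complexImage_p (hg : IsRootedBy g α) {L : Type*} [LieRing L] [LieAlgebra ℝ L]
    [FiniteDimensional ℝ L] {f : L → g} (hf : IsRealForm f) (P : MinimalParabolic L)
    (D : diagonalCartan g) (hfD : f P.H₀ = D) {a : Fin l → ℝ} (ha : ∀ k, 0 ≤ a k)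
    (hD : ∀ k, α k D = a k) {S : Set ℕ} (hS : ∀ k : Fin l, a k = 0 ↔ (k : ℕ) + 1 ∈ S) :
    complexImage hf.equiv P.p = standardParabolic (diagonalCartan g) α S := by
  refine hf.complexImage_p P ?_ ?_
  · rw [hfD]
    exact standardParabolic_le_nonnegEigenC D ha hD hS
  · rw [hfD]
    exact hg.standardParabolic_sup D ha hD hS

/-- If a real form takes the regular element to a diagonal matrix with distinct entries, then it
takes `m₀ + a₀` to the Cartan subalgebra. -/
theorem complexImage_m_sup_a {L : Type*} [LieRing L] [LieAlgebra ℝ L]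
    [FiniteDimensional ℝ L] {f : L → g} (hf : IsRealForm f) (P : MinimalParabolic L)
    (D : diagonalCartan g) (hfD : f P.H₀ = D) (hD : ∀ i j, i ≠ j → entry g i D ≠ entry g j D) :
    complexImage hf.equiv (P.m.toSubmodule ⊔ P.a.toSubmodule) =
      (diagonalCartan g).toSubmodule := by
  ext Y
  rw [hf.mem_complexImage_m_sup_a, hfD, lie_eq_zero_iff_mem_diagonalCartan D hD]
  rfl

end Complex

/-! ### The roots of the classical complex Lie algebras -/

section Complex

variable {κ : Type*} [Fintype κ] [DecidableEq κ]

theorem mem_skewAdjoint {R : Type*} [CommRing R] {J X : Matrix κ κ R} :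
    X ∈ skewAdjointMatricesLieSubalgebra J ↔ Xᵀ * J + J * X = 0 := by
  rw [mem_skewAdjointMatricesLieSubalgebra, mem_skewAdjointMatricesSubmodule]
  change Xᵀ * J = J * -X ↔ _
  rw [mul_neg, eq_neg_iff_add_eq_zero]

theorem mem_sl {R : Type*} [CommRing R] {X : Matrix κ κ R} :
    X ∈ LieAlgebra.SpecialLinear.sl κ R ↔ X.trace = 0 := Iff.rfl

theorem entry_apply (g : LieSubalgebra ℂ (Matrix κ κ ℂ)) (i : κ) (H : diagonalCartan g) :
    entry g i H = ((H : g) : Matrix κ κ ℂ) i i := rfl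

/-- The indices that pair under the form have opposite weights. -/
theorem entry_add_entry {J : Matrix κ κ ℂ} {i j : κ} (h : J i j ≠ 0) :
    entry (skewAdjointMatricesLieSubalgebra J) i + entry (skewAdjointMatricesLieSubalgebra J) j =
        0 := by
  refine LinearMap.ext fun H => ?_
  have h1 := congrFun (congrFun (mem_skewAdjoint.1 (H : skewAdjointMatricesLieSubalgebra J).2) i) j
  have h2 := mem_diagonalCartan.1 H.2
  rw [Matrix.add_apply, Matrix.mul_apply, Matrix.mul_apply,
    Finset.sum_eq_single i (fun k _ hk => by rw [transpose_apply, h2 k i hk, zero_mul]) (by simp),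
    Finset.sum_eq_single j (fun k _ hk => by rw [h2 k j hk, mul_zero]) (by simp)] at h1
  rw [LinearMap.add_apply, entry_apply, entry_apply, LinearMap.zero_apply]
  have h3 : J i j * (((H : skewAdjointMatricesLieSubalgebra J) : Matrix κ κ ℂ) i i +
      ((H : skewAdjointMatricesLieSubalgebra J) : Matrix κ κ ℂ) j j) = 0 := by
    rw [transpose_apply, Matrix.zero_apply] at h1
    linear_combination h1
  exact (mul_eq_zero.1 h3).resolve_left h

theorem weightPart_mem_skewAdjoint {J X : Matrix κ κ ℂ}
    (hX : X ∈ skewAdjointMatricesLieSubalgebra J) (χ) :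
    weightPart (skewAdjointMatricesLieSubalgebra J) χ X ∈ skewAdjointMatricesLieSubalgebra J := by
  classical
  rw [mem_skewAdjoint] at hX ⊢
  ext i j
  have h1 := congrFun (congrFun hX i) j
  simp only [Matrix.add_apply, Matrix.mul_apply, transpose_apply, Matrix.zero_apply] at h1 ⊢
  set w := entry (skewAdjointMatricesLieSubalgebra J) with hw
  have e1 : ∀ k, weightPart (skewAdjointMatricesLieSubalgebra J) χ X k i * J k j =
      if -w j - w i = χ then X k i * J k j else 0 := by
    intro k
    by_cases hJ : J k j = 0
    · simp [hJ]
    · rw [← eq_neg_of_add_eq_zero_left (entry_add_entry hJ), weightPart, of_apply, ite_mul,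
        zero_mul]
  have e2 : ∀ k, J i k * weightPart (skewAdjointMatricesLieSubalgebra J) χ X k j =
      if -w j - w i = χ then J i k * X k j else 0 := by
    intro k
    by_cases hJ : J i k = 0
    · simp [hJ]
    · rw [neg_sub_left, add_comm, ← neg_sub_left,
        ← eq_neg_of_add_eq_zero_right (entry_add_entry hJ),
        weightPart, of_apply, mul_ite, mul_zero]
  rw [Finset.sum_congr rfl fun k _ => e1 k, Finset.sum_congr rfl fun k _ => e2 k]
  split_ifs
  · exact h1
  · simp

/-- If `C = diagonal c` commutes with `J` and `J ^ 2` is a multiple of `C ^ 2`, then `C⁻¹ Xᵀ C` is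
skew for `J` together with `X`. The matrix `C` is only needed for type B, where `J ^ 2` is not a
scalar. -/
theorem transpose_mem_skewAdjoint {J X : Matrix κ κ ℂ} {c : κ → ℂ} (hc : ∀ i, c i ≠ 0) {s : ℂ}
    (hs : s ≠ 0) (hJ : J * J = s • (diagonal c * diagonal c))
    (hcomm : J * diagonal c = diagonal c * J)
    (hX : X ∈ skewAdjointMatricesLieSubalgebra J) :
    (Matrix.of fun i j => (c i)⁻¹ * X j i * c j) ∈ skewAdjointMatricesLieSubalgebra J := by
  rw [mem_skewAdjoint] at hX ⊢
  set C := diagonal c with hC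
  set D := diagonal fun i => (c i)⁻¹ with hD
  have hDC : D * C = 1 := by
    rw [hD, hC, diagonal_mul_diagonal, ← diagonal_one]
    congr 1
    ext i
    exact inv_mul_cancel₀ (hc i)
  have hCD : C * D = 1 := mul_eq_one_comm.1 hDC
  have hY : (Matrix.of fun i j => (c i)⁻¹ * X j i * c j) = D * Xᵀ * C := by
    ext i j
    rw [hC, mul_diagonal, hD, diagonal_mul]
    rfl
  have hYt : (D * Xᵀ * C)ᵀ = C * X * D := by
    rw [transpose_mul, transpose_mul, transpose_transpose, hC, hD, diagonal_transpose,
      diagonal_transpose, Matrix.mul_assoc]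
  have hJD : J * D = D * J := by
    calc J * D = D * (C * J) * D := by rw [← Matrix.mul_assoc, hDC, Matrix.one_mul]
      _ = D * (J * C) * D := by rw [hcomm]
      _ = D * J := by rw [Matrix.mul_assoc, Matrix.mul_assoc, hCD, Matrix.mul_one]
  have key : D * (J * (Xᵀ * J + J * X) * J) * D = s • (C * X * D * J + J * (D * Xᵀ * C)) := by
    have h1 : J * (Xᵀ * J + J * X) * J = J * Xᵀ * (J * J) + (J * J) * X * J := by
      simp only [mul_add, add_mul, Matrix.mul_assoc]
    rw [h1, hJ, mul_add, add_mul, smul_add, add_comm]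
    congr 1
    · calc D * (s • (C * C) * X * J) * D = s • ((D * C) * (C * X * (J * D))) := by
            simp only [smul_mul_assoc, mul_smul_comm, Matrix.mul_assoc]
        _ = s • (C * X * D * J) := by rw [hDC, Matrix.one_mul, hJD, Matrix.mul_assoc,
          Matrix.mul_assoc,
            Matrix.mul_assoc]
    · calc D * (J * Xᵀ * (s • (C * C))) * D = s • ((D * J) * Xᵀ * C * (C * D)) := by
            simp only [smul_mul_assoc, mul_smul_comm, Matrix.mul_assoc]
        _ = s • (J * (D * Xᵀ * C)) := by
            rw [hCD, Matrix.mul_one, ← hJD]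
            simp only [Matrix.mul_assoc]
  rw [hY, hYt]
  rw [hX] at key
  simp only [mul_zero, zero_mul] at key
  exact (smul_eq_zero.1 key.symm).resolve_left hs

/-- A telescoping sum: the differences of consecutive elements generate all `ε i - ε j` with
`i ≤ j`. -/
theorem sub_mem_of_le {M : Type*} [AddCommGroup M] {S : AddSubmonoid M} {l : ℕ} {ε : Fin l → M}
    (h : ∀ (k : ℕ) (hk : k + 1 < l), ε ⟨k, by omega⟩ - ε ⟨k + 1, hk⟩ ∈ S) {i j : Fin l}
    (hij : i ≤ j) : ε i - ε j ∈ S := by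
  obtain ⟨j, hj⟩ := j
  obtain ⟨i, hi⟩ := i
  simp only [Fin.mk_le_mk] at hij
  induction j, hij using Nat.le_induction with
  | base => simp
  | succ j hij ih => simpa using S.add_mem (ih (by omega)) (h j hj)

variable {g : LieSubalgebra ℂ (Matrix κ κ ℂ)}

/-- A central element of `g` is diagonal, and its diagonal entries at `i` and `j` agree when some
element of `g` has a nonzero entry at `(i, j)`. -/
theorem eq_of_central (hreg : ∃ D : diagonalCartan g, ∀ i j, i ≠ j → entry g i D ≠ entry g j D)
    {Y : g} (hY : ∀ Z : g, ⁅Y, Z⁆ = 0) : (∀ i j, i ≠ j → (Y : Matrix κ κ ℂ) i j = 0) ∧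
      ∀ E ∈ g, ∀ i j, E i j ≠ 0 → (Y : Matrix κ κ ℂ) i i = (Y : Matrix κ κ ℂ) j j := by
  obtain ⟨D, hD⟩ := hreg
  have h1 : Y ∈ diagonalCartan g := by
    rw [← lie_eq_zero_iff_mem_diagonalCartan D hD, ← lie_skew, hY, neg_zero]
  refine ⟨mem_diagonalCartan.1 h1, fun E hE i j hij => ?_⟩
  have h2 := lie_diagonalCartan_apply ⟨Y, h1⟩ ⟨E, hE⟩ i j
  rw [hY] at h2
  have h3 : (entry g i - entry g j) ⟨Y, h1⟩ * E i j = 0 := h2.symm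
  exact sub_eq_zero.1 ((mul_eq_zero.1 h3).resolve_right hij)

/-! #### Type A -/

theorem diagonal_mem_sl {d : κ → ℂ} (hd : ∑ i, d i = 0) :
    diagonal d ∈ LieAlgebra.SpecialLinear.sl κ ℂ := by
  rw [mem_sl, trace_diagonal, hd]

theorem exists_regular_sl (N : ℕ) : ∃ D : diagonalCartan (slC N), ∀ i j, i ≠ j →
    entry (slC N) i D ≠ entry (slC N) j D := by
  let s : ℂ := ∑ i : Fin N, (i : ℂ)
  refine ⟨⟨⟨diagonal fun i => (N : ℂ) * i - s, diagonal_mem_sl ?_⟩, ?_⟩, fun i j hij h => hij ?_⟩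
  · rw [Finset.sum_sub_distrib, ← Finset.mul_sum]
    simp [s]
  · exact isDiag_diagonal _
  · simp only [entry_apply, diagonal_apply_eq, sub_left_inj] at h
    have hN : (N : ℂ) ≠ 0 := Nat.cast_ne_zero.2 (by have := i.2; omega)
    exact Fin.ext (by exact_mod_cast mul_left_cancel₀ hN h)

theorem isRootedBy_sl (N : ℕ) : IsRootedBy (slC N) (simpleA N) where
  weightPart_mem X hX χ := by
    rw [mem_sl] at hX ⊢
    by_cases h : χ = 0
    · rw [← hX]
      exact Finset.sum_congr rfl fun i _ => if_pos (by rw [sub_self, h])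
    · exact Finset.sum_eq_zero fun i _ => if_neg (by rw [sub_self]; exact Ne.symm h)
  exists_regular := exists_regular_sl N
  exists_transpose := by
    refine ⟨fun _ => 1, fun _ => one_ne_zero, fun X hX => ?_⟩
    rw [mem_sl] at hX ⊢
    rw [← hX]
    exact Finset.sum_congr rfl fun i _ => by simp
  weight_mem X _ i j hij _ := by
    have h : ∀ i j : Fin N, i ≤ j → entry (slC N) i - entry (slC N) j ∈
        AddSubmonoid.closure (Set.range (simpleA N)) := fun i j hij =>
      sub_mem_of_le (fun k hk => AddSubmonoid.subset_closure
        (Set.mem_range_self (f := simpleA N) ⟨k, by omega⟩)) hij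
    rcases le_total i j with h1 | h1
    · exact Or.inl (h i j h1)
    · exact Or.inr (h j i h1)

theorem center_sl (N : ℕ) (Y : slC N) (hY : ∀ Z : slC N, ⁅Y, Z⁆ = 0) : Y = 0 := by
  obtain ⟨h1, h2⟩ := eq_of_central (exists_regular_sl N) hY
  refine Subtype.ext (Matrix.ext fun i j => ?_)
  by_cases hij : i = j
  · subst hij
    have h3 : ∀ j, (Y : Matrix (Fin N) (Fin N) ℂ) j j = (Y : Matrix (Fin N) (Fin N) ℂ) i i := by
      intro j
      by_cases hij : j = i
      · rw [hij]
      · refine h2 (Matrix.single j i 1) ?_ j i (by simp)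
        rw [mem_sl, trace_single_eq_of_ne _ _ _ hij]
    have h4 : ∑ j, (Y : Matrix (Fin N) (Fin N) ℂ) j j = 0 := Y.2
    rw [Finset.sum_congr rfl fun j _ => h3 j] at h4
    have hN : (N : ℂ) ≠ 0 := Nat.cast_ne_zero.2 (by have := i.2; omega)
    simpa [hN] using h4
  · exact h1 i j hij

end Complex

section Complex

/-! #### Type C -/

theorem mem_spC {l : ℕ} {X : Matrix (Fin l ⊕ Fin l) (Fin l ⊕ Fin l) ℂ} :
    X ∈ spC l ↔ Xᵀ * Matrix.J (Fin l) ℂ + Matrix.J (Fin l) ℂ * X = 0 :=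
  mem_skewAdjoint

theorem mem_soEvenC {l : ℕ} {X : Matrix (Fin l ⊕ Fin l) (Fin l ⊕ Fin l) ℂ} :
    X ∈ soEvenC l ↔ Xᵀ * LieAlgebra.Orthogonal.JD (Fin l) ℂ +
      LieAlgebra.Orthogonal.JD (Fin l) ℂ * X = 0 :=
  mem_skewAdjoint

theorem mem_soOddC {l : ℕ} {X : Matrix (Unit ⊕ Fin l ⊕ Fin l) (Unit ⊕ Fin l ⊕ Fin l) ℂ} :
    X ∈ soOddC l ↔ Xᵀ * LieAlgebra.Orthogonal.JB (Fin l) ℂ +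
      LieAlgebra.Orthogonal.JB (Fin l) ℂ * X = 0 :=
  mem_skewAdjoint

theorem fromBlocks_mem_spC {l : ℕ} {A B C D : Matrix (Fin l) (Fin l) ℂ} (hD : D = -Aᵀ)
    (hB : Bᵀ = B) (hC : Cᵀ = C) : fromBlocks A B C D ∈ spC l := by
  rw [mem_spC, fromBlocks_transpose, Matrix.J, fromBlocks_multiply, fromBlocks_multiply,
    fromBlocks_add, ← fromBlocks_zero, hD, hB, hC]
  congr 1 <;> simp

theorem fromBlocks_mem_soEvenC {l : ℕ} {A B C D : Matrix (Fin l) (Fin l) ℂ} (hD : D = -Aᵀ)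
    (hB : Bᵀ = -B) (hC : Cᵀ = -C) : fromBlocks A B C D ∈ soEvenC l := by
  rw [mem_soEvenC, fromBlocks_transpose, LieAlgebra.Orthogonal.JD, fromBlocks_multiply,
    fromBlocks_multiply, fromBlocks_add, ← fromBlocks_zero, hD, hB, hC]
  congr 1 <;> simp

theorem fromBlocks_mem_soOddC {l : ℕ} {u : Matrix Unit (Fin l ⊕ Fin l) ℂ}
    {v : Matrix (Fin l ⊕ Fin l) Unit ℂ} {X : Matrix (Fin l ⊕ Fin l) (Fin l ⊕ Fin l) ℂ}
    (hX : X ∈ soEvenC l) (huv : vᵀ * LieAlgebra.Orthogonal.JD (Fin l) ℂ = -(2 : ℂ) • u) :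
    fromBlocks 0 u v X ∈ soOddC l := by
  rw [mem_soEvenC] at hX
  have hJ : (LieAlgebra.Orthogonal.JD (Fin l) ℂ)ᵀ = LieAlgebra.Orthogonal.JD (Fin l) ℂ := by
    simp [LieAlgebra.Orthogonal.JD, fromBlocks_transpose]
  have h2 : LieAlgebra.Orthogonal.JD (Fin l) ℂ * v = -(2 : ℂ) • uᵀ := by
    have := congrArg transpose huv
    rwa [transpose_mul, hJ, transpose_transpose, transpose_smul] at this
  rw [mem_soOddC, fromBlocks_transpose, LieAlgebra.Orthogonal.JB, fromBlocks_multiply,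
    fromBlocks_multiply, fromBlocks_add, ← fromBlocks_zero]
  congr 1
  · simp
  · simp [huv]
  · simp [h2]
  · simpa using hX

/-- The functionals `ε₁, …, ε_l` and their negatives, as weights of `spC l`. -/
theorem entry_spC_inr {l : ℕ} (i : Fin l) :
    entry (spC l) (Sum.inr i) = -entry (spC l) (Sum.inl i) :=
  eq_neg_of_add_eq_zero_left (entry_add_entry (by simp [Matrix.J]))

theorem entry_soEvenC_inr {l : ℕ} (i : Fin l) :
    entry (soEvenC l) (Sum.inr i) = -entry (soEvenC l) (Sum.inl i) :=
  eq_neg_of_add_eq_zero_left (entry_add_entry (by simp [LieAlgebra.Orthogonal.JD]))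

theorem entry_soOddC_inr {l : ℕ} (i : Fin l) :
    entry (soOddC l) (Sum.inr (Sum.inr i)) = -entry (soOddC l) (Sum.inr (Sum.inl i)) :=
  eq_neg_of_add_eq_zero_left (entry_add_entry
    (by simp [LieAlgebra.Orthogonal.JB, LieAlgebra.Orthogonal.JD]))

theorem entry_soOddC_inl {l : ℕ} (i : Unit) : entry (soOddC l) (Sum.inl i) = 0 := by
  have h : entry (soOddC l) (Sum.inl i) + entry (soOddC l) (Sum.inl i) = 0 :=
    entry_add_entry (by simp [LieAlgebra.Orthogonal.JB])
  rw [← two_smul ℂ] at h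
  exact (smul_eq_zero.1 h).resolve_left two_ne_zero

/-- The diagonal matrix with entries `d, -d`. -/
def symmDiagonal {ι : Type*} [DecidableEq ι] (d : ι → ℂ) : Matrix (ι ⊕ ι) (ι ⊕ ι) ℂ :=
  diagonal (Sum.elim d fun i => -d i)

theorem symmDiagonal_eq {ι : Type*} [DecidableEq ι] (d : ι → ℂ) :
    symmDiagonal d = fromBlocks (diagonal d) 0 0 (-diagonal d) := by
  have h : -diagonal d = diagonal fun i => -d i := diagonal_neg d
  rw [symmDiagonal, h, fromBlocks_diagonal]

theorem symmDiagonal_mem_spC {l : ℕ} (d : Fin l → ℂ) : symmDiagonal d ∈ spC l := by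
  rw [symmDiagonal_eq]
  exact fromBlocks_mem_spC (by simp) (by simp) (by simp)

theorem symmDiagonal_mem_soEvenC {l : ℕ} (d : Fin l → ℂ) : symmDiagonal d ∈ soEvenC l := by
  rw [symmDiagonal_eq]
  exact fromBlocks_mem_soEvenC (by simp) (by simp) (by simp)

theorem symmDiagonal_mem_soOddC {l : ℕ} (d : Fin l → ℂ) :
    fromBlocks 0 0 0 (symmDiagonal d) ∈ soOddC l :=
  fromBlocks_mem_soOddC (symmDiagonal_mem_soEvenC d) (by simp)

theorem symmDiagonal_ne {l : ℕ} {i j : Fin l ⊕ Fin l} (hij : i ≠ j) :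
    symmDiagonal (fun k : Fin l => (k : ℂ) + 1) i i ≠
      symmDiagonal (fun k : Fin l => (k : ℂ) + 1) j j := by
  have h1 : ∀ i j : Fin l, ((i : ℂ) + 1 = (j : ℂ) + 1) → i = j := fun i j h =>
    Fin.ext (by exact_mod_cast add_right_cancel h)
  have h2 : ∀ i j : Fin l, ((i : ℂ) + 1 ≠ -((j : ℂ) + 1)) := fun i j h => by
    have h3 : ((i + 1 + (j + 1) : ℕ) : ℂ) = 0 := by
      push_cast
      linear_combination h
    have := Nat.cast_eq_zero.1 h3
    omega
  rcases i with i | i <;> rcases j with j | j <;>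
    simp only [symmDiagonal, diagonal_apply_eq, Sum.elim_inl, Sum.elim_inr, ne_eq, neg_inj]
  · exact fun h => hij (by rw [h1 i j h])
  · exact h2 i j
  · exact fun h => h2 j i h.symm
  · exact fun h => hij (by rw [h1 i j h])

theorem exists_regular_spC (l : ℕ) : ∃ D : diagonalCartan (spC l), ∀ i j, i ≠ j →
    entry (spC l) i D ≠ entry (spC l) j D :=
  ⟨⟨⟨_, symmDiagonal_mem_spC fun k => (k : ℂ) + 1⟩, isDiag_diagonal _⟩, fun _ _ => symmDiagonal_ne⟩

theorem exists_regular_soEvenC (l : ℕ) : ∃ D : diagonalCartan (soEvenC l), ∀ i j, i ≠ j →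
    entry (soEvenC l) i D ≠ entry (soEvenC l) j D :=
  ⟨⟨⟨_, symmDiagonal_mem_soEvenC fun k => (k : ℂ) + 1⟩, isDiag_diagonal _⟩,
    fun _ _ => symmDiagonal_ne⟩

theorem isDiag_fromBlocks_symmDiagonal {l : ℕ} (d : Fin l → ℂ) :
    (fromBlocks (0 : Matrix Unit Unit ℂ) 0 0 (symmDiagonal d)).IsDiag := by
  rw [isDiag_fromBlocks_iff]
  exact ⟨isDiag_zero, rfl, rfl, isDiag_diagonal _⟩

theorem exists_regular_soOddC (l : ℕ) : ∃ D : diagonalCartan (soOddC l), ∀ i j, i ≠ j →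
    entry (soOddC l) i D ≠ entry (soOddC l) j D := by
  refine ⟨⟨⟨_, symmDiagonal_mem_soOddC fun k => (k : ℂ) + 1⟩, isDiag_fromBlocks_symmDiagonal _⟩,
    fun i j hij => ?_⟩
  have h : ∀ i : Fin l ⊕ Fin l, symmDiagonal (fun k : Fin l => (k : ℂ) + 1) i i ≠ 0 := by
    intro i h
    have h1 : ∀ i : Fin l, (i : ℂ) + 1 ≠ 0 := fun i => by exact_mod_cast Nat.succ_ne_zero i
    rcases i with i | i
    · exact h1 i (by simpa [symmDiagonal] using h)
    · refine h1 i ?_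
      simp only [symmDiagonal, diagonal_apply_eq, Sum.elim_inr, neg_eq_zero] at h
      exact h
  simp only [entry_apply]
  rcases i with i | i <;> rcases j with j | j
  · exact absurd (by rfl) hij
  · exact (h j).symm
  · exact h i
  · exact symmDiagonal_ne fun h => hij (by rw [h])

theorem isRootedBy_spC (l : ℕ) : IsRootedBy (spC l) (simpleC l) where
  weightPart_mem _ hX χ := weightPart_mem_skewAdjoint hX χ
  exists_regular := exists_regular_spC l
  exists_transpose := by
    refine ⟨fun _ => 1, fun _ => one_ne_zero, fun X hX => ?_⟩
    refine transpose_mem_skewAdjoint (s := -1) (fun _ => one_ne_zero) (by simp) ?_ ?_ hX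
    · rw [diagonal_one, J_squared]
      simp
    · rw [diagonal_one, Matrix.one_mul, Matrix.mul_one]
  weight_mem X _ i j hij _ := by
    set S := AddSubmonoid.closure (Set.range (simpleC l)) with hS
    set ε : Fin l → Module.Dual ℂ (diagonalCartan (spC l)) := fun i => entry (spC l) (Sum.inl i)
      with hε
    have hle : ∀ i j : Fin l, i ≤ j → ε i - ε j ∈ S := fun i j hij =>
      sub_mem_of_le (fun k hk => by
        have := AddSubmonoid.subset_closure (Set.mem_range_self (f := simpleC l) ⟨k, by omega⟩)
        rwa [simpleC, dif_pos hk] at this) hij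
    have hadd : ∀ i j : Fin l, ε i + ε j ∈ S := by
      intro i j
      have hl := i.2
      have h0 := AddSubmonoid.subset_closure
        (Set.mem_range_self (f := simpleC l) ⟨l - 1, by omega⟩)
      rw [simpleC, dif_neg (by simp only; omega)] at h0
      have h1 := hle i ⟨l - 1, by omega⟩ (Fin.le_def.2 (by simp only; omega))
      have h2 := hle j ⟨l - 1, by omega⟩ (Fin.le_def.2 (by simp only; omega))
      have := S.add_mem (S.add_mem h1 h2) h0
      rw [two_smul] at this
      convert this using 1
      simp only [hε]
      abel
    rcases i with i | i <;> rcases j with j | j <;>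
      try simp only [entry_spC_inr, sub_neg_eq_add]
    · exact (le_total i j).imp (hle i j) (hle j i)
    · exact Or.inl (hadd i j)
    · refine Or.inr (hadd j i)
    · rw [neg_add_eq_sub, neg_add_eq_sub]
      exact (le_total j i).imp (hle j i) (hle i j)

theorem isRootedBy_soEvenC (l : ℕ) : IsRootedBy (soEvenC l) (simpleD l) where
  weightPart_mem _ hX χ := weightPart_mem_skewAdjoint hX χ
  exists_regular := exists_regular_soEvenC l
  exists_transpose := by
    refine ⟨fun _ => 1, fun _ => one_ne_zero, fun X hX => ?_⟩
    refine transpose_mem_skewAdjoint (s := 1) (fun _ => one_ne_zero) (by simp) ?_ ?_ hX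
    · rw [diagonal_one, LieAlgebra.Orthogonal.JD, fromBlocks_multiply]
      simp
    · rw [diagonal_one, Matrix.one_mul, Matrix.mul_one]
  weight_mem X hX i j hij hXij := by
    set S := AddSubmonoid.closure (Set.range (simpleD l)) with hS
    set ε : Fin l → Module.Dual ℂ (diagonalCartan (soEvenC l)) :=
      fun i => entry (soEvenC l) (Sum.inl i) with hε
    have hle : ∀ i j : Fin l, i ≤ j → ε i - ε j ∈ S := fun i j hij =>
      sub_mem_of_le (fun k hk => by
        have := AddSubmonoid.subset_closure (Set.mem_range_self (f := simpleD l) ⟨k, by omega⟩)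
        rwa [simpleD, dif_pos hk] at this) hij
    have hadd' : ∀ i j : Fin l, i < j → ε i + ε j ∈ S := by
      intro i j hij
      have hl := j.2
      have hij := Fin.lt_def.1 hij
      have h0 := AddSubmonoid.subset_closure
        (Set.mem_range_self (f := simpleD l) ⟨l - 1, by omega⟩)
      rw [simpleD, dif_neg (by simp only; omega)] at h0
      have h1 := hle i ⟨l - 1 - 1, by omega⟩ (Fin.le_def.2 (by simp only; omega))
      have h2 := hle j ⟨l - 1, by omega⟩ (Fin.le_def.2 (by simp only; omega))
      have := S.add_mem (S.add_mem h1 h2) h0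
      convert this using 1
      simp only [hε]
      abel
    have hadd : ∀ i j : Fin l, i ≠ j → ε i + ε j ∈ S := by
      intro i j hij
      rcases lt_or_gt_of_ne hij with h | h
      · exact hadd' i j h
      · rw [add_comm]
        exact hadd' j i h
    rw [mem_soEvenC] at hX
    -- the weights `±2 ε_i` do not occur: the off-diagonal blocks are skew-symmetric
    have h12 : ∀ i : Fin l, X (Sum.inl i) (Sum.inr i) = 0 := by
      intro i
      have h1 := congrFun (congrFun hX (Sum.inr i)) (Sum.inr i)
      simp [LieAlgebra.Orthogonal.JD, Matrix.mul_apply, Matrix.one_apply] at h1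
      exact h1
    have h21 : ∀ i : Fin l, X (Sum.inr i) (Sum.inl i) = 0 := by
      intro i
      have h1 := congrFun (congrFun hX (Sum.inl i)) (Sum.inl i)
      simp [LieAlgebra.Orthogonal.JD, Matrix.mul_apply, Matrix.one_apply] at h1
      exact h1
    rcases i with i | i <;> rcases j with j | j <;>
      try simp only [entry_soEvenC_inr, sub_neg_eq_add]
    · exact (le_total i j).imp (hle i j) (hle j i)
    · exact Or.inl (hadd i j fun h => hXij (by rw [h, h12]))
    · exact Or.inr (hadd j i fun h => hXij (by rw [h, h21]))
    · rw [neg_add_eq_sub, neg_add_eq_sub]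
      exact (le_total j i).imp (hle j i) (hle i j)

theorem isRootedBy_soOddC (l : ℕ) : IsRootedBy (soOddC l) (simpleB l) where
  weightPart_mem _ hX χ := weightPart_mem_skewAdjoint hX χ
  exists_regular := exists_regular_soOddC l
  exists_transpose := by
    -- conjugation with `diag(2, 1, …, 1)`, whose square is the square of the form
    refine ⟨Sum.elim (fun _ => 2) fun _ => 1, by rintro (i | i) <;> simp, fun X hX => ?_⟩
    have hd : diagonal (Sum.elim (fun _ : Unit => (2 : ℂ)) fun _ : Fin l ⊕ Fin l => 1) =
        fromBlocks ((2 : ℂ) • 1) 0 0 1 := by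
      rw [smul_one_eq_diagonal, ← diagonal_one, fromBlocks_diagonal]
    refine transpose_mem_skewAdjoint (s := 1) (by rintro (i | i) <;> simp) one_ne_zero ?_ ?_ hX
    · rw [hd, LieAlgebra.Orthogonal.JB, LieAlgebra.Orthogonal.JD, fromBlocks_multiply,
        fromBlocks_multiply, fromBlocks_multiply]
      simp
    · rw [hd, LieAlgebra.Orthogonal.JB, fromBlocks_multiply, fromBlocks_multiply]
      simp
  weight_mem X _ i j hij _ := by
    set S := AddSubmonoid.closure (Set.range (simpleB l)) with hS
    set ε : Fin l → Module.Dual ℂ (diagonalCartan (soOddC l)) :=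
      fun i => entry (soOddC l) (Sum.inr (Sum.inl i)) with hε
    have hle : ∀ i j : Fin l, i ≤ j → ε i - ε j ∈ S := fun i j hij =>
      sub_mem_of_le (fun k hk => by
        have := AddSubmonoid.subset_closure (Set.mem_range_self (f := simpleB l) ⟨k, by omega⟩)
        rwa [simpleB, dif_pos hk] at this) hij
    have hone : ∀ i : Fin l, ε i ∈ S := by
      intro i
      have hl := i.2
      have h0 := AddSubmonoid.subset_closure
        (Set.mem_range_self (f := simpleB l) ⟨l - 1, by omega⟩)
      rw [simpleB, dif_neg (by simp only; omega)] at h0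
      have := S.add_mem (hle i ⟨l - 1, by omega⟩ (Fin.le_def.2 (by simp only; omega))) h0
      simpa [hε] using this
    have hadd : ∀ i j : Fin l, ε i + ε j ∈ S := fun i j => S.add_mem (hone i) (hone j)
    rcases i with i | i | i <;> rcases j with j | j | j <;>
      try simp only [entry_soOddC_inr, entry_soOddC_inl, sub_neg_eq_add, zero_sub, sub_zero,
        zero_add]
    · exact absurd rfl hij
    · exact Or.inr (hone j)
    · exact Or.inl (hone j)
    · exact Or.inl (hone i)
    · exact (le_total i j).imp (hle i j) (hle j i)
    · exact Or.inl (hadd i j)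
    · exact Or.inr (hone i)
    · exact Or.inr (hadd j i)
    · rw [neg_add_eq_sub, neg_add_eq_sub]
      exact (le_total j i).imp (hle j i) (hle i j)

/-! #### The centers -/

theorem entry_inr_eq_neg {l : ℕ} {g : LieSubalgebra ℂ (Matrix (Fin l ⊕ Fin l) (Fin l ⊕ Fin l) ℂ)}
    (h : ∀ i, entry g (Sum.inr i) = -entry g (Sum.inl i)) {Y : g} (hY : Y ∈ diagonalCartan g)
    (i : Fin l) : (Y : Matrix (Fin l ⊕ Fin l) (Fin l ⊕ Fin l) ℂ) (Sum.inr i) (Sum.inr i) =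
      -(Y : Matrix (Fin l ⊕ Fin l) (Fin l ⊕ Fin l) ℂ) (Sum.inl i) (Sum.inl i) :=
  LinearMap.congr_fun (h i) ⟨Y, hY⟩

theorem center_spC (l : ℕ) (Y : spC l) (hY : ∀ Z : spC l, ⁅Y, Z⁆ = 0) : Y = 0 := by
  obtain ⟨h1, h2⟩ := eq_of_central (exists_regular_spC l) hY
  have hneg := entry_inr_eq_neg entry_spC_inr (mem_diagonalCartan.2 h1)
  have h3 : ∀ i : Fin l, (Y : Matrix (Fin l ⊕ Fin l) (Fin l ⊕ Fin l) ℂ) (Sum.inl i) (Sum.inl i) =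
      0 := by
    intro i
    have h4 := h2 (fromBlocks 0 1 0 0) (fromBlocks_mem_spC (by simp) (by simp) (by simp))
      (Sum.inl i) (Sum.inr i) (by simp)
    rw [hneg] at h4
    exact self_eq_neg.1 h4
  refine Subtype.ext (Matrix.ext fun i j => ?_)
  by_cases hij : i = j
  · subst hij
    rcases i with i | i
    · exact h3 i
    · rw [hneg, h3, neg_zero]
      rfl
  · exact h1 i j hij

theorem center_soEvenC {l : ℕ} (hl : 2 ≤ l) (Y : soEvenC l) (hY : ∀ Z : soEvenC l, ⁅Y, Z⁆ = 0) :
    Y = 0 := by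
  obtain ⟨h1, h2⟩ := eq_of_central (exists_regular_soEvenC l) hY
  have hneg := entry_inr_eq_neg entry_soEvenC_inr (mem_diagonalCartan.2 h1)
  have h3 : ∀ i : Fin l, (Y : Matrix (Fin l ⊕ Fin l) (Fin l ⊕ Fin l) ℂ) (Sum.inl i) (Sum.inl i) =
      0 := by
    intro i
    obtain ⟨j, hj⟩ : ∃ j : Fin l, i ≠ j := by
      have : Nontrivial (Fin l) := Fin.nontrivial_iff_two_le.2 hl
      obtain ⟨j, hj⟩ := exists_ne i
      exact ⟨j, hj.symm⟩
    have h4 := h2 (fromBlocks (Matrix.single i j 1) 0 0 (-(Matrix.single i j 1)ᵀ))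
      (fromBlocks_mem_soEvenC rfl (by simp) (by simp)) (Sum.inl i) (Sum.inl j) (by simp)
    have h5 := h2 (fromBlocks 0 (Matrix.single i j 1 - Matrix.single j i 1) 0 0)
      (fromBlocks_mem_soEvenC (by simp) (by simp) (by simp)) (Sum.inl i) (Sum.inr j)
      (by simp [hj])
    rw [hneg, ← h4] at h5
    exact self_eq_neg.1 h5
  refine Subtype.ext (Matrix.ext fun i j => ?_)
  by_cases hij : i = j
  · subst hij
    rcases i with i | i
    · exact h3 i
    · rw [hneg, h3, neg_zero]
      rfl
  · exact h1 i j hij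

theorem center_soOddC (l : ℕ) (Y : soOddC l) (hY : ∀ Z : soOddC l, ⁅Y, Z⁆ = 0) : Y = 0 := by
  obtain ⟨h1, h2⟩ := eq_of_central (exists_regular_soOddC l) hY
  have h0 : (Y : Matrix (Unit ⊕ Fin l ⊕ Fin l) (Unit ⊕ Fin l ⊕ Fin l) ℂ) (Sum.inl ()) (Sum.inl ()) =
    0 :=
    LinearMap.congr_fun (entry_soOddC_inl ()) ⟨Y, mem_diagonalCartan.2 h1⟩
  refine Subtype.ext (Matrix.ext fun i j => ?_)
  by_cases hij : i = j
  · subst hij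
    rcases i with i | i
    · exact h0
    · -- the root vectors of the short roots
      have h3 := h2 (fromBlocks 0 (replicateRow Unit fun _ => 1)
        (replicateCol Unit fun _ => -2) 0) (fromBlocks_mem_soOddC (zero_mem _) ?_)
        (Sum.inl ()) (Sum.inr i) (by simp)
      · rw [← h3, h0]
        rfl
      · ext a b
        rcases b with b | b <;>
          simp [LieAlgebra.Orthogonal.JD, Matrix.mul_apply, Matrix.one_apply]
  · exact h1 i j hij

end Complex

/-! ### Minimal parabolic subalgebras of Lie algebras of matrices -/

section Construction

variable {L : Type*} [LieRing L] [LieAlgebra ℝ L]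

/-- If the bracket operators satisfy `(ad X)ᵀ = -ad (θ X)` for some inner product, then
`κ(X, θ X)` is minus the square norm of `ad (θ X)`; so it is negative when the center is zero. -/
theorem isCartanInvolution_of_core [FiniteDimensional ℝ L] {θ : L ≃ₗ⁅ℝ⁆ L}
    (hθ : ∀ X, θ (θ X) = X) (c : InnerProductSpace.Core ℝ L)
    (hc : ∀ X Y Z, c.inner ⁅X, Y⁆ Z = -c.inner Y ⁅θ X, Z⁆)
    (hcenter : ∀ X : L, (∀ Z : L, ⁅X, Z⁆ = 0) → X = 0) : IsCartanInvolution θ := by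
  refine ⟨hθ, fun X hX => ?_⟩
  let _ : NormedAddCommGroup L := c.toNormedAddCommGroup
  let _ : InnerProductSpace ℝ L := InnerProductSpace.ofCore c.toCore
  have hin : ∀ X Y : L, inner ℝ X Y = c.inner X Y := fun _ _ => rfl
  let b := stdOrthonormalBasis ℝ L
  have h1 : killingForm ℝ L X (θ X) = ∑ i, -‖⁅θ X, b i⁆‖ ^ 2 := by
    rw [killingForm_apply_apply, LinearMap.trace_eq_sum_inner _ b]
    refine Finset.sum_congr rfl fun i _ => ?_
    rw [LinearMap.comp_apply, LieAlgebra.ad_apply, LieAlgebra.ad_apply, real_inner_comm, hin, hc,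
      ← hin, real_inner_comm, real_inner_self_eq_norm_sq]
  rw [h1, Finset.sum_neg_distrib, neg_lt_zero]
  refine lt_of_le_of_ne (Finset.sum_nonneg fun _ _ => by positivity) fun h0 => hX ?_
  have h2 := (Finset.sum_eq_zero_iff_of_nonneg fun _ _ => by positivity).1 h0.symm
  have h3 : θ X = 0 := by
    refine hcenter _ fun Z => ?_
    rw [← b.sum_repr Z, lie_sum]
    refine Finset.sum_eq_zero fun i hi => ?_
    have := h2 i hi
    rw [lie_smul, norm_eq_zero.1 (pow_eq_zero_iff (two_ne_zero) |>.1 this), smul_zero]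
  rw [← hθ X, h3, map_zero]

/-- The minimal parabolic subalgebra given by a Cartan involution and an element `H₀` of its
`-1`-eigenspace whose centralizer meets this eigenspace in an abelian subspace. -/
def ofRegular {θ : L ≃ₗ⁅ℝ⁆ L} (hθ : IsCartanInvolution θ) (H₀ : L) (hH₀ : θ H₀ = -H₀)
    (hab : ∀ X Y, θ X = -X → θ Y = -Y → ⁅H₀, X⁆ = 0 → ⁅H₀, Y⁆ = 0 → ⁅X, Y⁆ = 0) :
    MinimalParabolic L where
  θ := θ
  involutive := hθ.involutive
  killing_neg := hθ.killing_neg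
  a :=
    { carrier := {X | θ X = -X ∧ ⁅H₀, X⁆ = 0}
      add_mem' := by
        rintro X Y ⟨hX, hX'⟩ ⟨hY, hY'⟩
        exact ⟨by rw [map_add, hX, hY, neg_add], by rw [lie_add, hX', hY', add_zero]⟩
      zero_mem' := ⟨by rw [map_zero, neg_zero], lie_zero _⟩
      smul_mem' := by
        rintro c X ⟨hX, hX'⟩
        exact ⟨by rw [map_smul, hX, smul_neg], by rw [lie_smul, hX', smul_zero]⟩
      lie_mem' := by
        rintro X Y ⟨hX, hX'⟩ ⟨hY, hY'⟩
        rw [hab X Y hX hY hX' hY']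
        exact ⟨by rw [map_zero, neg_zero], lie_zero _⟩ }
  a_le X hX := hX.1
  a_abelian X hX Y hY := hab X Y hX.1 hY.1 hX.2 hY.2
  a_maximal X hX hX' := ⟨hX, hX' H₀ ⟨hH₀, lie_self _⟩⟩
  H₀ := ⟨H₀, hH₀, lie_self _⟩
  regular μ hμ h0 := by
    obtain ⟨E, hE, hE0⟩ := Submodule.exists_mem_ne_zero_of_ne_bot hμ.2
    rw [mem_rootSpace] at hE
    have h1 : ⁅H₀, E⁆ = 0 := by
      have := hE ⟨H₀, hH₀, lie_self _⟩
      rwa [h0, zero_smul] at this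
    have h2 : ⁅H₀, θ E⁆ = 0 := by
      have := congrArg θ h1
      rwa [LieEquiv.map_lie, hH₀, neg_lie, map_zero, neg_eq_zero] at this
    -- `E - θ E` lies in `a₀`, so `a₀` commutes with it; this forces `θ E = E` and then `μ = 0`
    have h3 : ∀ H : L, θ H = -H → ⁅H₀, H⁆ = 0 → ⁅H, E - θ E⁆ = 0 := fun H hH hH' =>
      hab _ _ hH (by rw [map_sub, hθ.involutive, neg_sub]) hH' (by rw [lie_sub, h1, h2, sub_zero])
    have h4 : ∀ (H : L) (hH : θ H = -H ∧ ⁅H₀, H⁆ = 0), μ ⟨H, hH⟩ • (E + θ E) = 0 := by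
      intro H hH
      have e1 : ⁅H, E⁆ = μ ⟨H, hH⟩ • E := hE ⟨H, hH⟩
      have e2 := h3 H hH.1 hH.2
      have e3 : θ ⁅H, E⁆ = -⁅H, θ E⁆ := by rw [LieEquiv.map_lie, hH.1, neg_lie]
      rw [lie_sub, e1, sub_eq_zero] at e2
      rw [e1, map_smul, ← e2] at e3
      rw [smul_add, e3, add_neg_cancel]
    have h5 : ∃ (H : L) (hH : θ H = -H ∧ ⁅H₀, H⁆ = 0), μ ⟨H, hH⟩ ≠ 0 := by
      by_contra! h
      exact hμ.1 (LinearMap.ext fun H => h H H.2)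
    obtain ⟨H, hH, hne⟩ := h5
    have h6 : θ E = -E := eq_neg_of_add_eq_zero_right ((smul_eq_zero.1 (h4 H hH)).resolve_left hne)
    have h7 := hab H E hH.1 h6 hH.2 h1
    rw [show ⁅H, E⁆ = μ ⟨H, hH⟩ • E from hE ⟨H, hH⟩] at h7
    exact hE0 ((smul_eq_zero.1 h7).resolve_left hne)

theorem mem_ofRegular_m [FiniteDimensional ℝ L] {θ : L ≃ₗ⁅ℝ⁆ L} (hθ : IsCartanInvolution θ) (H₀ : L)
    (hH₀ : θ H₀ = -H₀) (hab) (X : L) :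
    X ∈ (ofRegular hθ H₀ hH₀ hab).m ↔ θ X = X ∧ ⁅H₀, X⁆ = 0 := by
  rw [MinimalParabolic.mem_m]
  exact and_congr_right fun _ => ⟨fun h => h H₀ (ofRegular hθ H₀ hH₀ hab).H₀.2, fun h =>
    (ofRegular hθ H₀ hH₀ hab).lie_eq_zero_of_lie_H₀ h⟩

end Construction

section Scalars

open Quaternion

/-- The common properties of the star algebras `ℝ`, `ℂ` and `ℍ`: a real part with the properties of
a trace, for which `re (x̄ x)` is positive, and no selfadjoint elements except for the reals. -/
class RealScalars (F : Type*) [Ring F] [StarRing F] [Algebra ℝ F] where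
  /-- The real part. -/
  re : F →ₗ[ℝ] ℝ
  re_mul_comm : ∀ x y, re (x * y) = re (y * x)
  re_star : ∀ x, re (star x) = re x
  re_star_mul_self_pos : ∀ x, x ≠ 0 → 0 < re (star x * x)
  re_algebraMap : ∀ c, re (algebraMap ℝ F c) = c
  algebraMap_re : ∀ x, star x = x → algebraMap ℝ F (re x) = x
  star_real_smul : ∀ (c : ℝ) (x : F), star (c • x) = c • star x

instance : RealScalars ℝ where
  re := LinearMap.id
  re_mul_comm x y := mul_comm x y
  re_star _ := rfl
  re_star_mul_self_pos _ hx := mul_self_pos.2 hx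
  re_algebraMap _ := rfl
  algebraMap_re _ _ := rfl
  star_real_smul _ _ := rfl

instance : RealScalars ℂ where
  re := Complex.reLm
  re_mul_comm x y := by rw [mul_comm]
  re_star _ := rfl
  re_star_mul_self_pos x hx := by
    simpa [Complex.normSq_apply] using Complex.normSq_pos.2 hx
  re_algebraMap _ := rfl
  algebraMap_re x hx := Complex.conj_eq_iff_re.1 hx
  star_real_smul c x := by simp

/-- The real part of a quaternion, as a linear map. -/
def quaternionRe : ℍ[ℝ] →ₗ[ℝ] ℝ where
  toFun q := q.re
  map_add' _ _ := rfl
  map_smul' _ _ := rfl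

instance : RealScalars ℍ[ℝ] where
  re := quaternionRe
  re_mul_comm x y := by
    change (x * y).re = (y * x).re
    rw [Quaternion.re_mul, Quaternion.re_mul]
    ring
  re_star x := Quaternion.re_star x
  re_star_mul_self_pos x hx := by
    have h : 0 < Quaternion.normSq x :=
      lt_of_le_of_ne Quaternion.normSq_nonneg fun h => hx (Quaternion.normSq_eq_zero.1 h.symm)
    rw [Quaternion.star_mul_self]
    exact h
  re_algebraMap _ := rfl
  algebraMap_re x hx := (Quaternion.star_eq_self.1 hx).symm
  star_real_smul c x := by
    exact Quaternion.star_smul c x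

end Scalars

section Matrices

variable {F : Type*} [Ring F] [StarRing F] [Algebra ℝ F] [RealScalars F] {ι : Type*} [Fintype ι]

open RealScalars

theorem conjTranspose_real_smul (c : ℝ) (X : Matrix ι ι F) : (c • X)ᴴ = c • Xᴴ := by
  ext i j
  exact star_real_smul c _

/-- The real part of the trace. -/
def reTrace : Matrix ι ι F →ₗ[ℝ] ℝ := re ∘ₗ Matrix.traceLinearMap ι ℝ F

theorem reTrace_mul_comm (X Y : Matrix ι ι F) : reTrace (X * Y) = reTrace (Y * X) := by
  simp only [reTrace, LinearMap.comp_apply, traceLinearMap_apply, trace, diag_apply, mul_apply,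
    map_sum]
  rw [Finset.sum_comm]
  exact Finset.sum_congr rfl fun _ _ => Finset.sum_congr rfl fun _ _ => re_mul_comm _ _

theorem reTrace_conjTranspose (X : Matrix ι ι F) : reTrace Xᴴ = reTrace X := by
  simp only [reTrace, LinearMap.comp_apply, traceLinearMap_apply, trace, diag_apply,
    conjTranspose_apply, map_sum, re_star]

theorem reTrace_conjTranspose_mul_self (X : Matrix ι ι F) :
    reTrace (Xᴴ * X) = ∑ i, ∑ j, re (star (X j i) * X j i) := by
  simp only [reTrace, LinearMap.comp_apply, traceLinearMap_apply, trace, diag_apply, mul_apply,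
    conjTranspose_apply, map_sum]

variable [DecidableEq ι]

theorem re_star_mul_self_nonneg (x : F) : 0 ≤ re (star x * x) := by
  by_cases hx : x = 0
  · simp [hx]
  · exact (re_star_mul_self_pos x hx).le

/-- The inner product `re tr (Xᴴ Y)` on a space of matrices. -/
@[reducible] def traceCore (L : LieSubalgebra ℝ (Matrix ι ι F)) : InnerProductSpace.Core ℝ L where
  inner X Y := reTrace ((X : Matrix ι ι F)ᴴ * (Y : Matrix ι ι F))
  conj_inner_symm X Y := by
    rw [conj_trivial, ← reTrace_conjTranspose, conjTranspose_mul, conjTranspose_conjTranspose]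
  re_inner_nonneg X := by
    rw [reTrace_conjTranspose_mul_self]
    exact Finset.sum_nonneg fun i _ => Finset.sum_nonneg fun j _ => re_star_mul_self_nonneg _
  add_left X Y Z := by
    change reTrace (((X : Matrix ι ι F) + (Y : Matrix ι ι F))ᴴ * (Z : Matrix ι ι F)) = _
    rw [conjTranspose_add, add_mul, map_add]
  smul_left X Y c := by
    change reTrace ((c • (X : Matrix ι ι F))ᴴ * (Y : Matrix ι ι F)) = _
    rw [conjTranspose_real_smul, smul_mul_assoc, map_smul]
    rfl
  definite X hX := by
    rw [reTrace_conjTranspose_mul_self, Finset.sum_eq_zero_iff_of_nonneg fun i _ =>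
      Finset.sum_nonneg fun j _ => re_star_mul_self_nonneg _] at hX
    refine Subtype.ext (Matrix.ext fun j i => ?_)
    have h := (Finset.sum_eq_zero_iff_of_nonneg fun j _ => re_star_mul_self_nonneg _).1
      (hX i (Finset.mem_univ i)) j (Finset.mem_univ j)
    by_contra h0
    exact (re_star_mul_self_pos _ h0).ne' h

/-- The Cartan involution `X ↦ -Xᴴ` of a Lie algebra of matrices closed under `X ↦ Xᴴ`. -/
def negConjTranspose (L : LieSubalgebra ℝ (Matrix ι ι F)) (hL : ∀ X ∈ L, Xᴴ ∈ L) : L ≃ₗ⁅ℝ⁆ L where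
  toFun X := ⟨-(X : Matrix ι ι F)ᴴ, L.neg_mem (hL X X.2)⟩
  map_add' X Y := Subtype.ext (by simp [add_comm])
  map_smul' c X := Subtype.ext (by
    change -(c • (X : Matrix ι ι F))ᴴ = c • -(X : Matrix ι ι F)ᴴ
    rw [conjTranspose_real_smul, smul_neg])
  map_lie' {X Y} := Subtype.ext (by
    simp only [LieSubalgebra.coe_bracket, LieRing.of_associative_ring_bracket, conjTranspose_sub,
      conjTranspose_mul]
    noncomm_ring)
  invFun X := ⟨-(X : Matrix ι ι F)ᴴ, L.neg_mem (hL X X.2)⟩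
  left_inv X := Subtype.ext (by simp)
  right_inv X := Subtype.ext (by simp)

theorem coe_negConjTranspose {L : LieSubalgebra ℝ (Matrix ι ι F)} (hL : ∀ X ∈ L, Xᴴ ∈ L) (X : L) :
    (negConjTranspose L hL X : Matrix ι ι F) = -(X : Matrix ι ι F)ᴴ := rfl

theorem isCartanInvolution_negConjTranspose {L : LieSubalgebra ℝ (Matrix ι ι F)}
    [FiniteDimensional ℝ L] (hL : ∀ X ∈ L, Xᴴ ∈ L)
    (hcenter : ∀ X : L, (∀ Z : L, ⁅X, Z⁆ = 0) → X = 0) :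
    IsCartanInvolution (negConjTranspose L hL) := by
  refine isCartanInvolution_of_core (fun X => (negConjTranspose L hL).left_inv X) (traceCore L)
    (fun X Y Z => ?_) hcenter
  obtain ⟨X, hX⟩ := X
  obtain ⟨Y, hY⟩ := Y
  obtain ⟨Z, hZ⟩ := Z
  change reTrace ((X * Y - Y * X)ᴴ * Z) = -reTrace (Yᴴ * (-Xᴴ * Z - Z * -Xᴴ))
  have h : reTrace (Yᴴ * (Z * Xᴴ)) = reTrace (Xᴴ * Yᴴ * Z) := by
    rw [← mul_assoc, reTrace_mul_comm, mul_assoc]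
  rw [conjTranspose_sub, conjTranspose_mul, conjTranspose_mul, sub_mul, map_sub, mul_neg,
    sub_neg_eq_add, mul_add, map_add, h, neg_mul, mul_neg, map_neg, mul_assoc]
  ring

/-- The real diagonal matrix with entries `d`. -/
def realDiagonal (F : Type*) [Ring F] [Algebra ℝ F] (d : ι → ℝ) : Matrix ι ι F :=
  diagonal fun i => algebraMap ℝ F (d i)

theorem lie_realDiagonal_eq_zero (d : ι → ℝ) (X : Matrix ι ι F) :
    ⁅realDiagonal F d, X⁆ = 0 ↔ ∀ i j, d i ≠ d j → X i j = 0 := by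
  have h : ∀ i j, ⁅realDiagonal F d, X⁆ i j = (d i - d j) • X i j := by
    intro i j
    rw [lie_apply_of_isDiag (H := realDiagonal F d) (fun i j hij => diagonal_apply_ne _ hij),
      realDiagonal,
      diagonal_apply_eq, diagonal_apply_eq, ← Algebra.commutes, ← sub_mul, ← map_sub,
      Algebra.smul_def]
  constructor
  · intro h0 i j hij
    have := h i j
    rw [h0] at this
    exact (smul_eq_zero.1 this.symm).resolve_left (sub_ne_zero.2 hij)
  · intro h0
    ext i j
    rw [h]
    by_cases hij : d i = d j
    · rw [hij, sub_self, zero_smul]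
      rfl
    · rw [h0 i j hij, smul_zero]
      rfl

theorem conjTranspose_realDiagonal (d : ι → ℝ) : (realDiagonal F d)ᴴ = realDiagonal F d := by
  rw [realDiagonal, diagonal_conjTranspose]
  congr 1
  ext i
  change star (algebraMap ℝ F (d i)) = _
  rw [Algebra.algebraMap_eq_smul_one, star_real_smul, star_one]

/-- The minimal parabolic subalgebra of a Lie algebra of matrices, given by a real diagonal
matrix. -/
def ofDiagonal (L : LieSubalgebra ℝ (Matrix ι ι F)) [FiniteDimensional ℝ L]
    (hL : ∀ X ∈ L, Xᴴ ∈ L) (hcenter : ∀ X : L, (∀ Z : L, ⁅X, Z⁆ = 0) → X = 0) (d : ι → ℝ)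
    (hd : realDiagonal F d ∈ L)
    (hab : ∀ X ∈ L, ∀ Y ∈ L, Xᴴ = X → Yᴴ = Y → (∀ i j, d i ≠ d j → X i j = 0) →
      (∀ i j, d i ≠ d j → Y i j = 0) → ⁅X, Y⁆ = 0) : MinimalParabolic L :=
  ofRegular (isCartanInvolution_negConjTranspose hL hcenter) ⟨realDiagonal F d, hd⟩
    (Subtype.ext (by
      rw [coe_negConjTranspose, conjTranspose_realDiagonal]
      rfl))
    (fun X Y hX hY hX' hY' => Subtype.ext (hab X X.2 Y Y.2
      (by
        have := congrArg Subtype.val hX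
        rw [coe_negConjTranspose] at this
        exact neg_inj.1 this)
      (by
        have := congrArg Subtype.val hY
        rw [coe_negConjTranspose] at this
        exact neg_inj.1 this)
      ((lie_realDiagonal_eq_zero d _).1 (congrArg Subtype.val hX'))
      ((lie_realDiagonal_eq_zero d _).1 (congrArg Subtype.val hY'))))

section
variable {L : LieSubalgebra ℝ (Matrix ι ι F)} [FiniteDimensional ℝ L]
    (hL : ∀ X ∈ L, Xᴴ ∈ L) (hcenter : ∀ X : L, (∀ Z : L, ⁅X, Z⁆ = 0) → X = 0) (d : ι → ℝ)
    (hd : realDiagonal F d ∈ L) (hab)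

theorem mem_ofDiagonal_a (X : L) : X ∈ (ofDiagonal L hL hcenter d hd hab).a ↔
    (X : Matrix ι ι F)ᴴ = X ∧ ∀ i j, d i ≠ d j → (X : Matrix ι ι F) i j = 0 := by
  rw [← lie_realDiagonal_eq_zero]
  refine and_congr ?_ Subtype.ext_iff
  rw [Subtype.ext_iff, coe_negConjTranspose]
  exact neg_inj

theorem mem_ofDiagonal_m (X : L) : X ∈ (ofDiagonal L hL hcenter d hd hab).m ↔
    (X : Matrix ι ι F)ᴴ = -X ∧ ∀ i j, d i ≠ d j → (X : Matrix ι ι F) i j = 0 := by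
  rw [← lie_realDiagonal_eq_zero]
  refine (mem_ofRegular_m _ _ _ _ _).trans (and_congr ?_ Subtype.ext_iff)
  rw [Subtype.ext_iff, coe_negConjTranspose]
  exact neg_eq_iff_eq_neg

end

end Matrices

/-! ### Lie algebras of matrices that are skew for a sesquilinear form -/

section Pi

variable {ι R L : Type*} [CommRing R] [LieRing L] [LieAlgebra R L]

instance piLieRing : LieRing (ι → L) where
  bracket x y i := ⁅x i, y i⁆
  add_lie x y z := funext fun i => add_lie (x i) (y i) (z i)
  lie_add x y z := funext fun i => lie_add (x i) (y i) (z i)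
  lie_self x := funext fun i => lie_self (x i)
  leibniz_lie x y z := funext fun i => leibniz_lie (x i) (y i) (z i)

instance piLieAlgebra : LieAlgebra R (ι → L) where
  lie_smul c x y := funext fun i => lie_smul c (x i) (y i)

variable (ι R L) in
/-- For finitely many summands, the direct sum is the product. -/
noncomputable def piEquivDirectSum [Fintype ι] : (ι → L) ≃ₗ⁅R⁆ (⨁ _ : ι, L) :=
  { (DirectSum.linearEquivFunOnFintype R ι fun _ => L).symm with
    map_lie' := by
      intro x y
      apply (DirectSum.linearEquivFunOnFintype R ι fun _ => L).injective
      change (DirectSum.linearEquivFunOnFintype R ι fun _ => L)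
        ((DirectSum.linearEquivFunOnFintype R ι fun _ => L).symm ⁅x, y⁆) = _
      rw [LinearEquiv.apply_symm_apply]
      funext i
      change _ = (⁅(DirectSum.linearEquivFunOnFintype R ι fun _ => L).symm x,
        (DirectSum.linearEquivFunOnFintype R ι fun _ => L).symm y⁆ : ⨁ _ : ι, L) i
      rw [DirectSum.bracket_apply]
      rfl }

variable (ι) in
/-- The product of copies of an equivalence. -/
def piCongr {L' : Type*} [LieRing L'] [LieAlgebra R L'] (e : L ≃ₗ⁅R⁆ L') :
    (ι → L) ≃ₗ⁅R⁆ (ι → L') where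
  toFun x i := e (x i)
  map_add' x y := funext fun i => map_add e (x i) (y i)
  map_smul' c x := funext fun i => map_smul e c (x i)
  map_lie' {x y} := funext fun i => LieEquiv.map_lie e (x i) (y i)
  invFun x i := e.symm (x i)
  left_inv x := funext fun i => e.symm_apply_apply (x i)
  right_inv x := funext fun i => e.apply_symm_apply (x i)

/-- The product of two equivalences. -/
def prodCongr {L₁ L₁' L₂ L₂' : Type*} [LieRing L₁] [LieAlgebra R L₁] [LieRing L₁']
    [LieAlgebra R L₁'] [LieRing L₂] [LieAlgebra R L₂] [LieRing L₂'] [LieAlgebra R L₂']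
    (e₁ : L₁ ≃ₗ⁅R⁆ L₁') (e₂ : L₂ ≃ₗ⁅R⁆ L₂') : (L₁ × L₂) ≃ₗ⁅R⁆ (L₁' × L₂') where
  toFun x := (e₁ x.1, e₂ x.2)
  map_add' x y := Prod.ext (map_add e₁ x.1 y.1) (map_add e₂ x.2 y.2)
  map_smul' c x := Prod.ext (map_smul e₁ c x.1) (map_smul e₂ c x.2)
  map_lie' {x y} := Prod.ext (LieEquiv.map_lie e₁ x.1 y.1) (LieEquiv.map_lie e₂ x.2 y.2)
  invFun x := (e₁.symm x.1, e₂.symm x.2)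
  left_inv x := Prod.ext (e₁.symm_apply_apply x.1) (e₂.symm_apply_apply x.2)
  right_inv x := Prod.ext (e₁.apply_symm_apply x.1) (e₂.apply_symm_apply x.2)

end Pi

section Equivalences

/-- An equivalence of Lie subalgebras, given by a homomorphism of the ambient Lie algebras. -/
def subalgebraEquiv {R M M' : Type*} [CommRing R] [LieRing M] [LieAlgebra R M] [LieRing M']
    [LieAlgebra R M'] {L : LieSubalgebra R M} {L' : LieSubalgebra R M'} (φ : M →ₗ⁅R⁆ M')
    (ψ : M' → M) (hφ : ∀ X ∈ L, φ X ∈ L') (hψ : ∀ Y ∈ L', ψ Y ∈ L) (hl : ∀ X ∈ L, ψ (φ X) = X)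
    (hr : ∀ Y ∈ L', φ (ψ Y) = Y) : L ≃ₗ⁅R⁆ L' where
  toFun X := ⟨φ X, hφ X X.2⟩
  map_add' X Y := Subtype.ext (map_add φ (X : M) Y)
  map_smul' c X := Subtype.ext (map_smul φ c (X : M))
  map_lie' {X Y} := Subtype.ext (LieHom.map_lie φ (X : M) Y)
  invFun Y := ⟨ψ Y, hψ Y Y.2⟩
  left_inv X := Subtype.ext (hl X X.2)
  right_inv Y := Subtype.ext (hr Y Y.2)

variable {R F : Type*} [CommRing R] [Ring F] [Algebra R F] {κ ι : Type*} [Fintype κ]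
  [DecidableEq κ] [Fintype ι] [DecidableEq ι]

/-- The homomorphism `X ↦ S⁻¹ X S`. -/
def conjLieHom (R : Type*) [CommRing R] [Algebra R F] {S : Matrix κ ι F} {S' : Matrix ι κ F}
    (h : S * S' = 1) : Matrix κ κ F →ₗ⁅R⁆ Matrix ι ι F where
  toFun X := S' * X * S
  map_add' X Y := by rw [Matrix.mul_add, Matrix.add_mul]
  map_smul' c X := by rw [Matrix.mul_smul, Matrix.smul_mul, RingHom.id_apply]
  map_lie' {X Y} := by
    have h1 : ∀ X Y : Matrix κ κ F, S' * X * S * (S' * Y * S) = S' * (X * Y) * S := by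
      intro X Y
      rw [← Matrix.mul_assoc, ← Matrix.mul_assoc, Matrix.mul_assoc _ S S', h, Matrix.mul_one,
        Matrix.mul_assoc S' X Y]
    simp only [LieRing.of_associative_ring_bracket, h1, Matrix.mul_sub, Matrix.sub_mul]

/-- The equivalence `X ↦ S⁻¹ X S` of Lie algebras of matrices. -/
def conjEquiv {S : Matrix κ ι F} {S' : Matrix ι κ F} (h : S * S' = 1) (h' : S' * S = 1)
    (L : LieSubalgebra R (Matrix κ κ F)) (L' : LieSubalgebra R (Matrix ι ι F))
    (hL : ∀ X, S' * X * S ∈ L' ↔ X ∈ L) : L ≃ₗ⁅R⁆ L' :=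
  have h1 : ∀ X : Matrix κ κ F, S * (S' * X * S) * S' = X := fun X => by
    rw [Matrix.mul_assoc S', ← Matrix.mul_assoc S, h, Matrix.one_mul, Matrix.mul_assoc, h,
      Matrix.mul_one]
  have h2 : ∀ X : Matrix ι ι F, S' * (S * X * S') * S = X := fun X => by
    rw [Matrix.mul_assoc S, ← Matrix.mul_assoc S', h', Matrix.one_mul, Matrix.mul_assoc, h',
      Matrix.mul_one]
  subalgebraEquiv (conjLieHom R h) (fun Y => S * Y * S') (fun X hX => (hL X).2 hX)
    (fun Y hY => (hL _).1 (by rwa [h2])) (fun X _ => h1 X) (fun Y _ => h2 Y)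

end Equivalences

section Unitary

variable {F : Type*} [Ring F] [StarRing F] [Algebra ℝ F] [RealScalars F] {κ ι : Type*} [Fintype κ]
  [DecidableEq κ] [Fintype ι] [DecidableEq ι]

/-- The real Lie algebra of the matrices `X` over `F` with `Xᴴ K + K X = 0`. -/
def unitaryAlgebra (K : Matrix κ κ F) : LieSubalgebra ℝ (Matrix κ κ F) where
  carrier := {X | Xᴴ * K + K * X = 0}
  add_mem' := by
    intro X Y hX hY
    simp only [Set.mem_ofPred_eq] at hX hY ⊢
    rw [conjTranspose_add, add_mul, mul_add, add_add_add_comm, hX, hY, add_zero]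
  zero_mem' := by simp
  smul_mem' := by
    intro c X hX
    simp only [Set.mem_ofPred_eq] at hX ⊢
    rw [conjTranspose_real_smul, smul_mul_assoc, mul_smul_comm, ← smul_add, hX, smul_zero]
  lie_mem' := by
    intro X Y hX hY
    simp only [Set.mem_ofPred_eq] at hX hY ⊢
    have hX' : Xᴴ * K = -(K * X) := eq_neg_of_add_eq_zero_left hX
    have hY' : Yᴴ * K = -(K * Y) := eq_neg_of_add_eq_zero_left hY
    rw [LieRing.of_associative_ring_bracket, conjTranspose_sub, conjTranspose_mul,
      conjTranspose_mul, sub_mul, mul_assoc, mul_assoc, hX', hY', mul_neg, mul_neg,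
      ← mul_assoc, ← mul_assoc, hX', hY']
    noncomm_ring

theorem mem_unitaryAlgebra {K X : Matrix κ κ F} : X ∈ unitaryAlgebra K ↔ Xᴴ * K + K * X = 0 :=
  Iff.rfl

theorem mem_unitaryAlgebra_one {X : Matrix κ κ F} :
    X ∈ unitaryAlgebra (1 : Matrix κ κ F) ↔ Xᴴ = -X := by
  rw [mem_unitaryAlgebra, mul_one, one_mul, add_eq_zero_iff_eq_neg]

theorem conj_mem_unitaryAlgebra {S : Matrix κ ι F}
    {S' : Matrix ι κ F} (h : S * S' = 1) {K : Matrix κ κ F} {K' : Matrix ι ι F}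
    (hK : Sᴴ * K * S = K') (X : Matrix κ κ F) :
    S' * X * S ∈ unitaryAlgebra K' ↔ X ∈ unitaryAlgebra K := by
  have h1 : S'ᴴ * Sᴴ = 1 := by rw [← conjTranspose_mul, h, conjTranspose_one]
  have h2 : (S' * X * S)ᴴ * K' + K' * (S' * X * S) = Sᴴ * (Xᴴ * K + K * X) * S := by
    rw [← hK, conjTranspose_mul, conjTranspose_mul, Matrix.mul_add, Matrix.add_mul]
    congr 1
    · calc Sᴴ * (Xᴴ * S'ᴴ) * (Sᴴ * K * S) = Sᴴ * Xᴴ * (S'ᴴ * Sᴴ) * K * S := by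
            simp only [Matrix.mul_assoc]
        _ = _ := by rw [h1]; simp only [Matrix.mul_assoc, Matrix.one_mul]
    · calc Sᴴ * K * S * (S' * X * S) = Sᴴ * K * (S * S') * X * S := by
            simp only [Matrix.mul_assoc]
        _ = _ := by rw [h]; simp only [Matrix.mul_assoc, Matrix.one_mul]
  rw [mem_unitaryAlgebra, mem_unitaryAlgebra, h2]
  refine ⟨fun h3 => ?_, fun h3 => by rw [h3, Matrix.mul_zero, Matrix.zero_mul]⟩
  calc Xᴴ * K + K * X = S'ᴴ * Sᴴ * (Xᴴ * K + K * X) * (S * S') := by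
        rw [h1, h, Matrix.one_mul, Matrix.mul_one]
    _ = S'ᴴ * (Sᴴ * (Xᴴ * K + K * X) * S) * S' := by simp only [Matrix.mul_assoc]
    _ = 0 := by rw [h3, Matrix.mul_zero, Matrix.zero_mul]

theorem conjTranspose_mem_unitaryAlgebra {K : Matrix κ κ F} {ε : ℝ}
    (hε : ε * ε = 1) (hK : K * K = ε • (1 : Matrix κ κ F)) {X : Matrix κ κ F}
    (hX : X ∈ unitaryAlgebra K) : Xᴴ ∈ unitaryAlgebra K := by
  rw [mem_unitaryAlgebra] at hX ⊢
  have h1 : Xᴴ * K = -(K * X) := eq_neg_of_add_eq_zero_left hX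
  have h2 : ε • Xᴴ = -(K * X * K) := by
    calc ε • Xᴴ = Xᴴ * (K * K) := by rw [hK, mul_smul_comm, mul_one]
      _ = _ := by rw [← mul_assoc, h1, neg_mul]
  have h3 : Xᴴ = -(ε • (K * X * K)) := by
    rw [← smul_neg, ← h2, smul_smul, hε, one_smul]
  have h4 : K * Xᴴ = -(X * K) := by
    calc K * Xᴴ = -(ε • (K * K * X * K)) := by
          rw [h3, mul_neg, mul_smul_comm]
          simp only [mul_assoc]
      _ = -(X * K) := by rw [hK, smul_mul_assoc, smul_mul_assoc, one_mul, smul_smul, hε, one_smul]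
  rw [conjTranspose_conjTranspose, h4, add_neg_cancel]

end Unitary

section Witt

variable {F : Type*} [Ring F] [StarRing F] [Algebra ℝ F] [RealScalars F] {A : Type*} [Fintype A]
  [DecidableEq A] {r : ℕ}

/-- The orthogonal sum of a form `K` and `r` hyperbolic planes. -/
def wittForm (K : Matrix A A F) (ε : ℝ) (r : ℕ) :
    Matrix (A ⊕ (Fin r ⊕ Fin r)) (A ⊕ (Fin r ⊕ Fin r)) F :=
  fromBlocks K 0 0 (fromBlocks 0 1 (ε • 1) 0)

theorem wittForm_mul_self {K : Matrix A A F} {ε : ℝ} (hK : K * K = ε • (1 : Matrix A A F)) :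
    wittForm K ε r * wittForm K ε r = ε • 1 := by
  rw [wittForm, ← fromBlocks_one, ← fromBlocks_one, fromBlocks_smul, fromBlocks_smul]
  simp [fromBlocks_multiply, hK, -fromBlocks_one, -fromBlocks_diagonal]

/-- The matrices that act by `Y` on the first summand and diagonally on the hyperbolic planes. -/
def wittBlock (Y : Matrix A A F) (x y : Fin r → F) :
    Matrix (A ⊕ (Fin r ⊕ Fin r)) (A ⊕ (Fin r ⊕ Fin r)) F :=
  fromBlocks Y 0 0 (fromBlocks (diagonal x) 0 0 (diagonal y))

theorem wittBlock_mem {K : Matrix A A F} {ε : ℝ} (hε : ε * ε = 1) {Y : Matrix A A F}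
    {x y : Fin r → F} : wittBlock Y x y ∈ unitaryAlgebra (wittForm K ε r) ↔
      Y ∈ unitaryAlgebra K ∧ ∀ i, star (x i) + y i = 0 := by
  have h0 : ε ≠ 0 := left_ne_zero_of_mul_eq_one hε
  rw [mem_unitaryAlgebra, mem_unitaryAlgebra, wittBlock, wittForm, fromBlocks_conjTranspose,
    fromBlocks_conjTranspose, diagonal_conjTranspose, diagonal_conjTranspose]
  simp only [fromBlocks_multiply, fromBlocks_add, conjTranspose_zero, Matrix.mul_zero,
    Matrix.zero_mul, add_zero, zero_add, Matrix.mul_one, Matrix.one_mul, smul_mul_assoc,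
    mul_smul_comm]
  rw [← fromBlocks_zero, fromBlocks_inj, ← fromBlocks_zero, fromBlocks_inj, diagonal_add,
    ← smul_add, diagonal_add]
  refine and_congr_right fun _ => ⟨fun h i => ?_, fun h => ⟨rfl, rfl, by simp, ?_, ?_, by simp⟩⟩
  · have := congrFun (congrFun h.2.2.2.1 i) i
    rwa [diagonal_apply_eq] at this
  · rw [show (fun i => star x i + y i) = fun _ => 0 from funext h, diagonal_zero]
  · have : (fun i => star y i + x i) = fun _ => 0 := by
      funext i
      have := congrArg star (h i)
      rwa [star_add, star_star, star_zero, add_comm] at this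
    rw [this, diagonal_zero, smul_zero]

theorem conjTranspose_wittBlock (Y : Matrix A A F) (x y : Fin r → F) :
    (wittBlock Y x y)ᴴ = wittBlock Yᴴ (star x) (star y) := by
  rw [wittBlock, fromBlocks_conjTranspose, fromBlocks_conjTranspose, diagonal_conjTranspose,
    diagonal_conjTranspose]
  simp only [conjTranspose_zero]
  rfl

theorem neg_wittBlock (Y : Matrix A A F) (x y : Fin r → F) :
    -(wittBlock Y x y) = wittBlock (-Y) (-x) (-y) := by
  rw [wittBlock, fromBlocks_neg, fromBlocks_neg, diagonal_neg, diagonal_neg]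
  simp only [neg_zero]
  rfl

theorem wittBlock_mul (Y Y' : Matrix A A F) (x y x' y' : Fin r → F) :
    wittBlock Y x y * wittBlock Y' x' y' = wittBlock (Y * Y') (x * x') (y * y') := by
  simp only [wittBlock, fromBlocks_multiply, Matrix.mul_zero, Matrix.zero_mul, add_zero, zero_add,
    diagonal_mul_diagonal]
  rfl

theorem wittBlock_add (Y Y' : Matrix A A F) (x y x' y' : Fin r → F) :
    wittBlock Y x y + wittBlock Y' x' y' = wittBlock (Y + Y') (x + x') (y + y') := by
  simp only [wittBlock, fromBlocks_add, add_zero, diagonal_add]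
  rfl

theorem wittBlock_inj {Y Y' : Matrix A A F} {x y x' y' : Fin r → F} :
    wittBlock Y x y = wittBlock Y' x' y' ↔ Y = Y' ∧ x = x' ∧ y = y' := by
  simp only [wittBlock, fromBlocks_inj, diagonal_injective.eq_iff, true_and]

theorem trace_wittBlock (Y : Matrix A A F) (x y : Fin r → F) :
    (wittBlock Y x y).trace = Y.trace + (∑ i, x i + ∑ i, y i) := by
  simp [trace, wittBlock]

/-- The diagonal of the matrix that acts by `t` and `-t` on the hyperbolic planes. -/
def wittDiagonal (A : Type*) (t : Fin r → ℝ) : A ⊕ (Fin r ⊕ Fin r) → ℝ :=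
  Sum.elim 0 (Sum.elim t (-t))

theorem realDiagonal_wittDiagonal (t : Fin r → ℝ) : realDiagonal F (wittDiagonal A t) =
    wittBlock 0 (fun i => algebraMap ℝ F (t i)) (fun i => -algebraMap ℝ F (t i)) := by
  ext (i | i | i) (j | j | j) <;>
    simp [realDiagonal, wittDiagonal, wittBlock, diagonal_apply]

/-- A point of an open Weyl chamber. -/
def chamberPoint (r : ℕ) (i : Fin r) : ℝ := ((r - i : ℕ) : ℝ)

theorem chamberPoint_pos (i : Fin r) : 0 < chamberPoint r i := by
  have := i.2
  exact Nat.cast_pos.2 (by omega)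

theorem chamberPoint_injective : Function.Injective (chamberPoint r) := by
  intro i j hij
  have h1 := i.2
  have h2 := j.2
  have := Nat.cast_injective hij
  exact Fin.ext (by omega)

theorem eq_wittBlock {X : Matrix (A ⊕ (Fin r ⊕ Fin r)) (A ⊕ (Fin r ⊕ Fin r)) F}
    (hX : ∀ i j, wittDiagonal A (chamberPoint r) i ≠ wittDiagonal A (chamberPoint r) j →
      X i j = 0) :
    X = wittBlock X.toBlocks₁₁ (fun i => X (Sum.inr (Sum.inl i)) (Sum.inr (Sum.inl i)))
      (fun i => X (Sum.inr (Sum.inr i)) (Sum.inr (Sum.inr i))) := by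
  have hp := fun i : Fin r => chamberPoint_pos i
  ext (i | i | i) (j | j | j)
  · rfl
  · exact hX _ _ (hp j).ne
  · exact hX _ _ (neg_lt_zero.2 (hp j)).ne'
  · exact hX _ _ (hp i).ne'
  · by_cases hij : i = j
    · subst hij
      simp [wittBlock]
    · exact (hX (Sum.inr (Sum.inl i)) (Sum.inr (Sum.inl j))
        (fun h => hij (chamberPoint_injective h))).trans
        (diagonal_apply_ne (fun i => X (Sum.inr (Sum.inl i)) (Sum.inr (Sum.inl i))) hij).symm
  · exact hX _ _ ((neg_lt_zero.2 (hp j)).trans (hp i)).ne'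
  · exact hX _ _ (neg_lt_zero.2 (hp i)).ne
  · exact hX _ _ ((neg_lt_zero.2 (hp i)).trans (hp j)).ne
  · by_cases hij : i = j
    · subst hij
      simp [wittBlock]
    · exact (hX (Sum.inr (Sum.inr i)) (Sum.inr (Sum.inr j))
        (fun h => hij (chamberPoint_injective (neg_injective h)))).trans
        (diagonal_apply_ne (fun i => X (Sum.inr (Sum.inr i)) (Sum.inr (Sum.inr i))) hij).symm

theorem wittBlock_apply_eq_zero (Y : Matrix A A F) (x y : Fin r → F) (t : Fin r → ℝ)
    (i j : A ⊕ (Fin r ⊕ Fin r)) (hij : wittDiagonal A t i ≠ wittDiagonal A t j) :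
    wittBlock Y x y i j = 0 := by
  rcases i with i | i | i <;> rcases j with j | j | j <;> try rfl
  · exact absurd rfl hij
  · exact diagonal_apply_ne _ fun h => hij (by rw [h])
  · exact diagonal_apply_ne _ fun h => hij (by rw [h])

variable {K : Matrix A A F} {ε : ℝ}

/-- The selfadjoint matrices in `u(K₁)` that commute with the given element of the Weyl chamber, for
`K₁` the sum of hyperbolic planes and a form `K` for which `u(K)` consists of skew matrices. -/
theorem eq_realDiagonal (hε : ε * ε = 1) (hskew : ∀ Y ∈ unitaryAlgebra K, Yᴴ = -Y)
    {X : Matrix (A ⊕ (Fin r ⊕ Fin r)) (A ⊕ (Fin r ⊕ Fin r)) F}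
    (hX : X ∈ unitaryAlgebra (wittForm K ε r)) (hXs : Xᴴ = X)
    (hX0 : ∀ i j, wittDiagonal A (chamberPoint r) i ≠ wittDiagonal A (chamberPoint r) j →
      X i j = 0) :
    X = realDiagonal F (wittDiagonal A fun i =>
      RealScalars.re (X (Sum.inr (Sum.inl i)) (Sum.inr (Sum.inl i)))) := by
  have h1 := eq_wittBlock hX0
  set Y := X.toBlocks₁₁
  set x := fun i => X (Sum.inr (Sum.inl i)) (Sum.inr (Sum.inl i))
  set y := fun i => X (Sum.inr (Sum.inr i)) (Sum.inr (Sum.inr i))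
  rw [h1, wittBlock_mem hε] at hX
  rw [h1, conjTranspose_wittBlock, wittBlock_inj] at hXs
  have h2 : ∀ i, algebraMap ℝ F (RealScalars.re (x i)) = x i := fun i =>
    RealScalars.algebraMap_re _ (congrFun hXs.2.1 i)
  have h3 : Y = 0 := by
    have h := hskew Y hX.1
    rw [hXs.1] at h
    have h' : (2 : ℝ) • Y = 0 := by
      rw [two_smul]
      nth_rewrite 1 [h]
      exact neg_add_cancel _
    exact (smul_eq_zero.1 h').resolve_left two_ne_zero
  refine h1.trans ((wittBlock_inj.2 ⟨h3, funext fun i => (h2 i).symm, funext fun i => ?_⟩).trans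
    (realDiagonal_wittDiagonal _).symm)
  have h4 := hX.2 i
  rw [show star (x i) = x i from congrFun hXs.2.1 i] at h4
  change y i = -algebraMap ℝ F (RealScalars.re (x i))
  rw [h2 i]
  exact eq_neg_of_add_eq_zero_right h4

theorem realDiagonal_wittDiagonal_mem (t : Fin r → ℝ) (hε : ε * ε = 1) :
    realDiagonal F (wittDiagonal A t) ∈ unitaryAlgebra (wittForm K ε r) := by
  rw [realDiagonal_wittDiagonal, wittBlock_mem hε]
  refine ⟨(unitaryAlgebra K).zero_mem, fun i => ?_⟩
  rw [Algebra.algebraMap_eq_smul_one, RealScalars.star_real_smul, star_one, add_neg_cancel]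

end Witt

section WittParabolic

variable {F : Type*} [Ring F] [StarRing F] [Algebra ℝ F] [RealScalars F] {A : Type*} [Fintype A]
  [DecidableEq A] {r : ℕ} {K : Matrix A A F} {ε : ℝ}
  {L : LieSubalgebra ℝ (Matrix (A ⊕ (Fin r ⊕ Fin r)) (A ⊕ (Fin r ⊕ Fin r)) F)}

theorem lie_realDiagonal_realDiagonal {ι : Type*} [Fintype ι] [DecidableEq ι] (d d' : ι → ℝ) :
    ⁅realDiagonal F d, realDiagonal F d'⁆ = 0 := by
  refine (lie_realDiagonal_eq_zero d _).2 fun i j hij => diagonal_apply_ne _ fun h => hij ?_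
  rw [h]

variable (L K ε) in
/-- The conditions on a Lie subalgebra `L` of `u(K₁)`, for the sum `K₁` of a form `K` and `r`
hyperbolic planes, under which the diagonal matrices in `L` give a minimal parabolic subalgebra. -/
structure IsWittSubalgebra : Prop where
  mul_self : ε * ε = 1
  skew : ∀ Y ∈ unitaryAlgebra K, Yᴴ = -Y
  le : L ≤ unitaryAlgebra (wittForm K ε r)
  conjTranspose_mem : ∀ X ∈ L, Xᴴ ∈ L
  diagonal_mem : ∀ t : Fin r → ℝ, realDiagonal F (wittDiagonal A t) ∈ L

namespace IsWittSubalgebra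

variable [FiniteDimensional ℝ L] (hL : IsWittSubalgebra K ε L)
  (hcenter : ∀ X : L, (∀ Z : L, ⁅X, Z⁆ = 0) → X = 0)

/-- The minimal parabolic subalgebra given by the diagonal matrices in `L`. -/
def parabolic : MinimalParabolic L :=
  ofDiagonal L hL.conjTranspose_mem hcenter (wittDiagonal A (chamberPoint r)) (hL.diagonal_mem _)
    (fun X hX Y hY hXs hYs hX0 hY0 => by
      rw [eq_realDiagonal hL.mul_self hL.skew (hL.le hX) hXs hX0,
        eq_realDiagonal hL.mul_self hL.skew (hL.le hY) hYs hY0, lie_realDiagonal_realDiagonal])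

theorem coe_parabolic_H₀ : (hL.parabolic hcenter).H₀ =
    (⟨realDiagonal F (wittDiagonal A (chamberPoint r)), hL.diagonal_mem _⟩ : L) := rfl

/-- The subspace `a₀` consists of the real diagonal matrices. -/
def aEquiv : (hL.parabolic hcenter).a ≃ₗ[ℝ] (Fin r → ℝ) where
  toFun X i := RealScalars.re (((X : L) : Matrix (A ⊕ (Fin r ⊕ Fin r)) (A ⊕ (Fin r ⊕ Fin r)) F)
    (Sum.inr (Sum.inl i)) (Sum.inr (Sum.inl i)))
  map_add' X Y := funext fun i => map_add RealScalars.re _ _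
  map_smul' c X := funext fun i => map_smul RealScalars.re c _
  invFun t := ⟨⟨_, hL.diagonal_mem t⟩, (mem_ofDiagonal_a ..).2 ⟨conjTranspose_realDiagonal _,
    fun i j hij => (congrFun₂ (realDiagonal_wittDiagonal t) i j).trans
      (wittBlock_apply_eq_zero _ _ _ _ i j hij)⟩⟩
  left_inv X := by
    obtain ⟨h1, h2⟩ := (mem_ofDiagonal_a ..).1 X.2
    exact Subtype.ext (Subtype.ext
      (eq_realDiagonal hL.mul_self hL.skew (hL.le (X : L).2) h1 h2).symm)
  right_inv t := by
    funext i
    change RealScalars.re (realDiagonal F (wittDiagonal A t) (Sum.inr (Sum.inl i))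
      (Sum.inr (Sum.inl i))) = t i
    rw [realDiagonal, diagonal_apply_eq, RealScalars.re_algebraMap]
    rfl

theorem finrank_a : Module.finrank ℝ (hL.parabolic hcenter).a = r := by
  rw [(hL.aEquiv hcenter).finrank_eq, Module.finrank_fin_fun]

theorem mem_parabolic_m (X : L) : X ∈ (hL.parabolic hcenter).m ↔ ∃ (Y : Matrix A A F)
    (x : Fin r → F), Y ∈ unitaryAlgebra K ∧ (∀ i, star (x i) = -x i) ∧
      (X : Matrix _ _ F) = wittBlock Y x x := by
  refine (mem_ofDiagonal_m ..).trans ⟨fun ⟨h1, h2⟩ => ?_, fun ⟨Y, x, hY, hx, hX⟩ => ?_⟩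
  · have h3 := eq_wittBlock h2
    have h4 := hL.le X.2
    rw [h3, wittBlock_mem hL.mul_self] at h4
    rw [h3, conjTranspose_wittBlock, neg_wittBlock, wittBlock_inj] at h1
    refine ⟨_, _, h4.1, fun i => congrFun h1.2.1 i, h3.trans (wittBlock_inj.2 ⟨rfl, rfl, ?_⟩)⟩
    funext i
    have h5 := h4.2 i
    have h6 := congrFun h1.2.1 i
    simp only [Pi.star_apply, Pi.neg_apply] at h6
    rw [h6] at h5
    exact (neg_add_eq_zero.1 h5).symm
  · rw [hX]
    refine ⟨?_, fun i j hij => wittBlock_apply_eq_zero _ _ _ _ i j hij⟩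
    rw [conjTranspose_wittBlock, neg_wittBlock, hL.skew Y hY, show star x = -x from funext hx]

/-- The homomorphism from `m₀` to `u(K) × u(1)ʳ`. -/
def mHom : (hL.parabolic hcenter).m →ₗ⁅ℝ⁆
    (unitaryAlgebra K × (Fin r → unitaryAlgebra (1 : Matrix (Fin 1) (Fin 1) F))) where
  toFun X := (⟨((X : L) : Matrix (A ⊕ (Fin r ⊕ Fin r)) (A ⊕ (Fin r ⊕ Fin r)) F).toBlocks₁₁, by
      obtain ⟨Y, x, hY, hx, hX⟩ := (hL.mem_parabolic_m hcenter _).1 X.2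
      rw [hX]
      exact hY⟩, fun i => ⟨of fun _ _ =>
        ((X : L) : Matrix (A ⊕ (Fin r ⊕ Fin r)) (A ⊕ (Fin r ⊕ Fin r)) F)
          (Sum.inr (Sum.inl i)) (Sum.inr (Sum.inl i)), by
      obtain ⟨Y, x, hY, hx, hX⟩ := (hL.mem_parabolic_m hcenter _).1 X.2
      rw [mem_unitaryAlgebra_one, hX]
      ext
      simpa [wittBlock] using hx i⟩)
  map_add' X Y := rfl
  map_smul' c X := rfl
  map_lie' {X Y} := by
    obtain ⟨Y₁, x₁, -, -, hX⟩ := (hL.mem_parabolic_m hcenter _).1 X.2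
    obtain ⟨Y₂, x₂, -, -, hY⟩ := (hL.mem_parabolic_m hcenter _).1 Y.2
    have h : (((⁅X, Y⁆ : (hL.parabolic hcenter).m) : L) :
        Matrix (A ⊕ (Fin r ⊕ Fin r)) (A ⊕ (Fin r ⊕ Fin r)) F) =
        wittBlock (Y₁ * Y₂ - Y₂ * Y₁) (x₁ * x₂ - x₂ * x₁) (x₁ * x₂ - x₂ * x₁) := by
      change ((X : L) : Matrix (A ⊕ (Fin r ⊕ Fin r)) (A ⊕ (Fin r ⊕ Fin r)) F) * (Y : L) -
        ((Y : L) : Matrix (A ⊕ (Fin r ⊕ Fin r)) (A ⊕ (Fin r ⊕ Fin r)) F) * (X : L) = _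
      rw [hX, hY, wittBlock_mul, wittBlock_mul, sub_eq_add_neg, neg_wittBlock, wittBlock_add,
        ← sub_eq_add_neg, ← sub_eq_add_neg]
    refine Prod.ext (Subtype.ext ?_) (funext fun i => Subtype.ext ?_)
    · change toBlocks₁₁ (((⁅X, Y⁆ : (hL.parabolic hcenter).m) : L) :
        Matrix (A ⊕ (Fin r ⊕ Fin r)) (A ⊕ (Fin r ⊕ Fin r)) F) =
        ((X : L) : Matrix (A ⊕ (Fin r ⊕ Fin r)) (A ⊕ (Fin r ⊕ Fin r)) F).toBlocks₁₁ *
        ((Y : L) : Matrix (A ⊕ (Fin r ⊕ Fin r)) (A ⊕ (Fin r ⊕ Fin r)) F).toBlocks₁₁ -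
        ((Y : L) : Matrix (A ⊕ (Fin r ⊕ Fin r)) (A ⊕ (Fin r ⊕ Fin r)) F).toBlocks₁₁ *
        ((X : L) : Matrix (A ⊕ (Fin r ⊕ Fin r)) (A ⊕ (Fin r ⊕ Fin r)) F).toBlocks₁₁
      rw [h, hX, hY]
      rfl
    · change (of fun _ _ => (((⁅X, Y⁆ : (hL.parabolic hcenter).m) : L) :
          Matrix (A ⊕ (Fin r ⊕ Fin r)) (A ⊕ (Fin r ⊕ Fin r)) F)
          (Sum.inr (Sum.inl i)) (Sum.inr (Sum.inl i)) : Matrix (Fin 1) (Fin 1) F) =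
        (of fun _ _ => _ : Matrix (Fin 1) (Fin 1) F) * (of fun _ _ => _) -
          (of fun _ _ => _) * (of fun _ _ => _)
      rw [h, hX, hY]
      ext
      simp [wittBlock, mul_apply]

theorem mHom_injective : Function.Injective (hL.mHom hcenter) := by
  intro X Y h
  obtain ⟨Y₁, x₁, -, -, hX⟩ := (hL.mem_parabolic_m hcenter _).1 X.2
  obtain ⟨Y₂, x₂, -, -, hY⟩ := (hL.mem_parabolic_m hcenter _).1 Y.2
  have h1 := congrArg Subtype.val (congrArg Prod.fst h)
  have h2 := fun i => congrFun₂ (congrArg Subtype.val (congrFun (congrArg Prod.snd h) i)) 0 0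
  change toBlocks₁₁ ((X : L) : Matrix (A ⊕ (Fin r ⊕ Fin r)) (A ⊕ (Fin r ⊕ Fin r)) F) =
    toBlocks₁₁ ((Y : L) : Matrix (A ⊕ (Fin r ⊕ Fin r)) (A ⊕ (Fin r ⊕ Fin r)) F) at h1
  change ∀ i, ((X : L) : Matrix (A ⊕ (Fin r ⊕ Fin r)) (A ⊕ (Fin r ⊕ Fin r)) F) _ _ =
    ((Y : L) : Matrix (A ⊕ (Fin r ⊕ Fin r)) (A ⊕ (Fin r ⊕ Fin r)) F) _ _ at h2
  rw [hX, hY] at h1 h2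
  have h3 : x₁ = x₂ := funext fun i => by simpa [wittBlock] using h2 i
  refine Subtype.ext (Subtype.ext ?_)
  rw [hX, hY, show Y₁ = Y₂ from h1, h3]

theorem exists_mHom_eq (Y : unitaryAlgebra K)
    (x : Fin r → unitaryAlgebra (1 : Matrix (Fin 1) (Fin 1) F))
    (h : wittBlock (Y : Matrix A A F) (fun i => (x i : Matrix (Fin 1) (Fin 1) F) 0 0)
      (fun i => (x i : Matrix (Fin 1) (Fin 1) F) 0 0) ∈ L) :
    ∃ X, hL.mHom hcenter X = (Y, x) := by
  have hm : (⟨_, h⟩ : L) ∈ (hL.parabolic hcenter).m :=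
    (hL.mem_parabolic_m hcenter _).2 ⟨_, _, Y.2, fun i =>
      congrFun₂ (mem_unitaryAlgebra_one.1 (x i).2) 0 0, rfl⟩
  refine ⟨⟨_, hm⟩, Prod.ext rfl (funext fun i => Subtype.ext ?_)⟩
  ext a b
  rw [Subsingleton.elim a 0, Subsingleton.elim b 0]
  change wittBlock (Y : Matrix A A F) (fun i => (x i : Matrix (Fin 1) (Fin 1) F) 0 0)
    (fun i => (x i : Matrix (Fin 1) (Fin 1) F) 0 0) (Sum.inr (Sum.inl i)) (Sum.inr (Sum.inl i)) = _
  simp [wittBlock]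

theorem wittBlock_mem_mHom (X : (hL.parabolic hcenter).m) :
    wittBlock ((hL.mHom hcenter X).1 : Matrix A A F)
      (fun i => ((hL.mHom hcenter X).2 i : Matrix (Fin 1) (Fin 1) F) 0 0)
      (fun i => ((hL.mHom hcenter X).2 i : Matrix (Fin 1) (Fin 1) F) 0 0) ∈ L := by
  obtain ⟨Y₁, x₁, -, -, hX⟩ := (hL.mem_parabolic_m hcenter _).1 X.2
  have h := (X : L).2
  change wittBlock (toBlocks₁₁ ((X : L) : Matrix (A ⊕ (Fin r ⊕ Fin r)) (A ⊕ (Fin r ⊕ Fin r)) F))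
    (fun i => ((X : L) : Matrix (A ⊕ (Fin r ⊕ Fin r)) (A ⊕ (Fin r ⊕ Fin r)) F) _ _)
    (fun i => ((X : L) : Matrix (A ⊕ (Fin r ⊕ Fin r)) (A ⊕ (Fin r ⊕ Fin r)) F) _ _) ∈ L
  rw [hX] at h ⊢
  have h1 : ∀ i, wittBlock Y₁ x₁ x₁ (Sum.inr (Sum.inl i)) (Sum.inr (Sum.inl i)) = x₁ i := by
    simp [wittBlock]
  simp only [h1]
  exact h

end IsWittSubalgebra

theorem isWittSubalgebra_unitaryAlgebra (hε : ε * ε = 1) (hK : K * K = ε • (1 : Matrix A A F))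
    (hskew : ∀ Y ∈ unitaryAlgebra K, Yᴴ = -Y) (r : ℕ) :
    IsWittSubalgebra K ε (unitaryAlgebra (wittForm K ε r)) where
  mul_self := hε
  skew := hskew
  le := le_rfl
  conjTranspose_mem _ hX := conjTranspose_mem_unitaryAlgebra hε (wittForm_mul_self hK) hX
  diagonal_mem t := realDiagonal_wittDiagonal_mem t hε

/-- `m₀ ≅ u(K) × u(1)ʳ` when `L` is the full Lie algebra of the form. -/
noncomputable def IsWittSubalgebra.mEquiv [FiniteDimensional ℝ (unitaryAlgebra (wittForm K ε r))]
    (hL : IsWittSubalgebra K ε (unitaryAlgebra (wittForm K ε r)))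
    (hcenter : ∀ X : unitaryAlgebra (wittForm K ε r),
      (∀ Z : unitaryAlgebra (wittForm K ε r), ⁅X, Z⁆ = 0) → X = 0) :
    (hL.parabolic hcenter).m ≃ₗ⁅ℝ⁆
      (unitaryAlgebra K × (Fin r → unitaryAlgebra (1 : Matrix (Fin 1) (Fin 1) F))) :=
  LieEquiv.ofBijective (hL.mHom (F := F) hcenter) ⟨hL.mHom_injective hcenter, fun p =>
    hL.exists_mHom_eq hcenter p.1 p.2 ((wittBlock_mem (F := F) hL.mul_self).2 ⟨p.1.2, fun i => by
      have h := congrFun₂ ((mem_unitaryAlgebra_one (F := F)).1 (p.2 i).2) 0 0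
      change star ((p.2 i : Matrix (Fin 1) (Fin 1) F) 0 0) = -_ at h
      rw [h, neg_add_cancel]⟩)⟩

end WittParabolic

/-! ### Dimensions -/

section Dimension

variable {F : Type*} [Ring F] [StarRing F] [Algebra ℝ F] [RealScalars F] {ι : Type*} [Fintype ι]
  [DecidableEq ι]

variable (F) in
/-- The scalars `z` with `z̄ = -ε z`. -/
def skewScalars (ε : ℝ) : Submodule ℝ F where
  carrier := {z | star z = -(ε • z)}
  add_mem' := by
    intro x y hx hy
    simp only [Set.mem_ofPred_eq] at hx hy ⊢
    rw [star_add, hx, hy, smul_add, neg_add]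
  zero_mem' := by simp
  smul_mem' := by
    intro c x hx
    simp only [Set.mem_ofPred_eq] at hx ⊢
    rw [RealScalars.star_real_smul, hx, smul_neg, smul_comm]

variable (F ι) in
/-- The matrices `Z` with `Zᴴ = -ε Z`. -/
def skewMatrices (ε : ℝ) : Submodule ℝ (Matrix ι ι F) where
  carrier := {Z | Zᴴ = -(ε • Z)}
  add_mem' := by
    intro x y hx hy
    simp only [Set.mem_ofPred_eq] at hx hy ⊢
    rw [conjTranspose_add, hx, hy, smul_add, neg_add]
  zero_mem' := by simp
  smul_mem' := by
    intro c x hx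
    simp only [Set.mem_ofPred_eq] at hx ⊢
    rw [conjTranspose_real_smul, hx, smul_neg, smul_comm]

/-- A matrix with `Zᴴ = -ε Z` is determined by its entries on and above the diagonal. -/
noncomputable def skewMatricesEquiv {ε : ℝ} (hε : ε * ε = 1) {N : ℕ} (e : ι ≃ Fin N) :
    skewMatrices F ι ε ≃ₗ[ℝ] (Fin N → skewScalars F ε) × ((j : Fin N) → Fin j → F) where
  toFun Z := (fun i => ⟨(Z : Matrix ι ι F) (e.symm i) (e.symm i),
      congrFun₂ (Z.2 : (Z : Matrix ι ι F)ᴴ = _) (e.symm i) (e.symm i)⟩,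
    fun j i => (Z : Matrix ι ι F) (e.symm ⟨i, i.2.trans j.2⟩) (e.symm j))
  map_add' _ _ := rfl
  map_smul' _ _ := rfl
  invFun p := ⟨of fun i j => if h : e i < e j then p.2 (e j) ⟨e i, h⟩ else
      if h : e j < e i then -(ε • star (p.2 (e i) ⟨e j, h⟩)) else p.1 (e i), by
    change _ᴴ = _
    ext i j
    rw [conjTranspose_apply, Matrix.neg_apply, Matrix.smul_apply, of_apply, of_apply]
    rcases lt_trichotomy (e i) (e j) with h | h | h
    · rw [dif_neg h.not_gt, dif_pos h, dif_pos h, star_neg, RealScalars.star_real_smul, star_star]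
    · obtain rfl := e.injective h
      rw [dif_neg (lt_irrefl _), dif_neg (lt_irrefl _)]
      exact (p.1 (e i)).2
    · rw [dif_pos h, dif_neg h.not_gt, dif_pos h, smul_neg, smul_smul, hε, one_smul, neg_neg]⟩
  left_inv Z := by
    refine Subtype.ext (Matrix.ext fun i j => ?_)
    simp only [of_apply, Fin.eta, Equiv.symm_apply_apply]
    rcases lt_trichotomy (e i) (e j) with h | h | h
    · rw [dif_pos h]
    · obtain rfl := e.injective h
      rw [dif_neg (lt_irrefl _), dif_neg (lt_irrefl _)]
    · rw [dif_neg h.not_gt, dif_pos h]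
      have h1 := congrFun₂ (Z.2 : (Z : Matrix ι ι F)ᴴ = _) i j
      rw [conjTranspose_apply, Matrix.neg_apply, Matrix.smul_apply] at h1
      rw [h1, smul_neg, smul_smul, hε, one_smul, neg_neg]
  right_inv p := by
    refine Prod.ext (funext fun i => Subtype.ext ?_) (funext fun j => funext fun i => ?_)
    · simp
    · have h : (⟨i, i.2.trans j.2⟩ : Fin N) < j := i.2
      have h2 : ∀ (j' : Fin N) (hj : j' = j) (hi : (i : ℕ) < j'), p.2 j' ⟨i, hi⟩ = p.2 j i := by
        rintro _ rfl _
        rfl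
      simp only [of_apply, Equiv.apply_symm_apply, h, dite_true]
      exact h2 _ (e.apply_symm_apply j) _

theorem finrank_unitaryAlgebra [FiniteDimensional ℝ F] {K : Matrix ι ι F} {ε : ℝ}
    (hε : ε * ε = 1) (hK : K * K = ε • (1 : Matrix ι ι F)) (hK' : Kᴴ = ε • K) :
    Module.finrank ℝ (unitaryAlgebra K) = Fintype.card ι * Module.finrank ℝ (skewScalars F ε) +
      Fintype.card ι * (Fintype.card ι - 1) / 2 * Module.finrank ℝ F := by
  have h1 : ∀ X : Matrix ι ι F, ε • (K * (K * X)) = X := fun X => by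
    rw [← mul_assoc, hK, smul_mul_assoc, one_mul, smul_smul, hε, one_smul]
  have h2 : ∀ X : Matrix ι ι F, K * X ∈ skewMatrices F ι ε ↔ X ∈ unitaryAlgebra K := fun X => by
    change (K * X)ᴴ = _ ↔ _
    rw [conjTranspose_mul, hK', mul_smul_comm, mem_unitaryAlgebra, ← smul_neg,
      (smul_right_injective _ (left_ne_zero_of_mul_eq_one hε)).eq_iff, add_eq_zero_iff_eq_neg]
  let f : unitaryAlgebra K ≃ₗ[ℝ] skewMatrices F ι ε :=
    { toFun := fun X => ⟨K * X, (h2 X).2 X.2⟩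
      map_add' := fun X Y => Subtype.ext (mul_add K (X : Matrix ι ι F) Y)
      map_smul' := fun c X => Subtype.ext (mul_smul_comm c K (X : Matrix ι ι F))
      invFun := fun Z => ⟨ε • (K * Z), (h2 _).1 (by
        rw [mul_smul_comm, h1]
        exact Z.2)⟩
      left_inv := fun X => Subtype.ext (h1 X)
      right_inv := fun Z => Subtype.ext ((mul_smul_comm _ _ _).trans (h1 Z)) }
  rw [(f.trans (skewMatricesEquiv hε (Fintype.equivFin ι))).finrank_eq, Module.finrank_prod,
    Module.finrank_pi_fintype, Module.finrank_pi_fintype]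
  simp only [Module.finrank_pi_fintype, Finset.sum_const, Finset.card_univ, Fintype.card_fin,
    smul_eq_mul]
  rw [← Finset.sum_mul, Fin.sum_univ_eq_sum_range (fun i => i), Finset.sum_range_id]

open Quaternion

theorem finrank_skewScalars_real : Module.finrank ℝ (skewScalars ℝ 1) = 0 := by
  have : skewScalars ℝ 1 = ⊥ := by
    rw [eq_bot_iff]
    intro x hx
    have hx : x = -((1 : ℝ) • x) := hx
    rw [one_smul] at hx
    rw [Submodule.mem_bot]
    linarith
  rw [this, finrank_bot]

theorem finrank_skewScalars_complex : Module.finrank ℝ (skewScalars ℂ 1) = 1 := by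
  let f : skewScalars ℂ 1 ≃ₗ[ℝ] ℝ :=
    { toFun := fun z => (z : ℂ).im
      map_add' := fun _ _ => rfl
      map_smul' := fun c z => by simp
      invFun := fun t => ⟨⟨0, t⟩, by
        change star _ = _
        apply Complex.ext <;> simp⟩
      left_inv := fun z => Subtype.ext (Complex.ext (by
        have h := congrArg Complex.re (z.2 : star (z : ℂ) = _)
        simp at h
        change 0 = _
        linarith) rfl)
      right_inv := fun t => rfl }
  rw [f.finrank_eq, Module.finrank_self]

theorem finrank_skewScalars_quaternion : Module.finrank ℝ (skewScalars ℍ[ℝ] 1) = 3 := by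
  let f : skewScalars ℍ[ℝ] 1 ≃ₗ[ℝ] (Fin 3 → ℝ) :=
    { toFun := fun z => ![(z : ℍ[ℝ]).imI, (z : ℍ[ℝ]).imJ, (z : ℍ[ℝ]).imK]
      map_add' := fun x y => by
        ext i
        fin_cases i <;> simp
      map_smul' := fun c z => by
        ext i
        fin_cases i <;> simp
      invFun := fun t => ⟨⟨0, t 0, t 1, t 2⟩, by
        change star (⟨0, t 0, t 1, t 2⟩ : ℍ[ℝ]) = -((1 : ℝ) • (⟨0, t 0, t 1, t 2⟩ : ℍ[ℝ]))
        rw [one_smul]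
        ext
        · exact (Quaternion.re_star _).trans neg_zero.symm
        · exact Quaternion.imI_star _
        · exact Quaternion.imJ_star _
        · exact Quaternion.imK_star _⟩
      left_inv := fun z => Subtype.ext (by
        have h := congrArg QuaternionAlgebra.re (z.2 : star (z : ℍ[ℝ]) = _)
        simp at h
        ext
        · change 0 = _
          linarith
        · rfl
        · rfl
        · rfl)
      right_inv := fun t => by
        ext i
        fin_cases i <;> rfl }
  rw [f.finrank_eq, Module.finrank_fin_fun]

theorem finrank_skewScalars_quaternion_neg : Module.finrank ℝ (skewScalars ℍ[ℝ] (-1)) = 1 := by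
  let f : skewScalars ℍ[ℝ] (-1) ≃ₗ[ℝ] ℝ :=
    { toFun := fun z => (z : ℍ[ℝ]).re
      map_add' := fun _ _ => rfl
      map_smul' := fun c z => by simp
      invFun := fun t => ⟨(t : ℍ[ℝ]), by
        change star _ = _
        simp⟩
      left_inv := fun z => Subtype.ext (by
        have h : star (z : ℍ[ℝ]) = z := (z.2 : star (z : ℍ[ℝ]) = _).trans (by simp)
        exact (Quaternion.star_eq_self.1 h).symm)
      right_inv := fun t => by simp }
  rw [f.finrank_eq, Module.finrank_self]

end Dimension

section Linear

variable (F : Type*) [Ring F] [StarRing F] [Algebra ℝ F] [RealScalars F] (n : ℕ)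

/-- The matrices over `F` with real part of the trace zero. -/
def specialLinear : LieSubalgebra ℝ (Matrix (Fin n) (Fin n) F) where
  carrier := {X | reTrace X = 0}
  add_mem' := by
    intro X Y hX hY
    simp only [Set.mem_ofPred_eq] at hX hY ⊢
    rw [map_add, hX, hY, add_zero]
  zero_mem' := map_zero reTrace
  smul_mem' := by
    intro c X hX
    simp only [Set.mem_ofPred_eq] at hX ⊢
    rw [map_smul, hX, smul_zero]
  lie_mem' := by
    intro X Y _ _
    simp only [Set.mem_ofPred_eq]
    rw [LieRing.of_associative_ring_bracket, map_sub, reTrace_mul_comm, sub_self]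

variable {F n}

theorem mem_specialLinear {X : Matrix (Fin n) (Fin n) F} :
    X ∈ specialLinear F n ↔ reTrace X = 0 := Iff.rfl

theorem reTrace_diagonal (x : Fin n → F) : reTrace (diagonal x) = ∑ i, RealScalars.re (x i) := by
  rw [reTrace, LinearMap.comp_apply, traceLinearMap_apply, trace_diagonal, map_sum]

theorem realDiagonal_mem_specialLinear {t : Fin n → ℝ} :
    realDiagonal F t ∈ specialLinear F n ↔ ∑ i, t i = 0 := by
  rw [mem_specialLinear, realDiagonal, reTrace_diagonal]
  simp only [RealScalars.re_algebraMap]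

theorem re_eq_zero_of_star_eq_neg {x : F} (hx : star x = -x) : RealScalars.re x = 0 := by
  have h := RealScalars.re_star x
  rw [hx, map_neg] at h
  linarith

/-- A point of an open Weyl chamber of the diagonal matrices of trace zero. -/
noncomputable def linearChamberPoint (n : ℕ) (i : Fin n) : ℝ := ((n : ℝ) - 1) / 2 - (i : ℕ)

theorem sum_linearChamberPoint : ∑ i, linearChamberPoint n i = 0 := by
  simp only [linearChamberPoint, Finset.sum_sub_distrib, Finset.sum_const, Finset.card_univ,
    Fintype.card_fin, nsmul_eq_mul]
  rw [Fin.sum_univ_eq_sum_range (fun i => (i : ℝ)), ← Nat.cast_sum, Finset.sum_range_id]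
  have h := Finset.sum_range_id_mul_two n
  rw [Finset.sum_range_id] at h
  have h' : (((n * (n - 1) / 2 : ℕ) : ℝ)) * 2 = n * ((n : ℝ) - 1) := by
    rcases n with _ | n
    · simp
    · have h'' : (((n + 1) * (n + 1 - 1) / 2 * 2 : ℕ) : ℝ) = ((n + 1) * (n + 1 - 1) : ℕ) := by
        rw [h]
      push_cast [Nat.add_sub_cancel] at h'' ⊢
      linarith
  linarith

theorem linearChamberPoint_injective : Function.Injective (linearChamberPoint n) := by
  intro i j h
  simp only [linearChamberPoint, sub_right_inj, Nat.cast_inj] at h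
  exact Fin.ext h

theorem eq_diagonal_of_commutes {X : Matrix (Fin n) (Fin n) F}
    (hX : ∀ i j, linearChamberPoint n i ≠ linearChamberPoint n j → X i j = 0) :
    X = diagonal fun i => X i i := by
  ext i j
  by_cases hij : i = j
  · rw [hij, diagonal_apply_eq]
  · rw [diagonal_apply_ne _ hij, hX i j fun h => hij (linearChamberPoint_injective h)]

theorem diagonal_eq_realDiagonal {X : Matrix (Fin n) (Fin n) F} (hXs : Xᴴ = X)
    (hX : ∀ i j, linearChamberPoint n i ≠ linearChamberPoint n j → X i j = 0) :
    X = realDiagonal F fun i => RealScalars.re (X i i) := by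
  refine (eq_diagonal_of_commutes hX).trans ?_
  rw [realDiagonal]
  congr 1
  funext i
  exact (RealScalars.algebraMap_re _ (congrFun₂ hXs i i)).symm

variable [FiniteDimensional ℝ F]

variable (hcenter : ∀ X : specialLinear F n, (∀ Z : specialLinear F n, ⁅X, Z⁆ = 0) → X = 0)

/-- The minimal parabolic subalgebra of the linear Lie algebra given by the diagonal matrices. -/
noncomputable def linearParabolic : MinimalParabolic (specialLinear F n) :=
  ofDiagonal (specialLinear F n) (fun X hX => (reTrace_conjTranspose X).trans hX) hcenter
    (linearChamberPoint n) (realDiagonal_mem_specialLinear.2 sum_linearChamberPoint)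
    (fun X _ Y _ hXs hYs hX hY => by
      rw [diagonal_eq_realDiagonal hXs hX, diagonal_eq_realDiagonal hYs hY,
        lie_realDiagonal_realDiagonal])

theorem coe_linearParabolic_H₀ : (((linearParabolic hcenter).H₀ : specialLinear F n) :
    Matrix (Fin n) (Fin n) F) = realDiagonal F (linearChamberPoint n) := rfl

theorem finrank_linearParabolic_a : Module.finrank ℝ (linearParabolic hcenter).a = n - 1 := by
  let σ : (Fin n → ℝ) →ₗ[ℝ] ℝ := ∑ i, LinearMap.proj i
  have hσ : ∀ t, σ t = ∑ i, t i := fun t => by simp [σ]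
  have hoff : ∀ t : Fin n → ℝ, ∀ i j, linearChamberPoint n i ≠ linearChamberPoint n j →
      realDiagonal F t i j = 0 := fun t i j hij => diagonal_apply_ne _ fun h => hij (by rw [h])
  let f : (linearParabolic hcenter).a ≃ₗ[ℝ] LinearMap.ker σ :=
    { toFun := fun X => ⟨fun i =>
        RealScalars.re (((X : specialLinear F n) : Matrix (Fin n) (Fin n) F) i i), by
          rw [LinearMap.mem_ker, hσ, ← realDiagonal_mem_specialLinear (F := F)]
          obtain ⟨h1, h2⟩ := (mem_ofDiagonal_a ..).1 X.2
          rw [← diagonal_eq_realDiagonal h1 h2]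
          exact (X : specialLinear F n).2⟩
      map_add' := fun X Y => Subtype.ext (funext fun i => map_add RealScalars.re _ _)
      map_smul' := fun c X => Subtype.ext (funext fun i => map_smul RealScalars.re c _)
      invFun := fun t => ⟨⟨realDiagonal F t, realDiagonal_mem_specialLinear.2
        ((hσ _).symm.trans t.2)⟩, (mem_ofDiagonal_a ..).2 ⟨conjTranspose_realDiagonal _,
          hoff t⟩⟩
      left_inv := fun X => by
        obtain ⟨h1, h2⟩ := (mem_ofDiagonal_a ..).1 X.2
        exact Subtype.ext (Subtype.ext (diagonal_eq_realDiagonal h1 h2).symm)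
      right_inv := fun t => by
        refine Subtype.ext (funext fun i => ?_)
        change RealScalars.re (realDiagonal F (t : Fin n → ℝ) i i) = _
        rw [realDiagonal, diagonal_apply_eq, RealScalars.re_algebraMap] }
  rw [f.finrank_eq]
  rcases n with _ | n
  · rw [Module.finrank_zero_of_subsingleton]
  · have h1 := σ.finrank_range_add_finrank_ker
    have h2 : LinearMap.range σ = ⊤ := LinearMap.range_eq_top.2 fun c =>
      ⟨Pi.single 0 c, by rw [hσ]; simp⟩
    rw [h2, finrank_top, Module.finrank_self, Module.finrank_fin_fun] at h1
    omega

theorem finrank_specialLinear (hn : 1 ≤ n) :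
    Module.finrank ℝ (specialLinear F n) + 1 = n * n * Module.finrank ℝ F := by
  have h1 := (reTrace (F := F) (ι := Fin n)).finrank_range_add_finrank_ker
  have h2 : LinearMap.range (reTrace (F := F) (ι := Fin n)) = ⊤ := LinearMap.range_eq_top.2 fun c =>
    ⟨diagonal (Pi.single ⟨0, hn⟩ (algebraMap ℝ F c)), by
      rw [reTrace_diagonal, ← map_sum, Finset.sum_pi_single', if_pos (Finset.mem_univ _),
        RealScalars.re_algebraMap]⟩
  rw [h2, finrank_top, Module.finrank_self, Module.finrank_matrix, Fintype.card_fin] at h1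
  rw [← h1, add_comm]
  rfl

theorem mem_linearParabolic_m (X : specialLinear F n) : X ∈ (linearParabolic hcenter).m ↔
    ∃ x : Fin n → F, (∀ i, star (x i) = -x i) ∧ (X : Matrix (Fin n) (Fin n) F) = diagonal x := by
  refine (mem_ofDiagonal_m ..).trans ⟨fun ⟨h1, h2⟩ => ?_, fun ⟨x, hx, hX⟩ => ?_⟩
  · exact ⟨_, fun i => congrFun₂ h1 i i, eq_diagonal_of_commutes h2⟩
  · rw [hX, diagonal_conjTranspose, show star x = -x from funext hx, diagonal_neg]
    exact ⟨rfl, fun i j hij => diagonal_apply_ne _ fun h => hij (by rw [h])⟩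

/-- `m₀ ≅ u(1)ⁿ`, where `u(1)` consists of the purely imaginary scalars. -/
noncomputable def linearMEquiv : (linearParabolic hcenter).m ≃ₗ⁅ℝ⁆
    (Fin n → unitaryAlgebra (1 : Matrix (Fin 1) (Fin 1) F)) where
  toFun X i := ⟨of fun _ _ => ((X : specialLinear F n) : Matrix (Fin n) (Fin n) F) i i, by
    obtain ⟨x, hx, hX⟩ := (mem_linearParabolic_m hcenter _).1 X.2
    rw [mem_unitaryAlgebra_one, hX]
    ext
    simpa using hx i⟩
  map_add' X Y := rfl
  map_smul' c X := rfl
  map_lie' {X Y} := by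
    obtain ⟨x, -, hX⟩ := (mem_linearParabolic_m hcenter _).1 X.2
    obtain ⟨y, -, hY⟩ := (mem_linearParabolic_m hcenter _).1 Y.2
    refine funext fun i => Subtype.ext ?_
    change (of fun _ _ => (((X : specialLinear F n) : Matrix (Fin n) (Fin n) F) *
        ((Y : specialLinear F n) : Matrix (Fin n) (Fin n) F) -
        ((Y : specialLinear F n) : Matrix (Fin n) (Fin n) F) *
        ((X : specialLinear F n) : Matrix (Fin n) (Fin n) F)) i i : Matrix (Fin 1) (Fin 1) F) =
      (of fun _ _ => ((X : specialLinear F n) : Matrix (Fin n) (Fin n) F) i i) *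
        (of fun _ _ => ((Y : specialLinear F n) : Matrix (Fin n) (Fin n) F) i i) -
        (of fun _ _ => ((Y : specialLinear F n) : Matrix (Fin n) (Fin n) F) i i) *
        (of fun _ _ => ((X : specialLinear F n) : Matrix (Fin n) (Fin n) F) i i)
    rw [hX, hY]
    ext
    simp [mul_apply]
  invFun x := ⟨⟨diagonal fun i => (x i : Matrix (Fin 1) (Fin 1) F) 0 0, by
      rw [mem_specialLinear, reTrace_diagonal]
      exact Finset.sum_eq_zero fun i _ => re_eq_zero_of_star_eq_neg
        (congrFun₂ (mem_unitaryAlgebra_one.1 (x i).2) 0 0)⟩,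
    (mem_linearParabolic_m hcenter _).2
      ⟨_, fun i => congrFun₂ (mem_unitaryAlgebra_one.1 (x i).2) 0 0, rfl⟩⟩
  left_inv X := by
    obtain ⟨x, -, hX⟩ := (mem_linearParabolic_m hcenter _).1 X.2
    refine Subtype.ext (Subtype.ext ?_)
    change (diagonal fun i => ((X : specialLinear F n) : Matrix (Fin n) (Fin n) F) i i) =
      ((X : specialLinear F n) : Matrix (Fin n) (Fin n) F)
    rw [hX]
    simp
  right_inv x := by
    refine funext fun i => Subtype.ext ?_
    change (of fun _ _ => diagonal (fun i => (x i : Matrix (Fin 1) (Fin 1) F) 0 0) i i :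
      Matrix (Fin 1) (Fin 1) F) = _
    ext a b
    rw [Subsingleton.elim a 0, Subsingleton.elim b 0]
    simp

end Linear

/-! ### Complexification of the Lie algebra of a form -/

section ComplexModel

variable {F : Type*} [Ring F] [StarRing F] [Algebra ℝ F] [RealScalars F] {κ ι ι' : Type*}
  [Fintype κ] [DecidableEq κ] [Fintype ι] [DecidableEq ι] [Fintype ι'] [DecidableEq ι']

/-- A homomorphism `ρ` from the matrices over `F` to complex matrices that exhibits the latter as
the complexification of the former, and which takes `Xᴴ` to the adjoint of `ρ X` for the complex
bilinear form `W`. -/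
structure IsComplexModel (ρ : Matrix κ κ F → Matrix ι ι ℂ) (W : Matrix ι ι ℂ) : Prop where
  map_add : ∀ X Y, ρ (X + Y) = ρ X + ρ Y
  map_smul : ∀ (c : ℝ) X, ρ (c • X) = (c : ℂ) • ρ X
  map_mul : ∀ X Y, ρ (X * Y) = ρ X * ρ Y
  transpose_mul : ∀ X, (ρ X)ᵀ * W = W * ρ Xᴴ
  exists_eq : ∀ Y, ∃ A B, Y = ρ A + Complex.I • ρ B
  eq_zero : ∀ A B, ρ A + Complex.I • ρ B = 0 → A = 0 ∧ B = 0
  cancel : ∃ W', W' * W = 1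

/-- The complex bilinear forms `J` and `J'` are equivalent, by an equivalence that takes the
diagonal matrices `d t` to the diagonal matrices `d' t`. -/
def FormEquiv {T : Type*} (J : Matrix ι ι ℂ) (d : T → ι → ℂ) (J' : Matrix ι' ι' ℂ)
    (d' : T → ι' → ℂ) : Prop :=
  ∃ (Q : Matrix ι ι' ℂ) (Q' : Matrix ι' ι ℂ), Q * Q' = 1 ∧ Q' * Q = 1 ∧ Qᵀ * J * Q = J' ∧
    ∀ t, diagonal (d t) * Q = Q * diagonal (d' t)

namespace IsComplexModel

variable {ρ : Matrix κ κ F → Matrix ι ι ℂ} {W : Matrix ι ι ℂ}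

theorem map_zero (hρ : IsComplexModel ρ W) : ρ 0 = 0 := by
  simpa using hρ.map_smul 0 0

theorem map_neg (hρ : IsComplexModel ρ W) (X : Matrix κ κ F) : ρ (-X) = -ρ X := by
  simpa using hρ.map_smul (-1) X

theorem map_sub (hρ : IsComplexModel ρ W) (X Y : Matrix κ κ F) : ρ (X - Y) = ρ X - ρ Y := by
  rw [sub_eq_add_neg, hρ.map_add, hρ.map_neg, sub_eq_add_neg]

theorem map_lie (hρ : IsComplexModel ρ W) (X Y : Matrix κ κ F) : ρ ⁅X, Y⁆ = ⁅ρ X, ρ Y⁆ := by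
  rw [LieRing.of_associative_ring_bracket, LieRing.of_associative_ring_bracket, hρ.map_sub,
    hρ.map_mul, hρ.map_mul]

theorem transpose_mul_add (hρ : IsComplexModel ρ W) (K X : Matrix κ κ F) :
    (ρ X)ᵀ * (W * ρ K) + W * ρ K * ρ X = W * ρ (Xᴴ * K + K * X) := by
  rw [hρ.map_add, hρ.map_mul, hρ.map_mul, mul_add, ← mul_assoc, hρ.transpose_mul, mul_assoc,
    mul_assoc]

theorem injective (hρ : IsComplexModel ρ W) : Function.Injective ρ := by
  intro X Y h
  have h1 := hρ.eq_zero (X - Y) 0 (by rw [hρ.map_sub, h, sub_self, hρ.map_zero, smul_zero,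
    add_zero])
  exact sub_eq_zero.1 h1.1

/-- The complexification of the Lie algebra of a form `K` over `F` is the Lie algebra of any complex
bilinear form equivalent to `W ρ(K)`. -/
theorem exists_isRealForm (hρ : IsComplexModel ρ W) (K : Matrix κ κ F) {J' : Matrix ι' ι' ℂ}
    {g : LieSubalgebra ℂ (Matrix ι' ι' ℂ)} (hg : ∀ X, X ∈ g ↔ Xᵀ * J' + J' * X = 0)
    {T : Type*} {d : T → ι → ℂ} {d' : T → ι' → ℂ} (hQ : FormEquiv (W * ρ K) d J' d') :
    ∃ f : unitaryAlgebra K → g, IsRealForm f ∧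
      ∀ (X : unitaryAlgebra K) t, ρ X = diagonal (d t) →
        (f X : Matrix ι' ι' ℂ) = diagonal (d' t) := by
  obtain ⟨Q, Q', h, h', hJ, hd⟩ := hQ
  have hT : Qᵀ * Q'ᵀ = 1 := by rw [← Matrix.transpose_mul, h', transpose_one]
  have hT' : Q'ᵀ * Qᵀ = 1 := by rw [← Matrix.transpose_mul, h, transpose_one]
  have h1 : ∀ X, (Q' * X * Q)ᵀ * J' + J' * (Q' * X * Q) =
      Qᵀ * (Xᵀ * (W * ρ K) + W * ρ K * X) * Q := by
    intro X
    rw [← hJ, Matrix.transpose_mul, Matrix.transpose_mul, Matrix.mul_add, Matrix.add_mul]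
    congr 1
    · calc Qᵀ * (Xᵀ * Q'ᵀ) * (Qᵀ * (W * ρ K) * Q) = Qᵀ * Xᵀ * (Q'ᵀ * Qᵀ) * (W * ρ K) * Q := by
            simp only [Matrix.mul_assoc]
        _ = _ := by rw [hT']; simp only [Matrix.mul_assoc, Matrix.one_mul]
    · calc Qᵀ * (W * ρ K) * Q * (Q' * X * Q) = Qᵀ * (W * ρ K) * (Q * Q') * X * Q := by
            simp only [Matrix.mul_assoc]
        _ = _ := by rw [h]; simp only [Matrix.mul_assoc, Matrix.one_mul]
  have h2 : ∀ Z : Matrix ι ι ℂ, Qᵀ * Z * Q = 0 → Z = 0 := by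
    intro Z hZ
    calc Z = Q'ᵀ * Qᵀ * Z * (Q * Q') := by rw [hT', h, Matrix.one_mul, Matrix.mul_one]
      _ = Q'ᵀ * (Qᵀ * Z * Q) * Q' := by simp only [Matrix.mul_assoc]
      _ = 0 := by rw [hZ, Matrix.mul_zero, Matrix.zero_mul]
  have h3 : ∀ Z : Matrix ι ι ℂ, Q' * Z * Q = 0 → Z = 0 := by
    intro Z hZ
    calc Z = Q * Q' * Z * (Q * Q') := by rw [h, Matrix.one_mul, Matrix.mul_one]
      _ = Q * (Q' * Z * Q) * Q' := by simp only [Matrix.mul_assoc]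
      _ = 0 := by rw [hZ, Matrix.mul_zero, Matrix.zero_mul]
  have h4 : ∀ Y : Matrix ι' ι' ℂ, Q' * (Q * Y * Q') * Q = Y := by
    intro Y
    calc Q' * (Q * Y * Q') * Q = Q' * Q * Y * (Q' * Q) := by simp only [Matrix.mul_assoc]
      _ = Y := by rw [h', Matrix.one_mul, Matrix.mul_one]
  obtain ⟨W', hW'⟩ := hρ.cancel
  have h5 : ∀ Z, W * Z = 0 → Z = 0 := by
    intro Z hZ
    rw [← one_mul Z, ← hW', mul_assoc, hZ, mul_zero]
  have hmem : ∀ X ∈ unitaryAlgebra K, Q' * ρ X * Q ∈ g := by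
    intro X hX
    rw [hg, h1, hρ.transpose_mul_add, (mem_unitaryAlgebra.1 hX), hρ.map_zero, mul_zero,
      Matrix.mul_zero, Matrix.zero_mul]
  refine ⟨fun X => ⟨Q' * ρ X * Q, hmem X X.2⟩, ⟨fun X Y => Subtype.ext ?_, fun c X =>
    Subtype.ext ?_, fun X Y => Subtype.ext ?_, fun Y => ?_, fun A B hAB => ?_⟩, fun X t hX => ?_⟩
  · change Q' * ρ (X + Y) * Q = Q' * ρ X * Q + Q' * ρ Y * Q
    rw [hρ.map_add, Matrix.mul_add, Matrix.add_mul]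
  · change Q' * ρ (c • X) * Q = (c : ℂ) • (Q' * ρ X * Q)
    rw [hρ.map_smul, Matrix.mul_smul, Matrix.smul_mul]
  · change Q' * ρ ⁅(X : Matrix κ κ F), (Y : Matrix κ κ F)⁆ * Q = ⁅Q' * ρ X * Q, Q' * ρ Y * Q⁆
    rw [hρ.map_lie]
    exact LieHom.map_lie (conjLieHom ℂ h) (ρ X) (ρ Y)
  · obtain ⟨A, B, hAB⟩ := hρ.exists_eq (Q * (Y : Matrix ι' ι' ℂ) * Q')
    have hY := (hg Y).1 Y.2
    rw [← h4 (Y : Matrix ι' ι' ℂ), h1] at hY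
    have hY' := h2 _ hY
    rw [hAB, transpose_add, transpose_smul, add_mul, mul_add, smul_mul_assoc, mul_smul_comm,
      add_add_add_comm, ← smul_add, hρ.transpose_mul_add, hρ.transpose_mul_add, ← mul_smul_comm,
      ← mul_add] at hY'
    obtain ⟨hA, hB⟩ := hρ.eq_zero _ _ (h5 _ hY')
    refine ⟨⟨A, hA⟩, ⟨B, hB⟩, Subtype.ext ?_⟩
    change (Y : Matrix ι' ι' ℂ) = Q' * ρ A * Q + Complex.I • (Q' * ρ B * Q)
    rw [← Matrix.smul_mul, ← Matrix.mul_smul, ← Matrix.add_mul, ← Matrix.mul_add, ← hAB, h4]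
  · have h6 : Q' * ρ A * Q + Complex.I • (Q' * ρ B * Q) = 0 := congrArg Subtype.val hAB
    rw [← Matrix.smul_mul, ← Matrix.mul_smul, ← Matrix.add_mul, ← Matrix.mul_add] at h6
    obtain ⟨hA, hB⟩ := hρ.eq_zero _ _ (h3 _ h6)
    exact ⟨Subtype.ext hA, Subtype.ext hB⟩
  · change Q' * ρ X * Q = _
    rw [hX, Matrix.mul_assoc, hd, ← Matrix.mul_assoc, h', Matrix.one_mul]

end IsComplexModel

theorem isComplexModel_real : IsComplexModel
    (fun X : Matrix κ κ ℝ => X.map (fun x : ℝ => (x : ℂ))) 1 where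
  map_add X Y := by
    ext
    simp
  map_smul c X := by
    ext
    simp
  map_mul X Y := by
    ext
    simp [mul_apply]
  transpose_mul X := by
    ext
    simp
  exists_eq Y := ⟨Y.map Complex.re, Y.map Complex.im, by
    ext i j
    simp [mul_comm Complex.I, Complex.re_add_im]⟩
  eq_zero A B h := by
    have h1 : ∀ i j, (A i j : ℂ) + Complex.I * (B i j : ℂ) = 0 := fun i j => congrFun₂ h i j
    constructor
    · ext i j
      simpa using congrArg Complex.re (h1 i j)
    · ext i j
      simpa using congrArg Complex.im (h1 i j)
  cancel := ⟨1, mul_one 1⟩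

theorem map_realDiagonal (d : κ → ℝ) :
    (realDiagonal ℝ d).map (fun x : ℝ => (x : ℂ)) = diagonal fun i => (d i : ℂ) := by
  rw [realDiagonal, diagonal_map Complex.ofReal_zero]
  rfl

end ComplexModel

/-! ### Equivalences of complex bilinear forms -/

namespace FormEquiv

variable {T κ ι ι' ι'' : Type*} [Fintype κ] [DecidableEq κ] [Fintype ι] [DecidableEq ι]
  [Fintype ι'] [DecidableEq ι'] [Fintype ι''] [DecidableEq ι'']

theorem trans {J : Matrix ι ι ℂ} {d : T → ι → ℂ} {J' : Matrix ι' ι' ℂ} {d' : T → ι' → ℂ}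
    {J'' : Matrix ι'' ι'' ℂ} {d'' : T → ι'' → ℂ} (h₁ : FormEquiv J d J' d')
    (h₂ : FormEquiv J' d' J'' d'') : FormEquiv J d J'' d'' := by
  obtain ⟨Q, Q', h, h', hJ, hd⟩ := h₁
  obtain ⟨R, R', g, g', hJ', hd'⟩ := h₂
  refine ⟨Q * R, R' * Q', ?_, ?_, ?_, fun t => ?_⟩
  · rw [Matrix.mul_assoc, ← Matrix.mul_assoc R, g, Matrix.one_mul, h]
  · rw [Matrix.mul_assoc, ← Matrix.mul_assoc Q', h', Matrix.one_mul, g']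
  · rw [← hJ', ← hJ, transpose_mul]
    simp only [Matrix.mul_assoc]
  · rw [← Matrix.mul_assoc, hd, Matrix.mul_assoc, hd', Matrix.mul_assoc]

/-- The equivalence given by a permutation and a rescaling of the basis. -/
theorem of_monomial {J : Matrix ι ι ℂ} {d : T → ι → ℂ} {J' : Matrix ι' ι' ℂ} {d' : T → ι' → ℂ}
    (σ : ι' ≃ ι) (c : ι' → ℂ) (hc : ∀ i, c i ≠ 0)
    (hJ : ∀ i j, c i * J (σ i) (σ j) * c j = J' i j) (hd : ∀ t i, d t (σ i) = d' t i) :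
    FormEquiv J d J' d' := by
  refine ⟨(diagonal c).submatrix σ.symm id, (diagonal fun i => (c i)⁻¹).submatrix id σ.symm,
    ?_, ?_, ?_, fun t => ?_⟩
  · rw [← submatrix_mul _ _ σ.symm id σ.symm Function.bijective_id, diagonal_mul_diagonal]
    simp only [mul_inv_cancel₀ (hc _), diagonal_one]
    exact submatrix_one_equiv σ.symm
  · rw [submatrix_mul_equiv, diagonal_mul_diagonal]
    simp only [inv_mul_cancel₀ (hc _), diagonal_one]
    rfl
  · have h1 : J = (J.submatrix σ σ).submatrix σ.symm σ.symm := by simp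
    rw [h1, transpose_submatrix, diagonal_transpose, submatrix_mul_equiv, submatrix_mul_equiv]
    ext i j
    simp [hJ]
  · have h1 : diagonal (d t) = (diagonal (d' t)).submatrix σ.symm σ.symm := by
      rw [submatrix_diagonal_equiv]
      congr 1
      funext i
      simp [← hd]
    rw [h1, submatrix_mul_equiv, diagonal_mul_diagonal]
    conv_rhs => rw [show diagonal (d' t) = (diagonal (d' t)).submatrix id id from rfl]
    rw [← submatrix_mul _ _ σ.symm id id Function.bijective_id, diagonal_mul_diagonal]
    simp only [mul_comm]

/-- The equivalence of orthogonal sums with equal second summands. -/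
theorem fromBlocks {J : Matrix ι ι ℂ} {J' : Matrix ι' ι' ℂ}
    (h : FormEquiv J (fun (_ : T) _ => 0) J' fun _ _ => 0) (B : Matrix κ κ ℂ) (d : T → κ → ℂ) :
    FormEquiv (Matrix.fromBlocks J 0 0 B) (fun t => Sum.elim 0 (d t))
      (Matrix.fromBlocks J' 0 0 B) fun t => Sum.elim 0 (d t) := by
  obtain ⟨Q, Q', h, h', hJ, hd⟩ := h
  refine ⟨Matrix.fromBlocks Q 0 0 1, Matrix.fromBlocks Q' 0 0 1, ?_, ?_, ?_, fun t => ?_⟩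
  · simp [fromBlocks_multiply, h]
  · simp [fromBlocks_multiply, h']
  · simp [fromBlocks_multiply, fromBlocks_transpose, hJ]
  · rw [← fromBlocks_diagonal, ← fromBlocks_diagonal]
    simp [fromBlocks_multiply]

end FormEquiv

/-- The hyperbolic form, symmetric for `δ = 1` and alternating for `δ = -1`. -/
def hyperbolicForm (δ : ℂ) (ι : Type*) [DecidableEq ι] : Matrix (ι ⊕ ι) (ι ⊕ ι) ℂ :=
  fromBlocks 0 1 (δ • 1) 0

section ScalarBlocks

variable {F M : Type*} [Ring F] [DecidableEq M]

variable (M) in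
/-- The matrix of the `2 × 2` matrix with entries `a b c d`, acting on copies of a plane. -/
def scalarBlocks (a b c d : F) : Matrix (M ⊕ M) (M ⊕ M) F :=
  fromBlocks (diagonal fun _ => a) (diagonal fun _ => b) (diagonal fun _ => c)
    (diagonal fun _ => d)

theorem scalarBlocks_one : scalarBlocks M (1 : F) 0 0 1 = 1 := by
  simp [scalarBlocks, -fromBlocks_diagonal]

theorem scalarBlocks_mul [Fintype M] (a b c d a' b' c' d' : F) :
    scalarBlocks M a b c d * scalarBlocks M a' b' c' d' =
      scalarBlocks M (a * a' + b * c') (a * b' + b * d') (c * a' + d * c') (c * b' + d * d') := by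
  simp [scalarBlocks, fromBlocks_multiply, -fromBlocks_diagonal]

theorem scalarBlocks_transpose (a b c d : F) :
    (scalarBlocks M a b c d)ᵀ = scalarBlocks M a c b d := by
  simp [scalarBlocks, fromBlocks_transpose, -fromBlocks_diagonal]

theorem scalarBlocks_conjTranspose [StarRing F] (a b c d : F) :
    (scalarBlocks M a b c d)ᴴ = scalarBlocks M (star a) (star c) (star b) (star d) := by
  simp [scalarBlocks, fromBlocks_conjTranspose, -fromBlocks_diagonal, Pi.star_def]

theorem hyperbolicForm_eq (δ : ℂ) : hyperbolicForm δ M = scalarBlocks M 0 1 δ 0 := by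
  simp [scalarBlocks, hyperbolicForm, smul_one_eq_diagonal, -fromBlocks_diagonal]

theorem diagonal_zero' : diagonal (fun _ : M => (0 : F)) = 0 := diagonal_zero

end ScalarBlocks

section Hyperbolic

variable {T R M : Type*} [Fintype R] [DecidableEq R] [Fintype M] [DecidableEq M] {ι : Type*}
  [Fintype ι] [DecidableEq ι] {l : ℕ}

/-- The reordering of a basis of a sum of two hyperbolic spaces. -/
def sumSumSumEquiv (R M : Type*) : (R ⊕ M) ⊕ (R ⊕ M) ≃ (M ⊕ M) ⊕ (R ⊕ R) where
  toFun := Sum.elim (Sum.elim (Sum.inr ∘ Sum.inl) (Sum.inl ∘ Sum.inl))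
    (Sum.elim (Sum.inr ∘ Sum.inr) (Sum.inl ∘ Sum.inr))
  invFun := Sum.elim (Sum.elim (Sum.inl ∘ Sum.inr) (Sum.inr ∘ Sum.inr))
    (Sum.elim (Sum.inl ∘ Sum.inl) (Sum.inr ∘ Sum.inl))
  left_inv := by rintro ((i | i) | (i | i)) <;> rfl
  right_inv := by rintro ((i | i) | (i | i)) <;> rfl

/-- If the first summand is hyperbolic, then so is its sum with a hyperbolic space. -/
theorem formEquiv_hyperbolicForm {K : Matrix ι ι ℂ} {δ : ℂ}
    (hK : FormEquiv K (fun (_ : T) _ => 0) (hyperbolicForm δ M) fun _ _ => 0) (e : R ⊕ M ≃ Fin l)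
    {t : T → R → ℂ} {s : T → Fin l → ℂ} (hs : ∀ τ i, s τ (e (Sum.inl i)) = t τ i)
    (hs' : ∀ τ j, s τ (e (Sum.inr j)) = 0) :
    FormEquiv (fromBlocks K 0 0 (hyperbolicForm δ R))
      (fun τ => Sum.elim 0 (Sum.elim (t τ) fun i => -t τ i)) (hyperbolicForm δ (Fin l))
      fun τ => Sum.elim (s τ) fun i => -s τ i := by
  refine (hK.fromBlocks (hyperbolicForm δ R) fun τ => Sum.elim (t τ) fun i => -t τ i).trans
    (FormEquiv.of_monomial ((Equiv.sumCongr e e).symm.trans (sumSumSumEquiv R M)) (fun _ => 1)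
      (fun _ => one_ne_zero) (fun i j => ?_) fun τ i => ?_)
  · obtain ⟨i, rfl⟩ := (Equiv.sumCongr e e).surjective i
    obtain ⟨j, rfl⟩ := (Equiv.sumCongr e e).surjective j
    simp only [Equiv.trans_apply, Equiv.symm_apply_apply, one_mul, mul_one]
    rcases i with (i | i) | (i | i) <;> rcases j with (j | j) | (j | j) <;>
      simp [sumSumSumEquiv, hyperbolicForm, one_apply, e.injective.eq_iff]
  · obtain ⟨i, rfl⟩ := (Equiv.sumCongr e e).surjective i
    simp only [Equiv.trans_apply, Equiv.symm_apply_apply]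
    rcases i with (i | i) | (i | i) <;> simp [sumSumSumEquiv, hs, hs']

/-- The reordering of a basis of a sum of two hyperbolic spaces and a line. -/
def unitSumSumSumEquiv (R M : Type*) :
    Unit ⊕ ((R ⊕ M) ⊕ (R ⊕ M)) ≃ (Unit ⊕ (M ⊕ M)) ⊕ (R ⊕ R) :=
  ((Equiv.refl Unit).sumCongr (sumSumSumEquiv R M)).trans (Equiv.sumAssoc _ _ _).symm

/-- The analogue of `formEquiv_hyperbolicForm` for type B: a basis of the kernel of `H₀` that is
adapted to type B is merged with the hyperbolic planes on which `H₀` has entries `t` and `-t`. -/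
theorem formEquiv_JB {K : Matrix ι ι ℂ} (hK : FormEquiv K (fun (_ : T) _ => 0)
      (fromBlocks ((2 : ℂ) • (1 : Matrix Unit Unit ℂ)) 0 0 (hyperbolicForm 1 M)) fun _ _ => 0)
    (e : R ⊕ M ≃ Fin l) {t : T → R → ℂ} {s : T → Fin l → ℂ}
    (hs : ∀ τ i, s τ (e (Sum.inl i)) = t τ i) (hs' : ∀ τ j, s τ (e (Sum.inr j)) = 0) :
    FormEquiv (fromBlocks K 0 0 (hyperbolicForm 1 R))
      (fun τ => Sum.elim 0 (Sum.elim (t τ) fun i => -t τ i)) (LieAlgebra.Orthogonal.JB (Fin l) ℂ)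
      fun τ => Sum.elim 0 (Sum.elim (s τ) fun i => -s τ i) := by
  refine (hK.fromBlocks (hyperbolicForm 1 R) fun τ => Sum.elim (t τ) fun i => -t τ i).trans
    (FormEquiv.of_monomial (((Equiv.refl Unit).sumCongr (Equiv.sumCongr e e)).symm.trans
      (unitSumSumSumEquiv R M)) (fun _ => 1) (fun _ => one_ne_zero) (fun i j => ?_) fun τ i => ?_)
  · obtain ⟨i, rfl⟩ := ((Equiv.refl Unit).sumCongr (Equiv.sumCongr e e)).surjective i
    obtain ⟨j, rfl⟩ := ((Equiv.refl Unit).sumCongr (Equiv.sumCongr e e)).surjective j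
    simp only [Equiv.trans_apply, Equiv.symm_apply_apply, one_mul, mul_one]
    rcases i with i | (i | i) | (i | i) <;> rcases j with j | (j | j) | (j | j) <;>
      simp [unitSumSumSumEquiv, sumSumSumEquiv, hyperbolicForm, one_apply, e.injective.eq_iff,
        LieAlgebra.Orthogonal.JB, LieAlgebra.Orthogonal.JD]
  · obtain ⟨i, rfl⟩ := ((Equiv.refl Unit).sumCongr (Equiv.sumCongr e e)).surjective i
    simp only [Equiv.trans_apply, Equiv.symm_apply_apply]
    rcases i with i | (i | i) | (i | i) <;> simp [unitSumSumSumEquiv, sumSumSumEquiv, hs, hs']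

/-- Over `ℂ` an orthonormal basis of even size can be replaced by a hyperbolic one. -/
theorem formEquiv_one (T M : Type*) [Fintype M] [DecidableEq M] :
    FormEquiv (1 : Matrix (M ⊕ M) (M ⊕ M) ℂ) (fun (_ : T) _ => 0) (hyperbolicForm 1 M)
      fun _ _ => 0 := by
  refine ⟨scalarBlocks M 1 (1 / 2) Complex.I (-(Complex.I / 2)),
    scalarBlocks M (1 / 2) (-(Complex.I / 2)) 1 Complex.I, ?_, ?_, ?_, fun t => ?_⟩
  · rw [scalarBlocks_mul, ← scalarBlocks_one]
    congr 1 <;> ring_nf <;> norm_num [Complex.I_sq]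
  · rw [scalarBlocks_mul, ← scalarBlocks_one]
    congr 1 <;> ring_nf <;> norm_num [Complex.I_sq]
  · rw [scalarBlocks_transpose, Matrix.mul_one, scalarBlocks_mul, hyperbolicForm_eq]
    congr 1 <;> ring_nf <;> norm_num [Complex.I_sq]
  · rw [diagonal_zero', Matrix.mul_zero, Matrix.zero_mul]

/-- Over `ℂ` an orthonormal basis of odd size can be replaced by one adapted to type B. -/
theorem formEquiv_one_unit (T M : Type*) [Fintype M] [DecidableEq M] :
    FormEquiv (1 : Matrix (Unit ⊕ (M ⊕ M)) (Unit ⊕ (M ⊕ M)) ℂ) (fun (_ : T) _ => 0)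
      (fromBlocks ((2 : ℂ) • (1 : Matrix Unit Unit ℂ)) 0 0 (hyperbolicForm 1 M)) fun _ _ => 0 := by
  obtain ⟨s, hs⟩ := IsAlgClosed.exists_pow_nat_eq (2 : ℂ) zero_lt_two
  have h0 : s ≠ 0 := fun h => by simp [h] at hs
  obtain ⟨Q, Q', h, h', hJ, hd⟩ := formEquiv_one T M
  refine ⟨fromBlocks (s • 1) 0 0 Q, fromBlocks (s⁻¹ • 1) 0 0 Q', ?_, ?_, ?_, fun t => ?_⟩
  · simp [fromBlocks_multiply, h, smul_smul, h0]
  · simp [fromBlocks_multiply, h', smul_smul, h0]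
  · rw [Matrix.mul_one] at hJ
    simp [fromBlocks_multiply, fromBlocks_transpose, hJ, smul_smul, ← hs, sq]
  · rw [diagonal_zero', Matrix.mul_zero, Matrix.zero_mul]

end Hyperbolic

/-! ### Quaternionic matrices as complex matrices -/

section QuaternionModel

open Quaternion

variable {κ : Type*} [Fintype κ] [DecidableEq κ]

/-- The component `a` of a quaternion `a + b j`, for complex `a` and `b`. -/
def quaternionFst : ℍ[ℝ] →ₗ[ℝ] ℂ where
  toFun q := ⟨q.re, q.imI⟩
  map_add' _ _ := rfl
  map_smul' c q := by
    apply Complex.ext <;> simp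

/-- The component `b` of a quaternion `a + b j`, for complex `a` and `b`. -/
def quaternionSnd : ℍ[ℝ] →ₗ[ℝ] ℂ where
  toFun q := ⟨q.imJ, q.imK⟩
  map_add' _ _ := rfl
  map_smul' c q := by
    apply Complex.ext <;> simp

theorem quaternionFst_re (q : ℍ[ℝ]) : (quaternionFst q).re = q.re := rfl

theorem quaternionFst_im (q : ℍ[ℝ]) : (quaternionFst q).im = q.imI := rfl

theorem quaternionSnd_re (q : ℍ[ℝ]) : (quaternionSnd q).re = q.imJ := rfl

theorem quaternionSnd_im (q : ℍ[ℝ]) : (quaternionSnd q).im = q.imK := rfl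

/-- The quaternion `a + b j`. -/
def quaternionMk (a b : ℂ) : ℍ[ℝ] := ⟨a.re, a.im, b.re, b.im⟩

theorem quaternionFst_mk (a b : ℂ) : quaternionFst (quaternionMk a b) = a := rfl

theorem quaternionSnd_mk (a b : ℂ) : quaternionSnd (quaternionMk a b) = b := rfl

theorem quaternion_ext {x y : ℍ[ℝ]} (h1 : quaternionFst x = quaternionFst y)
    (h2 : quaternionSnd x = quaternionSnd y) : x = y :=
  QuaternionAlgebra.ext (congrArg Complex.re h1) (congrArg Complex.im h1) (congrArg Complex.re h2)
    (congrArg Complex.im h2)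

theorem quaternionFst_mul (x y : ℍ[ℝ]) : quaternionFst (x * y) =
    quaternionFst x * quaternionFst y - quaternionSnd x * star (quaternionSnd y) := by
  apply Complex.ext
  · change (x * y).re = _
    rw [Quaternion.re_mul]
    simp [quaternionFst_re, quaternionFst_im, quaternionSnd_re, quaternionSnd_im]
    ring
  · change (x * y).imI = _
    rw [Quaternion.imI_mul]
    simp [quaternionFst_re, quaternionFst_im, quaternionSnd_re, quaternionSnd_im]
    ring

theorem quaternionSnd_mul (x y : ℍ[ℝ]) : quaternionSnd (x * y) =
    quaternionFst x * quaternionSnd y + quaternionSnd x * star (quaternionFst y) := by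
  apply Complex.ext
  · change (x * y).imJ = _
    rw [Quaternion.imJ_mul]
    simp [quaternionFst_re, quaternionFst_im, quaternionSnd_re, quaternionSnd_im]
    ring
  · change (x * y).imK = _
    rw [Quaternion.imK_mul]
    simp [quaternionFst_re, quaternionFst_im, quaternionSnd_re, quaternionSnd_im]
    ring

theorem quaternionFst_star (x : ℍ[ℝ]) : quaternionFst (star x) = star (quaternionFst x) :=
  Complex.ext (Quaternion.re_star x) (Quaternion.imI_star x)

theorem quaternionSnd_star (x : ℍ[ℝ]) : quaternionSnd (star x) = -quaternionSnd x :=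
  Complex.ext (Quaternion.imJ_star x) (Quaternion.imK_star x)

/-- The complex matrix by which a quaternionic matrix acts, with respect to the complex basis
`e, e j`. -/
noncomputable def toComplex (X : Matrix κ κ ℍ[ℝ]) : Matrix (κ ⊕ κ) (κ ⊕ κ) ℂ :=
  fromBlocks (X.map quaternionFst) (X.map quaternionSnd) (-(X.map quaternionSnd).map star)
    ((X.map quaternionFst).map star)

theorem map_star_mul (A B : Matrix κ κ ℂ) : (A * B).map star = A.map star * B.map star :=
  Matrix.map_mul (f := starRingEnd ℂ)

theorem map_star_add {ι : Type*} (A B : Matrix ι ι ℂ) :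
    (A + B).map star = A.map star + B.map star :=
  Matrix.map_add star star_add A B

theorem map_star_sub {ι : Type*} (A B : Matrix ι ι ℂ) :
    (A - B).map star = A.map star - B.map star :=
  Matrix.map_sub star star_sub A B

theorem map_star_map_star {ι : Type*} (A : Matrix ι ι ℂ) : (A.map star).map star = A := by
  ext
  simp

theorem map_quaternionFst_mul (X Y : Matrix κ κ ℍ[ℝ]) : (X * Y).map quaternionFst =
    X.map quaternionFst * Y.map quaternionFst -
      X.map quaternionSnd * (Y.map quaternionSnd).map star := by
  ext i j
  rw [map_apply, mul_apply, map_sum, Matrix.sub_apply, mul_apply, mul_apply,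
    ← Finset.sum_sub_distrib]
  exact Finset.sum_congr rfl fun k _ => quaternionFst_mul _ _

theorem map_quaternionSnd_mul (X Y : Matrix κ κ ℍ[ℝ]) : (X * Y).map quaternionSnd =
    X.map quaternionFst * Y.map quaternionSnd +
      X.map quaternionSnd * (Y.map quaternionFst).map star := by
  ext i j
  rw [map_apply, mul_apply, map_sum, Matrix.add_apply, mul_apply, mul_apply,
    ← Finset.sum_add_distrib]
  exact Finset.sum_congr rfl fun k _ => quaternionSnd_mul _ _

theorem toComplex_mul (X Y : Matrix κ κ ℍ[ℝ]) :
    toComplex (X * Y) = toComplex X * toComplex Y := by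
  rw [toComplex, toComplex, toComplex, fromBlocks_multiply, map_quaternionFst_mul,
    map_quaternionSnd_mul, map_star_sub, map_star_add, map_star_mul, map_star_mul, map_star_mul,
    map_star_mul, map_star_map_star, map_star_map_star]
  congr 1 <;> noncomm_ring

theorem map_quaternionFst_conjTranspose (X : Matrix κ κ ℍ[ℝ]) :
    Xᴴ.map quaternionFst = ((X.map quaternionFst).map star)ᵀ := by
  ext i j
  exact quaternionFst_star _

theorem map_quaternionSnd_conjTranspose (X : Matrix κ κ ℍ[ℝ]) :
    Xᴴ.map quaternionSnd = -(X.map quaternionSnd)ᵀ := by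
  ext i j
  exact quaternionSnd_star _

theorem toComplex_conjTranspose (X : Matrix κ κ ℍ[ℝ]) : toComplex Xᴴ = (toComplex X)ᴴ := by
  rw [toComplex, toComplex, fromBlocks_conjTranspose, map_quaternionFst_conjTranspose,
    map_quaternionSnd_conjTranspose]
  congr 1 <;> ext i j <;> simp

theorem toComplex_transpose_mul (X : Matrix κ κ ℍ[ℝ]) :
    (toComplex X)ᵀ * J κ ℂ = J κ ℂ * toComplex Xᴴ := by
  rw [toComplex, toComplex, J, fromBlocks_transpose, fromBlocks_multiply, fromBlocks_multiply,
    map_quaternionFst_conjTranspose, map_quaternionSnd_conjTranspose]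
  congr 1 <;> ext i j <;> simp

/-- A complex matrix is quaternionic when it commutes with the antilinear operator `v ↦ J v̄`. -/
theorem exists_toComplex_eq_iff (Y : Matrix (κ ⊕ κ) (κ ⊕ κ) ℂ) :
    (∃ X, toComplex X = Y) ↔ Y * J κ ℂ = J κ ℂ * Y.map star := by
  constructor
  · rintro ⟨X, rfl⟩
    rw [toComplex, fromBlocks_map, J, fromBlocks_multiply, fromBlocks_multiply]
    congr 1 <;> ext i j <;> simp
  · intro h
    refine ⟨of fun i j => quaternionMk (Y (Sum.inl i) (Sum.inl j)) (Y (Sum.inl i) (Sum.inr j)), ?_⟩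
    rw [← fromBlocks_toBlocks Y, fromBlocks_map, J, fromBlocks_multiply, fromBlocks_multiply,
      fromBlocks_inj] at h
    obtain ⟨h1, -, h3, -⟩ := h
    simp only [mul_zero, zero_add, mul_one, zero_mul, neg_mul, one_mul, add_zero] at h1 h3
    have h1' : ∀ i j, Y (Sum.inl i) (Sum.inr j) = -star (Y (Sum.inr i) (Sum.inl j)) := congrFun₂ h1
    have h3' : ∀ i j, Y (Sum.inr i) (Sum.inr j) = star (Y (Sum.inl i) (Sum.inl j)) := congrFun₂ h3
    ext (i | i) (j | j)
    · rfl
    · rfl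
    · change -star (Y (Sum.inl i) (Sum.inr j)) = _
      rw [h1', star_neg, star_star, neg_neg]
    · exact (h3' i j).symm

theorem isComplexModel_toComplex : IsComplexModel (toComplex (κ := κ)) (J κ ℂ) where
  map_add X Y := by
    rw [toComplex, toComplex, toComplex, fromBlocks_add]
    congr 1 <;> ext i j <;> simp [add_comm]
  map_smul c X := by
    rw [toComplex, toComplex, fromBlocks_smul]
    congr 1 <;> ext i j <;> simp
  map_mul := toComplex_mul
  transpose_mul := toComplex_transpose_mul
  exists_eq Y := by
    refine ⟨of fun i j => quaternionMk
        ((Y (Sum.inl i) (Sum.inl j) + star (Y (Sum.inr i) (Sum.inr j))) / 2)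
        ((Y (Sum.inl i) (Sum.inr j) - star (Y (Sum.inr i) (Sum.inl j))) / 2),
      of fun i j => quaternionMk
        (-Complex.I * (Y (Sum.inl i) (Sum.inl j) - star (Y (Sum.inr i) (Sum.inr j))) / 2)
        (-Complex.I * (Y (Sum.inl i) (Sum.inr j) + star (Y (Sum.inr i) (Sum.inl j))) / 2), ?_⟩
    ext (i | i) (j | j) <;>
      simp [toComplex, quaternionFst_mk, quaternionSnd_mk] <;> ring_nf <;>
      simp [Complex.conj_ofNat] <;> ring
  eq_zero A B h := by
    have h1 : ∀ i j, quaternionFst (A i j) + Complex.I * quaternionFst (B i j) = 0 :=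
      fun i j => congrFun₂ h (Sum.inl i) (Sum.inl j)
    have h2 : ∀ i j, quaternionSnd (A i j) + Complex.I * quaternionSnd (B i j) = 0 :=
      fun i j => congrFun₂ h (Sum.inl i) (Sum.inr j)
    have h3 : ∀ i j, -star (quaternionSnd (A i j)) + Complex.I * -star (quaternionSnd (B i j)) =
      0 :=
      fun i j => congrFun₂ h (Sum.inr i) (Sum.inl j)
    have h4 : ∀ i j, star (quaternionFst (A i j)) + Complex.I * star (quaternionFst (B i j)) = 0 :=
      fun i j => congrFun₂ h (Sum.inr i) (Sum.inr j)
    have key : ∀ a b : ℂ, a + Complex.I * b = 0 → star a + Complex.I * star b = 0 →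
        a = 0 ∧ b = 0 := by
      intro a b h h'
      have h'' := congrArg star h'
      simp at h''
      have ha : a = 0 := by linear_combination (1 / 2 : ℂ) * h + (1 / 2 : ℂ) * h''
      refine ⟨ha, ?_⟩
      simpa [ha] using h
    have h5 := fun i j => key _ _ (h1 i j) (h4 i j)
    have h6 := fun i j => key _ _ (h2 i j) (by linear_combination -h3 i j)
    exact ⟨Matrix.ext fun i j => quaternion_ext (h5 i j).1 (h6 i j).1,
      Matrix.ext fun i j => quaternion_ext (h5 i j).2 (h6 i j).2⟩
  cancel := ⟨-J κ ℂ, by rw [neg_mul, J_squared, neg_neg]⟩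

theorem toComplex_realDiagonal (d : κ → ℝ) : toComplex (realDiagonal ℍ[ℝ] d) =
    diagonal (Sum.elim (fun i => (d i : ℂ)) fun i => (d i : ℂ)) := by
  rw [← fromBlocks_diagonal, toComplex, realDiagonal, diagonal_map (map_zero _),
    diagonal_map (map_zero _), diagonal_map (star_zero _), diagonal_map (star_zero _)]
  have h1 : ∀ c : ℝ, quaternionFst (algebraMap ℝ ℍ[ℝ] c) = c := fun c => rfl
  have h2 : ∀ c : ℝ, quaternionSnd (algebraMap ℝ ℍ[ℝ] c) = 0 := fun c => rfl
  have h3 : ∀ c : ℝ, star (c : ℂ) = c := Complex.conj_ofReal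
  simp only [h1, h2, h3, star_zero, diagonal_zero', neg_zero]

theorem trace_toComplex (X : Matrix κ κ ℍ[ℝ]) : (toComplex X).trace = 2 * (reTrace X : ℂ) := by
  have h : ∀ q : ℍ[ℝ], quaternionFst q + star (quaternionFst q) =
      2 * ((RealScalars.re q : ℝ) : ℂ) := by
    intro q
    rw [← starRingEnd_apply, Complex.add_conj]
    push_cast
    rfl
  simp only [trace, toComplex, reTrace, LinearMap.comp_apply, traceLinearMap_apply, diag_apply,
    Fintype.sum_sum_type, fromBlocks_apply₁₁, fromBlocks_apply₂₂, map_apply]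
  rw [← Finset.sum_add_distrib, map_sum, Complex.ofReal_sum, Finset.mul_sum]
  exact Finset.sum_congr rfl fun i _ => h _

end QuaternionModel

/-! ### Transfer of minimal parabolic subalgebras along isomorphisms -/

section Transfer

variable {g₀ L : Type*} [LieRing g₀] [LieAlgebra ℝ g₀] [LieRing L] [LieAlgebra ℝ L]

/-- The isomorphism `ψ` takes the minimal parabolic subalgebra `P` to `Q`. -/
structure Carries (ψ : g₀ ≃ₗ⁅ℝ⁆ L) (P : MinimalParabolic g₀) (Q : MinimalParabolic L) : Prop where
  a : ∀ X, ψ X ∈ Q.a ↔ X ∈ P.a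
  m : ∀ X, ψ X ∈ Q.m ↔ X ∈ P.m
  n : ∀ X, ψ X ∈ Q.n ↔ X ∈ P.n

theorem nonempty_and_forall_carries [FiniteDimensional ℝ L] (e : g₀ ≃ₗ⁅ℝ⁆ L)
    (Q : MinimalParabolic L) : Nonempty (MinimalParabolic g₀) ∧
      ∀ P : MinimalParabolic g₀, ∃ ψ : g₀ ≃ₗ⁅ℝ⁆ L, Carries ψ P Q := by
  have : FiniteDimensional ℝ g₀ := e.symm.toLinearEquiv.finiteDimensional
  refine ⟨⟨Q.map e.symm⟩, fun P => ?_⟩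
  obtain ⟨ψ, hψ⟩ := P.exists_equiv e Q
  exact ⟨ψ, fun X => (hψ X).1, fun X => (hψ X).2.1, fun X => (hψ X).2.2⟩

namespace Carries

variable {ψ : g₀ ≃ₗ⁅ℝ⁆ L} {P : MinimalParabolic g₀} {Q : MinimalParabolic L}

/-- The induced isomorphism of the subalgebras `m₀`. -/
def mEquiv (h : Carries ψ P Q) : P.m ≃ₗ⁅ℝ⁆ Q.m :=
  subalgebraEquiv ψ.toLieHom ψ.symm (fun X hX => (h.m X).2 hX)
    (fun Y hY => (h.m _).1 (by rwa [LieEquiv.apply_symm_apply]))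
    (fun X _ => ψ.symm_apply_apply X) (fun Y _ => ψ.apply_symm_apply Y)

theorem m_eq_bot (h : Carries ψ P Q) (hm : Q.m = ⊥) : P.m = ⊥ := by
  rw [LieSubalgebra.eq_bot_iff] at hm ⊢
  intro X hX
  exact (lieEquiv_inj ψ).1 ((hm _ ((h.m X).2 hX)).trans (map_zero ψ).symm)

theorem finrank_submodule {V : Submodule ℝ g₀} {W : Submodule ℝ L} (h : ∀ X, ψ X ∈ W ↔ X ∈ V) :
    Module.finrank ℝ V = Module.finrank ℝ W :=
  LinearEquiv.finrank_eq
    { toFun := fun X => (⟨ψ X, (h X).2 X.2⟩ : W)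
      map_add' := fun X Y => Subtype.ext (map_add ψ (X : g₀) Y)
      map_smul' := fun c X => Subtype.ext (map_smul ψ c (X : g₀))
      invFun := fun Y => ⟨ψ.symm Y, (h _).1 (by
        rw [LieEquiv.apply_symm_apply]
        exact Y.2)⟩
      left_inv := fun X => Subtype.ext (ψ.symm_apply_apply (X : g₀))
      right_inv := fun Y => Subtype.ext (ψ.apply_symm_apply (Y : L)) }

theorem finrank_a (h : Carries ψ P Q) : Module.finrank ℝ P.a = Module.finrank ℝ Q.a :=
  finrank_submodule (V := P.a.toSubmodule) (W := Q.a.toSubmodule) h.a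

theorem finrank_n (h : Carries ψ P Q) : Module.finrank ℝ P.n = Module.finrank ℝ Q.n :=
  finrank_submodule h.n

theorem mem_sup_iff {V₁ V₂ : Submodule ℝ g₀} {W₁ W₂ : Submodule ℝ L}
    (h₁ : ∀ X, ψ X ∈ W₁ ↔ X ∈ V₁) (h₂ : ∀ X, ψ X ∈ W₂ ↔ X ∈ V₂) (X : g₀) :
    ψ X ∈ W₁ ⊔ W₂ ↔ X ∈ V₁ ⊔ V₂ := by
  rw [Submodule.mem_sup, Submodule.mem_sup]
  constructor
  · rintro ⟨Y, hY, Z, hZ, h⟩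
    refine ⟨ψ.symm Y, (h₁ _).1 (by rwa [LieEquiv.apply_symm_apply]), ψ.symm Z,
      (h₂ _).1 (by rwa [LieEquiv.apply_symm_apply]), ?_⟩
    rw [← map_add, h, LieEquiv.symm_apply_apply]
  · rintro ⟨Y, hY, Z, hZ, rfl⟩
    exact ⟨ψ Y, (h₁ Y).2 hY, ψ Z, (h₂ Z).2 hZ, (map_add ψ Y Z).symm⟩

theorem m_sup_a (h : Carries ψ P Q) (X : g₀) :
    ψ X ∈ Q.m.toSubmodule ⊔ Q.a.toSubmodule ↔ X ∈ P.m.toSubmodule ⊔ P.a.toSubmodule :=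
  mem_sup_iff h.m h.a X

theorem p (h : Carries ψ P Q) (X : g₀) : ψ X ∈ Q.p ↔ X ∈ P.p :=
  mem_sup_iff h.m_sup_a h.n X

end Carries
end Transfer

/-! ### The images of the regular element in the classical complex Lie algebras -/

section Images

variable {L : Type*} [LieRing L] [LieAlgebra ℝ L] [FiniteDimensional ℝ L]

/-- Type A: `s` gives the entries of the image of the regular element. -/
theorem complexImage_p_slC {N : ℕ} {f : L → slC N} (hf : IsRealForm f) (P : MinimalParabolic L)
    (s : ℕ → ℝ) (hs : ∀ k, s (k + 1) ≤ s k)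
    (hH : (f P.H₀ : Matrix (Fin N) (Fin N) ℂ) = diagonal fun k : Fin N => (s k : ℂ)) {S : Set ℕ}
    (hS : ∀ k, k + 1 < N → (s (k + 1) = s k ↔ k + 1 ∈ S)) :
    complexImage hf.equiv P.p = standardParabolic (diagonalCartan (slC N)) (simpleA N) S := by
  refine (isRootedBy_sl N).complexImage_p hf P ⟨f P.H₀, by
    rw [mem_diagonalCartan, hH]
    exact fun i j hij => diagonal_apply_ne _ hij⟩ rfl (a := fun k => s k - s (k + 1))
    (fun k => sub_nonneg.2 (hs k)) (fun k => ?_) fun k => ?_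
  · rw [simpleA, LinearMap.sub_apply, entry_apply, entry_apply, hH, diagonal_apply_eq,
      diagonal_apply_eq, Complex.ofReal_sub]
  · rw [sub_eq_zero, eq_comm]
    exact hS k (by have := k.2; omega)

theorem complexImage_m_sup_a_slC {N : ℕ} {f : L → slC N} (hf : IsRealForm f)
    (P : MinimalParabolic L) (s : ℕ → ℝ) (hs : ∀ i < N, ∀ j < N, s i = s j → i = j)
    (hH : (f P.H₀ : Matrix (Fin N) (Fin N) ℂ) = diagonal fun k : Fin N => (s k : ℂ)) :
    complexImage hf.equiv (P.m.toSubmodule ⊔ P.a.toSubmodule) =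
      (diagonalCartan (slC N)).toSubmodule := by
  refine complexImage_m_sup_a hf P ⟨f P.H₀, by
    rw [mem_diagonalCartan, hH]
    exact fun i j hij => diagonal_apply_ne _ hij⟩ rfl fun i j hij h => hij ?_
  rw [entry_apply, entry_apply, hH, diagonal_apply_eq, diagonal_apply_eq, Complex.ofReal_inj] at h
  exact Fin.ext (hs i i.2 j j.2 h)

variable {l : ℕ}

theorem symmDiagonal_inl (d : Fin l → ℂ) (k : Fin l) :
    symmDiagonal d (Sum.inl k) (Sum.inl k) = d k := diagonal_apply_eq _ _

/-- The set `S` for type C: its labels `k < l` mark the equal consecutive entries of the image of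
`H₀`, and the label `l` marks a vanishing last entry. -/
theorem complexImage_p_spC {f : L → spC l} (hf : IsRealForm f) (P : MinimalParabolic L)
    (s : ℕ → ℕ) (hs : ∀ k, s (k + 1) ≤ s k)
    (hH : (f P.H₀ : Matrix (Fin l ⊕ Fin l) (Fin l ⊕ Fin l) ℂ) =
      symmDiagonal fun k : Fin l => (s k : ℂ)) {S : Set ℕ}
    (hS : ∀ k, k + 1 < l → (s (k + 1) = s k ↔ k + 1 ∈ S))
    (hS' : ∀ k, k + 1 = l → (s k = 0 ↔ k + 1 ∈ S)) :
    complexImage hf.equiv P.p = standardParabolic (diagonalCartan (spC l)) (simpleC l) S := by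
  refine (isRootedBy_spC l).complexImage_p hf P ⟨f P.H₀, by
    rw [mem_diagonalCartan, hH]
    exact fun i j hij => diagonal_apply_ne _ hij⟩ rfl
    (a := fun k => if (k : ℕ) + 1 < l then (s k : ℝ) - s (k + 1) else 2 * s k)
    (fun k => ?_) (fun k => ?_) fun k => ?_
  · split_ifs
    · exact sub_nonneg.2 (Nat.cast_le.2 (hs k))
    · positivity
  · rw [simpleC]
    split_ifs with h
    · rw [LinearMap.sub_apply, entry_apply, entry_apply, hH, symmDiagonal_inl, symmDiagonal_inl]
      simp
    · rw [LinearMap.smul_apply, entry_apply, hH, symmDiagonal_inl]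
      simp
  · split_ifs with h
    · rw [sub_eq_zero, Nat.cast_inj, eq_comm]
      exact hS k h
    · rw [mul_eq_zero_iff_left two_ne_zero, Nat.cast_eq_zero]
      exact hS' k (by have := k.2; omega)

/-- The set `S` for type D. The last simple root is the sum of the last two entries of the image of
`H₀`; as the entries are nonnegative and decreasing, it vanishes only if both are zero. -/
theorem complexImage_p_soEvenC {f : L → soEvenC l} (hf : IsRealForm f) (P : MinimalParabolic L)
    (s : ℕ → ℕ) (hs : ∀ k, s (k + 1) ≤ s k)
    (hH : (f P.H₀ : Matrix (Fin l ⊕ Fin l) (Fin l ⊕ Fin l) ℂ) =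
      symmDiagonal fun k : Fin l => (s k : ℂ)) {S : Set ℕ}
    (hS : ∀ k, k + 1 < l → (s (k + 1) = s k ↔ k + 1 ∈ S))
    (hS' : ∀ k, k + 1 = l → (s (k - 1) + s k = 0 ↔ k + 1 ∈ S)) :
    complexImage hf.equiv P.p =
      standardParabolic (diagonalCartan (soEvenC l)) (simpleD l) S := by
  refine (isRootedBy_soEvenC l).complexImage_p hf P ⟨f P.H₀, by
    rw [mem_diagonalCartan, hH]
    exact fun i j hij => diagonal_apply_ne _ hij⟩ rfl
    (a := fun k => if (k : ℕ) + 1 < l then (s k : ℝ) - s (k + 1) else s (k - 1) + s k)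
    (fun k => ?_) (fun k => ?_) fun k => ?_
  · split_ifs
    · exact sub_nonneg.2 (Nat.cast_le.2 (hs k))
    · positivity
  · rw [simpleD]
    split_ifs with h
    · rw [LinearMap.sub_apply, entry_apply, entry_apply, hH, symmDiagonal_inl, symmDiagonal_inl]
      simp
    · rw [LinearMap.add_apply, entry_apply, entry_apply, hH, symmDiagonal_inl, symmDiagonal_inl]
      simp
  · split_ifs with h
    · rw [sub_eq_zero, Nat.cast_inj, eq_comm]
      exact hS k h
    · rw [← Nat.cast_add, Nat.cast_eq_zero]
      exact hS' k (by have := k.2; omega)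

/-- The set `S` for type B: its labels `k < l` mark the equal consecutive entries of the image of
`H₀`, and the label `l` marks a vanishing last entry. -/
theorem complexImage_p_soOddC {f : L → soOddC l} (hf : IsRealForm f) (P : MinimalParabolic L)
    (s : ℕ → ℕ) (hs : ∀ k, s (k + 1) ≤ s k)
    (hH : (f P.H₀ : Matrix (Unit ⊕ Fin l ⊕ Fin l) (Unit ⊕ Fin l ⊕ Fin l) ℂ) =
      fromBlocks 0 0 0 (symmDiagonal fun k : Fin l => (s k : ℂ))) {S : Set ℕ}
    (hS : ∀ k, k + 1 < l → (s (k + 1) = s k ↔ k + 1 ∈ S))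
    (hS' : ∀ k, k + 1 = l → (s k = 0 ↔ k + 1 ∈ S)) :
    complexImage hf.equiv P.p = standardParabolic (diagonalCartan (soOddC l)) (simpleB l) S := by
  refine (isRootedBy_soOddC l).complexImage_p hf P ⟨f P.H₀, by
    change Matrix.IsDiag _
    rw [hH]
    exact isDiag_fromBlocks_symmDiagonal _⟩ rfl
    (a := fun k => if (k : ℕ) + 1 < l then (s k : ℝ) - s (k + 1) else s k)
    (fun k => ?_) (fun k => ?_) fun k => ?_
  · split_ifs
    · exact sub_nonneg.2 (Nat.cast_le.2 (hs k))
    · positivity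
  · rw [simpleB]
    split_ifs with h
    · rw [LinearMap.sub_apply, entry_apply, entry_apply, hH, fromBlocks_apply₂₂,
        fromBlocks_apply₂₂, symmDiagonal_inl, symmDiagonal_inl]
      simp
    · rw [entry_apply, hH, fromBlocks_apply₂₂, symmDiagonal_inl]
      simp
  · split_ifs with h
    · rw [sub_eq_zero, Nat.cast_inj, eq_comm]
      exact hS k h
    · rw [Nat.cast_eq_zero]
      exact hS' k (by have := k.2; omega)

theorem symmDiagonal_apply_ne {s : ℕ → ℕ} (hs : ∀ i < l, ∀ j < l, s i = s j → i = j)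
    (hs' : ∀ i < l, 0 < s i) {i j : Fin l ⊕ Fin l} (hij : i ≠ j) :
    symmDiagonal (fun k : Fin l => (s k : ℂ)) i i ≠
      symmDiagonal (fun k : Fin l => (s k : ℂ)) j j := by
  have h1 : ∀ i j : Fin l, ((s i : ℂ) = (s j : ℂ)) → i = j := fun i j h =>
    Fin.ext (hs i i.2 j j.2 (Nat.cast_injective h))
  have h2 : ∀ i j : Fin l, ((s i : ℂ) ≠ -(s j : ℂ)) := fun i j h => by
    have h3 : ((s i + s j : ℕ) : ℂ) = 0 := by
      push_cast
      linear_combination h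
    have h4 := Nat.cast_eq_zero.1 h3
    have h5 := hs' i i.2
    omega
  rcases i with i | i <;> rcases j with j | j <;>
    simp only [symmDiagonal, diagonal_apply_eq, Sum.elim_inl, Sum.elim_inr, ne_eq, neg_inj]
  · exact fun h => hij (by rw [h1 i j h])
  · exact h2 i j
  · exact fun h => h2 j i h.symm
  · exact fun h => hij (by rw [h1 i j h])

theorem complexImage_m_sup_a_of_symmDiagonal
    {g : LieSubalgebra ℂ (Matrix (Fin l ⊕ Fin l) (Fin l ⊕ Fin l) ℂ)} {f : L → g}
    (hf : IsRealForm f) (P : MinimalParabolic L) {s : ℕ → ℕ}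
    (hs : ∀ i < l, ∀ j < l, s i = s j → i = j) (hs' : ∀ i < l, 0 < s i)
    (hH : (f P.H₀ : Matrix (Fin l ⊕ Fin l) (Fin l ⊕ Fin l) ℂ) =
      symmDiagonal fun k : Fin l => (s k : ℂ)) :
    complexImage hf.equiv (P.m.toSubmodule ⊔ P.a.toSubmodule) =
      (diagonalCartan g).toSubmodule := by
  refine complexImage_m_sup_a hf P ⟨f P.H₀, by
    rw [mem_diagonalCartan, hH]
    exact fun i j hij => diagonal_apply_ne _ hij⟩ rfl fun i j hij => ?_
  rw [entry_apply, entry_apply, hH]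
  exact symmDiagonal_apply_ne hs hs' hij

theorem complexImage_m_sup_a_soOddC {f : L → soOddC l} (hf : IsRealForm f)
    (P : MinimalParabolic L) {s : ℕ → ℕ}
    (hs : ∀ i < l, ∀ j < l, s i = s j → i = j) (hs' : ∀ i < l, 0 < s i)
    (hH : (f P.H₀ : Matrix (Unit ⊕ Fin l ⊕ Fin l) (Unit ⊕ Fin l ⊕ Fin l) ℂ) =
      fromBlocks 0 0 0 (symmDiagonal fun k : Fin l => (s k : ℂ))) :
    complexImage hf.equiv (P.m.toSubmodule ⊔ P.a.toSubmodule) =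
      (diagonalCartan (soOddC l)).toSubmodule := by
  refine complexImage_m_sup_a hf P ⟨f P.H₀, by
    change Matrix.IsDiag _
    rw [hH]
    exact isDiag_fromBlocks_symmDiagonal _⟩ rfl fun i j hij => ?_
  have h0 : ∀ i : Fin l ⊕ Fin l, symmDiagonal (fun k : Fin l => (s k : ℂ)) i i ≠ 0 := by
    rintro (i | i) <;> simp only [symmDiagonal, diagonal_apply_eq, Sum.elim_inl, Sum.elim_inr,
      ne_eq, neg_eq_zero, Nat.cast_eq_zero] <;> exact (hs' i i.2).ne'
  rw [entry_apply, entry_apply, hH]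
  rcases i with i | i <;> rcases j with j | j
  · exact absurd rfl hij
  · exact (h0 j).symm
  · exact h0 i
  · exact symmDiagonal_apply_ne hs hs' fun h => hij (by rw [h])

end Images

section TransferOfImages

variable {g₀ L g : Type*} [LieRing g₀] [LieAlgebra ℝ g₀] [LieRing L] [LieAlgebra ℝ L]
  [FiniteDimensional ℝ L] [LieRing g] [LieAlgebra ℂ g] {f : L → g}

theorem Carries.exists_complexImage {ψ : g₀ ≃ₗ⁅ℝ⁆ L} {P : MinimalParabolic g₀}
    {Q : MinimalParabolic L} (h : Carries ψ P Q) (hf : IsRealForm f) : ∃ φ : ℂ ⊗[ℝ] g₀ ≃ₗ⁅ℂ⁆ g,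
      complexImage φ P.p = complexImage hf.equiv Q.p ∧
      complexImage φ (P.m.toSubmodule ⊔ P.a.toSubmodule) =
        complexImage hf.equiv (Q.m.toSubmodule ⊔ Q.a.toSubmodule) :=
  ⟨(hf.comp ψ).equiv, IsRealForm.complexImage_comp hf ψ h.p,
    IsRealForm.complexImage_comp hf ψ h.m_sup_a⟩

/-- A property of one minimal parabolic subalgebra of an isomorphic Lie algebra is one of all
minimal parabolic subalgebras. -/
theorem forall_of_realForm (e : g₀ ≃ₗ⁅ℝ⁆ L) (Q : MinimalParabolic L) (hf : IsRealForm f)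
    {M : Type*} [LieRing M] [LieAlgebra ℝ M] {k k' : ℕ} {V W : Submodule ℂ g}
    (hm : Nonempty (Q.m ≃ₗ⁅ℝ⁆ M)) (ha : Module.finrank ℝ Q.a = k) (hn : Module.finrank ℝ Q.n = k')
    (hV : complexImage hf.equiv Q.p = V)
    (hW : complexImage hf.equiv (Q.m.toSubmodule ⊔ Q.a.toSubmodule) = W) :
    Nonempty (MinimalParabolic g₀) ∧ ∀ P : MinimalParabolic g₀,
      Nonempty (P.m ≃ₗ⁅ℝ⁆ M) ∧ Module.finrank ℝ P.a = k ∧ Module.finrank ℝ P.n = k' ∧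
      ∃ φ : ℂ ⊗[ℝ] g₀ ≃ₗ⁅ℂ⁆ g, complexImage φ P.p = V ∧
        complexImage φ (P.m.toSubmodule ⊔ P.a.toSubmodule) = W := by
  obtain ⟨h1, h2⟩ := nonempty_and_forall_carries e Q
  refine ⟨h1, fun P => ?_⟩
  obtain ⟨ψ, hψ⟩ := h2 P
  obtain ⟨φ, hφ, hφ'⟩ := hψ.exists_complexImage hf
  exact ⟨hm.map fun i => hψ.mEquiv.trans i, hψ.finrank_a.trans ha, hψ.finrank_n.trans hn, φ,
    hφ.trans hV, hφ'.trans hW⟩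

/-- The variant of `forall_of_realForm` for split real forms. -/
theorem forall_of_realForm_of_m_eq_bot (e : g₀ ≃ₗ⁅ℝ⁆ L) (Q : MinimalParabolic L)
    (hf : IsRealForm f) {V W : Submodule ℂ g} (hm : Q.m = ⊥) (hV : complexImage hf.equiv Q.p = V)
    (hW : complexImage hf.equiv (Q.m.toSubmodule ⊔ Q.a.toSubmodule) = W) :
    Nonempty (MinimalParabolic g₀) ∧ ∀ P : MinimalParabolic g₀, P.m = ⊥ ∧
      ∃ φ : ℂ ⊗[ℝ] g₀ ≃ₗ⁅ℂ⁆ g, complexImage φ P.p = V ∧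
        complexImage φ P.a.toSubmodule = W := by
  obtain ⟨h1, h2⟩ := nonempty_and_forall_carries e Q
  refine ⟨h1, fun P => ?_⟩
  obtain ⟨ψ, hψ⟩ := h2 P
  obtain ⟨φ, hφ, hφ'⟩ := hψ.exists_complexImage hf
  have h3 := hψ.m_eq_bot hm
  refine ⟨h3, φ, hφ.trans hV, ?_⟩
  rw [h3, LieSubalgebra.bot_toSubmodule, bot_sup_eq] at hφ'
  exact hφ'.trans hW

end TransferOfImages

/-! ### The full Lie algebra of a sum of hyperbolic planes and an anisotropic form -/

section Full

variable {F : Type*} [Ring F] [StarRing F] [Algebra ℝ F] [RealScalars F] [FiniteDimensional ℝ F]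
  {A : Type*} [Fintype A] [DecidableEq A] {r : ℕ} {K : Matrix A A F} {ε : ℝ}

theorem conjTranspose_wittForm (hε : ε * ε = 1) (hK : Kᴴ = ε • K) :
    (wittForm K ε r)ᴴ = ε • wittForm K ε r := by
  simp only [wittForm, fromBlocks_conjTranspose, conjTranspose_zero, conjTranspose_real_smul,
    conjTranspose_one, fromBlocks_smul, hK, smul_zero, smul_smul, hε, one_smul]

theorem two_mul_choose_two (n : ℕ) : (2 : ℤ) * ((n * (n - 1) / 2 : ℕ) : ℤ) = n * (n - 1) := by
  have h1 : 2 * (n * (n - 1) / 2) = n * (n - 1) :=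
    Nat.two_mul_div_two_of_even (Nat.even_mul_pred_self n)
  have h2 : ((2 * (n * (n - 1) / 2) : ℕ) : ℤ) = ((n * (n - 1) : ℕ) : ℤ) := by rw [h1]
  rcases n with _ | n
  · simp
  · simpa using h2

/-- The dimension of `n₀`, as half of `dim g₀ - dim m₀ - dim a₀`. It depends on the scalars only
through the dimensions of `F` and of the skew scalars. -/
theorem finrank_n_of_full (Q : MinimalParabolic (unitaryAlgebra (wittForm K ε r)))
    (hε : ε * ε = 1) (hK : K * K = ε • (1 : Matrix A A F)) (hK' : Kᴴ = ε • K)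
    (hF : Module.finrank ℝ (skewScalars F 1) + 1 = Module.finrank ℝ F)
    (hm : Nonempty (Q.m ≃ₗ⁅ℝ⁆
      (unitaryAlgebra K × (Fin r → unitaryAlgebra (1 : Matrix (Fin 1) (Fin 1) F)))))
    (ha : Module.finrank ℝ Q.a = r) :
    Module.finrank ℝ Q.n = r * Module.finrank ℝ (skewScalars F ε) +
      (r * (r - 1) + r * Fintype.card A) * Module.finrank ℝ F := by
  have h1 := Q.finrank_eq
  obtain ⟨e⟩ := hm
  have h2 := e.toLinearEquiv.finrank_eq
  rw [Module.finrank_prod, Module.finrank_pi_fintype, Finset.sum_const, Finset.card_univ,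
    Fintype.card_fin, smul_eq_mul, finrank_unitaryAlgebra hε hK hK',
    finrank_unitaryAlgebra (one_mul 1) (by rw [one_smul, one_mul])
      (by rw [one_smul, conjTranspose_one])] at h2
  rw [h2, ha, finrank_unitaryAlgebra hε (wittForm_mul_self hK)
    (conjTranspose_wittForm hε hK')] at h1
  simp only [Fintype.card_sum, Fintype.card_fin] at h1
  generalize Module.finrank ℝ Q.n = n at h1 ⊢
  generalize Module.finrank ℝ (skewScalars F ε) = s at h1 ⊢
  rw [← hF] at h1 ⊢
  generalize Module.finrank ℝ (skewScalars F 1) = s' at h1 ⊢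
  generalize Fintype.card A = a at h1 ⊢
  have h3 := two_mul_choose_two (a + (r + r))
  have h4 := two_mul_choose_two a
  have h5 : ((r * (r - 1) : ℕ) : ℤ) = r * (r - 1) := by
    rcases r with _ | r <;> simp
  generalize (a + (r + r)) * (a + (r + r) - 1) / 2 = x at h1 h3
  generalize a * (a - 1) / 2 = y at h1 h4
  norm_num at h1
  have h6 : (((a + (r + r)) * s + x * (s' + 1) : ℕ) : ℤ) =
      ((a * s + y * (s' + 1) + r * s' + r + 2 * n : ℕ) : ℤ) := by exact_mod_cast h1
  have h7 : ((n : ℕ) : ℤ) = ((r * s + (r * (r - 1) + r * a) * (s' + 1) : ℕ) : ℤ) := by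
    rw [Nat.cast_add, Nat.cast_mul (r * (r - 1) + r * a), Nat.cast_add (r * (r - 1)), h5]
    push_cast at h3 h4 h6 ⊢
    refine mul_left_cancel₀ (four_ne_zero (α := ℤ)) ?_
    linear_combination (-2 : ℤ) * h6 + (s' + 1 : ℤ) * (h3 - h4)
  exact_mod_cast h7

variable {ι ι' : Type*} [Fintype ι] [DecidableEq ι] [Fintype ι'] [DecidableEq ι']
  {ρ : Matrix (A ⊕ (Fin r ⊕ Fin r)) (A ⊕ (Fin r ⊕ Fin r)) F → Matrix ι ι ℂ} {W : Matrix ι ι ℂ}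

/-- The minimal parabolic subalgebra of the Lie algebra of a sum of `r` hyperbolic planes and an
anisotropic form `K`, and the corresponding real form of the complex Lie algebra `g` of the form
`J'`. -/
theorem exists_parabolic_realForm (hρ : IsComplexModel ρ W) (hε : ε * ε = 1)
    (hK : K * K = ε • (1 : Matrix A A F)) (hK' : Kᴴ = ε • K)
    (hskew : ∀ Y ∈ unitaryAlgebra K, Yᴴ = -Y)
    (hF : Module.finrank ℝ (skewScalars F 1) + 1 = Module.finrank ℝ F)
    {J' : Matrix ι' ι' ℂ} {g : LieSubalgebra ℂ (Matrix ι' ι' ℂ)}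
    (hg : ∀ X, X ∈ g ↔ Xᵀ * J' + J' * X = 0)
    (hcenter : ∀ Y : g, (∀ Z : g, ⁅Y, Z⁆ = 0) → Y = 0)
    {T : Type*} {d : T → ι → ℂ} {d' : T → ι' → ℂ}
    (hQ : FormEquiv (W * ρ (wittForm K ε r)) d J' d') (t₀ : T)
    (hd : ρ (realDiagonal F (wittDiagonal A (chamberPoint r))) = diagonal (d t₀)) :
    ∃ (Q : MinimalParabolic (unitaryAlgebra (wittForm K ε r)))
      (f : unitaryAlgebra (wittForm K ε r) → g), IsRealForm f ∧
      (∀ (X : unitaryAlgebra (wittForm K ε r)) t,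
        ρ X = diagonal (d t) → (f X : Matrix ι' ι' ℂ) = diagonal (d' t)) ∧
      (f Q.H₀ : Matrix ι' ι' ℂ) = diagonal (d' t₀) ∧
      Nonempty (Q.m ≃ₗ⁅ℝ⁆
        (unitaryAlgebra K × (Fin r → unitaryAlgebra (1 : Matrix (Fin 1) (Fin 1) F)))) ∧
      Module.finrank ℝ Q.a = r ∧
      Module.finrank ℝ Q.n = r * Module.finrank ℝ (skewScalars F ε) +
        (r * (r - 1) + r * Fintype.card A) * Module.finrank ℝ F ∧
      ∀ X : unitaryAlgebra (wittForm K ε r), X ∈ Q.m ↔ ∃ (Y : Matrix A A F) (x : Fin r → F),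
        Y ∈ unitaryAlgebra K ∧ (∀ i, star (x i) = -x i) ∧
        (X : Matrix (A ⊕ (Fin r ⊕ Fin r)) (A ⊕ (Fin r ⊕ Fin r)) F) = wittBlock Y x x := by
  obtain ⟨f, hf, hfd⟩ := hρ.exists_isRealForm (wittForm K ε r) hg hQ
  have hL := isWittSubalgebra_unitaryAlgebra hε hK hskew r
  have hc := fun X => hf.center_eq_zero hcenter X
  have hm : Nonempty ((hL.parabolic hc).m ≃ₗ⁅ℝ⁆
      (unitaryAlgebra K × (Fin r → unitaryAlgebra (1 : Matrix (Fin 1) (Fin 1) F)))) :=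
    ⟨hL.mEquiv hc⟩
  have ha := hL.finrank_a hc
  exact ⟨hL.parabolic hc, f, hf, hfd, hfd _ _ hd, hm, ha,
    finrank_n_of_full _ hε hK hK' hF hm ha, hL.mem_parabolic_m hc⟩

end Full

/-! ### Indefinite forms as sums of hyperbolic planes and definite forms -/

section Indefinite

variable (F : Type*) [Ring F] [StarRing F] [Algebra ℝ F] [RealScalars F] {A : Type*} [Fintype A]
  [DecidableEq A] {p r : ℕ}

/-- An indefinite diagonal form is the sum of hyperbolic planes, spanned by `e + f` and
`(e - f) / 2` for vectors `e`, `f` of lengths `1` and `-1`, and a definite form. -/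
theorem exists_indefinite_eq_wittForm (σ : Fin p ≃ A ⊕ Fin r) :
    ∃ (S : Matrix (Fin p ⊕ Fin r) (A ⊕ (Fin r ⊕ Fin r)) F)
      (S' : Matrix (A ⊕ (Fin r ⊕ Fin r)) (Fin p ⊕ Fin r) F), S * S' = 1 ∧ S' * S = 1 ∧
      Sᴴ * (diagonal (Sum.elim (fun _ => 1) fun _ => -1) :
        Matrix (Fin p ⊕ Fin r) (Fin p ⊕ Fin r) F) * S = wittForm (1 : Matrix A A F) 1 r := by
  let τ : Fin p ⊕ Fin r ≃ A ⊕ (Fin r ⊕ Fin r) :=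
    (σ.sumCongr (Equiv.refl (Fin r))).trans (Equiv.sumAssoc _ _ _)
  let c : F := (1 / 2 : ℝ) • 1
  have hc : c + c = 1 := by
    rw [← add_smul, show (1 / 2 + 1 / 2 : ℝ) = 1 by norm_num, one_smul]
  have hc' : star c = c := by rw [RealScalars.star_real_smul, star_one]
  let T : Matrix (A ⊕ (Fin r ⊕ Fin r)) (A ⊕ (Fin r ⊕ Fin r)) F :=
    fromBlocks 1 0 0 (scalarBlocks (Fin r) 1 c 1 (-c))
  let T' : Matrix (A ⊕ (Fin r ⊕ Fin r)) (A ⊕ (Fin r ⊕ Fin r)) F :=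
    fromBlocks 1 0 0 (scalarBlocks (Fin r) c c 1 (-1))
  have hT : T * T' = 1 := by
    simp only [T, T', fromBlocks_multiply, scalarBlocks_mul, Matrix.mul_zero, Matrix.zero_mul,
      add_zero, zero_add, Matrix.mul_one]
    rw [show (1 : F) * c + c * 1 = 1 by rw [one_mul, mul_one, hc],
      show (1 : F) * c + c * -1 = 0 by noncomm_ring, show (1 : F) * c + -c * 1 = 0 by noncomm_ring,
      show (1 : F) * c + -c * -1 = 1 by rw [one_mul, neg_mul_neg, mul_one, hc],
      scalarBlocks_one, fromBlocks_one]
  have hT' : T' * T = 1 := by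
    simp only [T, T', fromBlocks_multiply, scalarBlocks_mul, Matrix.mul_zero, Matrix.zero_mul,
      add_zero, zero_add, Matrix.mul_one]
    rw [show c * 1 + c * 1 = 1 by rw [mul_one, hc], show c * c + c * -c = 0 by noncomm_ring,
      show (1 : F) * 1 + -1 * 1 = 0 by noncomm_ring,
      show (1 : F) * c + -1 * -c = 1 by rw [one_mul, neg_mul_neg, one_mul, hc],
      scalarBlocks_one, fromBlocks_one]
  refine ⟨T.submatrix τ id, T'.submatrix id τ, ?_, ?_, ?_⟩
  · rw [← submatrix_mul _ _ _ id _ Function.bijective_id, hT]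
    simp
  · rw [submatrix_mul_equiv, hT']
    simp
  · have h1 : (diagonal (Sum.elim (fun _ => 1) fun _ => -1) : Matrix (Fin p ⊕ Fin r) _ F) =
        (fromBlocks (1 : Matrix A A F) 0 0 (scalarBlocks (Fin r) 1 0 0 (-1))).submatrix τ τ := by
      have h2 : fromBlocks (1 : Matrix A A F) 0 0 (scalarBlocks (Fin r) 1 0 0 (-1)) =
          diagonal (Sum.elim (fun _ => 1) (Sum.elim (fun _ => 1) fun _ => -1)) := by
        rw [← fromBlocks_diagonal, ← fromBlocks_diagonal, scalarBlocks, diagonal_one, diagonal_one,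
          diagonal_zero']
      rw [h2, submatrix_diagonal_equiv]
      congr 1
      ext (i | i)
      · simp only [Sum.elim_inl, Function.comp_apply, τ, Equiv.trans_apply, Equiv.sumCongr_apply,
          Sum.map_inl]
        rcases σ i with j | j <;> rfl
      · rfl
    rw [h1, conjTranspose_submatrix, submatrix_mul_equiv, submatrix_mul_equiv, submatrix_id_id]
    simp only [T, fromBlocks_conjTranspose, scalarBlocks_conjTranspose, fromBlocks_multiply,
      scalarBlocks_mul, Matrix.mul_zero, Matrix.zero_mul, add_zero, zero_add, conjTranspose_zero,
      conjTranspose_one, Matrix.mul_one, hc', star_one, star_neg, mul_one, mul_zero, one_mul,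
      mul_neg, neg_mul, neg_neg, hc, add_neg_cancel]
    rw [wittForm, one_smul, scalarBlocks, diagonal_one, diagonal_zero']

end Indefinite

/-! ### The Lie algebras `so(p, r)` and `sp(n, ℝ)` -/

section Permutation

variable {F : Type*} [Ring F] [StarRing F] [Algebra ℝ F] [RealScalars F] {κ ι : Type*} [Fintype κ]
  [DecidableEq κ] [Fintype ι] [DecidableEq ι]

theorem submatrix_one_mul_submatrix_one (σ : ι ≃ κ) :
    (1 : Matrix κ κ F).submatrix id σ * (1 : Matrix κ κ F).submatrix σ id = 1 := by
  rw [submatrix_mul_equiv, one_mul, submatrix_id_id]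

theorem submatrix_one_mul_submatrix_one' (σ : ι ≃ κ) :
    (1 : Matrix κ κ F).submatrix σ id * (1 : Matrix κ κ F).submatrix id σ = 1 := by
  rw [← submatrix_mul _ _ _ id _ Function.bijective_id, one_mul, submatrix_one_equiv]

theorem conjTranspose_submatrix_one_mul (σ : ι ≃ κ) (K : Matrix κ κ F) :
    ((1 : Matrix κ κ F).submatrix id σ)ᴴ * K * (1 : Matrix κ κ F).submatrix id σ =
      K.submatrix σ σ := by
  rw [conjTranspose_submatrix, conjTranspose_one, ← submatrix_id_id K,
    ← submatrix_mul _ _ _ id _ Function.bijective_id, one_mul,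
    ← submatrix_mul _ _ _ id _ Function.bijective_id, mul_one, submatrix_id_id]

/-- A permutation of the basis. -/
def submatrixEquiv (σ : ι ≃ κ) {K : Matrix κ κ F} {K' : Matrix ι ι F}
    (hK : K.submatrix σ σ = K') : unitaryAlgebra K ≃ₗ⁅ℝ⁆ unitaryAlgebra K' :=
  conjEquiv (submatrix_one_mul_submatrix_one σ) (submatrix_one_mul_submatrix_one' σ) _ _
    (conj_mem_unitaryAlgebra (submatrix_one_mul_submatrix_one σ)
      ((conjTranspose_submatrix_one_mul σ K).trans hK))

end Permutation

section Real

theorem mem_unitaryAlgebra_real {κ : Type*} [Fintype κ] [DecidableEq κ] {K X : Matrix κ κ ℝ} :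
    X ∈ unitaryAlgebra K ↔ X ∈ skewAdjointMatricesLieSubalgebra K := by
  rw [mem_unitaryAlgebra, mem_skewAdjoint, conjTranspose_eq_transpose_of_trivial]

theorem unitaryAlgebra_real {κ : Type*} [Fintype κ] [DecidableEq κ] (K : Matrix κ κ ℝ) :
    unitaryAlgebra K = skewAdjointMatricesLieSubalgebra K :=
  LieSubalgebra.ext _ _ fun _ => mem_unitaryAlgebra_real

variable {p r m l : ℕ}

theorem finrank_unitaryAlgebra_one (A F : Type*) [Fintype A] [DecidableEq A] [Ring F] [StarRing F]
    [Algebra ℝ F] [RealScalars F] [FiniteDimensional ℝ F] :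
    Module.finrank ℝ (unitaryAlgebra (1 : Matrix A A F)) =
      Fintype.card A * Module.finrank ℝ (skewScalars F 1) +
        Fintype.card A * (Fintype.card A - 1) / 2 * Module.finrank ℝ F :=
  finrank_unitaryAlgebra (one_mul 1) (by rw [one_smul, one_mul])
    (by rw [one_smul, conjTranspose_one])

theorem subsingleton_unitaryAlgebra_one_real {A : Type*} [Fintype A] [DecidableEq A]
    (h : Fintype.card A ≤ 1) : Subsingleton (unitaryAlgebra (1 : Matrix A A ℝ)) := by
  apply (Module.finrank_zero_iff (R := ℝ)).1
  rw [finrank_unitaryAlgebra_one, finrank_skewScalars_real]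
  interval_cases Fintype.card A <;> simp

theorem skew_of_mem_unitaryAlgebra_one {F : Type*} [Ring F] [StarRing F] {A : Type*} [Fintype A]
    [DecidableEq A] [Algebra ℝ F] [RealScalars F] :
    ∀ Y ∈ unitaryAlgebra (1 : Matrix A A F), Yᴴ = -Y :=
  fun _ hY => mem_unitaryAlgebra_one.1 hY

theorem map_ofReal_wittForm {A : Type*} [DecidableEq A] (K : Matrix A A ℝ) (ε : ℝ) :
    (wittForm K ε r).map (fun x : ℝ => (x : ℂ)) =
      fromBlocks (K.map fun x : ℝ => (x : ℂ)) 0 0 (hyperbolicForm (ε : ℂ) (Fin r)) := by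
  ext (i | i | i) (j | j | j) <;> simp [wittForm, hyperbolicForm, one_apply] <;>
    split_ifs <;> simp

theorem map_ofReal_wittDiagonal (A : Type*) [Fintype A] [DecidableEq A] (t : Fin r → ℝ) :
    (realDiagonal ℝ (wittDiagonal A t)).map (fun x : ℝ => (x : ℂ)) =
      diagonal (Sum.elim 0 (Sum.elim (fun i => (t i : ℂ)) fun i => -(t i : ℂ))) := by
  rw [map_realDiagonal]
  congr 1
  ext (i | i | i) <;> simp [wittDiagonal]

theorem finrank_skewScalars_real_add_one :
    Module.finrank ℝ (skewScalars ℝ 1) + 1 = Module.finrank ℝ ℝ := by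
  rw [finrank_skewScalars_real, Module.finrank_self]

/-- The identification of the indices of the hyperbolic planes and of the pairs of vectors of a
definite form. -/
def sumEquiv (h : r + m = l) : Fin r ⊕ Fin m ≃ Fin l := finSumFinEquiv.trans (finCongr h)

theorem sumEquiv_inl (h : r + m = l) (i : Fin r) : (sumEquiv h (Sum.inl i) : ℕ) = i := by
  simp [sumEquiv]

theorem sumEquiv_inr (h : r + m = l) (i : Fin m) : (sumEquiv h (Sum.inr i) : ℕ) = r + i := by
  simp [sumEquiv]

theorem nonempty_soPR_equiv {A : Type*} [Fintype A] [DecidableEq A]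
    (hA : Fintype.card A + r = p) :
    Nonempty (soPR p r ≃ₗ⁅ℝ⁆ unitaryAlgebra (wittForm (1 : Matrix A A ℝ) 1 r)) := by
  obtain ⟨S, S', h, h', hS⟩ := exists_indefinite_eq_wittForm ℝ
    (Fintype.equivOfCardEq (α := Fin p) (β := A ⊕ Fin r) (by simp [hA]))
  exact ⟨conjEquiv h h' _ _ fun X =>
    (conj_mem_unitaryAlgebra h hS X).trans mem_unitaryAlgebra_real⟩

theorem nonempty_spR_equiv (r : ℕ) :
    Nonempty (spR r ≃ₗ⁅ℝ⁆ unitaryAlgebra (wittForm (1 : Matrix (Fin 0 ⊕ Fin 0) _ ℝ) (-1) r)) := by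
  have h1 : ∀ X, X ∈ unitaryAlgebra (-Matrix.J (Fin r) ℝ) ↔ X ∈ spR r := fun X => by
    rw [mem_unitaryAlgebra, mul_neg, neg_mul, ← neg_add, neg_eq_zero]
    exact mem_unitaryAlgebra_real
  have e1 : spR r ≃ₗ⁅ℝ⁆ unitaryAlgebra (-Matrix.J (Fin r) ℝ) :=
    LieEquiv.ofEq _ _ (Set.ext fun X => (h1 X).symm)
  refine ⟨e1.trans (submatrixEquiv (Equiv.emptySum (Fin 0 ⊕ Fin 0) (Fin r ⊕ Fin r)) ?_)⟩
  ext (i | i | i) (j | j | j)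
  · exact isEmptyElim i
  · exact isEmptyElim i
  · exact isEmptyElim i
  · exact isEmptyElim j
  all_goals first | exact isEmptyElim j | simp [Matrix.J, wittForm]

/-- After complexification, the definite part of even dimension of the form of `so(p, r)` splits
into `m` hyperbolic planes, on which `H₀` is zero. -/
theorem formEquiv_even (h : r + m = l) : FormEquiv
    ((1 : Matrix ((Fin m ⊕ Fin m) ⊕ (Fin r ⊕ Fin r)) _ ℂ) *
      (wittForm (1 : Matrix (Fin m ⊕ Fin m) _ ℝ) 1 r).map (fun x : ℝ => (x : ℂ)))
    (fun _ : Unit => Sum.elim 0 (Sum.elim (fun i => (chamberPoint r i : ℂ))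
      fun i => -(chamberPoint r i : ℂ)))
    (LieAlgebra.Orthogonal.JD (Fin l) ℂ)
    (fun _ : Unit => Sum.elim (fun k : Fin l => ((r - k : ℕ) : ℂ))
      fun k => -((r - k : ℕ) : ℂ)) := by
  have h1 := formEquiv_hyperbolicForm (formEquiv_one Unit (Fin m)) (sumEquiv h)
    (t := fun _ i => (chamberPoint r i : ℂ)) (s := fun _ k => ((r - k : ℕ) : ℂ))
    (fun _ i => by rw [sumEquiv_inl, chamberPoint, Complex.ofReal_natCast])
    (fun _ i => by rw [sumEquiv_inr, Nat.sub_eq_zero_of_le (by omega), Nat.cast_zero])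
  rw [one_mul, map_ofReal_wittForm, Matrix.map_one _ Complex.ofReal_zero Complex.ofReal_one,
    Complex.ofReal_one]
  rwa [show hyperbolicForm 1 (Fin l) = LieAlgebra.Orthogonal.JD (Fin l) ℂ by
    rw [hyperbolicForm, one_smul, LieAlgebra.Orthogonal.JD]] at h1

/-- The analogue of `formEquiv_even` for a definite part of odd dimension. -/
theorem formEquiv_odd (h : r + m = l) : FormEquiv
    ((1 : Matrix ((Unit ⊕ (Fin m ⊕ Fin m)) ⊕ (Fin r ⊕ Fin r)) _ ℂ) *
      (wittForm (1 : Matrix (Unit ⊕ (Fin m ⊕ Fin m)) _ ℝ) 1 r).map (fun x : ℝ => (x : ℂ)))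
    (fun _ : Unit => Sum.elim 0 (Sum.elim (fun i => (chamberPoint r i : ℂ))
      fun i => -(chamberPoint r i : ℂ)))
    (LieAlgebra.Orthogonal.JB (Fin l) ℂ)
    (fun _ : Unit => Sum.elim 0
      (Sum.elim (fun k : Fin l => ((r - k : ℕ) : ℂ)) fun k => -((r - k : ℕ) : ℂ))) := by
  have h1 := formEquiv_JB (formEquiv_one_unit Unit (Fin m)) (sumEquiv h)
    (t := fun _ i => (chamberPoint r i : ℂ)) (s := fun _ k => ((r - k : ℕ) : ℂ))
    (fun _ i => by rw [sumEquiv_inl, chamberPoint, Complex.ofReal_natCast])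
    (fun _ i => by rw [sumEquiv_inr, Nat.sub_eq_zero_of_le (by omega), Nat.cast_zero])
  rw [one_mul, map_ofReal_wittForm, Matrix.map_one _ Complex.ofReal_zero Complex.ofReal_one,
    Complex.ofReal_one]
  exact h1

theorem formEquiv_spR (r : ℕ) : FormEquiv
    ((1 : Matrix ((Fin 0 ⊕ Fin 0) ⊕ (Fin r ⊕ Fin r)) _ ℂ) *
      (wittForm (1 : Matrix (Fin 0 ⊕ Fin 0) _ ℝ) (-1) r).map (fun x : ℝ => (x : ℂ)))
    (fun _ : Unit => Sum.elim 0 (Sum.elim (fun i => (chamberPoint r i : ℂ))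
      fun i => -(chamberPoint r i : ℂ)))
    (hyperbolicForm (-1) (Fin r))
    (fun _ : Unit => Sum.elim (fun k : Fin r => ((r - k : ℕ) : ℂ))
      fun k => -((r - k : ℕ) : ℂ)) := by
  have h0 : FormEquiv (1 : Matrix (Fin 0 ⊕ Fin 0) _ ℂ) (fun (_ : Unit) _ => 0)
      (hyperbolicForm (-1) (Fin 0)) fun _ _ => 0 :=
    FormEquiv.of_monomial (Equiv.refl _) (fun _ => 1) (fun _ => one_ne_zero)
      (fun i => isEmptyElim i) fun _ i => isEmptyElim i
  have h1 := formEquiv_hyperbolicForm h0 (sumEquiv (add_zero r))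
    (t := fun _ i => (chamberPoint r i : ℂ)) (s := fun _ k => ((r - k : ℕ) : ℂ))
    (fun _ i => by rw [sumEquiv_inl, chamberPoint, Complex.ofReal_natCast])
    (fun _ i => isEmptyElim i)
  rw [one_mul, map_ofReal_wittForm, Matrix.map_one _ Complex.ofReal_zero Complex.ofReal_one,
    Complex.ofReal_neg, Complex.ofReal_one]
  exact h1

theorem mem_spC' {X : Matrix (Fin l ⊕ Fin l) (Fin l ⊕ Fin l) ℂ} :
    X ∈ spC l ↔ Xᵀ * hyperbolicForm (-1) (Fin l) + hyperbolicForm (-1) (Fin l) * X = 0 := by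
  have h1 : hyperbolicForm (-1) (Fin l) = -Matrix.J (Fin l) ℂ := by
    simp [hyperbolicForm, Matrix.J, fromBlocks_neg]
  rw [mem_spC, h1, mul_neg, neg_mul, ← neg_add, neg_eq_zero]

theorem m_eq_bot_of_subsingleton {g M : Type*} [LieRing g] [LieAlgebra ℝ g] [LieRing M]
    [LieAlgebra ℝ M] [Subsingleton M] {Q : MinimalParabolic g} (h : Nonempty (Q.m ≃ₗ⁅ℝ⁆ M)) :
    Q.m = ⊥ := by
  obtain ⟨e⟩ := h
  have : Subsingleton Q.m := e.injective.subsingleton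
  exact (LieSubalgebra.eq_bot_iff _).2 fun X hX =>
    congrArg Subtype.val (Subsingleton.elim (⟨X, hX⟩ : Q.m) 0)

instance : Subsingleton (unitaryAlgebra (1 : Matrix (Fin 1) (Fin 1) ℝ)) :=
  subsingleton_unitaryAlgebra_one_real (by simp)

/-- A product with a trivial factor. -/
def prodSubsingletonEquiv {R L L' : Type*} [CommRing R] [LieRing L] [LieAlgebra R L] [LieRing L']
    [LieAlgebra R L'] [Subsingleton L'] : (L × L') ≃ₗ⁅R⁆ L where
  toFun x := x.1
  map_add' _ _ := rfl
  map_smul' _ _ := rfl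
  map_lie' := rfl
  invFun x := (x, 0)
  left_inv _ := Prod.ext rfl (Subsingleton.elim _ _)
  right_inv _ := rfl

theorem nonempty_soCompact_equiv {A : Type*} [Fintype A] [DecidableEq A] {k : ℕ}
    (hA : Fintype.card A = k) : Nonempty (unitaryAlgebra (1 : Matrix A A ℝ) ≃ₗ⁅ℝ⁆ soCompact k) := by
  have e1 := submatrixEquiv (F := ℝ) (Fintype.equivOfCardEq (α := Fin k) (β := A) (by simp [hA]))
    (K := 1) (K' := 1) (submatrix_one_equiv _)
  exact ⟨e1.trans (LieEquiv.ofEq _ _ (congrArg _ (unitaryAlgebra_real 1)))⟩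

theorem exists_parabolic_soPR_even (hl : 2 ≤ l) (h : r + m = l) :
    ∃ (Q : MinimalParabolic (unitaryAlgebra (wittForm (1 : Matrix (Fin m ⊕ Fin m) _ ℝ) 1 r)))
      (f : unitaryAlgebra (wittForm (1 : Matrix (Fin m ⊕ Fin m) _ ℝ) 1 r) → soEvenC l),
      IsRealForm f ∧ (f Q.H₀ : Matrix (Fin l ⊕ Fin l) (Fin l ⊕ Fin l) ℂ) =
        symmDiagonal (fun k : Fin l => ((r - k : ℕ) : ℂ)) ∧
      Nonempty (Q.m ≃ₗ⁅ℝ⁆ unitaryAlgebra (1 : Matrix (Fin m ⊕ Fin m) _ ℝ)) ∧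
      Module.finrank ℝ Q.a = r ∧ Module.finrank ℝ Q.n = r * (r - 1) + r * (m + m) := by
  obtain ⟨Q, f, hf, -, hH, hm, ha, hn, -⟩ := exists_parabolic_realForm isComplexModel_real
    (one_mul 1) (by rw [one_smul, one_mul]) (by rw [one_smul, conjTranspose_one])
    skew_of_mem_unitaryAlgebra_one finrank_skewScalars_real_add_one (fun _ => mem_soEvenC)
    (center_soEvenC hl) (formEquiv_even h) () (map_ofReal_wittDiagonal _ _)
  refine ⟨Q, f, hf, hH, hm.map fun e => e.trans prodSubsingletonEquiv, ha, hn.trans ?_⟩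
  simp [finrank_skewScalars_real]

theorem exists_parabolic_soPR_odd (h : r + m = l) :
    ∃ (Q : MinimalParabolic
        (unitaryAlgebra (wittForm (1 : Matrix (Unit ⊕ (Fin m ⊕ Fin m)) _ ℝ) 1 r)))
      (f : unitaryAlgebra (wittForm (1 : Matrix (Unit ⊕ (Fin m ⊕ Fin m)) _ ℝ) 1 r) → soOddC l),
      IsRealForm f ∧ (f Q.H₀ : Matrix (Unit ⊕ Fin l ⊕ Fin l) (Unit ⊕ Fin l ⊕ Fin l) ℂ) =
        fromBlocks 0 0 0 (symmDiagonal (fun k : Fin l => ((r - k : ℕ) : ℂ))) ∧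
      Nonempty (Q.m ≃ₗ⁅ℝ⁆ unitaryAlgebra (1 : Matrix (Unit ⊕ (Fin m ⊕ Fin m)) _ ℝ)) ∧
      Module.finrank ℝ Q.a = r ∧ Module.finrank ℝ Q.n = r * (r - 1) + r * (1 + (m + m)) := by
  obtain ⟨Q, f, hf, -, hH, hm, ha, hn, -⟩ := exists_parabolic_realForm isComplexModel_real
    (one_mul 1) (by rw [one_smul, one_mul]) (by rw [one_smul, conjTranspose_one])
    skew_of_mem_unitaryAlgebra_one finrank_skewScalars_real_add_one (fun _ => mem_soOddC)
    (center_soOddC l) (formEquiv_odd h) () (map_ofReal_wittDiagonal _ _)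
  refine ⟨Q, f, hf, hH.trans ?_, hm.map fun e => e.trans prodSubsingletonEquiv, ha, hn.trans ?_⟩
  · rw [symmDiagonal, ← fromBlocks_diagonal]
    congr 1
  · simp [finrank_skewScalars_real]

theorem sub_succ_le (r k : ℕ) : r - (k + 1) ≤ r - k := by omega

theorem minimalParabolic_soPR_self (r : ℕ) (hr : 2 ≤ r) :
    Nonempty (MinimalParabolic (soPR r r)) ∧ ∀ P : MinimalParabolic (soPR r r), P.m = ⊥ ∧
      ∃ φ : ℂ ⊗[ℝ] (soPR r r) ≃ₗ⁅ℂ⁆ (soEvenC r),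
        complexImage φ P.p = borel (diagonalCartan (soEvenC r)) (simpleD r) ∧
        complexImage φ P.a.toSubmodule = (diagonalCartan (soEvenC r)).toSubmodule := by
  obtain ⟨Q, f, hf, hH, hm, -⟩ := exists_parabolic_soPR_even (r := r) (m := 0) hr (add_zero r)
  obtain ⟨e⟩ := nonempty_soPR_equiv (A := Fin 0 ⊕ Fin 0) (r := r) (p := r) (by simp)
  have := subsingleton_unitaryAlgebra_one_real (A := Fin 0 ⊕ Fin 0) (by simp)
  refine forall_of_realForm_of_m_eq_bot e Q hf (m_eq_bot_of_subsingleton hm) ?_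
    (complexImage_m_sup_a_of_symmDiagonal hf Q (by omega) (by omega) hH)
  rw [← standardParabolic_empty]
  exact complexImage_p_soEvenC hf Q (fun k => r - k) (sub_succ_le r) hH
    (fun k hk => by simp only [Set.mem_empty_iff_false, iff_false]; omega)
    (fun k hk => by simp only [Set.mem_empty_iff_false, iff_false]; omega)

theorem minimalParabolic_soPR_succ (r : ℕ) :
    Nonempty (MinimalParabolic (soPR (r + 1) r)) ∧ ∀ P : MinimalParabolic (soPR (r + 1) r),
      P.m = ⊥ ∧ ∃ φ : ℂ ⊗[ℝ] (soPR (r + 1) r) ≃ₗ⁅ℂ⁆ (soOddC r),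
        complexImage φ P.p = borel (diagonalCartan (soOddC r)) (simpleB r) ∧
        complexImage φ P.a.toSubmodule = (diagonalCartan (soOddC r)).toSubmodule := by
  obtain ⟨Q, f, hf, hH, hm, -⟩ := exists_parabolic_soPR_odd (r := r) (m := 0) (add_zero r)
  obtain ⟨e⟩ := nonempty_soPR_equiv (A := Unit ⊕ (Fin 0 ⊕ Fin 0)) (r := r) (p := r + 1)
    (by simp [add_comm])
  have := subsingleton_unitaryAlgebra_one_real (A := Unit ⊕ (Fin 0 ⊕ Fin 0)) (by simp)
  refine forall_of_realForm_of_m_eq_bot e Q hf (m_eq_bot_of_subsingleton hm) ?_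
    (complexImage_m_sup_a_soOddC hf Q (by omega) (by omega) hH)
  rw [← standardParabolic_empty]
  exact complexImage_p_soOddC hf Q (fun k => r - k) (sub_succ_le r) hH
    (fun k hk => by simp only [Set.mem_empty_iff_false, iff_false]; omega)
    (fun k hk => by simp only [Set.mem_empty_iff_false, iff_false]; omega)

theorem minimalParabolic_spR (n : ℕ) :
    Nonempty (MinimalParabolic (spR n)) ∧ ∀ P : MinimalParabolic (spR n),
      P.m = ⊥ ∧ ∃ φ : ℂ ⊗[ℝ] (spR n) ≃ₗ⁅ℂ⁆ (spC n),
        complexImage φ P.p = borel (diagonalCartan (spC n)) (simpleC n) ∧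
        complexImage φ P.a.toSubmodule = (diagonalCartan (spC n)).toSubmodule := by
  obtain ⟨Q, f, hf, -, hH, hm, -⟩ := exists_parabolic_realForm isComplexModel_real
    (ε := -1) (K := (1 : Matrix (Fin 0 ⊕ Fin 0) _ ℝ)) (by norm_num) (Subsingleton.elim _ _)
    (Subsingleton.elim _ _) (fun _ _ => Subsingleton.elim _ _) finrank_skewScalars_real_add_one
    (fun _ => mem_spC') (center_spC n) (formEquiv_spR n) () (map_ofReal_wittDiagonal _ _)
  obtain ⟨e⟩ := nonempty_spR_equiv n
  have := subsingleton_unitaryAlgebra_one_real (A := Fin 0 ⊕ Fin 0) (by simp)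
  refine forall_of_realForm_of_m_eq_bot e Q hf (m_eq_bot_of_subsingleton hm) ?_
    (complexImage_m_sup_a_of_symmDiagonal hf Q (s := fun k => n - k) (by omega) (by omega) hH)
  rw [← standardParabolic_empty]
  exact complexImage_p_spC hf Q (fun k => n - k) (sub_succ_le n) hH
    (fun k hk => by simp only [Set.mem_empty_iff_false, iff_false]; omega)
    (fun k hk => by simp only [Set.mem_empty_iff_false, iff_false]; omega)

theorem minimalParabolic_soPR_odd (p r l : ℕ) (hr : r + 1 < p) (hl : p + r = 2 * l + 1) :
    Nonempty (MinimalParabolic (soPR p r)) ∧ ∀ P : MinimalParabolic (soPR p r),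
      Nonempty (P.m ≃ₗ⁅ℝ⁆ soCompact (p - r)) ∧ Module.finrank ℝ P.a = r ∧
      Module.finrank ℝ P.n = r * (p - 1) ∧
      ∃ φ : ℂ ⊗[ℝ] (soPR p r) ≃ₗ⁅ℂ⁆ (soOddC l),
        complexImage φ P.p = standardParabolic (diagonalCartan (soOddC l)) (simpleB l)
          (Set.Icc (r + 1) l) := by
  obtain ⟨m, rfl⟩ : ∃ m, l = r + m := ⟨l - r, by omega⟩
  obtain ⟨Q, f, hf, hH, hm, ha, hn⟩ := exists_parabolic_soPR_odd (r := r) (m := m) rfl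
  obtain ⟨e⟩ := nonempty_soPR_equiv (A := Unit ⊕ (Fin m ⊕ Fin m)) (r := r) (p := p)
    (by simp; omega)
  obtain ⟨e'⟩ := nonempty_soCompact_equiv (A := Unit ⊕ (Fin m ⊕ Fin m)) (k := p - r)
    (by simp; omega)
  have h1 := complexImage_p_soOddC hf Q (fun k => r - k) (sub_succ_le r) hH
    (S := Set.Icc (r + 1) (r + m)) (fun k hk => by simp only [Set.mem_Icc]; omega)
    (fun k hk => by simp only [Set.mem_Icc]; omega)
  have h2 : r * (r - 1) + r * (1 + (m + m)) = r * (p - 1) := by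
    rcases Nat.eq_zero_or_pos r with rfl | h
    · simp
    · rw [← mul_add]
      congr 1
      omega
  obtain ⟨h3, h4⟩ := forall_of_realForm e Q hf (hm.map fun i => i.trans e') ha (hn.trans h2) h1 rfl
  refine ⟨h3, fun P => ?_⟩
  obtain ⟨h5, h6, h7, φ, hφ, -⟩ := h4 P
  exact ⟨h5, h6, h7, φ, hφ⟩

theorem minimalParabolic_soPR_even (p r l : ℕ) (h1 : 1 ≤ r) (hr : r + 1 < p) (hl : p + r = 2 * l) :
    Nonempty (MinimalParabolic (soPR p r)) ∧ ∀ P : MinimalParabolic (soPR p r),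
      Nonempty (P.m ≃ₗ⁅ℝ⁆ soCompact (p - r)) ∧ Module.finrank ℝ P.a = r ∧
      Module.finrank ℝ P.n = r * (p - 1) ∧
      ∃ φ : ℂ ⊗[ℝ] (soPR p r) ≃ₗ⁅ℂ⁆ (soEvenC l),
        complexImage φ P.p = standardParabolic (diagonalCartan (soEvenC l)) (simpleD l)
          (if p = r + 2 then ∅ else Set.Icc (r + 1) l) := by
  obtain ⟨m, rfl⟩ : ∃ m, l = r + m := ⟨l - r, by omega⟩
  obtain ⟨Q, f, hf, hH, hm, ha, hn⟩ := exists_parabolic_soPR_even (r := r) (m := m) (by omega) rfl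
  obtain ⟨e⟩ := nonempty_soPR_equiv (A := Fin m ⊕ Fin m) (r := r) (p := p)
    (by simp; omega)
  obtain ⟨e'⟩ := nonempty_soCompact_equiv (A := Fin m ⊕ Fin m) (k := p - r)
    (by simp; omega)
  have h1 := complexImage_p_soEvenC hf Q (fun k => r - k) (sub_succ_le r) hH
    (S := if p = r + 2 then ∅ else Set.Icc (r + 1) (r + m))
    (fun k hk => by
      split_ifs
      · simp only [Set.mem_empty_iff_false, iff_false]; omega
      · simp only [Set.mem_Icc]; omega)
    (fun k hk => by
      split_ifs
      · simp only [Set.mem_empty_iff_false, iff_false]; omega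
      · simp only [Set.mem_Icc]; omega)
  have h2 : r * (r - 1) + r * (m + m) = r * (p - 1) := by
    rw [← mul_add]
    congr 1
    omega
  obtain ⟨h3, h4⟩ := forall_of_realForm e Q hf (hm.map fun i => i.trans e') ha (hn.trans h2) h1 rfl
  refine ⟨h3, fun P => ?_⟩
  obtain ⟨h5, h6, h7, φ, hφ, -⟩ := h4 P
  exact ⟨h5, h6, h7, φ, hφ⟩

end Real

/-! ### The Lie algebras `sl(n, ℝ)` and `su*(2n)` -/

section LinearModel

variable {F : Type*} [Ring F] [StarRing F] [Algebra ℝ F] [RealScalars F] {κ ι ι' : Type*}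
  [Fintype κ] [DecidableEq κ] [Fintype ι] [DecidableEq ι] [Fintype ι'] [DecidableEq ι']
  {W : Matrix ι ι ℂ}

theorem real_smul_eq {ι : Type*} (c : ℝ) (X : Matrix ι ι ℂ) : c • X = (c : ℂ) • X := by
  ext i j
  simp

/-- A complex model, after a permutation of the basis, as a homomorphism of Lie algebras. -/
def IsComplexModel.lieHom {ρ : Matrix κ κ F → Matrix ι ι ℂ} (hρ : IsComplexModel ρ W)
    (σ : ι' ≃ ι) : Matrix κ κ F →ₗ⁅ℝ⁆ Matrix ι' ι' ℂ where
  toFun X := (ρ X).submatrix σ σ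
  map_add' X Y := by rw [hρ.map_add, submatrix_add]; rfl
  map_smul' c X := by rw [hρ.map_smul, submatrix_smul, RingHom.id_apply, real_smul_eq]; rfl
  map_lie' {X Y} := by
    rw [hρ.map_lie, LieRing.of_associative_ring_bracket, LieRing.of_associative_ring_bracket,
      submatrix_mul_equiv, submatrix_mul_equiv, submatrix_sub]
    rfl

theorem IsComplexModel.lieHom_injective {ρ : Matrix κ κ F → Matrix ι ι ℂ}
    (hρ : IsComplexModel ρ W) (σ : ι' ≃ ι) : Function.Injective (hρ.lieHom σ) := fun X Y h => by
  have h1 : (ρ X).submatrix σ σ = (ρ Y).submatrix σ σ := h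
  exact hρ.injective ((Matrix.reindex σ.symm σ.symm).injective h1)

/-- A Lie subalgebra is isomorphic to its image under an injective homomorphism. -/
theorem nonempty_lieEquiv_of_image {M M' : Type*} [LieRing M] [LieAlgebra ℝ M] [LieRing M']
    [LieAlgebra ℝ M'] {φ : M →ₗ⁅ℝ⁆ M'} (hφ : Function.Injective φ) {L : LieSubalgebra ℝ M}
    {L' : LieSubalgebra ℝ M'} (h : ∀ Y, Y ∈ L' ↔ ∃ X ∈ L, φ X = Y) : Nonempty (L' ≃ₗ⁅ℝ⁆ L) := by
  let ψ : L →ₗ⁅ℝ⁆ M' := φ.comp L.incl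
  have hψ : Function.Injective ψ := fun X Y hXY => Subtype.ext (hφ hXY)
  refine ⟨((LieEquiv.ofInjective ψ hψ).trans (LieEquiv.ofEq _ _ (Set.ext fun Y => ?_))).symm⟩
  rw [SetLike.mem_coe, SetLike.mem_coe, h, LieHom.mem_range]
  exact ⟨fun ⟨X, hX⟩ => ⟨X, X.2, hX⟩, fun ⟨X, hX, hXY⟩ => ⟨⟨X, hX⟩, hXY⟩⟩

/-- The trace-free matrices over `F` form a real form of `sl(N, ℂ)`. -/
theorem IsComplexModel.exists_isRealForm_sl {n N : ℕ} {ρ : Matrix (Fin n) (Fin n) F → Matrix ι ι ℂ}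
    (hρ : IsComplexModel ρ W) {c : ℂ} (hc : c ≠ 0)
    (htr : ∀ X, (ρ X).trace = c * ((reTrace X : ℝ) : ℂ)) (σ : Fin N ≃ ι) :
    ∃ f : specialLinear F n → slC N, IsRealForm f ∧
      ∀ X, (f X : Matrix (Fin N) (Fin N) ℂ) = (ρ X).submatrix σ σ := by
  have htr' : ∀ X, (hρ.lieHom σ X).trace = c * ((reTrace X : ℝ) : ℂ) := fun X =>
    (Equiv.sum_comp σ fun i => ρ X i i).trans (htr X)
  refine ⟨fun X => ⟨hρ.lieHom σ X, ?_⟩,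
    ⟨fun X Y => Subtype.ext (_root_.map_add (hρ.lieHom σ) (X : Matrix _ _ F) Y),
    fun c X => Subtype.ext ?_,
    fun X Y => Subtype.ext (LieHom.map_lie (hρ.lieHom σ) (X : Matrix _ _ F) Y),
    fun Y => ?_, fun A B h => ?_⟩, fun _ => rfl⟩
  · rw [mem_sl, htr', mem_specialLinear.1 X.2, Complex.ofReal_zero, mul_zero]
  · exact (_root_.map_smul (hρ.lieHom σ) c (X : Matrix _ _ F)).trans (real_smul_eq c _)
  · obtain ⟨A, B, h⟩ := hρ.exists_eq ((Y : Matrix (Fin N) (Fin N) ℂ).submatrix σ.symm σ.symm)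
    have h1 : (Y : Matrix (Fin N) (Fin N) ℂ) = hρ.lieHom σ A + Complex.I • hρ.lieHom σ B := by
      have h2 := congrArg (fun Z => submatrix Z σ σ) h
      simp only [submatrix_submatrix, Equiv.symm_comp_self, submatrix_id_id] at h2
      exact h2
    have h2 := congrArg trace h1
    rw [mem_sl.1 Y.2, trace_add, trace_smul, htr', htr', smul_eq_mul] at h2
    have h3 : ((reTrace A : ℝ) : ℂ) + Complex.I * ((reTrace B : ℝ) : ℂ) = 0 := by
      refine mul_left_cancel₀ hc ?_
      linear_combination -h2
    have h4 := congrArg Complex.re h3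
    have h5 := congrArg Complex.im h3
    simp at h4 h5
    exact ⟨⟨A, h4⟩, ⟨B, h5⟩, Subtype.ext h1⟩
  · have h1 : hρ.lieHom σ A + Complex.I • hρ.lieHom σ B = 0 := congrArg Subtype.val h
    have h2 := hρ.eq_zero A B (by
      have h3 := congrArg (fun Z => submatrix Z σ.symm σ.symm) h1
      change ((ρ A + Complex.I • ρ B).submatrix σ σ).submatrix σ.symm σ.symm = 0 at h3
      rwa [submatrix_submatrix, Equiv.self_comp_symm, submatrix_id_id] at h3)
    exact ⟨Subtype.ext h2.1, Subtype.ext h2.2⟩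

end LinearModel

section SpecialLinear

theorem submatrix_diagonal_equiv' {ι κ R : Type*} [DecidableEq ι] [DecidableEq κ] [Zero R]
    (σ : ι ≃ κ) {d : κ → R} {d' : ι → R} (h : ∀ i, d (σ i) = d' i) :
    (diagonal d).submatrix σ σ = diagonal d' := by
  rw [submatrix_diagonal_equiv]
  exact congrArg diagonal (funext h)

theorem minimalParabolic_slR (n : ℕ) :
    Nonempty (MinimalParabolic (slR n)) ∧ ∀ P : MinimalParabolic (slR n),
      P.m = ⊥ ∧ ∃ φ : ℂ ⊗[ℝ] (slR n) ≃ₗ⁅ℂ⁆ (slC n),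
        complexImage φ P.p = borel (diagonalCartan (slC n)) (simpleA n) ∧
        complexImage φ P.a.toSubmodule = (diagonalCartan (slC n)).toSubmodule := by
  obtain ⟨f, hf, hfX⟩ := (isComplexModel_real (κ := Fin n)).exists_isRealForm_sl one_ne_zero
    (fun X => by
      rw [one_mul]
      exact (AddMonoidHom.map_trace (Complex.ofRealHom : ℝ →+ ℂ) X).symm) (Equiv.refl _)
  have hc := fun X => hf.center_eq_zero (center_sl n) X
  have e : slR n ≃ₗ⁅ℝ⁆ specialLinear ℝ n := LieEquiv.ofEq _ _ rfl
  have hH : (f (linearParabolic hc).H₀ : Matrix (Fin n) (Fin n) ℂ) =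
      diagonal fun k : Fin n => ((((n : ℝ) - 1) / 2 - (k : ℕ) : ℝ) : ℂ) := by
    rw [hfX, coe_linearParabolic_H₀, map_realDiagonal]
    rfl
  have hm : (linearParabolic hc).m = ⊥ := m_eq_bot_of_subsingleton ⟨linearMEquiv hc⟩
  refine forall_of_realForm_of_m_eq_bot e _ hf hm ?_
    (complexImage_m_sup_a_slC hf _ (fun k => ((n : ℝ) - 1) / 2 - k) (fun i _ j _ h => ?_) hH)
  · rw [← standardParabolic_empty]
    refine complexImage_p_slC hf _ (fun k => ((n : ℝ) - 1) / 2 - k) (fun k => ?_) hH fun k _ => ?_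
    · push_cast
      linarith
    · simp
  · simpa using h

open Quaternion

/-- The vectors `e, e j` of the standard quaternionic basis, one after the other. -/
def pairEquiv (n : ℕ) : Fin (2 * n) ≃ Fin n ⊕ Fin n :=
  (finCongr (mul_comm 2 n)).trans (finProdFinEquiv.symm.trans
    (((Equiv.refl (Fin n)).prodCongr finTwoEquiv).trans
      ((Equiv.prodComm (Fin n) Bool).trans (Equiv.boolProdEquivSum (Fin n)))))

theorem elim_pairEquiv' {R : Type*} (n : ℕ) (d d' : Fin n → R) (k : Fin (2 * n)) :
    Sum.elim d d' (pairEquiv n k) =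
      if (k : ℕ) % 2 = 0 then d ⟨k / 2, by omega⟩ else d' ⟨k / 2, by omega⟩ := by
  have h : ∀ x : Fin n × Fin 2, Sum.elim d d' (Equiv.boolProdEquivSum (Fin n)
      ((Equiv.prodComm (Fin n) Bool) (((Equiv.refl (Fin n)).prodCongr finTwoEquiv) x))) =
      if (x.2 : ℕ) = 0 then d x.1 else d' x.1 := by
    rintro ⟨i, b⟩
    fin_cases b <;> rfl
  exact h _

theorem elim_pairEquiv {R : Type*} (n : ℕ) (d : Fin n → R) (k : Fin (2 * n)) :
    Sum.elim d d (pairEquiv n k) = d ⟨k / 2, by omega⟩ := by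
  rw [elim_pairEquiv', ite_self]

theorem mem_suStar_iff {n : ℕ} (Y : Matrix (Fin n ⊕ Fin n) (Fin n ⊕ Fin n) ℂ) :
    Y ∈ suStar n ↔ ∃ X ∈ specialLinear ℍ[ℝ] n,
      isComplexModel_toComplex.lieHom (Equiv.refl (Fin n ⊕ Fin n)) X = Y := by
  constructor
  · rintro ⟨h1, h2⟩
    obtain ⟨X, rfl⟩ := (exists_toComplex_eq_iff Y).2 h1
    refine ⟨X, ?_, rfl⟩
    have h3 : (toComplex X).trace = 0 := h2
    rw [trace_toComplex, mul_eq_zero_iff_left two_ne_zero, Complex.ofReal_eq_zero] at h3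
    exact h3
  · rintro ⟨X, hX, rfl⟩
    refine ⟨(exists_toComplex_eq_iff _).1 ⟨X, rfl⟩, ?_⟩
    change (toComplex X).trace = 0
    rw [trace_toComplex, mem_specialLinear.1 hX, Complex.ofReal_zero, mul_zero]

theorem mem_unitaryAlgebra_one_iff_toComplex {κ : Type*} [Fintype κ] [DecidableEq κ]
    {X : Matrix κ κ ℍ[ℝ]} : X ∈ unitaryAlgebra (1 : Matrix κ κ ℍ[ℝ]) ↔
      (toComplex X)ᴴ = -toComplex X := by
  rw [mem_unitaryAlgebra_one, ← toComplex_conjTranspose, ← isComplexModel_toComplex.map_neg,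
    isComplexModel_toComplex.injective.eq_iff]

/-- The skew quaternions form the Lie algebra `su(2)`. -/
theorem nonempty_suCompact_two_equiv :
    Nonempty (suCompact 2 ≃ₗ⁅ℝ⁆ unitaryAlgebra (1 : Matrix (Fin 1) (Fin 1) ℍ[ℝ])) := by
  refine nonempty_lieEquiv_of_image
    (isComplexModel_toComplex.lieHom_injective (finSumFinEquiv (m := 1) (n := 1)).symm)
    fun Y => ⟨?_, ?_⟩
  · rintro ⟨h1, h2⟩
    have h1 : Yᴴ * 1 + 1 * Y = 0 := h1
    have h2 : Y.trace = 0 := h2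
    rw [mul_one, one_mul] at h1
    have h3 : ∀ i j, star (Y j i) + Y i j = 0 := congrFun₂ h1
    rw [trace_fin_two] at h2
    have h4 := h3 0 0
    have h5 := h3 1 1
    have h6 := h3 0 1
    refine ⟨of fun _ _ => quaternionMk (Y 0 0) (Y 0 1), ?_, ?_⟩
    · rw [mem_unitaryAlgebra_one]
      ext1 i j
      refine quaternion_ext ?_ ?_
      · change quaternionFst (star (quaternionMk (Y 0 0) (Y 0 1))) =
          quaternionFst (-quaternionMk (Y 0 0) (Y 0 1))
        rw [quaternionFst_star, _root_.map_neg, quaternionFst_mk]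
        exact eq_neg_of_add_eq_zero_left h4
      · change quaternionSnd (star (quaternionMk (Y 0 0) (Y 0 1))) =
          quaternionSnd (-quaternionMk (Y 0 0) (Y 0 1))
        rw [quaternionSnd_star, _root_.map_neg]
    · ext i j
      fin_cases i <;> fin_cases j
      · exact quaternionFst_mk _ _
      · exact quaternionSnd_mk _ _
      · change -star (quaternionSnd (quaternionMk (Y 0 0) (Y 0 1))) = Y 1 0
        rw [quaternionSnd_mk]
        linear_combination -(h3 1 0)
      · change star (quaternionFst (quaternionMk (Y 0 0) (Y 0 1))) = Y 1 1
        rw [quaternionFst_mk]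
        linear_combination h4 - h2
  · rintro ⟨X, hX, rfl⟩
    rw [mem_unitaryAlgebra_one_iff_toComplex] at hX
    refine ⟨?_, ?_⟩
    · change ((toComplex X).submatrix _ _)ᴴ * 1 + 1 * (toComplex X).submatrix _ _ = 0
      rw [conjTranspose_submatrix, hX, mul_one, one_mul, submatrix_neg]
      exact neg_add_cancel _
    · refine (Equiv.sum_comp (finSumFinEquiv (m := 1) (n := 1)).symm
        fun i => toComplex X i i).trans ((trace_toComplex X).trans ?_)
      rw [← mem_unitaryAlgebra_one_iff_toComplex, mem_unitaryAlgebra_one] at hX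
      have h1 := reTrace_conjTranspose X
      rw [hX, _root_.map_neg] at h1
      rw [show reTrace X = 0 by linarith, Complex.ofReal_zero, mul_zero]

theorem minimalParabolic_suStar (n : ℕ) (hn : 1 ≤ n) :
    Nonempty (MinimalParabolic (suStar n)) ∧ ∀ P : MinimalParabolic (suStar n),
      Nonempty (P.m ≃ₗ⁅ℝ⁆ (⨁ _ : Fin n, suCompact 2)) ∧ Module.finrank ℝ P.a = n - 1 ∧
      Module.finrank ℝ P.n = 2 * n * (n - 1) ∧
      ∃ φ : ℂ ⊗[ℝ] (suStar n) ≃ₗ⁅ℂ⁆ (slC (2 * n)),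
        complexImage φ P.p = standardParabolic (diagonalCartan (slC (2 * n))) (simpleA (2 * n))
          {i | Odd i ∧ i ≤ 2 * n - 1} := by
  obtain ⟨f, hf, hfX⟩ := (isComplexModel_toComplex (κ := Fin n)).exists_isRealForm_sl
    two_ne_zero trace_toComplex (pairEquiv n)
  have hc := fun X => hf.center_eq_zero (center_sl (2 * n)) X
  obtain ⟨e⟩ := nonempty_lieEquiv_of_image (isComplexModel_toComplex.lieHom_injective
    (Equiv.refl _)) (mem_suStar_iff (n := n))
  obtain ⟨e₁⟩ := nonempty_suCompact_two_equiv
  have hm := linearMEquiv hc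
  have ha := finrank_linearParabolic_a hc
  have hn' : Module.finrank ℝ (linearParabolic hc).n = 2 * n * (n - 1) := by
    have h1 := (linearParabolic hc).finrank_eq
    have h2 := finrank_specialLinear (F := ℍ[ℝ]) hn
    rw [Quaternion.finrank_eq_four] at h2
    rw [ha, hm.toLinearEquiv.finrank_eq, Module.finrank_pi_fintype, Finset.sum_const,
      Finset.card_univ, Fintype.card_fin, smul_eq_mul, finrank_unitaryAlgebra_one,
      finrank_skewScalars_quaternion] at h1
    obtain ⟨k, rfl⟩ : ∃ k, n = k + 1 := ⟨n - 1, by omega⟩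
    simp at h1 ⊢
    nlinarith
  have hH : (f (linearParabolic hc).H₀ : Matrix (Fin (2 * n)) (Fin (2 * n)) ℂ) =
      diagonal fun k : Fin (2 * n) => ((((n : ℝ) - 1) / 2 - ((k / 2 : ℕ) : ℝ) : ℝ) : ℂ) := by
    rw [hfX, coe_linearParabolic_H₀, toComplex_realDiagonal]
    exact submatrix_diagonal_equiv' _ (elim_pairEquiv n _)
  have hV := complexImage_p_slC hf _ (fun k => ((n : ℝ) - 1) / 2 - ((k / 2 : ℕ) : ℝ))
    (fun k => by
      have : ((k / 2 : ℕ) : ℝ) ≤ (((k + 1) / 2 : ℕ) : ℝ) :=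
        Nat.cast_le.2 (Nat.div_le_div_right (by omega))
      linarith) hH (S := {i | Odd i ∧ i ≤ 2 * n - 1}) fun k hk => by
      simp only [sub_right_inj, Nat.cast_inj, Set.mem_ofPred_eq, Nat.odd_iff]
      omega
  obtain ⟨h3, h4⟩ := forall_of_realForm e _ hf
    ⟨hm.trans ((piCongr (Fin n) e₁.symm).trans (piEquivDirectSum _ _ _))⟩ ha hn' hV rfl
  refine ⟨h3, fun P => ?_⟩
  obtain ⟨h5, h6, h7, φ, hφ, -⟩ := h4 P
  exact ⟨h5, h6, h7, φ, hφ⟩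

end SpecialLinear

/-! ### Quaternionic forms as pairs of complex forms -/

section QuaternionForms

open Quaternion

variable {κ : Type*} [Fintype κ] [DecidableEq κ]

/-- The image of `u(K)`, for a quaternionic form `K`, in the complex matrices is the intersection of
the Lie algebras of the Hermitian and the bilinear form that `K` induces. -/
theorem exists_toComplex_mem_unitaryAlgebra_iff {K : Matrix κ κ ℍ[ℝ]}
    {K' : Matrix (κ ⊕ κ) (κ ⊕ κ) ℂ} (hK : toComplex K * K' = 1) (Y : Matrix (κ ⊕ κ) (κ ⊕ κ) ℂ) :
    (∃ X ∈ unitaryAlgebra K, toComplex X = Y) ↔ Yᴴ * toComplex K + toComplex K * Y = 0 ∧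
      Yᵀ * (Matrix.J κ ℂ * toComplex K) + Matrix.J κ ℂ * toComplex K * Y = 0 := by
  have hρ := isComplexModel_toComplex (κ := κ)
  constructor
  · rintro ⟨X, hX, rfl⟩
    rw [mem_unitaryAlgebra] at hX
    refine ⟨?_, ?_⟩
    · rw [← toComplex_conjTranspose, ← toComplex_mul, ← toComplex_mul, ← hρ.map_add, hX,
        hρ.map_zero]
    · rw [hρ.transpose_mul_add, hX, hρ.map_zero, mul_zero]
  · rintro ⟨h1, h2⟩
    have h3 : Yᵀ * Matrix.J κ ℂ = Matrix.J κ ℂ * Yᴴ := by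
      have h4 : (Yᵀ * Matrix.J κ ℂ - Matrix.J κ ℂ * Yᴴ) * toComplex K = 0 := by
        rw [sub_mul, mul_assoc, mul_assoc, eq_neg_of_add_eq_zero_left h2,
          eq_neg_of_add_eq_zero_left h1, mul_neg, ← mul_assoc, sub_self]
      have h5 := congrArg (· * K') h4
      simp only [mul_assoc, hK, mul_one, zero_mul] at h5
      exact sub_eq_zero.1 h5
    have h6 : Y * Matrix.J κ ℂ = Matrix.J κ ℂ * Y.map star := by
      have h7 := congrArg transpose h3
      rw [transpose_mul, transpose_mul, transpose_transpose, J_transpose, neg_mul, mul_neg,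
        neg_inj] at h7
      have h8 : Yᴴᵀ = Y.map star := rfl
      rw [h8] at h7
      have h9 := congrArg (fun Z => Matrix.J κ ℂ * Z * Matrix.J κ ℂ) h7
      simp only [← mul_assoc, J_squared, neg_mul, one_mul] at h9
      rw [mul_assoc (Matrix.J κ ℂ * Y.map star), J_squared, mul_neg, mul_one, neg_inj] at h9
      exact h9
    obtain ⟨X, rfl⟩ := (exists_toComplex_eq_iff Y).2 h6
    refine ⟨X, ?_, rfl⟩
    rw [← toComplex_conjTranspose, ← toComplex_mul, ← toComplex_mul, ← hρ.map_add] at h1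
    exact hρ.injective (h1.trans hρ.map_zero.symm)

theorem toComplex_one : toComplex (1 : Matrix κ κ ℍ[ℝ]) = 1 := by
  have h1 := toComplex_realDiagonal (κ := κ) 1
  have h2 : realDiagonal ℍ[ℝ] (1 : κ → ℝ) = 1 := by
    simp [realDiagonal, diagonal_one]
  rw [h2] at h1
  rw [h1]
  simp [← diagonal_one]

theorem J_mul_toComplex (X : Matrix κ κ ℍ[ℝ]) : Matrix.J κ ℂ * toComplex X =
    fromBlocks ((X.map quaternionSnd).map star) (-(X.map quaternionFst).map star)
      (X.map quaternionFst) (X.map quaternionSnd) := by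
  rw [toComplex, J, fromBlocks_multiply]
  simp

variable {A : Type*} [Fintype A] [DecidableEq A] {r : ℕ}

/-- The reordering of the complex basis of a sum of quaternionic hyperbolic planes and a form. -/
def quaternionReorder (A : Type*) (r : ℕ) :
    (A ⊕ A) ⊕ ((Fin r ⊕ Fin r) ⊕ (Fin r ⊕ Fin r)) ≃
      (A ⊕ (Fin r ⊕ Fin r)) ⊕ (A ⊕ (Fin r ⊕ Fin r)) where
  toFun := Sum.elim (Sum.elim (Sum.inl ∘ Sum.inl) (Sum.inr ∘ Sum.inl))
    (Sum.elim (Sum.elim (Sum.inl ∘ Sum.inr ∘ Sum.inl) (Sum.inr ∘ Sum.inr ∘ Sum.inl))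
      (Sum.elim (Sum.inr ∘ Sum.inr ∘ Sum.inr) (Sum.inl ∘ Sum.inr ∘ Sum.inr)))
  invFun := Sum.elim (Sum.elim (Sum.inl ∘ Sum.inl)
      (Sum.elim (Sum.inr ∘ Sum.inl ∘ Sum.inl) (Sum.inr ∘ Sum.inr ∘ Sum.inr)))
    (Sum.elim (Sum.inl ∘ Sum.inr)
      (Sum.elim (Sum.inr ∘ Sum.inl ∘ Sum.inr) (Sum.inr ∘ Sum.inr ∘ Sum.inl)))
  left_inv := by rintro ((i | i) | (i | i) | (i | i)) <;> rfl
  right_inv := by rintro ((i | i | i) | (i | i | i)) <;> rfl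

/-- A quaternionic hyperbolic plane gives two complex hyperbolic planes. The diagonal matrices with
entries `x`, `y` on the complex basis `h, h j` of an isotropic line and the entries `-y`, `-x` on
the basis `h', h' j` of the dual line become diagonal matrices with opposite entries on dual
vectors. -/
theorem formEquiv_quaternion {T : Type*} (K : Matrix A A ℍ[ℝ]) (ε : ℝ) (x y : T → Fin r → ℂ) :
    FormEquiv (Matrix.J _ ℂ * toComplex (wittForm K ε r))
      (fun t => Sum.elim (Sum.elim 0 (Sum.elim (x t) (-y t))) (Sum.elim 0 (Sum.elim (y t) (-x t))))
      (fromBlocks (Matrix.J A ℂ * toComplex K) 0 0 (hyperbolicForm (-ε) (Fin r ⊕ Fin r)))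
      (fun t => Sum.elim 0 (Sum.elim (Sum.elim (x t) (y t)) fun i => -Sum.elim (x t) (y t) i)) := by
  have h1 : quaternionFst 1 = 1 := by apply Complex.ext <;> rfl
  have h2 : quaternionSnd 1 = 0 := by apply Complex.ext <;> rfl
  refine FormEquiv.of_monomial (quaternionReorder A r)
    (Sum.elim (fun _ => 1) (Sum.elim (fun _ => 1) (Sum.elim (fun _ => -1) fun _ => 1))) ?_ ?_ ?_
  · rintro ((i | i) | (i | i) | (i | i)) <;> simp
  · rw [J_mul_toComplex, J_mul_toComplex]
    rintro ((i | i) | (i | i) | (i | i)) ((j | j) | (j | j) | (j | j)) <;>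
      simp [quaternionReorder, wittForm, hyperbolicForm, one_apply] <;> split_ifs <;> simp [h1, h2]
  · rintro t ((i | i) | (i | i) | (i | i)) <;> simp [quaternionReorder]

theorem toComplex_wittDiagonal (t : Fin r → ℝ) : toComplex (realDiagonal ℍ[ℝ] (wittDiagonal A t)) =
    diagonal (Sum.elim (Sum.elim 0 (Sum.elim (fun i => (t i : ℂ)) (-fun i => (t i : ℂ))))
      (Sum.elim 0 (Sum.elim (fun i => (t i : ℂ)) (-fun i => (t i : ℂ))))) := by
  rw [toComplex_realDiagonal]
  congr 1
  ext ((i | i | i) | (i | i | i)) <;> simp [wittDiagonal]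

/-- The identification of the indices of the pairs of hyperbolic planes and of the definite part. -/
def pairSumEquiv {m l : ℕ} (h : 2 * r + m = l) : (Fin r ⊕ Fin r) ⊕ Fin m ≃ Fin l :=
  ((pairEquiv r).symm.sumCongr (Equiv.refl (Fin m))).trans (sumEquiv h)

theorem pairSumEquiv_inl {m l : ℕ} (h : 2 * r + m = l) {s : ℕ → ℂ} {d d' : Fin r → ℂ}
    (hs : ∀ i : Fin r, s (2 * i) = d i) (hs' : ∀ i : Fin r, s (2 * i + 1) = d' i)
    (i : Fin r ⊕ Fin r) : s (pairSumEquiv h (Sum.inl i)) = Sum.elim d d' i := by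
  obtain ⟨k, rfl⟩ := (pairEquiv r).surjective i
  rw [elim_pairEquiv', pairSumEquiv, Equiv.trans_apply, Equiv.sumCongr_apply, Sum.map_inl,
    Equiv.symm_apply_apply, sumEquiv_inl]
  split_ifs with hk
  · rw [← hs]
    congr 1
    simp only
    omega
  · rw [← hs']
    congr 1
    simp only
    omega

theorem pairSumEquiv_inr {m l : ℕ} (h : 2 * r + m = l) (i : Fin m) :
    (pairSumEquiv h (Sum.inr i) : ℕ) = 2 * r + i := by
  rw [pairSumEquiv, Equiv.trans_apply, Equiv.sumCongr_apply, Sum.map_inr, sumEquiv_inr]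
  rfl

theorem finrank_skewScalars_quaternion_add_one :
    Module.finrank ℝ (skewScalars ℍ[ℝ] 1) + 1 = Module.finrank ℝ ℍ[ℝ] := by
  rw [finrank_skewScalars_quaternion, Quaternion.finrank_eq_four]

end QuaternionForms

/-! ### The Lie algebras `sp(p, r)` -/

section Symplectic

open Quaternion

theorem nonempty_spCompact_equiv (k : ℕ) :
    Nonempty (spCompact k ≃ₗ⁅ℝ⁆ unitaryAlgebra (1 : Matrix (Fin k) (Fin k) ℍ[ℝ])) := by
  refine nonempty_lieEquiv_of_image (isComplexModel_toComplex.lieHom_injective (Equiv.refl _))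
    fun Y => ?_
  have h1 := exists_toComplex_mem_unitaryAlgebra_iff (K := (1 : Matrix (Fin k) (Fin k) ℍ[ℝ]))
    (K' := 1) (by rw [toComplex_one, one_mul]) Y
  rw [toComplex_one, mul_one (Matrix.J (Fin k) ℂ), ← mem_spC] at h1
  exact h1.symm

/-- `sp(p, r)`, given by complex matrices that are skew for a Hermitian and a symplectic form, is
the Lie algebra of a quaternionic form. -/
theorem nonempty_spPR_equiv {p r k : ℕ} (hp : k + r = p) : Nonempty (spPR p r ≃ₗ⁅ℝ⁆
    unitaryAlgebra (wittForm (1 : Matrix (Fin k) (Fin k) ℍ[ℝ]) 1 r)) := by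
  obtain ⟨S, S', h, h', hS⟩ := exists_indefinite_eq_wittForm ℍ[ℝ]
    (Fintype.equivOfCardEq (α := Fin p) (β := Fin k ⊕ Fin r) (by simp [hp]))
  set K₀ : Matrix (Fin p ⊕ Fin r) (Fin p ⊕ Fin r) ℍ[ℝ] :=
    diagonal (Sum.elim (fun _ => 1) fun _ => -1) with hK₀
  have e₁ := conjEquiv h h' (unitaryAlgebra K₀) _ (conj_mem_unitaryAlgebra h hS)
  set K : Matrix (Fin p ⊕ Fin r) (Fin p ⊕ Fin r) ℂ :=
    LieAlgebra.Orthogonal.indefiniteDiagonal (Fin p) (Fin r) ℂ with hK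
  have hK₁ : toComplex K₀ = fromBlocks K 0 0 K := by
    have h1 : K₀ = realDiagonal ℍ[ℝ] (Sum.elim (fun _ => 1) fun _ => -1) := by
      rw [hK₀, realDiagonal]
      congr 1
      ext1 (i | i) <;> simp
    rw [h1, toComplex_realDiagonal, ← fromBlocks_diagonal, hK,
      LieAlgebra.Orthogonal.indefiniteDiagonal]
    congr 1 <;> congr 1 <;> ext1 (i | i) <;> simp
  have hK₂ : K * K = 1 := by
    rw [hK, LieAlgebra.Orthogonal.indefiniteDiagonal, diagonal_mul_diagonal, ← diagonal_one]
    congr 1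
    ext1 (i | i) <;> simp
  have hKt : Kᵀ = K := diagonal_transpose _
  have hKh : Kᴴ = K := by
    rw [hK, LieAlgebra.Orthogonal.indefiniteDiagonal, diagonal_conjTranspose]
    congr 1
    ext1 (i | i) <;> simp
  -- a congruence that preserves the Hermitian form and takes the standard symplectic form to the
  -- one induced by the quaternionic form
  let D : Matrix ((Fin p ⊕ Fin r) ⊕ (Fin p ⊕ Fin r)) ((Fin p ⊕ Fin r) ⊕ (Fin p ⊕ Fin r)) ℂ :=
    fromBlocks 1 0 0 K
  have hD : D * D = 1 := by simp [D, fromBlocks_multiply, hK₂]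
  let B := fromBlocks K 0 0 K
  have hB : B * B = 1 := by simp [B, fromBlocks_multiply, hK₂]
  have hDh : Dᴴ = D := by simp [D, fromBlocks_conjTranspose, hKh]
  have hDt : Dᵀ = D := by simp [D, fromBlocks_transpose, hKt]
  have hDB : D * B * D = B := by simp [D, B, fromBlocks_multiply, hK₂]
  have hDJ : D * Matrix.J _ ℂ * D = Matrix.J _ ℂ * B := by
    simp [D, B, Matrix.J, fromBlocks_multiply]
  have e₂ : Nonempty (spPR p r ≃ₗ⁅ℝ⁆ unitaryAlgebra K₀) := by
    have hφ : Function.Injective ((conjLieHom ℝ hD).comp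
        (isComplexModel_toComplex.lieHom (Equiv.refl ((Fin p ⊕ Fin r) ⊕ (Fin p ⊕ Fin r))))) := by
      intro X Y hXY
      have h1 : D * toComplex X * D = D * toComplex Y * D := hXY
      have h2 := congrArg (fun Z => D * Z * D) h1
      simp only [← mul_assoc, hD, one_mul] at h2
      simp only [mul_assoc, hD, mul_one] at h2
      exact isComplexModel_toComplex.injective h2
    refine nonempty_lieEquiv_of_image hφ fun Y => ?_
    have h1 := exists_toComplex_mem_unitaryAlgebra_iff (K := K₀) (K' := B) (by rw [hK₁, hB])
      (D * Y * D)
    have h2 : ∀ X, toComplex X = D * Y * D ↔ D * toComplex X * D = Y := fun X => by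
      constructor <;> intro h
      · rw [h, ← mul_assoc, ← mul_assoc, hD, one_mul, mul_assoc, hD, mul_one]
      · rw [← h, ← mul_assoc, ← mul_assoc, hD, one_mul, mul_assoc, hD, mul_one]
    have h3 : ∀ Z, D * Z * D = 0 ↔ Z = 0 := fun Z => by
      constructor <;> intro h
      · have h4 := congrArg (fun Z => D * Z * D) h
        simp only [← mul_assoc, hD, one_mul] at h4
        simpa only [mul_assoc, hD, mul_one, mul_zero, zero_mul] using h4
      · rw [h, mul_zero, zero_mul]
    have h5 : (D * Y * D)ᴴ * B + B * (D * Y * D) = D * (Yᴴ * B + B * Y) * D := by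
      rw [conjTranspose_mul, conjTranspose_mul, hDh]
      have h6 : D * (Yᴴ * D) * B = D * Yᴴ * (D * B * D) * D := by
        simp only [mul_assoc, hD, mul_one]
      have h7 : B * (D * Y * D) = D * (D * B * D) * Y * D := by
        simp only [← mul_assoc, hD, one_mul]
      rw [h6, h7, hDB]
      noncomm_ring
    have h8 : (D * Y * D)ᵀ * (Matrix.J _ ℂ * B) + Matrix.J _ ℂ * B * (D * Y * D) =
        D * (Yᵀ * Matrix.J _ ℂ + Matrix.J _ ℂ * Y) * D := by
      rw [transpose_mul, transpose_mul, hDt, ← hDJ]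
      have h6 : D * (Yᵀ * D) * (D * Matrix.J _ ℂ * D) = D * Yᵀ * (D * D) * Matrix.J _ ℂ * D := by
        simp only [mul_assoc]
      have h7 : D * Matrix.J _ ℂ * D * (D * Y * D) = D * Matrix.J _ ℂ * (D * D) * Y * D := by
        simp only [mul_assoc]
      rw [h6, h7, hD]
      noncomm_ring
    rw [hK₁, h5, h8, h3, h3, ← mem_skewAdjoint] at h1
    exact h1.symm.trans (exists_congr fun X => and_congr_right fun _ => h2 X)
  exact e₂.map fun e => e.trans e₁

/-- The symplectic form induced by the quaternionic form of `sp(p, r)`, in the order in which the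
entries of `H₀` decrease; each nonzero entry occurs twice. -/
theorem formEquiv_spPR {r k l : ℕ} (h : 2 * r + k = l) : FormEquiv
    (Matrix.J _ ℂ * toComplex (wittForm (1 : Matrix (Fin k) (Fin k) ℍ[ℝ]) 1 r))
    (fun _ : Unit => Sum.elim
      (Sum.elim 0 (Sum.elim (fun i => (chamberPoint r i : ℂ)) (-fun i => (chamberPoint r i : ℂ))))
      (Sum.elim 0 (Sum.elim (fun i => (chamberPoint r i : ℂ)) (-fun i => (chamberPoint r i : ℂ)))))
    (hyperbolicForm (-1) (Fin l))
    (fun _ : Unit => Sum.elim (fun i : Fin l => ((r - i / 2 : ℕ) : ℂ))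
      fun i => -((r - i / 2 : ℕ) : ℂ)) := by
  have h1 := formEquiv_quaternion (1 : Matrix (Fin k) (Fin k) ℍ[ℝ]) 1
    (fun _ : Unit => fun i => (chamberPoint r i : ℂ)) (fun _ => fun i => (chamberPoint r i : ℂ))
  have h2 : FormEquiv (Matrix.J (Fin k) ℂ * toComplex (1 : Matrix (Fin k) (Fin k) ℍ[ℝ]))
      (fun (_ : Unit) _ => 0) (hyperbolicForm (-1) (Fin k)) fun _ _ => 0 := by
    rw [toComplex_one, mul_one]
    refine FormEquiv.of_monomial (Equiv.refl _) (Sum.elim (fun _ => 1) fun _ => -1) ?_ ?_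
      fun _ _ => rfl
    · rintro (i | i) <;> simp
    · rintro (i | i) (j | j) <;> simp [Matrix.J, hyperbolicForm]
  have h3 := formEquiv_hyperbolicForm h2 (pairSumEquiv h)
    (t := fun _ => Sum.elim (fun i => (chamberPoint r i : ℂ)) (fun i => (chamberPoint r i : ℂ)))
    (s := fun _ i => ((r - i / 2 : ℕ) : ℂ))
    (fun _ i => pairSumEquiv_inl h (s := fun i => ((r - i / 2 : ℕ) : ℂ))
      (fun i => by simp [chamberPoint])
      (fun i => by
        rw [show (2 * (i : ℕ) + 1) / 2 = i by omega, chamberPoint, Complex.ofReal_natCast]) i)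
    (fun _ i => by rw [pairSumEquiv_inr, Nat.sub_eq_zero_of_le (by omega), Nat.cast_zero])
  rw [Complex.ofReal_one] at h1
  exact h1.trans h3

theorem minimalParabolic_spPR (p r : ℕ) (hr : 1 ≤ r) (hp : r ≤ p) :
    Nonempty (MinimalParabolic (spPR p r)) ∧ ∀ P : MinimalParabolic (spPR p r),
      Nonempty (P.m ≃ₗ⁅ℝ⁆ (spCompact (p - r) × ⨁ _ : Fin r, spCompact 1)) ∧
      Module.finrank ℝ P.a = r ∧ Module.finrank ℝ P.n = r * (4 * p - 1) ∧
      ∃ φ : ℂ ⊗[ℝ] (spPR p r) ≃ₗ⁅ℂ⁆ (spC (p + r)),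
        complexImage φ P.p = standardParabolic (diagonalCartan (spC (p + r))) (simpleC (p + r))
          ({i | Odd i ∧ i ≤ 2 * r - 1} ∪ Set.Icc (2 * r + 1) (p + r)) := by
  obtain ⟨Q, f, hf, -, hH, ⟨hm⟩, ha, hn, -⟩ := exists_parabolic_realForm isComplexModel_toComplex
    (one_mul 1) (by rw [one_smul, one_mul]) (by rw [one_smul, conjTranspose_one])
    skew_of_mem_unitaryAlgebra_one finrank_skewScalars_quaternion_add_one (fun _ => mem_spC')
    (center_spC (p + r)) (formEquiv_spPR (r := r) (k := p - r) (by omega)) ()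
    (toComplex_wittDiagonal _)
  obtain ⟨e⟩ := nonempty_spPR_equiv (p := p) (r := r) (k := p - r) (by omega)
  obtain ⟨e₁⟩ := nonempty_spCompact_equiv (p - r)
  obtain ⟨e₂⟩ := nonempty_spCompact_equiv 1
  have hn' : Module.finrank ℝ Q.n = r * (4 * p - 1) := by
    rw [hn, finrank_skewScalars_quaternion, Quaternion.finrank_eq_four, Fintype.card_fin, ← mul_add,
      mul_assoc, ← mul_add]
    congr 1
    omega
  have hV := complexImage_p_spC hf Q (fun k => r - k / 2) (fun k => by omega) hH
    (S := {i | Odd i ∧ i ≤ 2 * r - 1} ∪ Set.Icc (2 * r + 1) (p + r))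
    (fun k hk => by
      simp only [Set.mem_union, Set.mem_ofPred_eq, Nat.odd_iff, Set.mem_Icc]
      omega)
    (fun k hk => by
      simp only [Set.mem_union, Set.mem_ofPred_eq, Nat.odd_iff, Set.mem_Icc]
      omega)
  obtain ⟨h3, h4⟩ := forall_of_realForm e Q hf ⟨hm.trans (prodCongr e₁.symm
    ((piCongr (Fin r) e₂.symm).trans (piEquivDirectSum _ _ _)))⟩ ha hn' hV rfl
  refine ⟨h3, fun P => ?_⟩
  obtain ⟨h5, h6, h7, φ, hφ, -⟩ := h4 P
  exact ⟨h5, h6, h7, φ, hφ⟩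

end Symplectic

/-! ### Cartan subalgebras of `m₀` -/

section Cartan

variable {g₀ g : Type*} [LieRing g₀] [LieAlgebra ℝ g₀] [FiniteDimensional ℝ g₀] [LieRing g]
  [LieAlgebra ℂ g] {f : g₀ → g}

/-- If the common centralizer of the images of the regular element of `a₀` and of a semisimple
element `T` of `m₀` is the abelian subalgebra `h`, then the centralizer of `T` in `m₀` is a Cartan
subalgebra of `m₀`. -/
theorem exists_isCartanSubalgebra (hf : IsRealForm f) (P : MinimalParabolic g₀) {T : g₀}
    (hT : T ∈ P.m) {h : LieSubalgebra ℂ g} (hab : ∀ Y ∈ h, ∀ Z ∈ h, ⁅Y, Z⁆ = 0)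
    (hh : ∀ Y, Y ∈ h ↔ ⁅f P.H₀, Y⁆ = 0 ∧ ⁅f T, Y⁆ = 0)
    (hss : ∀ Y : g, ⁅f T, ⁅f T, Y⁆⁆ = 0 → ⁅f T, Y⁆ = 0) :
    ∃ t : LieSubalgebra ℝ P.m, t.IsCartanSubalgebra ∧
      complexImage hf.equiv (t.toSubmodule.map P.m.toSubmodule.subtype ⊔ P.a.toSubmodule) =
        h.toSubmodule := by
  have hinj : ∀ X, f X = 0 → X = 0 := fun X hX =>
    (hf.eq_zero X 0 (by rw [hX, hf.map_zero, smul_zero, add_zero])).1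
  have hmem : ∀ X ∈ P.m, ⁅T, X⁆ = 0 → f X ∈ h := fun X hX hTX => (hh _).2
    ⟨by rw [← hf.map_lie, hX.2 _ P.H₀.2, hf.map_zero], by rw [← hf.map_lie, hTX, hf.map_zero]⟩
  let t : LieSubalgebra ℝ P.m :=
    { carrier := {X | ⁅T, (X : g₀)⁆ = 0}
      add_mem' := fun {X Y} (hX : ⁅T, (X : g₀)⁆ = 0) (hY : ⁅T, (Y : g₀)⁆ = 0) => by
        change ⁅T, (X : g₀) + (Y : g₀)⁆ = 0
        rw [lie_add, hX, hY, add_zero]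
      zero_mem' := lie_zero T
      smul_mem' := fun c X (hX : ⁅T, (X : g₀)⁆ = 0) => by
        change ⁅T, c • (X : g₀)⁆ = 0
        rw [lie_smul, hX, smul_zero]
      lie_mem' := fun {X Y} (hX : ⁅T, (X : g₀)⁆ = 0) (hY : ⁅T, (Y : g₀)⁆ = 0) => by
        change ⁅T, ⁅(X : g₀), (Y : g₀)⁆⁆ = 0
        rw [leibniz_lie, hX, hY, zero_lie, lie_zero, add_zero] }
  have ht : ∀ X : P.m, X ∈ t ↔ ⁅T, (X : g₀)⁆ = 0 := fun X => Iff.rfl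
  refine ⟨t, ⟨?_, ?_⟩, ?_⟩
  · have : IsLieAbelian t := ⟨fun X Y => Subtype.ext (Subtype.ext (hinj _ ?_))⟩
    · infer_instance
    · change f ⁅((X : P.m) : g₀), ((Y : P.m) : g₀)⁆ = 0
      rw [hf.map_lie]
      exact hab _ (hmem _ (X : P.m).2 X.2) _ (hmem _ (Y : P.m).2 Y.2)
  · refine le_antisymm (fun X hX => ?_) (LieSubalgebra.le_normalizer t)
    rw [LieSubalgebra.mem_normalizer_iff'] at hX
    -- an element of the normalizer satisfies `⁅T, ⁅T, X⁆⁆ = 0`, as `T` lies in `t`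
    have h1 := (ht _).1 (hX ⟨T, hT⟩ ((ht _).2 (lie_self T)))
    change ⁅T, ⁅T, (X : g₀)⁆⁆ = 0 at h1
    refine (ht X).2 (hinj _ ?_)
    rw [hf.map_lie]
    refine hss _ ?_
    rw [← hf.map_lie, ← hf.map_lie, h1, hf.map_zero]
  · have hTa : ∀ X ∈ P.a, ⁅T, X⁆ = 0 := fun X hX => by rw [← lie_skew, hT.2 X hX, neg_zero]
    ext Y
    refine Iff.trans ?_ (hh Y).symm
    rw [← hf.mem_complexImage_m_sup_a, hf.mem_complexImage, hf.mem_complexImage]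
    constructor
    · rintro ⟨A, hA, B, hB, rfl⟩
      have h1 : ∀ A ∈ t.toSubmodule.map P.m.toSubmodule.subtype ⊔ P.a.toSubmodule,
          A ∈ P.m.toSubmodule ⊔ P.a.toSubmodule ∧ ⁅T, A⁆ = 0 := by
        intro A hA
        obtain ⟨X, ⟨X, hX, rfl⟩, Z, hZ, rfl⟩ := Submodule.mem_sup.1 hA
        refine ⟨Submodule.add_mem_sup X.2 hZ, ?_⟩
        rw [lie_add, hTa Z hZ, add_zero]
        exact hX
      refine ⟨⟨A, (h1 A hA).1, B, (h1 B hB).1, rfl⟩, ?_⟩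
      rw [lie_add, lie_smul, ← hf.map_lie, ← hf.map_lie, (h1 A hA).2, (h1 B hB).2, hf.map_zero,
        smul_zero, add_zero]
    · rintro ⟨⟨A, hA, B, hB, rfl⟩, h1⟩
      rw [lie_add, lie_smul, ← hf.map_lie, ← hf.map_lie] at h1
      obtain ⟨h2, h3⟩ := hf.eq_zero _ _ h1
      have h4 : ∀ A ∈ P.m.toSubmodule ⊔ P.a.toSubmodule, ⁅T, A⁆ = 0 →
          A ∈ t.toSubmodule.map P.m.toSubmodule.subtype ⊔ P.a.toSubmodule := by
        intro A hA h
        obtain ⟨X, hX, Z, hZ, rfl⟩ := Submodule.mem_sup.1 hA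
        rw [lie_add, hTa Z hZ, add_zero] at h
        exact Submodule.add_mem_sup ⟨⟨X, hX⟩, h, rfl⟩ hZ
      exact ⟨A, h4 A hA h2, B, h4 B hB h3, rfl⟩

/-- The diagonal matrices are the common centralizer of two diagonal matrices whose entries jointly
separate the indices. -/
theorem mem_diagonalCartan_iff_lie_eq_zero {κ : Type*} [Fintype κ] [DecidableEq κ]
    {g : LieSubalgebra ℂ (Matrix κ κ ℂ)} {D D' : g} {u w : κ → ℂ}
    (hD : (D : Matrix κ κ ℂ) = diagonal u) (hD' : (D' : Matrix κ κ ℂ) = diagonal w)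
    (h : ∀ i j, u i = u j → w i = w j → i = j) (Y : g) :
    Y ∈ diagonalCartan g ↔ ⁅D, Y⁆ = 0 ∧ ⁅D', Y⁆ = 0 := by
  have key : ∀ {D : g} {u : κ → ℂ}, (D : Matrix κ κ ℂ) = diagonal u →
      (⁅D, Y⁆ = 0 ↔ ∀ i j, (u i - u j) * (Y : Matrix κ κ ℂ) i j = 0) := by
    intro D u hD
    have h1 : ∀ i j, (⁅D, Y⁆ : g).1 i j = (u i - u j) * (Y : Matrix κ κ ℂ) i j := by
      intro i j
      rw [LieSubalgebra.coe_bracket, hD, lie_apply_of_isDiag fun i j hij => diagonal_apply_ne _ hij,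
        diagonal_apply_eq, diagonal_apply_eq]
      ring
    constructor
    · intro h2 i j
      rw [← h1, h2]
      rfl
    · exact fun h2 => Subtype.ext (Matrix.ext fun i j => (h1 i j).trans (h2 i j))
  rw [mem_diagonalCartan, key hD, key hD']
  constructor
  · intro h1
    constructor <;> intro i j <;> by_cases hij : i = j
    · rw [hij, sub_self, zero_mul]
    · rw [h1 i j hij, mul_zero]
    · rw [hij, sub_self, zero_mul]
    · rw [h1 i j hij, mul_zero]
  · rintro ⟨h1, h2⟩ i j hij
    by_contra h3
    exact hij (h i j (sub_eq_zero.1 ((mul_eq_zero.1 (h1 i j)).resolve_right h3))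
      (sub_eq_zero.1 ((mul_eq_zero.1 (h2 i j)).resolve_right h3)))

/-- A diagonal matrix acts semisimply, so that `0` is not a proper generalized eigenvalue. -/
theorem lie_eq_zero_of_lie_lie_eq_zero {κ : Type*} [Fintype κ] [DecidableEq κ]
    {g : LieSubalgebra ℂ (Matrix κ κ ℂ)} {D : g} {u : κ → ℂ}
    (hD : (D : Matrix κ κ ℂ) = diagonal u) (Y : g) (hY : ⁅D, ⁅D, Y⁆⁆ = 0) : ⁅D, Y⁆ = 0 := by
  have h1 : ∀ (Y : g) i j, (⁅D, Y⁆ : g).1 i j = (u i - u j) * (Y : Matrix κ κ ℂ) i j := by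
    intro Y i j
    rw [LieSubalgebra.coe_bracket, hD, lie_apply_of_isDiag fun i j hij => diagonal_apply_ne _ hij,
      diagonal_apply_eq, diagonal_apply_eq]
    ring
  refine Subtype.ext (Matrix.ext fun i j => ?_)
  have h2 := congrFun₂ (congrArg Subtype.val hY) i j
  rw [h1] at h2
  rcases mul_eq_zero.1 h2 with h3 | h3
  · rw [h1, h3, zero_mul]
    rfl
  · exact h3

theorem lie_eq_zero_of_mem_diagonalCartan {κ : Type*} [Fintype κ] [DecidableEq κ]
    {g : LieSubalgebra ℂ (Matrix κ κ ℂ)} {Y Z : g} (hY : Y ∈ diagonalCartan g)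
    (hZ : Z ∈ diagonalCartan g) : ⁅Y, Z⁆ = 0 := by
  rw [mem_diagonalCartan] at hY hZ
  refine Subtype.ext (Matrix.ext fun i j => ?_)
  rw [LieSubalgebra.coe_bracket, lie_apply_of_isDiag hY]
  by_cases hij : i = j
  · rw [hij, mul_comm, sub_self]
    rfl
  · rw [hZ i j hij, mul_zero, zero_mul, sub_self]
    rfl

end Cartan

/-! ### The Lie algebras `so*(2n)` -/

section SkewHermitian

open Quaternion

/-- The quaternion with the given real coordinates. -/
noncomputable def quaternionOf (a b c d : ℝ) : ℍ[ℝ] := ⟨a, b, c, d⟩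

@[simp] theorem quaternionOf_re (a b c d : ℝ) : (quaternionOf a b c d).re = a := rfl
@[simp] theorem quaternionOf_imI (a b c d : ℝ) : (quaternionOf a b c d).imI = b := rfl
@[simp] theorem quaternionOf_imJ (a b c d : ℝ) : (quaternionOf a b c d).imJ = c := rfl
@[simp] theorem quaternionOf_imK (a b c d : ℝ) : (quaternionOf a b c d).imK = d := rfl

/-- The quaternion `j`. -/
noncomputable def quaternionJ : ℍ[ℝ] := quaternionOf 0 0 1 0

theorem star_quaternionJ : star quaternionJ = -quaternionJ := by
  ext <;> simp [quaternionJ]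

theorem quaternionJ_mul_self : quaternionJ * quaternionJ = -1 := by
  ext <;> simp [quaternionJ]

/-- The standard skew-Hermitian quaternionic form. -/
noncomputable def skewForm (κ : Type*) [DecidableEq κ] : Matrix κ κ ℍ[ℝ] :=
  diagonal fun _ => quaternionJ

variable {κ : Type*} [DecidableEq κ]

theorem conjTranspose_skewForm : (skewForm κ)ᴴ = (-1 : ℝ) • skewForm κ := by
  rw [skewForm, diagonal_conjTranspose, neg_one_smul, diagonal_neg]
  congr 1
  funext i
  exact star_quaternionJ

variable [Fintype κ]

theorem skewForm_mul_self : skewForm κ * skewForm κ = (-1 : ℝ) • 1 := by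
  rw [skewForm, diagonal_mul_diagonal, neg_one_smul, ← diagonal_one, diagonal_neg]
  congr 1
  funext i
  exact quaternionJ_mul_self

theorem toComplex_skewForm : toComplex (skewForm κ) = -Matrix.J κ ℂ := by
  have h1 : quaternionFst quaternionJ = 0 := by apply Complex.ext <;> rfl
  have h2 : quaternionSnd quaternionJ = 1 := by apply Complex.ext <;> rfl
  rw [toComplex, skewForm, diagonal_map (map_zero _), diagonal_map (map_zero _), Matrix.J,
    fromBlocks_neg]
  simp only [h1, h2, diagonal_zero', diagonal_one]
  congr 1 <;> ext i j <;> simp [one_apply, apply_ite]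

theorem J_mul_toComplex_skewForm : Matrix.J κ ℂ * toComplex (skewForm κ) = 1 := by
  rw [toComplex_skewForm, mul_neg, J_squared, neg_neg]

theorem nonempty_soStar_equiv (n : ℕ) :
    Nonempty (soStar n ≃ₗ⁅ℝ⁆ unitaryAlgebra (skewForm (Fin n))) := by
  refine nonempty_lieEquiv_of_image (isComplexModel_toComplex.lieHom_injective (Equiv.refl _))
    fun Y => ?_
  have h1 := exists_toComplex_mem_unitaryAlgebra_iff (K := skewForm (Fin n))
    (K' := Matrix.J (Fin n) ℂ) (by rw [toComplex_skewForm, neg_mul, J_squared, neg_neg]) Y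
  rw [J_mul_toComplex_skewForm, toComplex_skewForm, mul_neg, neg_mul, ← neg_add, neg_eq_zero,
    ← mem_skewAdjoint] at h1
  exact h1.symm

/-- The standard skew-Hermitian form of rank `a + 2r` is a sum of `r` hyperbolic planes and the
standard form of rank `a`: the vectors `(1, i)` and `(-j/2, k/2)` span a hyperbolic plane. -/
theorem nonempty_skewForm_equiv {n a r : ℕ} (hn : n = a + (r + r)) :
    Nonempty (unitaryAlgebra (skewForm (Fin n)) ≃ₗ⁅ℝ⁆
      unitaryAlgebra (wittForm (skewForm (Fin a)) (-1) r)) := by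
  let σ : Fin a ⊕ (Fin r ⊕ Fin r) ≃ Fin n := Fintype.equivOfCardEq (by simp [hn])
  have e₁ := submatrixEquiv σ (K := skewForm (Fin n)) (K' := skewForm _) (by
    rw [skewForm, submatrix_diagonal_equiv]
    rfl)
  let i := quaternionOf 0 1 0 0
  let v := quaternionOf 0 0 (-1 / 2) 0
  let w := quaternionOf 0 0 0 (1 / 2)
  let S : Matrix (Fin a ⊕ (Fin r ⊕ Fin r)) (Fin a ⊕ (Fin r ⊕ Fin r)) ℍ[ℝ] :=
    fromBlocks 1 0 0 (scalarBlocks (Fin r) 1 v i w)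
  let S' : Matrix (Fin a ⊕ (Fin r ⊕ Fin r)) (Fin a ⊕ (Fin r ⊕ Fin r)) ℍ[ℝ] :=
    fromBlocks 1 0 0 (scalarBlocks (Fin r) (quaternionOf (1 / 2) 0 0 0)
      (quaternionOf 0 (-1 / 2) 0 0) (quaternionOf 0 0 1 0) (quaternionOf 0 0 0 (-1)))
  have h1 : S * S' = 1 := by
    simp only [S, S', fromBlocks_multiply, scalarBlocks_mul, Matrix.mul_zero, Matrix.zero_mul,
      add_zero, zero_add, Matrix.mul_one, ← fromBlocks_one (l := Fin a)]
    congr 1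
    rw [← scalarBlocks_one]
    congr 1 <;> ext <;> simp [i, v, w] <;> norm_num
  have h2 : S' * S = 1 := by
    simp only [S, S', fromBlocks_multiply, scalarBlocks_mul, Matrix.mul_zero, Matrix.zero_mul,
      add_zero, zero_add, Matrix.mul_one, ← fromBlocks_one (l := Fin a)]
    congr 1
    rw [← scalarBlocks_one]
    congr 1 <;> ext <;> simp [i, v, w] <;> norm_num
  have h3 : Sᴴ * skewForm _ * S = wittForm (skewForm (Fin a)) (-1) r := by
    have h4 : skewForm (Fin a ⊕ (Fin r ⊕ Fin r)) = fromBlocks (skewForm (Fin a)) 0 0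
        (scalarBlocks (Fin r) quaternionJ 0 0 quaternionJ) := by
      rw [skewForm, skewForm, scalarBlocks, diagonal_zero', fromBlocks_diagonal,
        fromBlocks_diagonal]
      congr 1
      ext1 (k | k | k) <;> rfl
    have h5 : (fromBlocks 0 1 ((-1 : ℝ) • 1) 0 : Matrix (Fin r ⊕ Fin r) (Fin r ⊕ Fin r) ℍ[ℝ]) =
        scalarBlocks (Fin r) 0 1 (-1) 0 := by
      rw [scalarBlocks, diagonal_zero', diagonal_one, neg_one_smul, ← diagonal_one, diagonal_neg]
    rw [h4, wittForm, h5]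
    simp only [S, fromBlocks_multiply, scalarBlocks_mul, Matrix.mul_zero, Matrix.zero_mul,
      add_zero, zero_add, Matrix.mul_one, Matrix.one_mul, fromBlocks_conjTranspose,
      scalarBlocks_conjTranspose, conjTranspose_zero, conjTranspose_one]
    congr 1
    congr 1 <;> ext <;> simp [i, v, w, quaternionJ] <;> norm_num
  exact ⟨e₁.trans (conjEquiv h1 h2 _ _ (conj_mem_unitaryAlgebra h1 h3))⟩

/-- In rank at most `1`, the Lie algebra of the standard form consists of multiples of `j`. -/
theorem apply_of_mem_skewForm [Subsingleton κ] {Y : Matrix κ κ ℍ[ℝ]}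
    (hY : Y ∈ unitaryAlgebra (skewForm κ)) (i : κ) : Y i i = quaternionOf 0 0 (Y i i).imJ 0 := by
  have h1 : (Yᴴ * skewForm κ + skewForm κ * Y) i i = 0 := congrFun₂ hY i i
  rw [Matrix.add_apply, skewForm, mul_diagonal, diagonal_mul, conjTranspose_apply] at h1
  generalize Y i i = q at h1 ⊢
  have h2 := congrArg QuaternionAlgebra.imI h1
  have h3 := congrArg QuaternionAlgebra.imJ h1
  have h4 := congrArg QuaternionAlgebra.imK h1
  simp [quaternionJ] at h2 h3 h4
  ext <;> simp <;> linarith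

/-- The standard form of rank at most `1` is anisotropic, and its Lie algebra is compact. -/
theorem skew_of_mem_skewForm [Subsingleton κ] {Y : Matrix κ κ ℍ[ℝ]}
    (hY : Y ∈ unitaryAlgebra (skewForm κ)) : Yᴴ = -Y := by
  ext1 i j
  obtain rfl := Subsingleton.elim i j
  rw [conjTranspose_apply, Matrix.neg_apply, apply_of_mem_skewForm hY]
  ext <;> simp

/-- The entries of the image of an element of `m₀` that is regular in `m₀`. -/
noncomputable def regularEntry (r k : ℕ) : ℂ :=
  if k < 2 * r then if k % 2 = 0 then Complex.I else -Complex.I else 0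

/-- The symmetric form induced by the skew quaternionic form of `so*(2n)`. The two diagonal matrices
that are carried along are the images of `H₀` (for `false`), whose nonzero entries occur twice, and
of an element of `m₀` (for `true`), whose entries `i` and `-i` separate these. -/
theorem formEquiv_soStar {r a l : ℕ} (h : 2 * r + a = l) : FormEquiv
    (Matrix.J _ ℂ * toComplex (wittForm (skewForm (Fin a)) (-1) r))
    (fun b : Bool => bif b then
      Sum.elim (Sum.elim 0 (Sum.elim (fun _ => Complex.I) (-fun _ => -Complex.I)))
        (Sum.elim 0 (Sum.elim (fun _ => -Complex.I) (-fun _ => Complex.I)))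
      else Sum.elim
        (Sum.elim 0 (Sum.elim (fun i => (chamberPoint r i : ℂ)) (-fun i => (chamberPoint r i : ℂ))))
        (Sum.elim 0 (Sum.elim (fun i => (chamberPoint r i : ℂ))
          (-fun i => (chamberPoint r i : ℂ)))))
    (LieAlgebra.Orthogonal.JD (Fin l) ℂ)
    (fun b : Bool => bif b then
      Sum.elim (fun k : Fin l => regularEntry r k) fun k => -regularEntry r k
      else Sum.elim (fun k : Fin l => ((r - k / 2 : ℕ) : ℂ)) fun k => -((r - k / 2 : ℕ) : ℂ)) := by
  let x : Bool → Fin r → ℂ := fun b => bif b then fun _ => Complex.I else fun i => chamberPoint r i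
  let y : Bool → Fin r → ℂ := fun b => bif b then fun _ => -Complex.I else fun i => chamberPoint r i
  let s : Bool → ℕ → ℂ := fun b k => bif b then regularEntry r k else ((r - k / 2 : ℕ) : ℂ)
  have h1 := formEquiv_quaternion (skewForm (Fin a)) (-1) x y
  rw [J_mul_toComplex_skewForm, Complex.ofReal_neg, Complex.ofReal_one, neg_neg] at h1
  have h3 := formEquiv_hyperbolicForm (formEquiv_one Bool (Fin a)) (pairSumEquiv h)
    (t := fun b => Sum.elim (x b) (y b)) (s := fun b k => s b k)
    (fun b i => pairSumEquiv_inl h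
      (fun i => by
        cases b
        · change (((r - 2 * i / 2 : ℕ)) : ℂ) = ((((r - i : ℕ)) : ℝ) : ℂ)
          rw [show 2 * (i : ℕ) / 2 = i by omega, Complex.ofReal_natCast]
        · change regularEntry r (2 * i) = Complex.I
          rw [regularEntry, if_pos (by omega), if_pos (by omega)])
      (fun i => by
        cases b
        · change (((r - (2 * i + 1) / 2 : ℕ)) : ℂ) = ((((r - i : ℕ)) : ℝ) : ℂ)
          rw [show (2 * (i : ℕ) + 1) / 2 = i by omega, Complex.ofReal_natCast]
        · change regularEntry r (2 * i + 1) = -Complex.I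
          rw [regularEntry, if_pos (by omega), if_neg (by omega)]) i)
    (fun b i => by
      rw [pairSumEquiv_inr]
      cases b
      · change (((r - (2 * r + i) / 2 : ℕ)) : ℂ) = 0
        rw [Nat.sub_eq_zero_of_le (by omega), Nat.cast_zero]
      · change regularEntry r (2 * r + i) = 0
        rw [regularEntry, if_neg (by omega)])
  rw [show hyperbolicForm 1 (Fin l) = LieAlgebra.Orthogonal.JD (Fin l) ℂ by
    rw [hyperbolicForm, one_smul, LieAlgebra.Orthogonal.JD]] at h3
  convert h1.trans h3 using 1
  · funext b
    cases b <;> rfl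
  · funext b
    cases b <;> rfl

theorem lie_apply_zero {F : Type*} [Ring F] (X Y : Matrix (Fin 1) (Fin 1) F) :
    ⁅X, Y⁆ 0 0 = X 0 0 * Y 0 0 - Y 0 0 * X 0 0 := by
  rw [LieRing.of_associative_ring_bracket, Matrix.sub_apply, mul_apply, mul_apply,
    Fin.sum_univ_one, Fin.sum_univ_one]

/-- The matrix of the commutator with the imaginary part of a quaternion. -/
noncomputable def adMatrix (q : ℍ[ℝ]) : Matrix (Fin 3) (Fin 3) ℝ :=
  !![0, -2 * q.imK, 2 * q.imJ; 2 * q.imK, 0, -2 * q.imI; -2 * q.imJ, 2 * q.imI, 0]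

theorem adMatrix_lie (q q' : ℍ[ℝ]) :
    adMatrix (q * q' - q' * q) = adMatrix q * adMatrix q' - adMatrix q' * adMatrix q := by
  ext i j
  rw [Matrix.sub_apply, mul_apply, mul_apply, Fin.sum_univ_three, Fin.sum_univ_three]
  fin_cases i <;> fin_cases j <;> simp [adMatrix] <;> ring

theorem mem_soCompact {k : ℕ} {Y : Matrix (Fin k) (Fin k) ℝ} :
    Y ∈ soCompact k ↔ ∀ i j, Y j i + Y i j = 0 := by
  refine mem_skewAdjoint.trans ?_
  rw [mul_one, one_mul, ← Matrix.ext_iff]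
  rfl

/-- The skew quaternions form the Lie algebra `so(3)`, by the adjoint representation. -/
noncomputable def soCompactThreeEquiv :
    unitaryAlgebra (1 : Matrix (Fin 1) (Fin 1) ℍ[ℝ]) ≃ₗ⁅ℝ⁆ soCompact 3 where
  toFun X := ⟨adMatrix ((X : Matrix (Fin 1) (Fin 1) ℍ[ℝ]) 0 0), mem_soCompact.2 fun i j => by
    fin_cases i <;> fin_cases j <;> simp [adMatrix]⟩
  map_add' X Y := by
    have h : ∀ q q' : ℍ[ℝ], adMatrix (q + q') = adMatrix q + adMatrix q' := fun q q' => by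
      ext i j
      fin_cases i <;> fin_cases j <;> simp [adMatrix] <;> ring
    exact Subtype.ext (h _ _)
  map_smul' c X := by
    have h : ∀ q : ℍ[ℝ], adMatrix (c • q) = c • adMatrix q := fun q => by
      ext i j
      fin_cases i <;> fin_cases j <;> simp [adMatrix] <;> ring
    exact Subtype.ext (h _)
  map_lie' {X Y} := Subtype.ext ((congrArg adMatrix (lie_apply_zero _ _)).trans (adMatrix_lie _ _))
  invFun Y := ⟨of fun _ _ => quaternionOf 0 ((Y : Matrix (Fin 3) (Fin 3) ℝ) 2 1 / 2)
      ((Y : Matrix (Fin 3) (Fin 3) ℝ) 0 2 / 2) ((Y : Matrix (Fin 3) (Fin 3) ℝ) 1 0 / 2), by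
    rw [mem_unitaryAlgebra_one]
    ext i j <;> simp⟩
  left_inv X := by
    have h1 : star ((X : Matrix (Fin 1) (Fin 1) ℍ[ℝ]) 0 0) =
        -(X : Matrix (Fin 1) (Fin 1) ℍ[ℝ]) 0 0 :=
      congrFun₂ (mem_unitaryAlgebra_one.1 X.2) 0 0
    have h2 := congrArg QuaternionAlgebra.re h1
    rw [Quaternion.re_star, Quaternion.re_neg] at h2
    have h3 : ∀ q : ℍ[ℝ], q.re = -q.re → quaternionOf 0 (adMatrix q 2 1 / 2) (adMatrix q 0 2 / 2)
        (adMatrix q 1 0 / 2) = q := by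
      intro q hq
      ext <;> simp [adMatrix]
      linarith
    refine Subtype.ext (Matrix.ext fun i j => ?_)
    rw [Subsingleton.elim i 0, Subsingleton.elim j 0]
    exact h3 _ h2
  right_inv Y := by
    have h2 := mem_soCompact.1 Y.2
    have h3 := h2 0 0
    have h4 := h2 1 1
    have h5 := h2 2 2
    have h6 := h2 0 1
    have h7 := h2 0 2
    have h8 := h2 1 2
    refine Subtype.ext (Matrix.ext fun i j => ?_)
    fin_cases i <;> fin_cases j <;> simp [adMatrix] <;> linarith

/-- The Lie algebra of the standard skew-Hermitian form of rank `1` is `ℝ j`. -/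
noncomputable def soCompactTwoEquiv : unitaryAlgebra (skewForm (Fin 1)) ≃ₗ⁅ℝ⁆ soCompact 2 where
  toFun X := ⟨!![0, -((X : Matrix (Fin 1) (Fin 1) ℍ[ℝ]) 0 0).imJ;
      ((X : Matrix (Fin 1) (Fin 1) ℍ[ℝ]) 0 0).imJ, 0], mem_soCompact.2 fun i j => by
    fin_cases i <;> fin_cases j <;> simp⟩
  map_add' X Y := by
    refine Subtype.ext (Matrix.ext fun i j => ?_)
    fin_cases i <;> fin_cases j <;> simp <;> ring
  map_smul' c X := by
    refine Subtype.ext (Matrix.ext fun i j => ?_)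
    fin_cases i <;> fin_cases j <;> simp
  map_lie' {X Y} := by
    -- both algebras are abelian
    have h1 : ⁅X, Y⁆ = 0 := by
      refine Subtype.ext (Matrix.ext fun i j => ?_)
      rw [Subsingleton.elim i 0, Subsingleton.elim j 0]
      refine (lie_apply_zero _ _).trans ?_
      rw [apply_of_mem_skewForm X.2, apply_of_mem_skewForm Y.2]
      ext <;> simp <;> ring
    have h2 : ∀ a b : ℝ, ⁅!![0, -a; a, 0], !![0, -b; b, 0]⁆ = 0 := fun a b => by
      rw [LieRing.of_associative_ring_bracket]
      ext i j
      fin_cases i <;> fin_cases j <;> simp [mul_comm]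
    rw [h1]
    refine Subtype.ext (Eq.trans ?_ (h2 _ _).symm)
    ext i j
    fin_cases i <;> fin_cases j <;> simp
  invFun Y := ⟨of fun _ _ => quaternionOf 0 0 ((Y : Matrix (Fin 2) (Fin 2) ℝ) 1 0) 0, by
    rw [mem_unitaryAlgebra, skewForm]
    ext i j <;> simp [quaternionJ]⟩
  left_inv X := by
    refine Subtype.ext (Matrix.ext fun i j => ?_)
    rw [Subsingleton.elim i 0, Subsingleton.elim j 0]
    exact (apply_of_mem_skewForm X.2 0).symm
  right_inv Y := by
    have h2 := mem_soCompact.1 Y.2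
    have h3 := h2 0 0
    have h4 := h2 1 1
    have h6 := h2 0 1
    refine Subtype.ext (Matrix.ext fun i j => ?_)
    fin_cases i <;> fin_cases j <;> simp <;> linarith

end SkewHermitian

section SkewHermitianParabolics

open Quaternion

/-- A product with a trivial first factor. -/
def subsingletonProdEquiv {R L L' : Type*} [CommRing R] [LieRing L] [LieAlgebra R L] [LieRing L']
    [LieAlgebra R L'] [Subsingleton L] : (L × L') ≃ₗ⁅R⁆ L' where
  toFun x := x.2
  map_add' _ _ := rfl
  map_smul' _ _ := rfl
  map_lie' := rfl
  invFun x := (0, x)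
  left_inv _ := Prod.ext (Subsingleton.elim _ _) rfl
  right_inv _ := rfl

/-- A minimal parabolic subalgebra of `so*(2n)` and the corresponding real form of `so(2n, ℂ)`,
where `n = 2 r + a` with `a ≤ 1`, together with an element `T` of `m₀`, regular if `a = 0`. -/
theorem exists_parabolic_soStar {n a r : ℕ} [Subsingleton (Fin a)] (hn : 2 * r + a = n)
    (hn' : 2 ≤ n) :
    ∃ (Q : MinimalParabolic (unitaryAlgebra (wittForm (skewForm (Fin a)) (-1) r)))
      (f : unitaryAlgebra (wittForm (skewForm (Fin a)) (-1) r) → soEvenC n), IsRealForm f ∧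
      (f Q.H₀ : Matrix (Fin n ⊕ Fin n) (Fin n ⊕ Fin n) ℂ) =
        symmDiagonal (fun k : Fin n => ((r - k / 2 : ℕ) : ℂ)) ∧
      (∃ T ∈ Q.m, (f T : Matrix (Fin n ⊕ Fin n) (Fin n ⊕ Fin n) ℂ) =
        symmDiagonal (fun k : Fin n => regularEntry r k)) ∧
      Nonempty (Q.m ≃ₗ⁅ℝ⁆ (unitaryAlgebra (skewForm (Fin a)) × (Fin r → soCompact 3))) ∧
      Module.finrank ℝ Q.a = r ∧ Module.finrank ℝ Q.n = r + (r * (r - 1) + r * a) * 4 := by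
  have hε : (-1 : ℝ) * -1 = 1 := by norm_num
  obtain ⟨Q, f, hf, hfd, hH, ⟨hm⟩, ha, hn'', hQm⟩ := exists_parabolic_realForm
    isComplexModel_toComplex hε skewForm_mul_self conjTranspose_skewForm
    (fun _ hY => skew_of_mem_skewForm hY) finrank_skewScalars_quaternion_add_one
    (fun _ => mem_soEvenC) (center_soEvenC hn') (formEquiv_soStar hn) false
    (toComplex_wittDiagonal _)
  have hstar : star (quaternionOf 0 1 0 0) = -quaternionOf 0 1 0 0 := by ext <;> simp
  let T : unitaryAlgebra (wittForm (skewForm (Fin a)) (-1) r) :=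
    ⟨wittBlock 0 (fun _ => quaternionOf 0 1 0 0) fun _ => quaternionOf 0 1 0 0,
      (wittBlock_mem hε).2 ⟨LieSubalgebra.zero_mem _, fun _ => by rw [hstar, neg_add_cancel]⟩⟩
  refine ⟨Q, f, hf, hH, ⟨T, (hQm T).2 ⟨0, _, LieSubalgebra.zero_mem _, fun _ => hstar, rfl⟩, ?_⟩,
    ⟨hm.trans (prodCongr LieEquiv.refl (piCongr (Fin r) soCompactThreeEquiv))⟩, ha, ?_⟩
  · refine hfd T true ?_
    have h1 : quaternionFst (quaternionOf 0 1 0 0) = Complex.I := rfl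
    have h2 : quaternionSnd (quaternionOf 0 1 0 0) = 0 := rfl
    have h3 : T.1 =
        diagonal (Sum.elim 0 (Sum.elim (fun _ => quaternionOf 0 1 0 0)
          fun _ => quaternionOf 0 1 0 0)) := by
      rw [← fromBlocks_diagonal, ← fromBlocks_diagonal]
      change wittBlock 0 _ _ = _
      rw [wittBlock]
      congr 1
      exact diagonal_zero.symm
    rw [h3, toComplex, diagonal_map (map_zero _), diagonal_map (map_zero _),
      diagonal_map (star_zero _), diagonal_map (star_zero _)]
    have h4 : ∀ m, quaternionSnd ((Sum.elim 0 (Sum.elim (fun _ => quaternionOf 0 1 0 0)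
        fun _ => quaternionOf 0 1 0 0) : Fin a ⊕ (Fin r ⊕ Fin r) → ℍ[ℝ]) m) = 0 := by
      rintro (i | i | i)
      · exact map_zero _
      · exact h2
      · exact h2
    simp only [h4, star_zero, diagonal_zero', neg_zero]
    rw [fromBlocks_diagonal]
    congr 1
    ext1 ((i | i | i) | (i | i | i)) <;> simp [h1]
  · rw [hn'', finrank_skewScalars_quaternion_neg, Quaternion.finrank_eq_four, Fintype.card_fin,
      mul_one]

/-- The images of `H₀` and of the regular element of `m₀` jointly separate the indices. -/
theorem regularEntry_separates {n r : ℕ} (hn : n = 2 * r) (i j : Fin n ⊕ Fin n)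
    (h : Sum.elim (fun k : Fin n => ((r - k / 2 : ℕ) : ℂ))
      (-fun k : Fin n => ((r - k / 2 : ℕ) : ℂ)) i =
      Sum.elim (fun k : Fin n => ((r - k / 2 : ℕ) : ℂ)) (-fun k : Fin n => ((r - k / 2 : ℕ) : ℂ)) j)
    (h' : Sum.elim (fun k : Fin n => regularEntry r k) (-fun k : Fin n => regularEntry r k) i =
      Sum.elim (fun k : Fin n => regularEntry r k) (-fun k : Fin n => regularEntry r k) j) :
    i = j := by
  have h1 : ∀ i j : Fin n, ((r - i / 2 : ℕ) : ℂ) ≠ -((r - j / 2 : ℕ) : ℂ) := by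
    intro i j h
    have h2 : (((r - i / 2) + (r - j / 2) : ℕ) : ℂ) = 0 := by
      push_cast
      linear_combination h
    have h3 := Nat.cast_eq_zero.1 h2
    omega
  have hI : Complex.I ≠ -Complex.I := fun h => Complex.I_ne_zero (self_eq_neg.1 h)
  have h4 : ∀ i j : Fin n, ((r - i / 2 : ℕ) : ℂ) = ((r - j / 2 : ℕ) : ℂ) →
      regularEntry r i = regularEntry r j → i = j := by
    intro i j hij hij'
    have h5 := Nat.cast_injective hij
    have h6 : (i : ℕ) % 2 = 0 ↔ (j : ℕ) % 2 = 0 := by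
      have hi : (i : ℕ) < 2 * r := hn ▸ i.2
      have hj : (j : ℕ) < 2 * r := hn ▸ j.2
      rw [regularEntry, regularEntry, if_pos hi, if_pos hj] at hij'
      split_ifs at hij' with h7 h8 h8
      · exact ⟨fun _ => h8, fun _ => h7⟩
      · exact absurd hij' hI
      · exact absurd hij'.symm hI
      · exact ⟨fun h => absurd h h7, fun h => absurd h h8⟩
    exact Fin.ext (by omega)
  rcases i with i | i <;> rcases j with j | j
  · exact congrArg Sum.inl (h4 i j h h')
  · exact absurd h (h1 i j)
  · exact absurd h.symm (h1 j i)
  · exact congrArg Sum.inr (h4 i j (neg_injective h) (neg_injective h'))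

theorem minimalParabolic_soStar_even (n r : ℕ) (hr : 1 ≤ r) (hn : n = 2 * r) :
    Nonempty (MinimalParabolic (soStar n)) ∧ ∀ P : MinimalParabolic (soStar n),
      Nonempty (P.m ≃ₗ⁅ℝ⁆ (⨁ _ : Fin r, soCompact 3)) ∧ Module.finrank ℝ P.a = r ∧
      Module.finrank ℝ P.n = r * (4 * r - 3) ∧
      ∃ t : LieSubalgebra ℝ P.m, t.IsCartanSubalgebra ∧
      ∃ φ : ℂ ⊗[ℝ] (soStar n) ≃ₗ⁅ℂ⁆ (soEvenC n),
        complexImage φ P.p = standardParabolic (diagonalCartan (soEvenC n)) (simpleD n)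
          {i | Odd i ∧ i ≤ n - 1} ∧
        complexImage φ (t.toSubmodule.map P.m.toSubmodule.subtype ⊔ P.a.toSubmodule) =
          (diagonalCartan (soEvenC n)).toSubmodule := by
  obtain ⟨Q, f, hf, hH, ⟨T, hT, hfT⟩, ⟨hm⟩, ha, hn'⟩ :=
    exists_parabolic_soStar (n := n) (a := 0) (r := r) hn.symm (by omega)
  obtain ⟨e₁⟩ := nonempty_soStar_equiv n
  obtain ⟨e₂⟩ := nonempty_skewForm_equiv (n := n) (a := 0) (r := r) (by omega)
  have : Subsingleton (unitaryAlgebra (skewForm (Fin 0))) :=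
    ⟨fun _ _ => Subtype.ext (Subsingleton.elim _ _)⟩
  have hV := complexImage_p_soEvenC hf Q (fun k => r - k / 2) (fun k => by omega) hH
    (S := {i | Odd i ∧ i ≤ n - 1})
    (fun k hk => by
      simp only [Set.mem_ofPred_eq, Nat.odd_iff]
      omega)
    (fun k hk => by
      simp only [Set.mem_ofPred_eq, Nat.odd_iff]
      omega)
  have hn₂ : Module.finrank ℝ Q.n = r * (4 * r - 3) := by
    obtain ⟨k, rfl⟩ : ∃ k, r = k + 1 := ⟨r - 1, by omega⟩
    rw [hn', show 4 * (k + 1) - 3 = 4 * k + 1 by omega, Nat.add_sub_cancel]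
    ring
  obtain ⟨h1, h2⟩ := nonempty_and_forall_carries (e₁.trans e₂) Q
  refine ⟨h1, fun P => ?_⟩
  obtain ⟨ψ, hψ⟩ := h2 P
  have : FiniteDimensional ℝ (soStar n) := ψ.symm.toLinearEquiv.finiteDimensional
  have hψT : (f ∘ ψ) (ψ.symm T) = f T := congrArg f (ψ.apply_symm_apply T)
  obtain ⟨t, ht, ht'⟩ := exists_isCartanSubalgebra (hf.comp ψ) P (T := ψ.symm T)
    ((hψ.m _).1 (by rwa [ψ.apply_symm_apply])) (h := diagonalCartan (soEvenC n))
    (fun Y hY Z hZ => lie_eq_zero_of_mem_diagonalCartan hY hZ)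
    (fun Y => by
      rw [mem_diagonalCartan_iff_lie_eq_zero hH hfT (regularEntry_separates hn),
        ← hf.mem_complexImage_m_sup_a, ← (hf.comp ψ).mem_complexImage_m_sup_a, hψT,
        IsRealForm.complexImage_comp hf ψ hψ.m_sup_a])
    (fun Y hY => by
      rw [hψT] at hY ⊢
      exact lie_eq_zero_of_lie_lie_eq_zero hfT Y hY)
  exact ⟨⟨hψ.mEquiv.trans (hm.trans (subsingletonProdEquiv.trans (piEquivDirectSum _ _ _)))⟩,
    hψ.finrank_a.trans ha, hψ.finrank_n.trans hn₂, t, ht, (hf.comp ψ).equiv,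
    (IsRealForm.complexImage_comp hf ψ hψ.p).trans hV, ht'⟩

theorem minimalParabolic_soStar_odd (n r : ℕ) (hr : 1 ≤ r) (hn : n = 2 * r + 1) :
    Nonempty (MinimalParabolic (soStar n)) ∧ ∀ P : MinimalParabolic (soStar n),
      Nonempty (P.m ≃ₗ⁅ℝ⁆ (soCompact 2 × ⨁ _ : Fin r, soCompact 3)) ∧
      Module.finrank ℝ P.a = r ∧ Module.finrank ℝ P.n = r * (4 * r + 1) ∧
      ∃ φ : ℂ ⊗[ℝ] (soStar n) ≃ₗ⁅ℂ⁆ (soEvenC n),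
        complexImage φ P.p = standardParabolic (diagonalCartan (soEvenC n)) (simpleD n)
          {i | Odd i ∧ i ≤ n - 2} := by
  obtain ⟨Q, f, hf, hH, -, ⟨hm⟩, ha, hn'⟩ :=
    exists_parabolic_soStar (n := n) (a := 1) (r := r) hn.symm (by omega)
  obtain ⟨e₁⟩ := nonempty_soStar_equiv n
  obtain ⟨e₂⟩ := nonempty_skewForm_equiv (n := n) (a := 1) (r := r) (by omega)
  have hV := complexImage_p_soEvenC hf Q (fun k => r - k / 2) (fun k => by omega) hH
    (S := {i | Odd i ∧ i ≤ n - 2})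
    (fun k hk => by
      simp only [Set.mem_ofPred_eq, Nat.odd_iff]
      omega)
    (fun k hk => by
      simp only [Set.mem_ofPred_eq, Nat.odd_iff]
      omega)
  have hn₂ : Module.finrank ℝ Q.n = r * (4 * r + 1) := by
    obtain ⟨k, rfl⟩ : ∃ k, r = k + 1 := ⟨r - 1, by omega⟩
    rw [hn', Nat.add_sub_cancel]
    ring
  obtain ⟨h3, h4⟩ := forall_of_realForm (e₁.trans e₂) Q hf
    ⟨hm.trans (prodCongr soCompactTwoEquiv (piEquivDirectSum _ _ _))⟩ ha hn₂ hV rfl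
  refine ⟨h3, fun P => ?_⟩
  obtain ⟨h5, h6, h7, φ, hφ, -⟩ := h4 P
  exact ⟨h5, h6, h7, φ, hφ⟩

end SkewHermitianParabolics

/-! ### The Lie algebras `su(p, r)` -/

section SpecialUnitary

variable {ι ι' : Type*} [Fintype ι] [DecidableEq ι] [Fintype ι'] [DecidableEq ι']

/-- The matrices of trace zero in the Lie algebra of a form over `ℂ`. -/
noncomputable abbrev specialUnitary (K : Matrix ι ι ℂ) : LieSubalgebra ℝ (Matrix ι ι ℂ) :=
  unitaryAlgebra K ⊓ realified (LieAlgebra.SpecialLinear.sl ι ℂ)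

theorem mem_specialUnitary {K X : Matrix ι ι ℂ} :
    X ∈ specialUnitary K ↔ X ∈ unitaryAlgebra K ∧ X.trace = 0 := Iff.rfl

theorem eq_of_mem_unitaryAlgebra {K X : Matrix ι ι ℂ} (hK : K * K = 1) (hX : X ∈ unitaryAlgebra K) :
    K * Xᴴ * K = -X := by
  rw [mul_assoc, eq_neg_of_add_eq_zero_left (mem_unitaryAlgebra.1 hX), mul_neg, ← mul_assoc, hK,
    one_mul]

theorem trace_conj {K : Matrix ι ι ℂ} (hK : K * K = 1) (X : Matrix ι ι ℂ) :
    (K * X * K).trace = X.trace := by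
  rw [trace_mul_comm, ← mul_assoc, hK, one_mul]

theorem re_trace_eq_zero {K X : Matrix ι ι ℂ} (hK : K * K = 1) (hX : X ∈ unitaryAlgebra K) :
    X.trace.re = 0 := by
  have h1 := congrArg (fun Z => (trace Z).re) (eq_of_mem_unitaryAlgebra hK hX)
  simp only [trace_conj hK, trace_conjTranspose, trace_neg, Complex.neg_re] at h1
  have h2 : (star X.trace).re = X.trace.re := Complex.conj_re _
  linarith

theorem I_smul_one_mem_unitaryAlgebra (K : Matrix ι ι ℂ) (c : ℝ) :
    ((c : ℂ) * Complex.I) • (1 : Matrix ι ι ℂ) ∈ unitaryAlgebra K := by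
  rw [mem_unitaryAlgebra, conjTranspose_smul, conjTranspose_one, smul_mul_assoc, one_mul,
    mul_smul_comm, mul_one, ← add_smul]
  simp

theorem finrank_specialUnitary {K : Matrix ι ι ℂ} (hK : K * K = 1) (hK' : Kᴴ = K)
    (h0 : 0 < Fintype.card ι) :
    Module.finrank ℝ (specialUnitary K) + 1 = Fintype.card ι * Fintype.card ι := by
  let σ : unitaryAlgebra K →ₗ[ℝ] ℝ :=
    { toFun := fun X => (X : Matrix ι ι ℂ).trace.im
      map_add' := fun X Y =>
        (congrArg Complex.im (trace_add (X : Matrix ι ι ℂ) Y)).trans (Complex.add_im _ _)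
      map_smul' := fun c X =>
        (congrArg Complex.im (trace_smul c (X : Matrix ι ι ℂ))).trans (Complex.smul_im _ _) }
  have hσ : LinearMap.range σ = ⊤ := LinearMap.range_eq_top.2 fun c =>
    ⟨⟨_, I_smul_one_mem_unitaryAlgebra K (c / Fintype.card ι)⟩, by
      change (trace (((c / Fintype.card ι : ℝ) * Complex.I) • (1 : Matrix ι ι ℂ))).im = c
      rw [trace_smul, trace_one, smul_eq_mul]
      have h1 : (Fintype.card ι : ℝ) ≠ 0 := Nat.cast_ne_zero.2 h0.ne'
      simp [Complex.mul_im]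
      field_simp⟩
  have h1 := σ.finrank_range_add_finrank_ker
  let f : specialUnitary K ≃ₗ[ℝ] LinearMap.ker σ :=
    { toFun := fun X => ⟨⟨X, X.2.1⟩, by
        rw [LinearMap.mem_ker]
        change (trace (X : Matrix ι ι ℂ)).im = 0
        rw [(mem_specialUnitary.1 X.2).2, Complex.zero_im]⟩
      map_add' := fun _ _ => rfl
      map_smul' := fun _ _ => rfl
      invFun := fun X => ⟨X.1, X.1.2, Complex.ext (re_trace_eq_zero hK X.1.2) X.2⟩
      left_inv := fun _ => rfl
      right_inv := fun _ => rfl }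
  rw [hσ, finrank_top, Module.finrank_self, ← f.finrank_eq,
    finrank_unitaryAlgebra (one_mul 1) (by rw [one_smul, hK]) (by rw [one_smul, hK']),
    finrank_skewScalars_complex, Complex.finrank_real_complex,
    Nat.div_mul_cancel (Nat.even_mul_pred_self _).two_dvd] at h1
  rw [add_comm, h1]
  obtain ⟨k, hk⟩ := Nat.exists_eq_add_of_lt h0
  rw [hk]
  simp only [zero_add, Nat.add_sub_cancel]
  ring

/-- The complexification of the special unitary algebra of a form `K` is `sl(N, ℂ)`, as
`X ↦ -K Xᴴ K` is a conjugation. -/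
theorem exists_isRealForm_specialUnitary {K : Matrix ι ι ℂ} (hK : K * K = 1) (hK' : Kᴴ = K) {N : ℕ}
    (σ : Fin N ≃ ι) : ∃ f : specialUnitary K → slC N, IsRealForm f ∧
      ∀ X, (f X : Matrix (Fin N) (Fin N) ℂ) = (X : Matrix ι ι ℂ).submatrix σ σ := by
  have htr : ∀ X : Matrix ι ι ℂ, (X.submatrix σ σ).trace = X.trace := fun X =>
    Equiv.sum_comp σ fun i => X i i
  have htr' : ∀ Z : Matrix ι ι ℂ, Z.trace = 0 → (K * Zᴴ * K).trace = 0 := fun Z hZ => by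
    rw [trace_conj hK, trace_conjTranspose, hZ, star_zero]
  have h0 : ∀ Z : Matrix ι ι ℂ, K * (K * Zᴴ * K) = Zᴴ * K := fun Z => by
    rw [← mul_assoc, ← mul_assoc, hK, one_mul]
  have h0' : ∀ Z : Matrix ι ι ℂ, (K * Zᴴ * K)ᴴ * K = K * Z := fun Z => by
    rw [conjTranspose_mul, conjTranspose_mul, hK', conjTranspose_conjTranspose, mul_assoc,
      mul_assoc,
      hK, mul_one]
  have hA : ∀ Z : Matrix ι ι ℂ, Z.trace = 0 →
      (1 / 2 : ℂ) • (Z - K * Zᴴ * K) ∈ specialUnitary K := fun Z hZ => by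
    refine mem_specialUnitary.2 ⟨?_, ?_⟩
    · rw [mem_unitaryAlgebra, conjTranspose_smul, conjTranspose_sub, smul_mul_assoc, sub_mul, h0',
        mul_smul_comm, mul_sub, h0, show star (1 / 2 : ℂ) = 1 / 2 by simp, ← smul_add,
        sub_add_sub_cancel, sub_self, smul_zero]
    · rw [trace_smul, trace_sub, htr' Z hZ, hZ, sub_zero, smul_zero]
  have hB : ∀ Z : Matrix ι ι ℂ, Z.trace = 0 →
      (-(Complex.I / 2)) • (Z + K * Zᴴ * K) ∈ specialUnitary K := fun Z hZ => by
    refine mem_specialUnitary.2 ⟨?_, ?_⟩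
    · rw [mem_unitaryAlgebra, conjTranspose_smul, conjTranspose_add, smul_mul_assoc, add_mul, h0',
        mul_smul_comm, mul_add, h0, show star (-(Complex.I / 2)) = Complex.I / 2 by simp [neg_div],
        add_comm (K * Z), ← add_smul, add_neg_cancel, zero_smul]
    · rw [trace_smul, trace_add, htr' Z hZ, hZ, add_zero, smul_zero]
  refine ⟨fun X => ⟨(X : Matrix ι ι ℂ).submatrix σ σ, by
    rw [mem_sl, htr, (mem_specialUnitary.1 X.2).2]⟩, ⟨fun X Y => rfl, fun c X => Subtype.ext ?_,
    fun X Y => Subtype.ext ?_, fun Y => ?_, fun A B h => ?_⟩, fun _ => rfl⟩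
  · exact real_smul_eq c _
  · change (⁅(X : Matrix ι ι ℂ), (Y : Matrix ι ι ℂ)⁆).submatrix σ σ =
      ⁅(X : Matrix ι ι ℂ).submatrix σ σ, (Y : Matrix ι ι ℂ).submatrix σ σ⁆
    rw [LieRing.of_associative_ring_bracket, LieRing.of_associative_ring_bracket,
      submatrix_mul_equiv, submatrix_mul_equiv]
    rfl
  · have h1 : ((Y : Matrix (Fin N) (Fin N) ℂ).submatrix σ.symm σ.symm).trace = 0 := by
      rw [← htr, submatrix_submatrix, Equiv.symm_comp_self, submatrix_id_id]
      exact mem_sl.1 Y.2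
    refine ⟨⟨_, hA _ h1⟩, ⟨_, hB _ h1⟩, Subtype.ext ?_⟩
    change (Y : Matrix (Fin N) (Fin N) ℂ) = ((1 / 2 : ℂ) •
      ((Y : Matrix (Fin N) (Fin N) ℂ).submatrix σ.symm σ.symm -
        K * ((Y : Matrix (Fin N) (Fin N) ℂ).submatrix σ.symm σ.symm)ᴴ * K) +
      Complex.I • (-(Complex.I / 2)) • ((Y : Matrix (Fin N) (Fin N) ℂ).submatrix σ.symm σ.symm +
        K * ((Y : Matrix (Fin N) (Fin N) ℂ).submatrix σ.symm σ.symm)ᴴ * K)).submatrix σ σ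
    generalize hZ : (Y : Matrix (Fin N) (Fin N) ℂ).submatrix σ.symm σ.symm = Z
    have h2 : (Y : Matrix (Fin N) (Fin N) ℂ) = Z.submatrix σ σ := by
      rw [← hZ, submatrix_submatrix, Equiv.symm_comp_self, submatrix_id_id]
    rw [smul_smul, show Complex.I * -(Complex.I / 2) = 1 / 2 by
      linear_combination (-1 / 2 : ℂ) * Complex.I_mul_I, ← smul_add, sub_add_add_cancel,
        ← two_smul ℂ,
      smul_smul, show (1 / 2 : ℂ) * 2 = 1 by norm_num, one_smul, h2]
  · have h1 : (A : Matrix ι ι ℂ) + Complex.I • (B : Matrix ι ι ℂ) = 0 := by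
      have h2 : ((A : Matrix ι ι ℂ) + Complex.I • (B : Matrix ι ι ℂ)).submatrix σ σ = 0 :=
        congrArg Subtype.val h
      exact (Matrix.reindex σ.symm σ.symm).injective h2
    have h2 := congrArg (fun Z => K * Zᴴ * K) h1
    simp only [conjTranspose_add, conjTranspose_smul, mul_add, add_mul, mul_smul_comm,
      smul_mul_assoc, eq_of_mem_unitaryAlgebra hK A.2.1, eq_of_mem_unitaryAlgebra hK B.2.1,
      conjTranspose_zero, mul_zero, zero_mul] at h2
    have h3 : star Complex.I = -Complex.I := Complex.conj_I
    rw [h3, neg_smul, smul_neg, neg_neg] at h2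
    have h4 : (2 : ℂ) • (A : Matrix ι ι ℂ) = 0 := by
      have h5 := congrArg₂ (· - ·) h1 h2
      rw [two_smul]
      refine Eq.trans ?_ (h5.trans (sub_zero 0))
      abel
    have h5 : (A : Matrix ι ι ℂ) = 0 := (smul_eq_zero_iff_right two_ne_zero).1 h4
    rw [h5, zero_add] at h1
    exact ⟨Subtype.ext h5, Subtype.ext ((smul_eq_zero_iff_right Complex.I_ne_zero).1 h1)⟩

variable {k r : ℕ}

/-- The order in which the eigenvalues of the regular element decrease. -/
def wittEquiv (k r : ℕ) : Fin ((r + k) + r) ≃ Fin k ⊕ (Fin r ⊕ Fin r) :=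
  finSumFinEquiv.symm.trans ((Equiv.sumCongr
    (finSumFinEquiv.symm.trans (Equiv.sumComm _ _)) Fin.revPerm).trans (Equiv.sumAssoc _ _ _))

theorem elim_wittEquiv (j : Fin ((r + k) + r)) :
    wittDiagonal (Fin k) (chamberPoint r) (wittEquiv k r j) =
      ((r - j : ℕ) : ℝ) - ((j + 1 - (r + k) : ℕ) : ℝ) := by
  obtain ⟨x, rfl⟩ := (wittEquiv k r).symm.surjective j
  rw [Equiv.apply_symm_apply]
  rcases x with i | i | i
  · have h : ((wittEquiv k r).symm (Sum.inl i) : ℕ) = r + i := rfl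
    have := i.2
    rw [h, show r - (r + i) = 0 by omega, show r + i + 1 - (r + k) = 0 by omega]
    simp [wittDiagonal]
  · have h : ((wittEquiv k r).symm (Sum.inr (Sum.inl i)) : ℕ) = i := rfl
    have := i.2
    rw [h, show i + 1 - (r + k) = 0 by omega]
    simp [wittDiagonal, chamberPoint]
  · have h : ((wittEquiv k r).symm (Sum.inr (Sum.inr i)) : ℕ) = r + k + (r - (i + 1)) := rfl
    have := i.2
    rw [h, show r - (r + k + (r - (i + 1))) = 0 by omega,
      show r + k + (r - (i + 1)) + 1 - (r + k) = r - i by omega]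
    simp [wittDiagonal, chamberPoint]

theorem wittForm_one_mul_self : wittForm (1 : Matrix (Fin k) (Fin k) ℂ) 1 r *
    wittForm (1 : Matrix (Fin k) (Fin k) ℂ) 1 r = 1 := by
  rw [wittForm_mul_self (by rw [one_smul, one_mul]), one_smul]

theorem conjTranspose_wittForm_one : (wittForm (1 : Matrix (Fin k) (Fin k) ℂ) 1 r)ᴴ =
    wittForm (1 : Matrix (Fin k) (Fin k) ℂ) 1 r := by
  rw [conjTranspose_wittForm (one_mul 1) (by rw [one_smul, conjTranspose_one]), one_smul]

theorem isWittSubalgebra_specialUnitary (k r : ℕ) :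
    IsWittSubalgebra (1 : Matrix (Fin k) (Fin k) ℂ) 1
      (specialUnitary (wittForm (1 : Matrix (Fin k) (Fin k) ℂ) 1 r)) where
  mul_self := one_mul 1
  skew := skew_of_mem_unitaryAlgebra_one
  le := inf_le_left
  conjTranspose_mem X hX := mem_specialUnitary.2 ⟨conjTranspose_mem_unitaryAlgebra (one_mul 1)
    (wittForm_mul_self (by rw [one_smul, one_mul])) hX.1, by
      rw [trace_conjTranspose, (mem_specialUnitary.1 hX).2, star_zero]⟩
  diagonal_mem t := mem_specialUnitary.2 ⟨realDiagonal_wittDiagonal_mem t (one_mul 1), by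
    rw [realDiagonal_wittDiagonal, trace_wittBlock]
    simp⟩

theorem nonempty_suPR_equiv (k r : ℕ) :
    Nonempty (suPR (r + k) r ≃ₗ⁅ℝ⁆
      specialUnitary (wittForm (1 : Matrix (Fin k) (Fin k) ℂ) 1 r)) := by
  obtain ⟨S, S', h, h', hS⟩ := exists_indefinite_eq_wittForm ℂ
    (Fintype.equivOfCardEq (α := Fin (r + k)) (β := Fin k ⊕ Fin r) (by simp [add_comm]))
  refine ⟨conjEquiv h h' _ _ fun X => and_congr (conj_mem_unitaryAlgebra h hS X) ?_⟩
  change (S' * X * S).trace = 0 ↔ X.trace = 0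
  rw [trace_mul_comm, ← Matrix.mul_assoc, h, Matrix.one_mul]

theorem wittBlock_mem_specialUnitary {Y : unitaryAlgebra (1 : Matrix (Fin k) (Fin k) ℂ)}
    {x : Fin r → unitaryAlgebra (1 : Matrix (Fin 1) (Fin 1) ℂ)} :
    wittBlock (Y : Matrix (Fin k) (Fin k) ℂ) (fun i => (x i : Matrix (Fin 1) (Fin 1) ℂ) 0 0)
      (fun i => (x i : Matrix (Fin 1) (Fin 1) ℂ) 0 0) ∈ specialUnitary (wittForm 1 1 r) ↔
    (Y : Matrix (Fin k) (Fin k) ℂ).trace +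
      2 * ∑ i, (x i : Matrix (Fin 1) (Fin 1) ℂ) 0 0 = 0 := by
  rw [mem_specialUnitary, trace_wittBlock, ← two_mul, wittBlock_mem (one_mul 1)]
  refine and_iff_right ⟨Y.2, fun i => ?_⟩
  have h := congrFun₂ (mem_unitaryAlgebra_one.1 (x i).2) 0 0
  change star ((x i : Matrix (Fin 1) (Fin 1) ℂ) 0 0) = -_ at h
  rw [h, neg_add_cancel]

/-- The projection of the matrices to those of trace zero along the scalar matrices. -/
noncomputable def tracelessPart (k : ℕ) :
    Matrix (Fin k) (Fin k) ℂ →ₗ⁅ℝ⁆ Matrix (Fin k) (Fin k) ℂ where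
  toFun Y := Y - (Y.trace / k) • 1
  map_add' X Y := by
    rw [trace_add, add_div, add_smul]
    abel
  map_smul' c X := by
    rw [trace_smul, RingHom.id_apply, smul_sub, smul_div_assoc, smul_assoc]
  map_lie' {X Y} := by
    simp only [LieRing.of_associative_ring_bracket, trace_sub]
    rw [trace_mul_comm, sub_self, zero_div, zero_smul, sub_zero]
    simp only [sub_mul, mul_sub, smul_mul_assoc, mul_smul_comm, one_mul, mul_one, smul_sub]
    rw [smul_comm (X.trace / (k : ℂ)) (Y.trace / (k : ℂ))]
    abel

theorem tracelessPart_apply (Y : Matrix (Fin k) (Fin k) ℂ) :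
    tracelessPart k Y = Y - (Y.trace / k) • 1 := rfl

theorem tracelessPart_mem (hk : k ≠ 0) {Y : Matrix (Fin k) (Fin k) ℂ}
    (hY : Y ∈ unitaryAlgebra (1 : Matrix (Fin k) (Fin k) ℂ)) : tracelessPart k Y ∈ suCompact k := by
  have h1 := re_trace_eq_zero (one_mul 1) hY
  have h2 := I_smul_one_mem_unitaryAlgebra (1 : Matrix (Fin k) (Fin k) ℂ) (Y.trace.im / k)
  have h3 : ((Y.trace.im / k : ℝ) : ℂ) * Complex.I = Y.trace / k := by
    have h4 := Complex.re_add_im Y.trace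
    rw [h1, Complex.ofReal_zero, zero_add] at h4
    rw [Complex.ofReal_div, Complex.ofReal_natCast, div_mul_eq_mul_div, h4]
  rw [h3] at h2
  refine mem_specialUnitary.2 ⟨LieSubalgebra.sub_mem _ hY h2, ?_⟩
  rw [tracelessPart_apply, trace_sub, trace_smul, trace_one, Fintype.card_fin, smul_eq_mul,
    div_mul_cancel₀ _ (Nat.cast_ne_zero.2 hk), sub_self]

/-- The isomorphism of `m₀` with `su(k) ⊕ u(1)ʳ`: the scalar part of the component in `u(k)` is
determined by the condition on the trace. -/
theorem nonempty_mEquiv_of_ne_zero (hk : k ≠ 0)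
    (hcenter : ∀ X : specialUnitary (wittForm (1 : Matrix (Fin k) (Fin k) ℂ) 1 r),
      (∀ Z : specialUnitary (wittForm (1 : Matrix (Fin k) (Fin k) ℂ) 1 r), ⁅X, Z⁆ = 0) → X = 0) :
    Nonempty (((isWittSubalgebra_specialUnitary k r).parabolic hcenter).m ≃ₗ⁅ℝ⁆
      (suCompact k × (Fin r → unitaryAlgebra (1 : Matrix (Fin 1) (Fin 1) ℂ)))) := by
  have hL := isWittSubalgebra_specialUnitary k r
  let π : (unitaryAlgebra (1 : Matrix (Fin k) (Fin k) ℂ) ×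
      (Fin r → unitaryAlgebra (1 : Matrix (Fin 1) (Fin 1) ℂ))) →ₗ⁅ℝ⁆
      (suCompact k × (Fin r → unitaryAlgebra (1 : Matrix (Fin 1) (Fin 1) ℂ))) :=
    { toFun := fun Y => (⟨tracelessPart k Y.1, tracelessPart_mem hk Y.1.2⟩, Y.2)
      map_add' := fun Y Z => Prod.ext (Subtype.ext
        (map_add (tracelessPart k) (Y.1 : Matrix (Fin k) (Fin k) ℂ) Z.1)) rfl
      map_smul' := fun c Y => Prod.ext (Subtype.ext
        (map_smul (tracelessPart k) c (Y.1 : Matrix (Fin k) (Fin k) ℂ))) rfl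
      map_lie' := fun {Y Z} => Prod.ext (Subtype.ext
        (LieHom.map_lie (tracelessPart k) (Y.1 : Matrix (Fin k) (Fin k) ℂ) Z.1)) rfl }
  let ψ := π.comp (hL.mHom hcenter)
  have hk' : (k : ℂ) ≠ 0 := Nat.cast_ne_zero.2 hk
  refine ⟨LieEquiv.ofBijective ψ ⟨fun X X' h => hL.mHom_injective hcenter ?_, fun p => ?_⟩⟩
  · have h1 := wittBlock_mem_specialUnitary.1 (hL.wittBlock_mem_mHom hcenter X)
    have h2 := wittBlock_mem_specialUnitary.1 (hL.wittBlock_mem_mHom hcenter X')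
    have h' : π (hL.mHom hcenter X) = π (hL.mHom hcenter X') := h
    have h3 : (hL.mHom hcenter X).2 = (hL.mHom hcenter X').2 :=
      (congrArg Prod.snd h' :)
    have h4 : tracelessPart k (hL.mHom hcenter X).1 = tracelessPart k (hL.mHom hcenter X').1 :=
      (congrArg Subtype.val (congrArg Prod.fst h') :)
    rw [← h3] at h2
    rw [tracelessPart_apply, tracelessPart_apply,
      add_right_cancel (h1.trans h2.symm)] at h4
    exact Prod.ext (Subtype.ext (sub_left_injective h4)) h3
  · obtain ⟨Z, x⟩ := p
    let c : ℂ := 2 * ∑ i, (x i : Matrix (Fin 1) (Fin 1) ℂ) 0 0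
    have hc : c.re = 0 := by
      have h1 : ∀ i, ((x i : Matrix (Fin 1) (Fin 1) ℂ) 0 0).re = 0 := fun i =>
        re_eq_zero_of_star_eq_neg (congrFun₂ (mem_unitaryAlgebra_one.1 (x i).2) 0 0)
      simp [c, h1]
    have h3 : ((-c.im / k : ℝ) : ℂ) * Complex.I = -c / k := by
      have h4 := Complex.re_add_im c
      rw [hc, Complex.ofReal_zero, zero_add] at h4
      rw [Complex.ofReal_div, Complex.ofReal_natCast, div_mul_eq_mul_div, Complex.ofReal_neg,
        neg_mul, h4]
    have h2 := I_smul_one_mem_unitaryAlgebra (1 : Matrix (Fin k) (Fin k) ℂ) (-c.im / k)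
    rw [h3] at h2
    let Y : unitaryAlgebra (1 : Matrix (Fin k) (Fin k) ℂ) :=
      ⟨Z + (-c / k) • 1, LieSubalgebra.add_mem _ Z.2.1 h2⟩
    have hY : (Y : Matrix (Fin k) (Fin k) ℂ).trace = -c := by
      change trace ((Z : Matrix (Fin k) (Fin k) ℂ) + (-c / k) • 1) = -c
      rw [trace_add, (mem_specialUnitary.1 Z.2).2, trace_smul, trace_one, Fintype.card_fin,
        smul_eq_mul, div_mul_cancel₀ _ hk', zero_add]
    obtain ⟨X, hX⟩ := hL.exists_mHom_eq hcenter Y x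
      (wittBlock_mem_specialUnitary.2 (by rw [hY]; exact neg_add_cancel c))
    refine ⟨X, ?_⟩
    change π (hL.mHom hcenter X) = _
    rw [hX]
    refine Prod.ext (Subtype.ext ?_) rfl
    change tracelessPart k (Y : Matrix (Fin k) (Fin k) ℂ) = Z
    rw [tracelessPart_apply, hY]
    exact add_sub_cancel_right _ _

/-- If the form is a sum of hyperbolic planes, then `m₀` is the subalgebra of `u(1)ʳ` given by the
condition on the trace, which determines the last component. -/
theorem nonempty_mEquiv_of_eq_zero
    (hcenter : ∀ X : specialUnitary (wittForm (1 : Matrix (Fin 0) (Fin 0) ℂ) 1 (r + 1)),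
      (∀ Z : specialUnitary (wittForm (1 : Matrix (Fin 0) (Fin 0) ℂ) 1 (r + 1)), ⁅X, Z⁆ = 0) →
        X = 0) :
    Nonempty (((isWittSubalgebra_specialUnitary 0 (r + 1)).parabolic hcenter).m ≃ₗ⁅ℝ⁆
      (Fin r → unitaryAlgebra (1 : Matrix (Fin 1) (Fin 1) ℂ))) := by
  have hL := isWittSubalgebra_specialUnitary 0 (r + 1)
  let π : (unitaryAlgebra (1 : Matrix (Fin 0) (Fin 0) ℂ) ×
      (Fin (r + 1) → unitaryAlgebra (1 : Matrix (Fin 1) (Fin 1) ℂ))) →ₗ⁅ℝ⁆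
      (Fin r → unitaryAlgebra (1 : Matrix (Fin 1) (Fin 1) ℂ)) :=
    { toFun := fun Y i => Y.2 i.castSucc
      map_add' := fun _ _ => rfl
      map_smul' := fun _ _ => rfl
      map_lie' := rfl }
  let ψ := π.comp (hL.mHom hcenter)
  have hψ : ∀ (Y : unitaryAlgebra (1 : Matrix (Fin 0) (Fin 0) ℂ))
      (x : Fin (r + 1) → unitaryAlgebra (1 : Matrix (Fin 1) (Fin 1) ℂ)),
      wittBlock (Y : Matrix (Fin 0) (Fin 0) ℂ) (fun i => (x i : Matrix (Fin 1) (Fin 1) ℂ) 0 0)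
        (fun i => (x i : Matrix (Fin 1) (Fin 1) ℂ) 0 0) ∈ specialUnitary (wittForm 1 1 (r + 1)) ↔
      x (Fin.last r) = -∑ i : Fin r, x i.castSucc := fun Y x => by
    rw [wittBlock_mem_specialUnitary, trace_eq_zero_of_isEmpty, zero_add,
      mul_eq_zero_iff_left two_ne_zero, Fin.sum_univ_castSucc, add_comm, add_eq_zero_iff_eq_neg]
    have h1 : ((-∑ i : Fin r, x i.castSucc : unitaryAlgebra (1 : Matrix (Fin 1) (Fin 1) ℂ)) :
      Matrix (Fin 1) (Fin 1) ℂ) 0 0 =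
        -∑ i : Fin r, (x i.castSucc : Matrix (Fin 1) (Fin 1) ℂ) 0 0 := by
      simp [Matrix.sum_apply]
    rw [← h1]
    refine ⟨fun h => Subtype.ext (Matrix.ext fun a b => ?_), fun h => by rw [h]⟩
    rw [Subsingleton.elim a 0, Subsingleton.elim b 0, h]
  refine ⟨LieEquiv.ofBijective ψ ⟨fun X X' h => hL.mHom_injective hcenter ?_, fun y => ?_⟩⟩
  · have h1 := (hψ _ _).1 (hL.wittBlock_mem_mHom hcenter X)
    have h2 := (hψ _ _).1 (hL.wittBlock_mem_mHom hcenter X')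
    have h3 : ∀ i : Fin r, (hL.mHom hcenter X).2 i.castSucc = (hL.mHom hcenter X').2 i.castSucc :=
      fun i => congrFun h i
    refine Prod.ext (Subsingleton.elim _ _) (funext fun i => ?_)
    exact Fin.lastCases (by rw [h1, h2]; simp only [h3]) h3 i
  · obtain ⟨X, hX⟩ := hL.exists_mHom_eq hcenter 0
      (Fin.snoc (α := fun _ => unitaryAlgebra (1 : Matrix (Fin 1) (Fin 1) ℂ)) y (-∑ i, y i))
      ((hψ _ _).2 (by simp))
    refine ⟨X, ?_⟩
    change π (hL.mHom hcenter X) = _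
    rw [hX]
    funext i
    exact Fin.snoc_castSucc (α := fun _ => unitaryAlgebra (1 : Matrix (Fin 1) (Fin 1) ℂ)) _ _ _

theorem finrank_unitaryAlgebra_one_complex :
    Module.finrank ℝ (unitaryAlgebra (1 : Matrix (Fin 1) (Fin 1) ℂ)) = 1 := by
  rw [finrank_unitaryAlgebra_one, finrank_skewScalars_complex]
  simp

instance : Module.Finite ℝ (unitaryAlgebra (1 : Matrix (Fin 1) (Fin 1) ℂ)) :=
  Module.finite_of_finrank_pos (by rw [finrank_unitaryAlgebra_one_complex]; exact one_pos)

/-- The skew complex numbers form the Lie algebra `u(1)`. -/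
noncomputable def u1Equiv : unitaryAlgebra (1 : Matrix (Fin 1) (Fin 1) ℂ) ≃ₗ⁅ℝ⁆ u1 :=
  LieEquiv.ofEq _ _ rfl

/-- A minimal parabolic subalgebra of the special unitary algebra of a definite form of rank `k` and
`r` hyperbolic planes, and the corresponding real form of `sl(k + 2 r, ℂ)`. The image of `H₀` has
`k` zeros in the middle, so that its entries are distinct if `k = 0`. -/
theorem exists_parabolic_suPR (k : ℕ) (hr : 1 ≤ r) {N : ℕ} (hN : r + k + r = N)
    {M : Type*} [LieRing M] [LieAlgebra ℝ M] {d : ℕ}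
    (hM : ∀ hcenter, Nonempty (((isWittSubalgebra_specialUnitary k r).parabolic hcenter).m ≃ₗ⁅ℝ⁆ M))
    (hd : ∀ hcenter, Module.finrank ℝ ((isWittSubalgebra_specialUnitary k r).parabolic hcenter).m +
      r + 2 * d + 1 = (k + 2 * r) * (k + 2 * r)) :
    ∃ (Q : MinimalParabolic (specialUnitary (wittForm (1 : Matrix (Fin k) (Fin k) ℂ) 1 r)))
      (f : specialUnitary (wittForm (1 : Matrix (Fin k) (Fin k) ℂ) 1 r) → slC N)
      (hf : IsRealForm f), Nonempty (Q.m ≃ₗ⁅ℝ⁆ M) ∧ Module.finrank ℝ Q.a = r ∧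
      Module.finrank ℝ Q.n = d ∧
      complexImage hf.equiv Q.p = standardParabolic (diagonalCartan (slC N))
        (simpleA N) (Set.Icc (r + 1) (r + k - 1)) ∧
      (k = 0 → complexImage hf.equiv (Q.m.toSubmodule ⊔ Q.a.toSubmodule) =
        (diagonalCartan (slC N)).toSubmodule) := by
  subst hN
  obtain ⟨f, hf, hfX⟩ := exists_isRealForm_specialUnitary
    (wittForm_one_mul_self (k := k) (r := r)) conjTranspose_wittForm_one (wittEquiv k r)
  have hL := isWittSubalgebra_specialUnitary k r
  have hc := fun X => hf.center_eq_zero (center_sl _) X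
  have ha := hL.finrank_a hc
  let s : ℕ → ℝ := fun j => ((r - j : ℕ) : ℝ) - ((j + 1 - (r + k) : ℕ) : ℝ)
  have hH : (f (hL.parabolic hc).H₀ : Matrix (Fin (r + k + r)) (Fin (r + k + r)) ℂ) =
      diagonal fun j : Fin (r + k + r) => (s j : ℂ) := by
    rw [hfX, hL.coe_parabolic_H₀]
    refine submatrix_diagonal_equiv' _ fun j => ?_
    rw [elim_wittEquiv]
    rfl
  have hs : ∀ i j, s i = s j ↔ (r - i) + (j + 1 - (r + k)) = (r - j) + (i + 1 - (r + k)) := by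
    intro i j
    rw [sub_eq_sub_iff_add_eq_add]
    norm_cast
  refine ⟨hL.parabolic hc, f, hf, hM hc, ha, ?_, complexImage_p_slC hf _ s (fun j => ?_) hH
    fun j hj => ?_, fun hk => complexImage_m_sup_a_slC hf _ s (fun i hi j hj h => ?_) hH⟩
  · have h1 := (hL.parabolic hc).finrank_eq
    have h2 := finrank_specialUnitary (wittForm_one_mul_self (k := k) (r := r))
      conjTranspose_wittForm_one (by simp; omega)
    have h3 := hd hc
    rw [Fintype.card_sum, Fintype.card_sum, Fintype.card_fin, Fintype.card_fin, ← two_mul] at h2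
    omega
  · have h1 : ((r - (j + 1) : ℕ) : ℝ) ≤ ((r - j : ℕ) : ℝ) := Nat.cast_le.2 (by omega)
    have h2 : ((j + 1 - (r + k) : ℕ) : ℝ) ≤ ((j + 1 + 1 - (r + k) : ℕ) : ℝ) :=
      Nat.cast_le.2 (by omega)
    exact sub_le_sub h1 h2
  · rw [hs, Set.mem_Icc]
    omega
  · rw [hs] at h
    omega

theorem minimalParabolic_suPR (p r : ℕ) (hr : 1 ≤ r) (hp : r < p) :
    Nonempty (MinimalParabolic (suPR p r)) ∧ ∀ P : MinimalParabolic (suPR p r),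
      Nonempty (P.m ≃ₗ⁅ℝ⁆ (suCompact (p - r) × ⨁ _ : Fin r, u1)) ∧ Module.finrank ℝ P.a = r ∧
      Module.finrank ℝ P.n = r * (2 * p - 1) ∧
      ∃ φ : ℂ ⊗[ℝ] (suPR p r) ≃ₗ⁅ℂ⁆ (slC (p + r)),
        complexImage φ P.p = standardParabolic (diagonalCartan (slC (p + r))) (simpleA (p + r))
          (Set.Icc (r + 1) (p - 1)) := by
  obtain ⟨k, rfl⟩ : ∃ k, p = r + k := ⟨p - r, by omega⟩
  have hk : k ≠ 0 := by omega
  obtain ⟨Q, f, hf, ⟨hm⟩, ha, hn, hV, -⟩ := exists_parabolic_suPR k hr rfl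
    (nonempty_mEquiv_of_ne_zero hk) (d := r * (2 * (r + k) - 1)) fun hc => by
      obtain ⟨e⟩ := nonempty_mEquiv_of_ne_zero hk hc
      have h1 : Module.finrank ℝ (suCompact k) + 1 = k * k := by
        have h2 := finrank_specialUnitary (K := (1 : Matrix (Fin k) (Fin k) ℂ)) (one_mul 1)
          conjTranspose_one (by simpa using Nat.pos_of_ne_zero hk)
        rwa [Fintype.card_fin] at h2
      rw [e.toLinearEquiv.finrank_eq, Module.finrank_prod, Module.finrank_pi_fintype]
      simp only [finrank_unitaryAlgebra_one_complex, Finset.sum_const, Finset.card_univ,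
        Fintype.card_fin, smul_eq_mul, mul_one]
      obtain ⟨q, rfl⟩ : ∃ q, k = q + 1 := ⟨k - 1, by omega⟩
      rw [show 2 * (r + (q + 1)) - 1 = 2 * r + 2 * q + 1 by omega]
      linarith
  obtain ⟨e⟩ := nonempty_suPR_equiv k r
  obtain ⟨h3, h4⟩ := forall_of_realForm e Q hf
    ⟨hm.trans (prodCongr LieEquiv.refl ((piCongr _ u1Equiv).trans (piEquivDirectSum _ _ _)))⟩
    ha hn hV rfl
  refine ⟨h3, fun P => ?_⟩
  obtain ⟨h5, h6, h7, φ, hφ, -⟩ := h4 P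
  rw [Nat.add_sub_cancel_left]
  exact ⟨h5, h6, h7, φ, hφ⟩

theorem minimalParabolic_suPR_self (n : ℕ) (hn : 1 ≤ n) :
    Nonempty (MinimalParabolic (suPR n n)) ∧ ∀ P : MinimalParabolic (suPR n n),
      Nonempty (P.m ≃ₗ⁅ℝ⁆ (⨁ _ : Fin (n - 1), u1)) ∧ Module.finrank ℝ P.a = n ∧
      Module.finrank ℝ P.n = n * (2 * n - 1) ∧
      ∃ φ : ℂ ⊗[ℝ] (suPR n n) ≃ₗ⁅ℂ⁆ (slC (2 * n)),
        complexImage φ P.p = borel (diagonalCartan (slC (2 * n))) (simpleA (2 * n)) ∧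
        complexImage φ (P.m.toSubmodule ⊔ P.a.toSubmodule) =
          (diagonalCartan (slC (2 * n))).toSubmodule := by
  obtain ⟨r, rfl⟩ : ∃ r, n = r + 1 := ⟨n - 1, by omega⟩
  obtain ⟨Q, f, hf, ⟨hm⟩, ha, hn, hV, hW⟩ := exists_parabolic_suPR 0 hn
    (N := 2 * (r + 1)) (by omega)
    nonempty_mEquiv_of_eq_zero (d := (r + 1) * (2 * (r + 1) - 1)) fun hc => by
      obtain ⟨e⟩ := nonempty_mEquiv_of_eq_zero hc
      rw [e.toLinearEquiv.finrank_eq, Module.finrank_pi_fintype]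
      simp only [finrank_unitaryAlgebra_one_complex, Finset.sum_const, Finset.card_univ,
        Fintype.card_fin, smul_eq_mul, mul_one]
      rw [show 2 * (r + 1) - 1 = 2 * r + 1 by omega]
      ring
  obtain ⟨e⟩ := nonempty_suPR_equiv 0 (r + 1)
  rw [add_zero] at e
  rw [Set.Icc_eq_empty (by omega), standardParabolic_empty] at hV
  exact forall_of_realForm e Q hf ⟨hm.trans ((piCongr _ u1Equiv).trans (piEquivDirectSum _ _ _))⟩
    ha hn hV (hW rfl)

end SpecialUnitary

end MinimalParabolics

open MinimalParabolics in
theorem mainTheorem1 :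
    -- `sl(n, ℝ)`
    (∀ n : ℕ, 2 ≤ n →
      Nonempty (MinimalParabolic (slR n)) ∧
      ∀ P : MinimalParabolic (slR n),
        P.m = ⊥ ∧
        ∃ φ : ℂ ⊗[ℝ] (slR n) ≃ₗ⁅ℂ⁆ (slC n),
          complexImage φ P.p = borel (diagonalCartan (slC n)) (simpleA n) ∧
          complexImage φ P.a.toSubmodule = (diagonalCartan (slC n)).toSubmodule) ∧
    -- `so(r, r)`
    (∀ r : ℕ, 2 ≤ r →
      Nonempty (MinimalParabolic (soPR r r)) ∧
      ∀ P : MinimalParabolic (soPR r r),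
        P.m = ⊥ ∧
        ∃ φ : ℂ ⊗[ℝ] (soPR r r) ≃ₗ⁅ℂ⁆ (soEvenC r),
          complexImage φ P.p = borel (diagonalCartan (soEvenC r)) (simpleD r) ∧
          complexImage φ P.a.toSubmodule = (diagonalCartan (soEvenC r)).toSubmodule) ∧
    -- `so(r + 1, r)`
    (∀ r : ℕ, 1 ≤ r →
      Nonempty (MinimalParabolic (soPR (r + 1) r)) ∧
      ∀ P : MinimalParabolic (soPR (r + 1) r),
        P.m = ⊥ ∧
        ∃ φ : ℂ ⊗[ℝ] (soPR (r + 1) r) ≃ₗ⁅ℂ⁆ (soOddC r),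
          complexImage φ P.p = borel (diagonalCartan (soOddC r)) (simpleB r) ∧
          complexImage φ P.a.toSubmodule = (diagonalCartan (soOddC r)).toSubmodule) ∧
    -- `sp(n, ℝ)`
    (∀ n : ℕ, 1 ≤ n →
      Nonempty (MinimalParabolic (spR n)) ∧
      ∀ P : MinimalParabolic (spR n),
        P.m = ⊥ ∧
        ∃ φ : ℂ ⊗[ℝ] (spR n) ≃ₗ⁅ℂ⁆ (spC n),
          complexImage φ P.p = borel (diagonalCartan (spC n)) (simpleC n) ∧
          complexImage φ P.a.toSubmodule = (diagonalCartan (spC n)).toSubmodule) ∧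
    -- `su(n, n)`
    (∀ n : ℕ, 2 ≤ n →
      Nonempty (MinimalParabolic (suPR n n)) ∧
      ∀ P : MinimalParabolic (suPR n n),
        Nonempty (P.m ≃ₗ⁅ℝ⁆ (⨁ _ : Fin (n - 1), u1)) ∧
        Module.finrank ℝ P.a = n ∧
        Module.finrank ℝ P.n = n * (2 * n - 1) ∧
        ∃ φ : ℂ ⊗[ℝ] (suPR n n) ≃ₗ⁅ℂ⁆ (slC (2 * n)),
          complexImage φ P.p = borel (diagonalCartan (slC (2 * n))) (simpleA (2 * n)) ∧
          complexImage φ (P.m.toSubmodule ⊔ P.a.toSubmodule) =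
            (diagonalCartan (slC (2 * n))).toSubmodule) ∧
    -- `su*(2n)`
    (∀ n : ℕ, 2 ≤ n →
      Nonempty (MinimalParabolic (suStar n)) ∧
      ∀ P : MinimalParabolic (suStar n),
        Nonempty (P.m ≃ₗ⁅ℝ⁆ (⨁ _ : Fin n, suCompact 2)) ∧
        Module.finrank ℝ P.a = n - 1 ∧
        Module.finrank ℝ P.n = 2 * n * (n - 1) ∧
        ∃ φ : ℂ ⊗[ℝ] (suStar n) ≃ₗ⁅ℂ⁆ (slC (2 * n)),
          complexImage φ P.p = standardParabolic (diagonalCartan (slC (2 * n))) (simpleA (2 * n))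
            {i | Odd i ∧ i ≤ 2 * n - 1}) ∧
    -- `su(p, r)`
    (∀ p r : ℕ, 1 ≤ r → r < p →
      Nonempty (MinimalParabolic (suPR p r)) ∧
      ∀ P : MinimalParabolic (suPR p r),
        Nonempty (P.m ≃ₗ⁅ℝ⁆ (suCompact (p - r) × ⨁ _ : Fin r, u1)) ∧
        Module.finrank ℝ P.a = r ∧
        Module.finrank ℝ P.n = r * (2 * p - 1) ∧
        ∃ φ : ℂ ⊗[ℝ] (suPR p r) ≃ₗ⁅ℂ⁆ (slC (p + r)),
          complexImage φ P.p = standardParabolic (diagonalCartan (slC (p + r))) (simpleA (p + r))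
            (Set.Icc (r + 1) (p - 1))) ∧
    -- `so(p, r), p + r odd`
    (∀ p r l : ℕ, 1 ≤ r → r + 1 < p → p + r = 2 * l + 1 →
      Nonempty (MinimalParabolic (soPR p r)) ∧
      ∀ P : MinimalParabolic (soPR p r),
        Nonempty (P.m ≃ₗ⁅ℝ⁆ soCompact (p - r)) ∧
        Module.finrank ℝ P.a = r ∧
        Module.finrank ℝ P.n = r * (p - 1) ∧
        ∃ φ : ℂ ⊗[ℝ] (soPR p r) ≃ₗ⁅ℂ⁆ (soOddC l),
          complexImage φ P.p = standardParabolic (diagonalCartan (soOddC l)) (simpleB l)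
            (Set.Icc (r + 1) l)) ∧
    -- `so(p, r), p + r even`
    (∀ p r l : ℕ, 1 ≤ r → r + 1 < p → p + r = 2 * l →
      Nonempty (MinimalParabolic (soPR p r)) ∧
      ∀ P : MinimalParabolic (soPR p r),
        Nonempty (P.m ≃ₗ⁅ℝ⁆ soCompact (p - r)) ∧
        Module.finrank ℝ P.a = r ∧
        Module.finrank ℝ P.n = r * (p - 1) ∧
        ∃ φ : ℂ ⊗[ℝ] (soPR p r) ≃ₗ⁅ℂ⁆ (soEvenC l),
          complexImage φ P.p = standardParabolic (diagonalCartan (soEvenC l)) (simpleD l)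
            (if p = r + 2 then ∅ else Set.Icc (r + 1) l)) ∧
    -- `sp(p, r)`
    (∀ p r : ℕ, 1 ≤ r → r ≤ p →
      Nonempty (MinimalParabolic (spPR p r)) ∧
      ∀ P : MinimalParabolic (spPR p r),
        Nonempty (P.m ≃ₗ⁅ℝ⁆ (spCompact (p - r) × ⨁ _ : Fin r, spCompact 1)) ∧
        Module.finrank ℝ P.a = r ∧
        Module.finrank ℝ P.n = r * (4 * p - 1) ∧
        ∃ φ : ℂ ⊗[ℝ] (spPR p r) ≃ₗ⁅ℂ⁆ (spC (p + r)),
          complexImage φ P.p = standardParabolic (diagonalCartan (spC (p + r))) (simpleC (p + r))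
            ({i | Odd i ∧ i ≤ 2 * r - 1} ∪ Set.Icc (2 * r + 1) (p + r))) ∧
    -- `so*(2n), n even`
    (∀ n r : ℕ, 1 ≤ r → n = 2 * r →
      Nonempty (MinimalParabolic (soStar n)) ∧
      ∀ P : MinimalParabolic (soStar n),
        Nonempty (P.m ≃ₗ⁅ℝ⁆ (⨁ _ : Fin r, soCompact 3)) ∧
        Module.finrank ℝ P.a = r ∧
        Module.finrank ℝ P.n = r * (4 * r - 3) ∧
        ∃ t : LieSubalgebra ℝ P.m, t.IsCartanSubalgebra ∧
        ∃ φ : ℂ ⊗[ℝ] (soStar n) ≃ₗ⁅ℂ⁆ (soEvenC n),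
          complexImage φ P.p = standardParabolic (diagonalCartan (soEvenC n)) (simpleD n)
            {i | Odd i ∧ i ≤ n - 1} ∧
          complexImage φ (t.toSubmodule.map P.m.toSubmodule.subtype ⊔ P.a.toSubmodule) =
            (diagonalCartan (soEvenC n)).toSubmodule) ∧
    -- `so*(2n), n odd`
    (∀ n r : ℕ, 1 ≤ r → n = 2 * r + 1 →
      Nonempty (MinimalParabolic (soStar n)) ∧
      ∀ P : MinimalParabolic (soStar n),
        Nonempty (P.m ≃ₗ⁅ℝ⁆ (soCompact 2 × ⨁ _ : Fin r, soCompact 3)) ∧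
        Module.finrank ℝ P.a = r ∧
        Module.finrank ℝ P.n = r * (4 * r + 1) ∧
        ∃ φ : ℂ ⊗[ℝ] (soStar n) ≃ₗ⁅ℂ⁆ (soEvenC n),
          complexImage φ P.p = standardParabolic (diagonalCartan (soEvenC n)) (simpleD n)
            {i | Odd i ∧ i ≤ n - 2}) :=
  ⟨fun n _ => minimalParabolic_slR n, minimalParabolic_soPR_self,
    fun r _ => minimalParabolic_soPR_succ r, fun n _ => minimalParabolic_spR n,
    fun n hn => minimalParabolic_suPR_self n (one_le_two.trans hn),
    fun n hn => minimalParabolic_suStar n (one_le_two.trans hn), minimalParabolic_suPR,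
    fun p r l _ => minimalParabolic_soPR_odd p r l, minimalParabolic_soPR_even,
    minimalParabolic_spPR, minimalParabolic_soStar_even, minimalParabolic_soStar_odd⟩
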